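/- **Setting.** Let $\mathbb T^3=[-1,1]^3$ (periodic), $N\ge 1$, $\varepsilon=\frac{2}{2N+1}$, $|k|_\infty=\max_j|k^j|$, and let $P_M$ be the Fourier projection onto $\{k\in\mathbb Z^3:|k|_\infty\le M\}$ (with respect to $e^{\imath\pi k\cdot x}$). Let $(\chi,\theta)$ be a smooth, radial, nonnegative dyadic partition of unity on $\mathbb R^3$: $\chi$ is supported in a ball, $\theta$ in an annulus, $\chi+\sum_{j\ge0}\theta(2^{-j}\cdot)=1$, $\operatorname{supp}\chi\cap\operatorname{supp}\theta(2^{-j}\cdot)=\emptyset$ for $j\ge1$ and $\operatorname{supp}\theta(2^{-i}\cdot)\cap\operatorname{supp}\theta(2^{-j}\cdot)=\emptyset$ for $|i-j|>1$. Let $\Delta_{-1}=\mathcal F^{-1}\chi\mathcal F$, $\Delta_j=\mathcal F^{-1}\theta(2^{-j}\cdot)\mathcal F$ for $j\ge 0$ be the Littlewood–Paley blocks, $\|u\|_\alpha=\sup_{j\ge-1}2^{j\alpha}\|\Delta_ju\|_{L^\infty(\mathbb T^3)}$, $\mathcal C^\alpha=\{u\in\mathcal S'(\mathbb T^3):\|u\|_\alpha<\infty\}$,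 $\pi_<(f,g)=\sum_{j\ge-1}\sum_{i<j-1}\Delta_if\,\Delta_jg$ and $\pi_0(f,g)=\sum_{|i-j|\le1}\Delta_if\,\Delta_jg$. For distributions $\psi,\zeta$ put $$A^1_N(\psi,\zeta)(f)=\pi_0\big((I-P_N)\pi_<(f,P_N\psi),\zeta\big),\qquad A^2_N(\psi,\zeta)(f)=\pi_0\big(P_N\pi_<(f,(P_{3N}-P_N)\psi),\zeta\big).$$ Let $F(x)=\frac{4}{|x|^2}\sum_{j=1}^3\sin^2\frac{\pi x_j}{2}$, let $\varphi$ be a smooth function on $\mathbb R^3$ with $\varphi=1$ on $\{|x|_\infty\le1\}$ and support in $\{|x|\le1.8\}$, and let $P^\varepsilon_t$, $\tilde P^\varepsilon_t$ be the Fourier multipliers with symbols $1_{|k|_\infty\le N}e^{-t|k|^2F(\varepsilon k)}$ and $e^{-t|k|^2F(\varepsilon k)}\varphi(\varepsilon k)$ (with $|k|^2F(\varepsilon k):=0$ at $k=0$). Let $W$ be a real two-sided cylindrical Wiener process on the mean-zero part of $L^2(\mathbb T^3)$, i.e. $W(t)=2^{-3/2}\sum_{k\ne0}\beta_k(t)e^{\imath\pi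 k\cdot x}$ with complex Brownian motions $\beta_k$, $E|\beta_k(t)|^2=|t|$, $\beta_{-k}=\overline{\beta_k}$, independent up to this constraint. Define $$u_1^\varepsilon(t)=\int_{-\infty}^tP^\varepsilon_{t-s}P_N\,dW(s),\qquad (u_1^\varepsilon)^{\diamond2}=(u_1^\varepsilon)^2-C_0^\varepsilon,\qquad C_0^\varepsilon=2^{-3}\sum_{0<|k|_\infty\le N}\frac1{2|k|^2F(\varepsilon k)},$$ $e_N^{i}(x)=e^{-\imath\pi(2N+1)i\cdot x}$ for $i\in I:=\{-1,0,1\}^3\setminus\{0\}$, and $$K^\varepsilon(t)=\int_0^tP^\varepsilon_{t-s}(u_1^\varepsilon)^{\diamond2}(s)\,ds,\qquad K_1^\varepsilon(t)=\sum_{i\in I}\int_0^tP^\varepsilon_{t-s}\big[e_N^{i}(u_1^\varepsilon)^{\diamond2}(s)\big]ds,$$ and $\tilde K^\varepsilon,\tilde K_1^\varepsilon$ in the same way with $\tilde P^\varepsilon$ in place of $P^\varepsilon$. Finally, for $T\ge0$ and $0<\delta<\frac14$, with $X^\varepsilon=(u_1^\varepsilon)^{\diamond2}+\sum_{i\in I}e_N^{i}(u_1^\varepsilon)^{\diamond2}$,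 $$A_N=\big\|A^1_N(K^\varepsilon+K_1^\varepsilon,X^\varepsilon)\big\|_{C([0,T];L(\mathcal C^{1-\delta},\mathcal C^{-1/2-2\delta}))}+\big\|A^2_N(\tilde K^\varepsilon+\tilde K_1^\varepsilon,X^\varepsilon)\big\|_{C([0,T];L(\mathcal C^{1-\delta},\mathcal C^{-1/2-2\delta}))}.$$ **Theorem 6.7.** For every $N\ge1$ the two operator-valued processes almost surely have paths in $C([0,T];L(\mathcal C^{1-\delta},\mathcal C^{-1/2-2\delta}))$ and $A_N$ is a random variable. For every $0<\eta<\delta$ and $r\ge1$ there is a constant $C$, independent of $N$, such that $$E[(A_N)^r]^{1/r}\le C\,N^{-\delta+\eta}\qquad\text{for all }N\ge1.$$ In particular $A_N\to0$ in probability as $N\to\infty$. -/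

import Mathlib

open MeasureTheory ProbabilityTheory Filter Topology
open scoped ENNReal ComplexConjugate

noncomputable section

namespace LatticePhi

/-- Frequencies: points of `ℤ³`. -/
abbrev Freq : Type := Fin 3 → ℤ

/-- A (complex) distribution `u` on the torus `𝕋³ = [-1,1]³` is represented by its Fourier
coefficients: `u = ∑ₖ u(k) e^{iπ k·x}`. Polynomial growth of the coefficients is implied by
finiteness of any of the norms `holderNorm` below. -/
abbrev Coeff : Type := Freq → ℂ

/-- `k ∈ ℤ³` as a point of Euclidean space `ℝ³`. -/
def toE (k : Freq) : EuclideanSpace ℝ (Fin 3) := WithLp.toLp 2 fun j => (k j : ℝ)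

/-- The character `e^{iπ k·x}`. -/
def char (k : Freq) (x : Fin 3 → ℝ) : ℂ :=
  Complex.exp (Complex.I * ((Real.pi * ∑ j, (k j : ℝ) * x j : ℝ) : ℂ))

/-! ### Littlewood–Paley theory -/

/-- Smooth radial dyadic partitions of unity `(χ, θ)` on `ℝ³`. -/
structure DyadicPartition where
  χ : EuclideanSpace ℝ (Fin 3) → ℝ
  θ : EuclideanSpace ℝ (Fin 3) → ℝ
  χ_smooth : ContDiff ℝ ((⊤ : ℕ∞) : WithTop ℕ∞) χ
  θ_smooth : ContDiff ℝ ((⊤ : ℕ∞) : WithTop ℕ∞) θ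
  χ_nonneg : ∀ z, 0 ≤ χ z
  θ_nonneg : ∀ z, 0 ≤ θ z
  χ_radial : ∀ z w, ‖z‖ = ‖w‖ → χ z = χ w
  θ_radial : ∀ z w, ‖z‖ = ‖w‖ → θ z = θ w
  χ_ball : ∃ R : ℝ, tsupport χ ⊆ Metric.closedBall 0 R
  θ_annulus : ∃ a b : ℝ, 0 < a ∧ tsupport θ ⊆ {z | a ≤ ‖z‖ ∧ ‖z‖ ≤ b}
  sum_eq_one : ∀ z, χ z + ∑' j : ℕ, θ (((2 : ℝ) ^ j)⁻¹ • z) = 1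
  disjoint_χ : ∀ j : ℕ, 1 ≤ j → Disjoint (tsupport χ) (tsupport fun z => θ (((2 : ℝ) ^ j)⁻¹ • z))
  disjoint_θ : ∀ i j : ℕ, i + 1 < j →
    Disjoint (tsupport fun z => θ (((2 : ℝ) ^ i)⁻¹ • z)) (tsupport fun z => θ (((2 : ℝ) ^ j)⁻¹ • z))

/-- Symbol of the Littlewood–Paley block `Δ_{n-1}`: the index `n : ℕ` stands for the usual
index `j = n - 1 ≥ -1`. -/
def DyadicPartition.symbol (D : DyadicPartition) : ℕ → EuclideanSpace ℝ (Fin 3) → ℝ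
  | 0 => D.χ
  | n + 1 => fun z => D.θ (((2 : ℝ) ^ n)⁻¹ • z)

/-- Littlewood–Paley block `Δ_{n-1} u`. -/
def block (D : DyadicPartition) (n : ℕ) (u : Coeff) : Coeff :=
  fun k => (D.symbol n (toE k) : ℂ) * u k

/-- `L^∞(𝕋³)` norm of the trigonometric polynomial with coefficients `u`. It is only used for
finitely supported `u`, for which the function is continuous and the essential supremum is the
supremum. -/
def supNorm (u : Coeff) : ℝ≥0∞ :=
  ⨆ x : Fin 3 → ℝ, ‖∑' k, u k * char k x‖ₑ

/-- The Hölder–Besov norm of `𝒞^α = B^α_{∞,∞}(𝕋³)`: `sup_{j ≥ -1} 2^{jα} ‖Δ_j u‖_{L^∞}`. -/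
def holderNorm (D : DyadicPartition) (α : ℝ) (u : Coeff) : ℝ≥0∞ :=
  ⨆ n : ℕ, ENNReal.ofReal ((2 : ℝ) ^ (((n : ℝ) - 1) * α)) * supNorm (block D n u)

/-- The norm of `L(𝒞^α, 𝒞^β)` (for a linear `A`; the value is `∞` if `A` is not bounded). -/
def opNorm (D : DyadicPartition) (α β : ℝ) (A : Coeff → Coeff) : ℝ≥0∞ :=
  ⨆ (f : Coeff) (_ : holderNorm D α f ≤ 1), holderNorm D β (A f)

/-- Pointwise product of functions on the torus, in terms of Fourier coefficients. -/
def mul (u v : Coeff) : Coeff := fun k => ∑' l, u l * v (k - l)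

/-- Paraproduct `π_<(f,g) = ∑_j ∑_{i < j-1} Δ_i f Δ_j g`. -/
def paraLt (D : DyadicPartition) (f g : Coeff) : Coeff :=
  fun k => ∑' j : ℕ, ∑ i ∈ (Finset.range j).filter (fun i => i + 1 < j),
    mul (block D i f) (block D j g) k

/-- Resonant product `π_0(f,g) = ∑_{|i-j| ≤ 1} Δ_i f Δ_j g`. -/
def paraRes (D : DyadicPartition) (f g : Coeff) : Coeff :=
  fun k => ∑' j : ℕ, ∑ i ∈ (Finset.range (j + 2)).filter (fun i => j ≤ i + 1),
    mul (block D i f) (block D j g) k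

/-! ### Lattice operators -/

/-- `|k|_∞ ≤ M`. -/
def inBox (M : ℕ) (k : Freq) : Prop := ∀ j, |k j| ≤ (M : ℤ)

instance (M : ℕ) (k : Freq) : Decidable (inBox M k) := by unfold inBox; infer_instance

/-- The sharp Fourier cutoff `P_M`. -/
def proj (M : ℕ) (u : Coeff) : Coeff := fun k => if inBox M k then u k else 0

/-- Lattice spacing `ε = 2 / (2N+1)`. -/
def eps (N : ℕ) : ℝ := 2 / (2 * N + 1)

/-- `f(x) = 4 |x|⁻² (sin²(πx₁/2) + sin²(πx₂/2) + sin²(πx₃/2))`. -/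
def fSymb (x : EuclideanSpace ℝ (Fin 3)) : ℝ :=
  4 / ‖x‖ ^ 2 * ∑ j, Real.sin (Real.pi * x j / 2) ^ 2

/-- `|k|² f(εk)`: minus the discrete Laplacian `Δ_ε` acts on `e^{iπ k·x}`, for `|k|_∞ ≤ N`, as
multiplication by this number. -/
def rate (N : ℕ) (k : Freq) : ℝ := ‖toE k‖ ^ 2 * fSymb (eps N • toE k)

/-- The lattice heat semigroup `P_t^ε`. -/
def heat (N : ℕ) (t : ℝ) (u : Coeff) : Coeff :=
  fun k => if inBox N k then (Real.exp (-(t * rate N k)) : ℂ) * u k else 0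

/-- Smooth cutoffs `φ` on `ℝ³`: equal to `1` on `|x|_∞ ≤ 1`, supported in `|x| ≤ 1.8`. -/
structure IsCutoff (φ : EuclideanSpace ℝ (Fin 3) → ℝ) : Prop where
  smooth : ContDiff ℝ ((⊤ : ℕ∞) : WithTop ℕ∞) φ
  eq_one : ∀ x, (∀ j, |x j| ≤ 1) → φ x = 1
  supp : tsupport φ ⊆ {x | ‖x‖ ≤ 1.8}

/-- The smoothly cut off semigroup `P̃_t^ε`, with symbol `e^{-t|k|²f(εk)} φ(εk)`. -/
def heatTilde (φ : EuclideanSpace ℝ (Fin 3) → ℝ) (N : ℕ) (t : ℝ) (u : Coeff) : Coeff :=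
  fun k => (Real.exp (-(t * rate N k)) : ℂ) * (φ (eps N • toE k) : ℂ) * u k

/-- `∫₀ᵗ S_{t-s} F(s) ds`, for Fourier multipliers `S_t`. -/
def duhamel (S : ℝ → Coeff → Coeff) (F : ℝ → Coeff) (t : ℝ) : Coeff :=
  fun k => ∫ s in (0 : ℝ)..t, S (t - s) (F s) k

/-- `∑_{i ∈ {-1,0,1}³, i ≠ 0} e_N^i u`, where `e_N^i(x) = e^{-iπ(2N+1) i·x}`; multiplication by
`e_N^i` moves the frequency `k + (2N+1)i` to `k`. -/
def fold (N : ℕ) (u : Coeff) : Coeff :=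
  fun k => ∑ i ∈ (Finset.Icc (-1 : Freq) 1).erase 0, u (k + (2 * (N : ℤ) + 1) • i)

/-! ### The noise and the stochastic objects -/

/-- The Fourier modes `W(t,k) = ⟨W(t), e_k⟩`, `k ≠ 0`, `t ∈ ℝ`, of a real-valued (two-sided)
cylindrical Wiener process on the mean-zero part of `L²(𝕋³)`, where `e_k = 2^{-3/2} e^{iπ k·x}`:
complex Brownian motions with `E|W(t,k)|² = |t|`, independent up to the reality constraint
`W(t,-k) = conj W(t,k)`. The mode `k = 0` is not constrained and never used. -/
structure IsWienerModes {Ω : Type*} [MeasurableSpace Ω] (P : Measure Ω)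
    (W : ℝ → Freq → Ω → ℂ) : Prop where
  gaussian : IsGaussianProcess (fun p : ℝ × {k : Freq // k ≠ 0} => W p.1 p.2) P
  mean : ∀ t k, k ≠ 0 → ∫ ω, W t k ω ∂P = 0
  reality : ∀ t k, k ≠ 0 → ∀ᵐ ω ∂P, W t (-k) ω = conj (W t k ω)
  cov : ∀ s t k l, k ≠ 0 → l ≠ 0 →
    ∫ ω, W s k ω * conj (W t l ω) ∂P = if k = l then (((|s| + |t| - |s - t|) / 2 : ℝ) : ℂ) else 0
  continuous : ∀ k, k ≠ 0 → ∀ᵐ ω ∂P, Continuous fun t => W t k ω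

/-- The Wiener integral `∫_{-∞}^t e^{-c(t-s)} db(s)` (`c > 0`) of a smooth deterministic integrand
against a Brownian path `b`, evaluated pathwise through integration by parts. This is its
version with continuous paths. -/
def wienerConv (c : ℝ) (b : ℝ → ℂ) (t : ℝ) : ℂ :=
  b t - c * ∫ s in Set.Iic t, (Real.exp (-(c * (t - s))) : ℂ) * b s

/-- `u₁^ε(t) = ∫_{-∞}^t P^ε_{t-s} P_N dW`, for the path `w` of the noise modes. -/
def u1 (N : ℕ) (w : ℝ → Freq → ℂ) (t : ℝ) : Coeff :=
  fun k => if k ≠ 0 ∧ inBox N k then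
    (((2 : ℝ) ^ (-(3 / 2) : ℝ) : ℝ) : ℂ) * wienerConv (rate N k) (fun s => w s k) t else 0

/-- `C₀^ε = 2⁻³ ∑_{0 < |k|_∞ ≤ N} 1 / (2|k|² f(εk))`. -/
def C0 (N : ℕ) : ℝ :=
  2⁻¹ ^ 3 * ∑ k ∈ (Finset.Icc (fun _ => -(N : ℤ) : Freq) (fun _ => (N : ℤ))).erase 0,
    1 / (2 * rate N k)

/-- The Wick square `(u₁^ε)^{◇2} = (u₁^ε)² - C₀^ε`. -/
def wickSq (N : ℕ) (w : ℝ → Freq → ℂ) (t : ℝ) : Coeff :=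
  fun k => mul (u1 N w t) (u1 N w t) k - if k = 0 then (C0 N : ℂ) else 0

/-- `(u₁^ε)^{◇2} + ∑_i e_N^i (u₁^ε)^{◇2}`. -/
def wickFull (N : ℕ) (w : ℝ → Freq → ℂ) (t : ℝ) : Coeff :=
  wickSq N w t + fold N (wickSq N w t)

/-- `K^ε(t) = ∫₀ᵗ P^ε_{t-s} (u₁^ε)^{◇2} ds`. -/
def K (N : ℕ) (w : ℝ → Freq → ℂ) : ℝ → Coeff := duhamel (heat N) (wickSq N w)

/-- `K₁^ε(t) = ∑_i ∫₀ᵗ P^ε_{t-s} [e_N^i (u₁^ε)^{◇2}] ds`. -/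
def K1 (N : ℕ) (w : ℝ → Freq → ℂ) : ℝ → Coeff :=
  duhamel (heat N) fun s => fold N (wickSq N w s)

/-- `K̃^ε`: as `K^ε`, with `P̃^ε` in place of `P^ε`. -/
def Kt (φ : EuclideanSpace ℝ (Fin 3) → ℝ) (N : ℕ) (w : ℝ → Freq → ℂ) : ℝ → Coeff :=
  duhamel (heatTilde φ N) (wickSq N w)

/-- `K̃₁^ε`: as `K₁^ε`, with `P̃^ε` in place of `P^ε`. -/
def Kt1 (φ : EuclideanSpace ℝ (Fin 3) → ℝ) (N : ℕ) (w : ℝ → Freq → ℂ) : ℝ → Coeff :=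
  duhamel (heatTilde φ N) fun s => fold N (wickSq N w s)

/-! ### The random operators -/

/-- `A¹_N(ψ,χ)(f) = π_0((I - P_N) π_<(f, P_N ψ), χ)`. -/
def A1 (D : DyadicPartition) (N : ℕ) (ψ χ f : Coeff) : Coeff :=
  paraRes D (paraLt D f (proj N ψ) - proj N (paraLt D f (proj N ψ))) χ

/-- `A²_N(ψ,χ)(f) = π_0(P_N π_<(f, (P_{3N} - P_N) ψ), χ)`. -/
def A2 (D : DyadicPartition) (N : ℕ) (ψ χ f : Coeff) : Coeff :=
  paraRes D (proj N (paraLt D f (proj (3 * N) ψ - proj N ψ))) χ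

/-- `A¹_N(K^ε + K₁^ε, (u₁^ε)^{◇2} + e_N (u₁^ε)^{◇2})(t)`. -/
def op1 (D : DyadicPartition) (N : ℕ) (w : ℝ → Freq → ℂ) (t : ℝ) : Coeff → Coeff :=
  A1 D N (K N w t + K1 N w t) (wickFull N w t)

/-- `A²_N(K̃^ε + K̃₁^ε, (u₁^ε)^{◇2} + e_N (u₁^ε)^{◇2})(t)`. -/
def op2 (D : DyadicPartition) (φ : EuclideanSpace ℝ (Fin 3) → ℝ) (N : ℕ)
    (w : ℝ → Freq → ℂ) (t : ℝ) : Coeff → Coeff :=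
  A2 D N (Kt φ N w t + Kt1 φ N w t) (wickFull N w t)

/-- `t ↦ A(t)` is continuous from `[0,T]` to `L(𝒞^α, 𝒞^β)`. -/
def ContinuousInOpNorm (D : DyadicPartition) (α β T : ℝ) (A : ℝ → Coeff → Coeff) : Prop :=
  ∀ t ∈ Set.Icc 0 T, Tendsto (fun s => opNorm D α β fun f => A s f - A t f)
    (𝓝[Set.Icc 0 T] t) (𝓝 0)

/-- The norm of `C([0,T]; L(𝒞^α, 𝒞^β))`. -/
def pathOpNorm (D : DyadicPartition) (α β T : ℝ) (A : ℝ → Coeff → Coeff) : ℝ≥0∞ :=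
  ⨆ t ∈ Set.Icc 0 T, opNorm D α β (A t)

/-- The random variable `A_N`, as a function of the noise path. -/
def AN (D : DyadicPartition) (φ : EuclideanSpace ℝ (Fin 3) → ℝ) (δ T : ℝ) (N : ℕ)
    (w : ℝ → Freq → ℂ) : ℝ≥0∞ :=
  pathOpNorm D (1 - δ) (-1 / 2 - 2 * δ) T (op1 D N w) +
    pathOpNorm D (1 - δ) (-1 / 2 - 2 * δ) T (op2 D φ N w)

end LatticePhi

end

/-! Both operators have the form f ↦ π_0(m₁(D) π_<(f, m₂(D)ψ), X) (`genOp`), where X is the Wick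
square together with its aliases and ψ solves the heat equation driven by X. The q-th block of the
result at a point x is a finite linear functional of the Fourier coefficients of the blocks of f,
with random kernel G(k₁) = ∑ c(k₁,k₂,k₃) ψ(k₂) X(k₃) e^{iπ(k₁+k₂+k₃)·x} (`HasKernel`).
Cauchy–Schwarz in k₁ and Bessel's inequality for the blocks of f eliminate f: the operator norm is
at most the supremum over q and x of a weighted square function of G (`HasKernel.opNorm_le`). Only
moments of G are then needed. Of the resonant product only the bound of its symbol by one enters.

The gain comes from the cutoffs. On the support of c exactly one of k₂ and k₁+k₂ lies in the box
|·|_∞ ≤ N. Hence k₂ is within O(2^i) of a face of the box, where 2^i is the size of k₁, and, as the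
paraproduct forces |k₁| ≲ |k₂|, also |k₂| ≳ N (`goodKernel_of`). The heat flow therefore decays at a
rate of order N² in every mode k₂ that matters, its time integral costs N⁻², and Minkowski's
inequality reduces G to bilinear forms ∑ e(k,l) X_s(k) X_t(l) at two fixed times with bounded e
(`IsRegularOU.eLpNorm_gker_le`). No decay of correlations in time is needed.

Such a form splits into Wick chaoses of order four, two and zero
(`IsModeGaussian.eLpNorm_wick_product_le`). In place of hypercontractivity there is a rotation
argument: a Wick product of Gaussians g is the conditional expectation of the product of the
variables g + ig', with g' an independent copy. The law of these circular variables is invariant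
under separate rotations of the modes, so monomials with different sets of modes are orthogonal, and
a power of a homogeneous polynomial is a sum of almost orthogonal terms
(`IsModeGaussian.integral_circ_chaos_le`). The variances, of order |k|⁻², are dominated by products
of one-dimensional weights, so that convolutions factorise over coordinates and sums over windows
are bounded uniformly in their centres, which takes care of the aliases (`sum_modeVar_conv_le`). Up
to logarithms, orders four and two contribute N·2^q; the expectation contributes (2^i)^{2/3}
N^{4/3}, but only for k₁ in windows of radius O(2^q).

With R = 2^i and Q = 2^q, both at most of order N, summation over k₁ gives Q^{-1/2-2δ} R^{-(1-δ)}
N⁻² · Q (N R^{3/2} + R^{7/6} N^{4/3}) ≲ N^{-δ} (`exponent_bound`).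

The suprema over t and x are replaced by maxima over a grid with polynomially many points. High
moments make the cost of the maximum an arbitrarily small power of N, and the discretisation error
is controlled by a crude polynomial bound and a dyadic chaining estimate for the modes
(`IsRegularOU.moment_pathOpNorm_le`, `exists_moment_pathOpNorm_le`). Continuity in t follows because
each operator depends linearly and boundedly on finitely many continuous coefficients; measurability
follows from lower semicontinuity of the norm in these coefficients. -/

noncomputable section
namespace LatticePhi

/-! ### Integrability of all orders and Gaussian moments -/

section Moments

variable {Ω : Type*} [MeasurableSpace Ω] {P : Measure Ω}

/-- Functions with finite moments of all orders. -/
def AllLp {E : Type*} [NormedAddCommGroup E] (f : Ω → E) (μ : Measure Ω) : Prop :=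
  ∀ p : ℝ≥0∞, p ≠ ∞ → MemLp f p μ

lemma AllLp.mul {f g : Ω → ℂ} (hf : AllLp f P) (hg : AllLp g P) :
    AllLp (fun ω => f ω * g ω) P := by
  intro p hp
  have h2 : (2 * p) ≠ ∞ := ENNReal.mul_ne_top (by simp) hp
  have : ENNReal.HolderTriple (2 * p) (2 * p) p := ⟨by
    rw [ENNReal.mul_inv (by simp) (by simp), ← add_mul, ENNReal.inv_two_add_inv_two, one_mul]⟩
  exact (hg _ h2).mul (hf _ h2)

lemma AllLp.const [IsFiniteMeasure P] {E : Type*} [NormedAddCommGroup E] (c : E) :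
    AllLp (fun _ : Ω => c) P := fun _ _ => memLp_const c

lemma AllLp.add {E : Type*} [NormedAddCommGroup E] {f g : Ω → E} (hf : AllLp f P)
    (hg : AllLp g P) : AllLp (fun ω => f ω + g ω) P := fun p hp => (hf p hp).add (hg p hp)

lemma AllLp.sub {E : Type*} [NormedAddCommGroup E] {f g : Ω → E} (hf : AllLp f P)
    (hg : AllLp g P) : AllLp (fun ω => f ω - g ω) P := fun p hp => (hf p hp).sub (hg p hp)

lemma AllLp.const_mul {f : Ω → ℂ} (hf : AllLp f P) (c : ℂ) : AllLp (fun ω => c * f ω) P :=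
  fun p hp => (hf p hp).const_mul c

lemma AllLp.conj {f : Ω → ℂ} (hf : AllLp f P) : AllLp (fun ω => conj (f ω)) P :=
  fun p hp => (hf p hp).star

lemma AllLp.sum {ι : Type*} {E : Type*} [NormedAddCommGroup E] (s : Finset ι) {f : ι → Ω → E}
    (hf : ∀ i ∈ s, AllLp (f i) P) : AllLp (fun ω => ∑ i ∈ s, f i ω) P := fun p hp =>
  memLp_finsetSum _ fun i hi => hf i hi p hp

lemma AllLp.prod [IsFiniteMeasure P] {ι : Type*} (s : Finset ι) {f : ι → Ω → ℂ}
    (hf : ∀ i ∈ s, AllLp (f i) P) : AllLp (fun ω => ∏ i ∈ s, f i ω) P := by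
  classical
  induction s using Finset.induction_on with
  | empty => simpa using AllLp.const (P := P) (1 : ℂ)
  | insert a s ha ih =>
    simp_rw [Finset.prod_insert ha]
    exact (hf a (by simp)).mul (ih fun i hi => hf i (by simp [hi]))

lemma AllLp.pow [IsFiniteMeasure P] {f : Ω → ℂ} (hf : AllLp f P) (n : ℕ) :
    AllLp (fun ω => f ω ^ n) P := by
  simpa using AllLp.prod (Finset.range n) (f := fun _ => f) fun _ _ => hf

lemma AllLp.integrable {E : Type*} [NormedAddCommGroup E] {f : Ω → E} (hf : AllLp f P) :
    Integrable f P :=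
  memLp_one_iff_integrable.1 (hf 1 (by simp))

lemma AllLp.integrable_norm_pow [IsFiniteMeasure P] {f : Ω → ℂ} (hf : AllLp f P) (n : ℕ) :
    Integrable (fun ω => ‖f ω‖ ^ n) P := by
  simpa using (hf.pow n).integrable.norm

lemma AllLp.comp_fst {Ω' : Type*} [MeasurableSpace Ω'] {Q : Measure Ω'} [IsProbabilityMeasure Q]
    [SFinite P] {E : Type*} [NormedAddCommGroup E] {f : Ω → E} (hf : AllLp f P) :
    AllLp (fun x : Ω × Ω' => f x.1) (P.prod Q) := fun p hp =>
  (hf p hp).comp_measurePreserving measurePreserving_fst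

lemma AllLp.comp_snd {Ω' : Type*} [MeasurableSpace Ω'] {Q : Measure Ω'} [SFinite Q]
    [IsProbabilityMeasure P] {E : Type*} [NormedAddCommGroup E] {f : Ω' → E} (hf : AllLp f Q) :
    AllLp (fun x : Ω × Ω' => f x.2) (P.prod Q) := fun p hp =>
  (hf p hp).comp_measurePreserving measurePreserving_snd

lemma AllLp.of_gaussian {E : Type*} [NormedAddCommGroup E] [NormedSpace ℝ E] [MeasurableSpace E]
    [BorelSpace E] [CompleteSpace E] [SecondCountableTopology E] {X : Ω → E}
    (hX : HasGaussianLaw X P) : AllLp X P := fun _ hp => hX.memLp hp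

/-- Even absolute moments of the standard Gaussian law. -/
def gaussMoment (n : ℕ) : ℝ := ∫ x, x ^ (2 * n) ∂(gaussianReal 0 1)

lemma gaussMoment_nonneg (n : ℕ) : 0 ≤ gaussMoment n :=
  integral_nonneg fun x => by simp only [pow_mul]; positivity

lemma integral_pow_of_gaussian {X : Ω → ℝ} (hX : HasGaussianLaw X P) (h0 : ∫ ω, X ω ∂P = 0)
    (n : ℕ) : ∫ ω, X ω ^ (2 * n) ∂P = (∫ ω, X ω ^ 2 ∂P) ^ n * gaussMoment n := by
  have hm := hX.map_eq_gaussianReal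
  have hv : Var[X; P] = ∫ ω, X ω ^ 2 ∂P := variance_of_integral_eq_zero hX.aemeasurable h0
  rw [h0, hv] at hm
  set v := ∫ ω, X ω ^ 2 ∂P with hvdef
  have hv0 : 0 ≤ v := integral_nonneg fun x => by positivity
  have h1 : ∫ ω, X ω ^ (2 * n) ∂P = ∫ x, x ^ (2 * n) ∂(P.map X) := by
    rw [integral_map hX.aemeasurable (by fun_prop)]
  have h2 : gaussianReal 0 v.toNNReal = (gaussianReal 0 1).map (Real.sqrt v * ·) := by
    rw [gaussianReal_map_const_mul]
    congr 1
    · simp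
    · ext; simp [Real.sq_sqrt hv0, hv0]
  rw [h1, hm, h2, integral_map (by fun_prop) (by fun_prop)]
  simp_rw [mul_pow, integral_const_mul, pow_mul, Real.sq_sqrt hv0]
  simp [gaussMoment, pow_mul]

/-- The real and imaginary parts are centred real Gaussians of variance at most `v`, and their joint
law plays no role since (a² + b²)ⁿ ≤ 2ⁿ(a²ⁿ + b²ⁿ). -/
lemma integral_norm_pow_le_of_gaussian {Y : Ω → ℂ} (hY : HasGaussianLaw Y P)
    (h0 : ∫ ω, Y ω ∂P = 0) {v : ℝ} (hv : ∫ ω, ‖Y ω‖ ^ 2 ∂P ≤ v) (n : ℕ) :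
    ∫ ω, ‖Y ω‖ ^ (2 * n) ∂P ≤ 2 ^ n * (2 * gaussMoment n) * v ^ n := by
  have := hY.isProbabilityMeasure
  have hre : HasGaussianLaw (fun ω => (Y ω).re) P := hY.map_fun Complex.reCLM
  have him : HasGaussianLaw (fun ω => (Y ω).im) P := hY.map_fun Complex.imCLM
  have hi := (AllLp.of_gaussian hY)
  have r0 : ∫ ω, (Y ω).re ∂P = 0 := by
    have := integral_re hi.integrable; simp [h0] at this; simpa using this
  have i0 : ∫ ω, (Y ω).im ∂P = 0 := by
    have := integral_im hi.integrable; simp [h0] at this; simpa using this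
  have hre2 : ∫ ω, (Y ω).re ^ 2 ∂P ≤ v := by
    refine le_trans (integral_mono (AllLp.of_gaussian hre 2 (by simp)).integrable_sq
      (hi.integrable_norm_pow 2) fun ω => ?_) hv
    simpa using pow_le_pow_left₀ (abs_nonneg _) (Complex.abs_re_le_norm (Y ω)) 2
  have him2 : ∫ ω, (Y ω).im ^ 2 ∂P ≤ v := by
    refine le_trans (integral_mono (AllLp.of_gaussian him 2 (by simp)).integrable_sq
      (hi.integrable_norm_pow 2) fun ω => ?_) hv
    simpa using pow_le_pow_left₀ (abs_nonneg _) (Complex.abs_im_le_norm (Y ω)) 2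
  have key : ∀ a b : ℝ, (a ^ 2 + b ^ 2) ^ n ≤ 2 ^ n * (a ^ (2 * n) + b ^ (2 * n)) := by
    intro a b
    calc (a ^ 2 + b ^ 2) ^ n ≤ 2 ^ (n - 1) * ((a ^ 2) ^ n + (b ^ 2) ^ n) :=
          add_pow_le (by positivity) (by positivity) n
      _ ≤ 2 ^ n * ((a ^ 2) ^ n + (b ^ 2) ^ n) := by
          gcongr
          · norm_num
          · omega
      _ = _ := by rw [pow_mul, pow_mul]
  have ir : ∀ {Z : Ω → ℝ}, HasGaussianLaw Z P → Integrable (fun ω => Z ω ^ (2 * n)) P := by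
    intro Z hZ
    have h := AllLp.of_gaussian hZ (2 * n : ℕ) (ENNReal.natCast_ne_top _)
    have := h.integrable_norm_pow' (p := 2 * n)
    refine this.congr (ae_of_all _ fun ω => ?_)
    simp [pow_mul]
  calc ∫ ω, ‖Y ω‖ ^ (2 * n) ∂P
      ≤ ∫ ω, 2 ^ n * ((Y ω).re ^ (2 * n) + (Y ω).im ^ (2 * n)) ∂P := by
        refine integral_mono (hi.integrable_norm_pow _) (((ir hre).add (ir him)).const_mul _)
          fun ω => ?_
        have : ‖Y ω‖ ^ (2 * n) = ((Y ω).re ^ 2 + (Y ω).im ^ 2) ^ n := by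
          rw [pow_mul, ← Complex.normSq_eq_norm_sq, Complex.normSq_apply]; ring_nf
        simpa only [this] using key _ _
    _ = 2 ^ n * ((∫ ω, (Y ω).re ^ 2 ∂P) ^ n * gaussMoment n +
          (∫ ω, (Y ω).im ^ 2 ∂P) ^ n * gaussMoment n) := by
        rw [integral_const_mul, integral_add (ir hre) (ir him), integral_pow_of_gaussian hre r0,
          integral_pow_of_gaussian him i0]
    _ ≤ 2 ^ n * (v ^ n * gaussMoment n + v ^ n * gaussMoment n) := by
        have := gaussMoment_nonneg n
        have h1 : 0 ≤ ∫ ω, (Y ω).re ^ 2 ∂P := integral_nonneg fun x => by positivity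
        have h2 : 0 ≤ ∫ ω, (Y ω).im ^ 2 ∂P := integral_nonneg fun x => by positivity
        gcongr
    _ = _ := by ring

end Moments

/-! ### Complex Gaussian laws determined by second moments -/

section Law

variable {Ω : Type*} [MeasurableSpace Ω] {P : Measure Ω}

/-- Centred Gaussian vectors with the same covariance and pseudo-covariance have the same law. -/
lemma map_eq_of_gaussian {α : Type*} [Fintype α] {Z Z' : Ω → α → ℂ} (hZ : HasGaussianLaw Z P)
    (hZ' : HasGaussianLaw Z' P) (h0 : ∀ a, ∫ ω, Z ω a ∂P = 0) (h0' : ∀ a, ∫ ω, Z' ω a ∂P = 0)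
    (hp : ∀ a b, ∫ ω, Z ω a * Z ω b ∂P = ∫ ω, Z' ω a * Z' ω b ∂P)
    (hc : ∀ a b, ∫ ω, Z ω a * conj (Z ω b) ∂P = ∫ ω, Z' ω a * conj (Z' ω b) ∂P) :
    P.map Z = P.map Z' := by
  classical
  have := hZ.isProbabilityMeasure
  have := hZ.isGaussian_map
  have := hZ'.isGaussian_map
  -- every real functional is the real part of a complex one
  have hL : ∀ L : StrongDual ℝ (α → ℂ), ∃ w : α → ℂ, ∀ x, L x = (∑ a, w a * x a).re := by
    intro L
    refine ⟨fun a => (L (Pi.single a 1) : ℂ) - Complex.I * L (Pi.single a Complex.I), fun x => ?_⟩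
    have hx : x = ∑ a, ((x a).re • (Pi.single a 1 : α → ℂ) +
        (x a).im • (Pi.single a Complex.I : α → ℂ)) := by
      ext b
      rw [Finset.sum_apply, Finset.sum_eq_single b]
      · simp
      · intro c _ hcb; simp [Ne.symm hcb]
      · simp
    conv_lhs => rw [hx]
    simp only [map_sum, map_add, map_smul, Complex.re_sum]
    refine Finset.sum_congr rfl fun a _ => ?_
    simp; ring
  -- (Re S)² = Re(S² + |S|²)/2 expresses the variance of a real functional by pseudo-covariances
  -- (from S²) and covariances (from |S|²).
  have second : ∀ {Y : Ω → α → ℂ}, HasGaussianLaw Y P → ∀ w : α → ℂ,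
      ∫ ω, (∑ a, w a * Y ω a).re ^ 2 ∂P = (∑ a, ∑ b, (w a * w b * ∫ ω, Y ω a * Y ω b ∂P +
        w a * conj (w b) * ∫ ω, Y ω a * conj (Y ω b) ∂P) / 2).re := by
    intro Y hY w
    have hA : ∀ a, AllLp (fun ω => Y ω a) P := fun a =>
      AllLp.of_gaussian (hY.map_fun (ContinuousLinearMap.proj (R := ℝ) a))
    have e : ∀ ω, (∑ a, w a * Y ω a).re ^ 2 = (∑ a, ∑ b, (w a * w b * (Y ω a * Y ω b) +
        w a * conj (w b) * (Y ω a * conj (Y ω b))) / 2).re := by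
      intro ω
      have : ∑ a, ∑ b, (w a * w b * (Y ω a * Y ω b) +
        w a * conj (w b) * (Y ω a * conj (Y ω b))) / 2 = ((∑ a, w a * Y ω a) * (∑ a, w a * Y ω a) +
          (∑ a, w a * Y ω a) * conj (∑ a, w a * Y ω a)) / 2 := by
        rw [map_sum, Finset.sum_mul_sum, Finset.sum_mul_sum, ← Finset.sum_add_distrib,
          Finset.sum_div]
        refine Finset.sum_congr rfl fun a _ => ?_
        rw [← Finset.sum_add_distrib, Finset.sum_div]
        refine Finset.sum_congr rfl fun b _ => ?_
        rw [map_mul]; ring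
      rw [this]
      generalize ∑ a, w a * Y ω a = S
      simp [Complex.add_re, Complex.mul_re]
      ring
    have i1 : ∀ a b, Integrable (fun ω => w a * w b * (Y ω a * Y ω b)) P := fun a b =>
      (((hA a).mul (hA b)).const_mul _).integrable
    have i2 : ∀ a b, Integrable (fun ω => w a * conj (w b) * (Y ω a * conj (Y ω b))) P := fun a b =>
      (((hA a).mul (hA b).conj).const_mul _).integrable
    have i3 : ∀ a b, Integrable (fun ω => (w a * w b * (Y ω a * Y ω b) +
        w a * conj (w b) * (Y ω a * conj (Y ω b))) / 2) P := fun a b =>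
      ((i1 a b).add (i2 a b)).div_const 2
    have i4 : ∀ a, Integrable (fun ω => ∑ b, (w a * w b * (Y ω a * Y ω b) +
        w a * conj (w b) * (Y ω a * conj (Y ω b))) / 2) P := fun a =>
      integrable_finsetSum _ fun b _ => i3 a b
    simp_rw [e]
    have := integral_re (𝕜 := ℂ) (μ := P) (f := fun ω => ∑ a, ∑ b, (w a * w b * (Y ω a * Y ω b) +
        w a * conj (w b) * (Y ω a * conj (Y ω b))) / 2)
      (integrable_finsetSum _ fun a _ => i4 a)
    simp only [RCLike.re_to_complex] at this
    rw [this, integral_finsetSum _ fun a _ => i4 a]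
    congr 1
    refine Finset.sum_congr rfl fun a _ => ?_
    rw [integral_finsetSum _ fun b _ => i3 a b]
    refine Finset.sum_congr rfl fun b _ => ?_
    rw [integral_div, integral_add (i1 a b) (i2 a b), integral_const_mul, integral_const_mul]
  have mean : ∀ {Y : Ω → α → ℂ}, HasGaussianLaw Y P → (∀ a, ∫ ω, Y ω a ∂P = 0) →
      ∀ L : StrongDual ℝ (α → ℂ), ∫ ω, L (Y ω) ∂P = 0 := by
    intro Y hY h L
    have hi := (AllLp.of_gaussian hY).integrable
    rw [L.integral_comp_comm hi]
    have : ∫ ω, Y ω ∂P = 0 := by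
      ext a
      have := (ContinuousLinearMap.proj (R := ℝ) (φ := fun _ : α => ℂ) a).integral_comp_comm hi
      simpa [h a] using this.symm
    simp [this]
  -- The characteristic function of a centred Gaussian vector at `L` depends only on the variance of
  -- `L`.
  refine Measure.ext_of_charFunDual (funext fun L => ?_)
  obtain ⟨w, hw⟩ := hL L
  have hv : ∀ {Y : Ω → α → ℂ}, HasGaussianLaw Y P → (∀ a, ∫ ω, Y ω a ∂P = 0) →
      Var[fun ω => L (Y ω); P] = ∫ ω, (∑ a, w a * Y ω a).re ^ 2 ∂P := by
    intro Y hY h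
    rw [variance_of_integral_eq_zero (hY.map_fun L).aemeasurable (mean hY h L)]
    simp [hw]
  rw [hZ.charFunDual_map_eq_fun, hZ'.charFunDual_map_eq_fun, mean hZ h0, mean hZ' h0',
    hv hZ h0, hv hZ' h0', second hZ, second hZ']
  simp_rw [hp, hc]

end Law

/-! ### Circular Gaussian families and moments of homogeneous polynomials -/

section Circular

variable {Ω : Type*} [MeasurableSpace Ω] {P : Measure Ω}

/-- A sum of almost orthogonal random variables. -/
lemma integral_norm_sum_sq_le {A : Type*} [Fintype A] {F : A → Ω → ℂ} (hF : ∀ T, AllLp (F T) P)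
    (r : A → A → Prop) [DecidableRel r] (hsymm : ∀ T T', r T T' → r T' T)
    (horth : ∀ T T', ¬ r T T' → ∫ ω, F T ω * conj (F T' ω) ∂P = 0) (K : ℕ)
    (hK : ∀ T, (Finset.univ.filter (r T)).card ≤ K) :
    ∫ ω, ‖∑ T, F T ω‖ ^ 2 ∂P ≤ K * ∑ T, ∫ ω, ‖F T ω‖ ^ 2 ∂P := by
  have hi : ∀ T T', Integrable (fun ω => F T ω * conj (F T' ω)) P := fun T T' =>
    ((hF T).mul (hF T').conj).integrable
  have hsq : ∀ T, Integrable (fun ω => ‖F T ω‖ ^ 2) P := fun T => by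
    refine (hi T T).norm.congr (ae_of_all _ fun ω => ?_)
    simp [sq]
  set e : A → ℝ := fun T => ∫ ω, ‖F T ω‖ ^ 2 ∂P
  have h1 : ((∫ ω, ‖∑ T, F T ω‖ ^ 2 ∂P : ℝ) : ℂ) = ∑ T, ∑ T', ∫ ω, F T ω * conj (F T' ω) ∂P := by
    rw [← integral_complex_ofReal]
    have : ∀ ω, ((‖∑ T, F T ω‖ ^ 2 : ℝ) : ℂ) = ∑ T, ∑ T', F T ω * conj (F T' ω) := by
      intro ω
      rw [← Finset.sum_mul_sum, ← map_sum, Complex.mul_conj, Complex.normSq_eq_norm_sq]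
    simp_rw [this]
    rw [integral_finsetSum _ fun T _ => integrable_finsetSum _ fun T' _ => hi T T']
    exact Finset.sum_congr rfl fun T _ => integral_finsetSum _ fun T' _ => hi T T'
  have h2 : ∀ T T', ‖∫ ω, F T ω * conj (F T' ω) ∂P‖ ≤ if r T T' then (e T + e T') / 2 else 0 := by
    intro T T'
    split_ifs with h
    · refine (norm_integral_le_integral_norm _).trans ?_
      rw [← integral_add (hsq T) (hsq T'), ← integral_div]
      refine integral_mono (hi T T').norm (((hsq T).add (hsq T')).div_const 2) fun ω => ?_
      simp only [norm_mul, RCLike.norm_conj]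
      nlinarith [sq_nonneg (‖F T ω‖ - ‖F T' ω‖)]
    · rw [horth T T' h, norm_zero]
  have e0 : ∀ T, 0 ≤ e T := fun T => integral_nonneg fun ω => by positivity
  have h3 : ∫ ω, ‖∑ T, F T ω‖ ^ 2 ∂P ≤ ∑ T, ∑ T', if r T T' then (e T + e T') / 2 else 0 := by
    have : ∫ ω, ‖∑ T, F T ω‖ ^ 2 ∂P = ‖((∫ ω, ‖∑ T, F T ω‖ ^ 2 ∂P : ℝ) : ℂ)‖ := by
      rw [Complex.norm_real, Real.norm_of_nonneg (integral_nonneg fun ω => by positivity)]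
    rw [this, h1]
    exact (norm_sum_le _ _).trans (Finset.sum_le_sum fun T _ => (norm_sum_le _ _).trans
      (Finset.sum_le_sum fun T' _ => h2 T T'))
  -- By symmetry of `r`, the two halves of the average contribute equally, so that each `e T` is
  -- counted once per partner of `T`.
  have h4 : ∑ T, ∑ T', (if r T T' then (e T + e T') / 2 else 0) =
      ∑ T, ∑ T', if r T T' then e T else 0 := by
    have a1 : ∑ T, ∑ T', (if r T T' then e T' / 2 else 0) =
        ∑ T, ∑ T', if r T T' then e T / 2 else 0 := by
      rw [Finset.sum_comm]
      refine Finset.sum_congr rfl fun T _ => Finset.sum_congr rfl fun T' _ => ?_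
      simp only [show r T' T ↔ r T T' from ⟨hsymm _ _, hsymm _ _⟩]
    calc ∑ T, ∑ T', (if r T T' then (e T + e T') / 2 else 0)
        = ∑ T, ∑ T', (if r T T' then e T / 2 else 0) +
          ∑ T, ∑ T', (if r T T' then e T' / 2 else 0) := by
          simp_rw [← Finset.sum_add_distrib]
          refine Finset.sum_congr rfl fun T _ => Finset.sum_congr rfl fun T' _ => ?_
          split_ifs <;> ring
      _ = _ := by
          rw [a1]
          simp_rw [← Finset.sum_add_distrib]
          refine Finset.sum_congr rfl fun T _ => Finset.sum_congr rfl fun T' _ => ?_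
          split_ifs <;> ring
  refine h3.trans ?_
  rw [h4, Finset.mul_sum]
  refine Finset.sum_le_sum fun T _ => ?_
  rw [← Finset.sum_filter, Finset.sum_const, nsmul_eq_mul]
  exact mul_le_mul_of_nonneg_right (by exact_mod_cast hK T) (e0 T)

/-- Centred jointly Gaussian complex variables `g t k` that are uncorrelated for different modes
`k`. -/
structure IsModeGaussian {θ κ : Type*} (g : θ → κ → Ω → ℂ) (P : Measure Ω) : Prop where
  gaussian : IsGaussianProcess (fun p : θ × κ => g p.1 p.2) P
  mean : ∀ t k, ∫ ω, g t k ω ∂P = 0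
  cov : ∀ s t k l, k ≠ l → ∫ ω, g s k ω * conj (g t l ω) ∂P = 0

/-- The circular version `g + i g'` of a family `g`, with `g'` an independent copy. -/
def circ {θ κ : Type*} (g : θ → κ → Ω → ℂ) (t : θ) (k : κ) (x : Ω × Ω) : ℂ :=
  g t k x.1 + Complex.I * g t k x.2

variable {θ κ : Type*} {g : θ → κ → Ω → ℂ}

lemma IsModeGaussian.isProbabilityMeasure (hg : IsModeGaussian g P) : IsProbabilityMeasure P :=
  hg.gaussian.isProbabilityMeasure

lemma IsModeGaussian.hasGaussianLaw_pi (hg : IsModeGaussian g P) {α : Type*} [Fintype α]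
    (p : α → θ × κ) : HasGaussianLaw (fun ω a => g (p a).1 (p a).2 ω) P := by
  have h := (hg.gaussian.comp_right p).hasGaussianLaw Finset.univ
  let L : (↥(Finset.univ : Finset α) → ℂ) →L[ℝ] (α → ℂ) :=
    ContinuousLinearMap.pi fun a => ContinuousLinearMap.proj ⟨a, Finset.mem_univ a⟩
  exact h.map_fun L

lemma IsModeGaussian.allLp (hg : IsModeGaussian g P) (t : θ) (k : κ) : AllLp (g t k) P :=
  AllLp.of_gaussian (hg.gaussian.hasGaussianLaw_eval (t, k))

lemma IsModeGaussian.allLp_circ (hg : IsModeGaussian g P) (t : θ) (k : κ) :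
    AllLp (circ g t k) (P.prod P) := by
  have := hg.isProbabilityMeasure
  exact (hg.allLp t k).comp_fst.add ((hg.allLp t k).comp_snd.const_mul _)

lemma IsModeGaussian.hasGaussianLaw_circ (hg : IsModeGaussian g P) {α : Type*} [Fintype α]
    (p : α → θ × κ) :
    HasGaussianLaw (fun x a => circ g (p a).1 (p a).2 x) (P.prod P) := by
  have := hg.isProbabilityMeasure
  have h := hg.hasGaussianLaw_pi p
  have h1 : HasGaussianLaw (fun x : Ω × Ω => fun a => g (p a).1 (p a).2 x.1) (P.prod P) := by
    constructor
    have : (P.prod P).map (fun x : Ω × Ω => fun a => g (p a).1 (p a).2 x.1) =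
        P.map (fun ω a => g (p a).1 (p a).2 ω) := by
      have hm := (measurePreserving_fst (μ := P) (ν := P)).map_eq
      have := AEMeasurable.map_map_of_aemeasurable (μ := P.prod P) (f := Prod.fst)
        (g := fun ω a => g (p a).1 (p a).2 ω) (by rw [hm]; exact h.aemeasurable) (by fun_prop)
      rw [hm] at this
      exact this.symm
    rw [this]; exact h.isGaussian_map
  have h2 : HasGaussianLaw (fun x : Ω × Ω => fun a => g (p a).1 (p a).2 x.2) (P.prod P) := by
    constructor
    have : (P.prod P).map (fun x : Ω × Ω => fun a => g (p a).1 (p a).2 x.2) =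
        P.map (fun ω a => g (p a).1 (p a).2 ω) := by
      have hm := (measurePreserving_snd (μ := P) (ν := P)).map_eq
      have := AEMeasurable.map_map_of_aemeasurable (μ := P.prod P) (f := Prod.snd)
        (g := fun ω a => g (p a).1 (p a).2 ω) (by rw [hm]; exact h.aemeasurable) (by fun_prop)
      rw [hm] at this
      exact this.symm
    rw [this]; exact h.isGaussian_map
  have hind : IndepFun (fun x : Ω × Ω => fun a => g (p a).1 (p a).2 x.1)
      (fun x : Ω × Ω => fun a => g (p a).1 (p a).2 x.2) (P.prod P) :=
    indepFun_prod₀ h.aemeasurable h.aemeasurable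
  have h3 := hind.hasGaussianLaw h1 h2
  let L : ((α → ℂ) × (α → ℂ)) →L[ℝ] (α → ℂ) :=
    ContinuousLinearMap.fst ℝ (α → ℂ) (α → ℂ) +
      ContinuousLinearMap.pi fun a => (ContinuousLinearMap.lsmul ℝ ℂ Complex.I).comp
        ((ContinuousLinearMap.proj a).comp (ContinuousLinearMap.snd ℝ (α → ℂ) (α → ℂ)))
  exact h3.map_fun L

lemma IsModeGaussian.integral_circ (hg : IsModeGaussian g P) (t : θ) (k : κ) :
    ∫ x, circ g t k x ∂(P.prod P) = 0 := by
  have := hg.isProbabilityMeasure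
  have h := hg.allLp t k
  simp only [circ]
  rw [integral_add h.comp_fst.integrable (h.comp_snd.const_mul _).integrable, integral_const_mul,
    integral_fun_fst (μ := P) (ν := P) (g t k), integral_fun_snd (μ := P) (ν := P) (g t k)]
  simp [hg.mean]

/-- The factor i² = -1 makes the copy cancel the original, and the mixed terms vanish by
independence and centring. In contrast to `g`, where the modes k and -k may be correlated without
conjugation, the circular family has no pseudo-covariance. -/
lemma IsModeGaussian.integral_circ_mul (hg : IsModeGaussian g P) (s t : θ) (k l : κ) :
    ∫ x, circ g s k x * circ g t l x ∂(P.prod P) = 0 := by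
  have := hg.isProbabilityMeasure
  have h1 := hg.allLp s k
  have h2 := hg.allLp t l
  have e : ∀ x : Ω × Ω, circ g s k x * circ g t l x =
      (g s k x.1 * g t l x.1 - g s k x.2 * g t l x.2) +
        Complex.I * (g s k x.1 * g t l x.2 + g t l x.1 * g s k x.2) := by
    intro x
    simp only [circ]
    linear_combination (g s k x.2 * g t l x.2) * Complex.I_mul_I
  have i1 := (h1.mul h2).comp_fst (Q := P)
  have i2 := (h1.mul h2).comp_snd (P := P)
  have i3 := (h1.comp_fst (Q := P)).mul (h2.comp_snd (P := P))
  have i4 := (h2.comp_fst (Q := P)).mul (h1.comp_snd (P := P))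
  simp_rw [e]
  rw [integral_add (i1.sub i2).integrable ((i3.add i4).const_mul _).integrable,
    integral_sub i1.integrable i2.integrable, integral_const_mul,
    integral_add i3.integrable i4.integrable, integral_prod_mul (μ := P) (ν := P) (g s k) (g t l),
    integral_prod_mul (μ := P) (ν := P) (g t l) (g s k),
    integral_fun_fst (μ := P) (ν := P) (fun ω => g s k ω * g t l ω),
    integral_fun_snd (μ := P) (ν := P) (fun ω => g s k ω * g t l ω)]
  simp [hg.mean]

lemma IsModeGaussian.integral_circ_mul_conj (hg : IsModeGaussian g P) (s t : θ) (k l : κ) :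
    ∫ x, circ g s k x * conj (circ g t l x) ∂(P.prod P) =
      2 * ∫ ω, g s k ω * conj (g t l ω) ∂P := by
  have := hg.isProbabilityMeasure
  have h1 := hg.allLp s k
  have h2 := (hg.allLp t l).conj
  have e : ∀ x : Ω × Ω, circ g s k x * conj (circ g t l x) =
      (g s k x.1 * conj (g t l x.1) + g s k x.2 * conj (g t l x.2)) +
        Complex.I * (conj (g t l x.1) * g s k x.2 - g s k x.1 * conj (g t l x.2)) := by
    intro x
    simp only [circ, map_add, map_mul, Complex.conj_I]
    linear_combination (- g s k x.2 * conj (g t l x.2)) * Complex.I_mul_I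
  have i1 := (h1.mul h2).comp_fst (Q := P)
  have i2 := (h1.mul h2).comp_snd (P := P)
  have i3 := (h1.comp_fst (Q := P)).mul (h2.comp_snd (P := P))
  have i4 := (h2.comp_fst (Q := P)).mul (h1.comp_snd (P := P))
  simp_rw [e]
  rw [integral_add (i1.add i2).integrable ((i4.sub i3).const_mul _).integrable,
    integral_add i1.integrable i2.integrable, integral_const_mul,
    integral_sub i4.integrable i3.integrable,
    integral_prod_mul (μ := P) (ν := P) (g s k) (fun ω => conj (g t l ω)),
    integral_prod_mul (μ := P) (ν := P) (fun ω => conj (g t l ω)) (g s k),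
    integral_fun_fst (μ := P) (ν := P) (fun ω => g s k ω * conj (g t l ω)),
    integral_fun_snd (μ := P) (ν := P) (fun ω => g s k ω * conj (g t l ω))]
  simp [hg.mean]
  ring

/-- The law of the circular family is invariant under rotations of the modes. -/
lemma IsModeGaussian.integral_rotate (hg : IsModeGaussian g P) {α : Type*} [Fintype α]
    (p : α → θ × κ) (ρ : κ → ℂ) (hρ : ∀ k, ρ k * conj (ρ k) = 1) (Φ : (α → ℂ) → ℂ)
    (hΦ : Continuous Φ) :
    ∫ x, Φ (fun a => circ g (p a).1 (p a).2 x) ∂(P.prod P) =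
      ∫ x, Φ (fun a => ρ (p a).2 * circ g (p a).1 (p a).2 x) ∂(P.prod P) := by
  have := hg.isProbabilityMeasure
  have h1 := hg.hasGaussianLaw_circ p
  have h2 : HasGaussianLaw (fun x a => ρ (p a).2 * circ g (p a).1 (p a).2 x) (P.prod P) := by
    let L : (α → ℂ) →L[ℝ] (α → ℂ) :=
      ContinuousLinearMap.pi fun a => (ContinuousLinearMap.lsmul ℝ ℂ (ρ (p a).2)).comp
        (ContinuousLinearMap.proj a)
    exact h1.map_fun L
  have hmap := map_eq_of_gaussian h1 h2 (fun a => hg.integral_circ _ _)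
    (fun a => by rw [integral_const_mul, hg.integral_circ, mul_zero])
    (fun a b => by
      have : ∀ x, ρ (p a).2 * circ g (p a).1 (p a).2 x * (ρ (p b).2 * circ g (p b).1 (p b).2 x) =
        (ρ (p a).2 * ρ (p b).2) * (circ g (p a).1 (p a).2 x * circ g (p b).1 (p b).2 x) := by
        intro x; ring
      simp_rw [this]
      rw [integral_const_mul, hg.integral_circ_mul, mul_zero])
    (fun a b => by
      have : ∀ x, ρ (p a).2 * circ g (p a).1 (p a).2 x *
          conj (ρ (p b).2 * circ g (p b).1 (p b).2 x) = (ρ (p a).2 * conj (ρ (p b).2)) *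
          (circ g (p a).1 (p a).2 x * conj (circ g (p b).1 (p b).2 x)) := by
        intro x; rw [map_mul]; ring
      simp_rw [this]
      rw [integral_const_mul, hg.integral_circ_mul_conj]
      by_cases h : (p a).2 = (p b).2
      · rw [h, hρ, one_mul]
      · rw [hg.cov _ _ _ _ h]; simp)
  rw [← integral_map h1.aemeasurable hΦ.aestronglyMeasurable, hmap,
    integral_map h2.aemeasurable hΦ.aestronglyMeasurable]

/-- Rotate the mode `k₀` alone by w = e^{iπ/n}, where n is the number of its occurrences in the
second product. The first product does not change, the second is multiplied by wⁿ = -1, and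
invariance of the law forces the integral to equal its negative. -/
lemma IsModeGaussian.circ_orthogonal [DecidableEq κ] (hg : IsModeGaussian g P) {α β : Type*}
    [Fintype α] [Fintype β] (p : α → θ × κ) (q : β → θ × κ) (k₀ : κ) (hp : ∀ a, (p a).2 ≠ k₀)
    (hq : ∃ b, (q b).2 = k₀) :
    ∫ x, (∏ a, circ g (p a).1 (p a).2 x) * conj (∏ b, circ g (q b).1 (q b).2 x) ∂(P.prod P)
      = 0 := by
  set n := (Finset.univ.filter fun b => (q b).2 = k₀).card with hn
  have hn0 : n ≠ 0 := by
    obtain ⟨b, hb⟩ := hq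
    exact (Finset.card_pos.2 ⟨b, by simp [hb]⟩).ne'
  set w : ℂ := Complex.exp (Real.pi / n * Complex.I) with hw
  have hwn : w ^ n = -1 := by
    rw [hw, ← Complex.exp_nat_mul, ← Complex.exp_pi_mul_I]
    congr 1
    have : (n : ℂ) ≠ 0 := by exact_mod_cast hn0
    field_simp
  have hww : w * conj w = 1 := by
    have : ‖w‖ = 1 := by
      rw [hw]
      have := Complex.norm_exp_ofReal_mul_I (Real.pi / n)
      push_cast at this; exact this
    rw [Complex.mul_conj, Complex.normSq_eq_norm_sq, this]; simp
  let ρ : κ → ℂ := fun k => if k = k₀ then w else 1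
  have h := hg.integral_rotate (α := α ⊕ β) (Sum.elim p q) ρ
    (fun k => by simp only [ρ]; split_ifs; exacts [hww, by simp])
    (fun y => (∏ a, y (Sum.inl a)) * conj (∏ b, y (Sum.inr b)))
    (by fun_prop)
  simp only [Sum.elim_inl, Sum.elim_inr, Finset.prod_mul_distrib, map_mul] at h
  have h1 : ∏ a, ρ (p a).2 = 1 := Finset.prod_eq_one fun a _ => by simp [ρ, hp a]
  have h2 : ∏ b, ρ (q b).2 = -1 := by
    simp only [ρ]
    rw [Finset.prod_ite, Finset.prod_const, Finset.prod_const_one, mul_one, ← hn, hwn]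
  rw [h1, h2] at h
  simp only [one_mul, map_neg, map_one, neg_mul, mul_neg, integral_neg] at h
  exact CharZero.eq_neg_self_iff.1 h

/-- The constant in `IsModeGaussian.integral_circ_chaos_le`. -/
def chaosConst (n : ℕ) : ℝ := n ^ n * (1 + n * (4 ^ n * (2 * gaussMoment n)))

lemma chaosConst_nonneg (n : ℕ) : 0 ≤ chaosConst n := by
  have := gaussMoment_nonneg n
  unfold chaosConst; positivity

/-- The product is at most the power of its largest factor. This replaces a generalised Hölder
inequality; the summand one is only needed for the empty product. -/
lemma prod_le_one_add_sum_pow {α : Type*} [Fintype α] (y : α → ℝ) (hy : ∀ a, 0 ≤ y a) :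
    ∏ a, y a ≤ 1 + ∑ a, y a ^ Fintype.card α := by
  rcases isEmpty_or_nonempty α with h | h
  · simp
  · obtain ⟨b, -, hb⟩ := Finset.exists_max_image Finset.univ y ⟨Classical.arbitrary α, by simp⟩
    calc ∏ a, y a ≤ ∏ _a : α, y b := Finset.prod_le_prod (fun a _ => hy a) fun a ha => hb a ha
      _ = y b ^ Fintype.card α := by simp
      _ ≤ ∑ a, y a ^ Fintype.card α :=
        Finset.single_le_sum (f := fun a => y a ^ Fintype.card α)
          (fun a _ => pow_nonneg (hy a) _) (Finset.mem_univ b)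
      _ ≤ _ := by simp

/-- After normalisation of every factor by its standard deviation, the product is dominated by a sum
of single-variable powers, whose Gaussian moments are known. No independence is used, so repeated
modes and different times are allowed. -/
lemma IsModeGaussian.integral_prod_circ_le (hg : IsModeGaussian g P) {σ : κ → ℝ}
    (hσ : ∀ k, 0 < σ k) (hσ2 : ∀ t k, ∫ ω, ‖g t k ω‖ ^ 2 ∂P ≤ σ k ^ 2) {α : Type*} [Fintype α]
    (p : α → θ × κ) :
    ∫ x, ‖∏ a, circ g (p a).1 (p a).2 x‖ ^ 2 ∂(P.prod P) ≤
      (1 + Fintype.card α * (4 ^ Fintype.card α * (2 * gaussMoment (Fintype.card α)))) *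
        ∏ a, σ (p a).2 ^ 2 := by
  have := hg.isProbabilityMeasure
  set n := Fintype.card α
  have hc2 : ∀ t k, ∫ x, ‖circ g t k x‖ ^ 2 ∂(P.prod P) ≤ 2 * σ k ^ 2 := by
    intro t k
    have h := hg.integral_circ_mul_conj t t k k
    simp only [Complex.mul_conj, Complex.normSq_eq_norm_sq, integral_complex_ofReal] at h
    have h' : ∫ x, ‖circ g t k x‖ ^ 2 ∂(P.prod P) = 2 * ∫ ω, ‖g t k ω‖ ^ 2 ∂P := by
      exact_mod_cast h
    linarith [hσ2 t k]
  have hcn : ∀ t k, ∫ x, (‖circ g t k x‖ ^ 2 / σ k ^ 2) ^ n ∂(P.prod P) ≤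
      4 ^ n * (2 * gaussMoment n) := by
    intro t k
    have hG : HasGaussianLaw (circ g t k) (P.prod P) :=
      (hg.hasGaussianLaw_circ (fun _ : Unit => (t, k))).map_fun
        (ContinuousLinearMap.proj (R := ℝ) ())
    have h := integral_norm_pow_le_of_gaussian hG (hg.integral_circ t k) (hc2 t k) n
    simp_rw [div_pow, ← pow_mul]
    rw [integral_div, div_le_iff₀ (by have := hσ k; positivity)]
    refine h.trans (le_of_eq ?_)
    rw [mul_pow, pow_mul, show (4 : ℝ) = 2 * 2 by norm_num, mul_pow]; ring
  have hci : ∀ a, Integrable (fun x => (‖circ g (p a).1 (p a).2 x‖ ^ 2 / σ (p a).2 ^ 2) ^ n)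
      (P.prod P) := fun a => by
    simp_rw [div_pow, ← pow_mul]
    exact ((hg.allLp_circ _ _).integrable_norm_pow _).div_const _
  have hpos : 0 < ∏ a, σ (p a).2 ^ 2 := Finset.prod_pos fun a _ => pow_pos (hσ _) 2
  calc ∫ x, ‖∏ a, circ g (p a).1 (p a).2 x‖ ^ 2 ∂(P.prod P)
      ≤ ∫ x, (∏ a, σ (p a).2 ^ 2) *
          (1 + ∑ a, (‖circ g (p a).1 (p a).2 x‖ ^ 2 / σ (p a).2 ^ 2) ^ n) ∂(P.prod P) := by
        refine integral_mono ((AllLp.prod _ fun a _ => hg.allLp_circ _ _).integrable_norm_pow 2)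
          (((integrable_const _).add (integrable_finsetSum _ fun a _ => hci a)).const_mul _)
          fun x => ?_
        have h := prod_le_one_add_sum_pow (fun a => ‖circ g (p a).1 (p a).2 x‖ ^ 2 / σ (p a).2 ^ 2)
          (fun a => by positivity)
        rw [Finset.prod_div_distrib, div_le_iff₀ hpos] at h
        simp only [norm_prod, ← Finset.prod_pow]
        linarith [h]
    _ = (∏ a, σ (p a).2 ^ 2) *
          (1 + ∑ a, ∫ x, (‖circ g (p a).1 (p a).2 x‖ ^ 2 / σ (p a).2 ^ 2) ^ n ∂(P.prod P)) := by
        rw [integral_const_mul, integral_add (integrable_const _)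
          (integrable_finsetSum _ fun a _ => hci a), integral_finsetSum _ fun a _ => hci a]
        simp
    _ ≤ (∏ a, σ (p a).2 ^ 2) * (1 + ∑ _a : α, 4 ^ n * (2 * gaussMoment n)) := by
        gcongr with a
        exact hcn _ _
    _ = _ := by simp [n]; ring

/-- Moments of homogeneous polynomials in the circular family. -/
theorem IsModeGaussian.integral_circ_chaos_le [Fintype κ] [DecidableEq κ]
    (hg : IsModeGaussian g P) {σ : κ → ℝ} (hσ : ∀ k, 0 < σ k)
    (hσ2 : ∀ t k, ∫ ω, ‖g t k ω‖ ^ 2 ∂P ≤ σ k ^ 2) (d m : ℕ) (s : Fin d → θ)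
    (c : (Fin d → κ) → ℂ) :
    ∫ x, ‖∑ τ, c τ * ∏ j, circ g (s j) (τ j) x‖ ^ (2 * m) ∂(P.prod P) ≤
      chaosConst (m * d) * (∑ τ, ‖c τ‖ ^ 2 * ∏ j, σ (τ j) ^ 2) ^ m := by
  have := hg.isProbabilityMeasure
  -- The monomials of the m-th power of the polynomial, so that its 2m-th moment becomes a second
  -- moment of their sum.
  let F : (Fin m → Fin d → κ) → Ω × Ω → ℂ := fun T x =>
    (∏ i, c (T i)) * ∏ ij : Fin m × Fin d, circ g (s ij.2) (T ij.1 ij.2) x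
  have hF : ∀ T, AllLp (F T) (P.prod P) := fun T =>
    (AllLp.prod _ fun ij _ => hg.allLp_circ _ _).const_mul _
  have hexp : ∀ x, ‖∑ τ, c τ * ∏ j, circ g (s j) (τ j) x‖ ^ (2 * m) = ‖∑ T, F T x‖ ^ 2 := by
    intro x
    rw [mul_comm, pow_mul, ← norm_pow, Fintype.sum_pow]
    congr 2
    refine Finset.sum_congr rfl fun T _ => ?_
    rw [Finset.prod_mul_distrib]
    simp only [F, Fintype.prod_prod_type]
  -- Monomials can only be correlated when the same modes occur in both: a mode that occurs in one
  -- and not in the other can be rotated.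
  let r (T T' : Fin m → Fin d → κ) : Prop :=
    Set.range (Function.uncurry T) = Set.range (Function.uncurry T')
  classical
  have hpq : ∀ T T', ∀ ij : Fin m × Fin d, Function.uncurry T' ij ∉ Set.range (Function.uncurry T) →
      ∫ x, F T x * conj (F T' x) ∂(P.prod P) = 0 := by
    intro T T' ij hij
    have h := hg.circ_orthogonal (fun ij : Fin m × Fin d => (s ij.2, T ij.1 ij.2))
      (fun ij : Fin m × Fin d => (s ij.2, T' ij.1 ij.2)) (T' ij.1 ij.2)
      (fun a ha => hij ⟨a, ha⟩) ⟨ij, rfl⟩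
    have e : ∀ x, F T x * conj (F T' x) = ((∏ i, c (T i)) * conj (∏ i, c (T' i))) *
        ((∏ a : Fin m × Fin d, circ g (s a.2) (T a.1 a.2) x) *
          conj (∏ b : Fin m × Fin d, circ g (s b.2) (T' b.1 b.2) x)) := by
      intro x; simp only [F, map_mul]; ring
    simp_rw [e]
    rw [integral_const_mul, h, mul_zero]
  have horth : ∀ T T', ¬ r T T' → ∫ x, F T x * conj (F T' x) ∂(P.prod P) = 0 := by
    intro T T' hr
    by_cases h1 : Set.range (Function.uncurry T') ⊆ Set.range (Function.uncurry T)
    · have h2 : ¬ Set.range (Function.uncurry T) ⊆ Set.range (Function.uncurry T') := fun h2 =>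
        hr (Set.Subset.antisymm h2 h1)
      obtain ⟨_, ⟨ij, rfl⟩, hij⟩ := Set.not_subset.1 h2
      have h := hpq T' T ij hij
      have e : ∀ x, F T x * conj (F T' x) = conj (F T' x * conj (F T x)) := by
        intro x; simp [mul_comm]
      simp_rw [e]
      rw [integral_conj, h, map_zero]
    · obtain ⟨_, ⟨ij, rfl⟩, hij⟩ := Set.not_subset.1 h1
      exact hpq T T' ij hij
  -- A tuple with the same range as T is T composed with a self-map of its `m * d` positions, which
  -- bounds the number of partners independently of the number of modes.
  have hK : ∀ T, (Finset.univ.filter (r T)).card ≤ (m * d) ^ (m * d) := by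
    intro T
    have hc : (m * d) ^ (m * d) = Fintype.card (Fin m × Fin d → Fin m × Fin d) := by simp
    rw [hc, ← Finset.card_univ]
    refine Finset.card_le_card_of_surjOn
      (fun f : Fin m × Fin d → Fin m × Fin d => Function.curry (Function.uncurry T ∘ f)) ?_
    intro T' hT'
    have hT' : r T T' := by simpa using hT'
    have : ∀ ij, ∃ ij', Function.uncurry T ij' = Function.uncurry T' ij := fun ij => by
      have : Function.uncurry T' ij ∈ Set.range (Function.uncurry T) := by
        rw [show Set.range (Function.uncurry T) = _ from hT']; exact ⟨ij, rfl⟩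
      exact this
    choose f hf using this
    refine ⟨f, by simp, ?_⟩
    funext i j
    simpa using hf (i, j)
  have hmain := integral_norm_sum_sq_le hF r (fun T T' h => Eq.symm h) horth _ hK
  simp_rw [hexp]
  refine hmain.trans ?_
  have hFT : ∀ T, ∫ x, ‖F T x‖ ^ 2 ∂(P.prod P) ≤
      (1 + ((m * d : ℕ) : ℝ) * (4 ^ (m * d) * (2 * gaussMoment (m * d)))) *
        ∏ i, (‖c (T i)‖ ^ 2 * ∏ j, σ (T i j) ^ 2) := by
    intro T
    have h := hg.integral_prod_circ_le hσ hσ2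
      (fun ij : Fin m × Fin d => (s ij.2, T ij.1 ij.2))
    simp only [F, norm_mul, mul_pow]
    rw [integral_const_mul, Finset.prod_mul_distrib, norm_prod, Finset.prod_pow]
    have h' := mul_le_mul_of_nonneg_left h (show 0 ≤ (∏ i, ‖c (T i)‖) ^ 2 by positivity)
    refine h'.trans (le_of_eq ?_)
    simp only [Fintype.card_prod, Fintype.card_fin, Fintype.prod_prod_type]
    ring
  calc _ ≤ (((m * d) ^ (m * d) : ℕ) : ℝ) * ∑ T : Fin m → Fin d → κ,
        (1 + ((m * d : ℕ) : ℝ) * (4 ^ (m * d) * (2 * gaussMoment (m * d)))) *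
        ∏ i, (‖c (T i)‖ ^ 2 * ∏ j, σ (T i j) ^ 2) := by
        gcongr with T; exact hFT T
    _ = _ := by
        rw [← Finset.mul_sum, Fintype.sum_pow (fun τ => ‖c τ‖ ^ 2 * ∏ j, σ (τ j) ^ 2), chaosConst]
        push_cast; ring

end Circular

/-! ### Wick products as averages over an independent copy -/

section Wick

variable {Ω : Type*} [MeasurableSpace Ω] {P : Measure Ω}

lemma integral_affine_mul {A Y : Ω → ℂ} (hA : AllLp A P) (hY : AllLp Y P) (a : ℂ) :
    ∫ ω, (a + Complex.I * A ω) * Y ω ∂P =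
      a * ∫ ω, Y ω ∂P + Complex.I * ∫ ω, A ω * Y ω ∂P := by
  have e : ∀ ω, (a + Complex.I * A ω) * Y ω = a * Y ω + Complex.I * (A ω * Y ω) := fun ω => by ring
  simp_rw [e]
  rw [integral_add (hY.const_mul a).integrable ((hA.mul hY).const_mul _).integrable,
    integral_const_mul, integral_const_mul]

lemma integral_affine_mul_affine_mul [IsProbabilityMeasure P] {A B Y : Ω → ℂ} (hA : AllLp A P)
    (hB : AllLp B P) (hY : AllLp Y P) (a b : ℂ) :
    ∫ ω, (a + Complex.I * A ω) * ((b + Complex.I * B ω) * Y ω) ∂P =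
      a * b * ∫ ω, Y ω ∂P + Complex.I * (a * ∫ ω, B ω * Y ω ∂P + b * ∫ ω, A ω * Y ω ∂P) -
        ∫ ω, A ω * (B ω * Y ω) ∂P := by
  have hB' : AllLp (fun ω => b + Complex.I * B ω) P := (AllLp.const b).add (hB.const_mul _)
  rw [integral_affine_mul hA (hB'.mul hY), integral_affine_mul hB hY]
  have e : ∀ ω, A ω * ((b + Complex.I * B ω) * Y ω) = (b + Complex.I * B ω) * (A ω * Y ω) :=
    fun ω => by ring
  simp_rw [e]
  rw [integral_affine_mul hB (hA.mul hY)]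
  have e' : ∀ ω, B ω * (A ω * Y ω) = A ω * (B ω * Y ω) := fun ω => by ring
  simp_rw [e']
  linear_combination (∫ ω, A ω * (B ω * Y ω) ∂P) * Complex.I_mul_I

variable {θ κ : Type*} {g : θ → κ → Ω → ℂ}

/-- Averaging (a + iA')(b + iB') over the centred copy leaves ab - E[AB], the Wick product of second
order. -/
lemma integral_circ_mul_right (hg : IsModeGaussian g P) (s t : θ) (k l : κ) (ω : Ω) :
    ∫ ω', circ g s k (ω, ω') * circ g t l (ω, ω') ∂P =
      g s k ω * g t l ω - ∫ ω', g s k ω' * g t l ω' ∂P := by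
  have := hg.isProbabilityMeasure
  have h := integral_affine_mul_affine_mul (hg.allLp s k) (hg.allLp t l) (AllLp.const (1 : ℂ))
    (g s k ω) (g t l ω)
  simp only [mul_one, integral_const, probReal_univ, one_smul, hg.mean, mul_zero, add_zero] at h
  simpa [circ] using h

/-- Third moments of the family vanish. -/
lemma IsModeGaussian.integral_mul_mul (hg : IsModeGaussian g P) (t₁ t₂ t₃ : θ) (k₁ k₂ k₃ : κ) :
    ∫ ω, g t₁ k₁ ω * (g t₂ k₂ ω * g t₃ k₃ ω) ∂P = 0 := by
  classical
  have := hg.isProbabilityMeasure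
  have h := hg.circ_orthogonal (α := Fin 0) (β := Fin 3) (fun a => a.elim0)
    ![(t₁, k₁), (t₂, k₂), (t₃, k₃)] k₁ (fun a => a.elim0) ⟨0, rfl⟩
  simp only [Finset.univ_eq_empty, Finset.prod_empty, one_mul] at h
  rw [integral_conj, ← map_zero (starRingEnd ℂ)] at h
  replace h := (starRingEnd ℂ).injective h
  simp only [Fin.prod_univ_three, Matrix.cons_val_zero, Matrix.cons_val_one, Matrix.cons_val_two,
    Matrix.tail_cons, Matrix.head_cons, mul_assoc] at h
  have hA := hg.allLp t₁ k₁
  have hB := hg.allLp t₂ k₂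
  have hC := hg.allLp t₃ k₃
  set M := ∫ ω, g t₁ k₁ ω * (g t₂ k₂ ω * g t₃ k₃ ω) ∂P with hM
  have inner : ∀ ω, ∫ ω', circ g t₁ k₁ (ω, ω') * (circ g t₂ k₂ (ω, ω') * circ g t₃ k₃ (ω, ω')) ∂P =
      g t₁ k₁ ω * (g t₂ k₂ ω * g t₃ k₃ ω) - (g t₁ k₁ ω * ∫ ω', g t₂ k₂ ω' * g t₃ k₃ ω' ∂P +
        g t₂ k₂ ω * ∫ ω', g t₁ k₁ ω' * g t₃ k₃ ω' ∂P + g t₃ k₃ ω * ∫ ω', g t₁ k₁ ω' * g t₂ k₂ ω' ∂P)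
        - Complex.I * M := by
    intro ω
    have hC' : AllLp (fun ω' => g t₃ k₃ ω + Complex.I * g t₃ k₃ ω') P :=
      (AllLp.const _).add (hC.const_mul _)
    have e1 := integral_affine_mul_affine_mul hA hB hC' (g t₁ k₁ ω) (g t₂ k₂ ω)
    have e2 : ∫ ω', (g t₃ k₃ ω + Complex.I * g t₃ k₃ ω') ∂P = g t₃ k₃ ω := by
      rw [integral_add (AllLp.const (P := P) (g t₃ k₃ ω)).integrable (hC.const_mul _).integrable,
        integral_const_mul, hg.mean]
      simp
    have e3 := integral_affine_mul hC hB (g t₃ k₃ ω)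
    have e4 := integral_affine_mul hC hA (g t₃ k₃ ω)
    have e5 := integral_affine_mul hC (hA.mul hB) (g t₃ k₃ ω)
    rw [hg.mean] at e3 e4
    simp only [circ]
    rw [e1, e2]
    simp_rw [mul_comm _ (g t₃ k₃ ω + Complex.I * g t₃ k₃ _)]
    have c5 : ∀ ω', g t₁ k₁ ω' * ((g t₃ k₃ ω + Complex.I * g t₃ k₃ ω') * g t₂ k₂ ω') =
      (g t₃ k₃ ω + Complex.I * g t₃ k₃ ω') * (g t₁ k₁ ω' * g t₂ k₂ ω') := fun ω' => by ring
    simp_rw [c5]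
    rw [e3, e4, e5]
    have c1 : ∫ ω', g t₃ k₃ ω' * (g t₁ k₁ ω' * g t₂ k₂ ω') ∂P = M := by
      rw [hM]; congr 1; funext ω'; ring
    have c2 : ∫ ω', g t₃ k₃ ω' * g t₂ k₂ ω' ∂P = ∫ ω', g t₂ k₂ ω' * g t₃ k₃ ω' ∂P := by
      congr 1; funext ω'; ring
    have c3 : ∫ ω', g t₃ k₃ ω' * g t₁ k₁ ω' ∂P = ∫ ω', g t₁ k₁ ω' * g t₃ k₃ ω' ∂P := by
      congr 1; funext ω'; ring
    rw [c1, c2, c3]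
    linear_combination (g t₁ k₁ ω * (∫ ω', g t₂ k₂ ω' * g t₃ k₃ ω' ∂P) +
      g t₂ k₂ ω * ∫ ω', g t₁ k₁ ω' * g t₃ k₃ ω' ∂P) * Complex.I_mul_I
  rw [integral_prod _ ((hg.allLp_circ t₁ k₁).mul ((hg.allLp_circ t₂ k₂).mul
    (hg.allLp_circ t₃ k₃))).integrable] at h
  simp_rw [inner] at h
  have iA := fun c : ℂ => (hA.mul (AllLp.const c))
  have iB := fun c : ℂ => (hB.mul (AllLp.const c))
  have iC := fun c : ℂ => (hC.mul (AllLp.const c))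
  rw [integral_sub (((hA.mul (hB.mul hC)).sub (((iA _).add (iB _)).add (iC _)))).integrable
      (AllLp.const _).integrable, integral_sub (hA.mul (hB.mul hC)).integrable
      (((iA _).add (iB _)).add (iC _)).integrable, integral_add ((iA _).add (iB _)).integrable
      (iC _).integrable, integral_add (iA _).integrable (iB _).integrable] at h
  simp only [integral_mul_const, hg.mean, zero_mul, add_zero, sub_zero, integral_const,
    probReal_univ, one_smul, ← hM] at h
  -- The original contributes M and the copy i³M = -iM, while every mixed term contains a mean;
  -- their sum vanishes by circular orthogonality.
  have h1 : (1 - Complex.I) * M = 0 := by linear_combination h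
  rcases mul_eq_zero.1 h1 with h2 | h2
  · exfalso
    have := congrArg Complex.re h2
    simp at this
  · exact h2

/-- The fourth Wick product as an integral over the independent copy. -/
lemma integral_circ_four (hg : IsModeGaussian g P) (t₁ t₂ t₃ t₄ : θ) (k₁ k₂ k₃ k₄ : κ) (ω : Ω) :
    ∫ ω', circ g t₁ k₁ (ω, ω') * (circ g t₂ k₂ (ω, ω') *
      (circ g t₃ k₃ (ω, ω') * circ g t₄ k₄ (ω, ω'))) ∂P =
      g t₁ k₁ ω * (g t₂ k₂ ω * (g t₃ k₃ ω * g t₄ k₄ ω))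
      - (g t₁ k₁ ω * g t₂ k₂ ω * ∫ ω', g t₃ k₃ ω' * g t₄ k₄ ω' ∂P
        + g t₁ k₁ ω * g t₃ k₃ ω * ∫ ω', g t₂ k₂ ω' * g t₄ k₄ ω' ∂P
        + g t₁ k₁ ω * g t₄ k₄ ω * ∫ ω', g t₂ k₂ ω' * g t₃ k₃ ω' ∂P
        + g t₂ k₂ ω * g t₃ k₃ ω * ∫ ω', g t₁ k₁ ω' * g t₄ k₄ ω' ∂P
        + g t₂ k₂ ω * g t₄ k₄ ω * ∫ ω', g t₁ k₁ ω' * g t₃ k₃ ω' ∂P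
        + g t₃ k₃ ω * g t₄ k₄ ω * ∫ ω', g t₁ k₁ ω' * g t₂ k₂ ω' ∂P)
      + ∫ ω', g t₁ k₁ ω' * (g t₂ k₂ ω' * (g t₃ k₃ ω' * g t₄ k₄ ω')) ∂P := by
  have := hg.isProbabilityMeasure
  have hA := hg.allLp t₁ k₁
  have hB := hg.allLp t₂ k₂
  have hC := hg.allLp t₃ k₃
  have hD := hg.allLp t₄ k₄
  have aff : ∀ {A : Ω → ℂ} (a : ℂ), AllLp A P → AllLp (fun ω' => a + Complex.I * A ω') P :=
    fun a hA => (AllLp.const a).add (hA.const_mul _)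
  set a := g t₁ k₁ ω
  set b := g t₂ k₂ ω
  set c := g t₃ k₃ ω
  set d := g t₄ k₄ ω
  simp only [circ]
  rw [integral_affine_mul_affine_mul hA hB ((aff c hC).mul (aff d hD)) a b]
  have y1 := integral_affine_mul_affine_mul hC hD (AllLp.const (1 : ℂ)) c d
  have yB := integral_affine_mul_affine_mul hC hD hB c d
  have yA := integral_affine_mul_affine_mul hC hD hA c d
  have yAB := integral_affine_mul_affine_mul hC hD (hA.mul hB) c d
  simp only [mul_one, integral_const, probReal_univ, one_smul, hg.mean, mul_zero, add_zero] at y1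
  have r1 : ∀ {X : Ω → ℂ}, ∫ ω', X ω' * ((c + Complex.I * g t₃ k₃ ω') *
      (d + Complex.I * g t₄ k₄ ω')) ∂P = ∫ ω', (c + Complex.I * g t₃ k₃ ω') *
      ((d + Complex.I * g t₄ k₄ ω') * X ω') ∂P := fun {X} => by
    congr 1; funext ω'; ring
  have r2 : ∫ ω', g t₁ k₁ ω' * (g t₂ k₂ ω' * ((c + Complex.I * g t₃ k₃ ω') *
      (d + Complex.I * g t₄ k₄ ω'))) ∂P = ∫ ω', (c + Complex.I * g t₃ k₃ ω') *
      ((d + Complex.I * g t₄ k₄ ω') * (g t₁ k₁ ω' * g t₂ k₂ ω')) ∂P := by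
    congr 1; funext ω'; ring
  rw [r1, r1, r2, y1, yA, yB, yAB]
  have z1 := hg.integral_mul_mul t₃ t₄ t₂ k₃ k₄ k₂
  have z2 := hg.integral_mul_mul t₃ t₄ t₁ k₃ k₄ k₁
  have z3 := hg.integral_mul_mul t₄ t₁ t₂ k₄ k₁ k₂
  have z4 := hg.integral_mul_mul t₃ t₁ t₂ k₃ k₁ k₂
  rw [z1, z2, z3, z4, hg.mean, hg.mean]
  have sw : ∀ (s t : θ) (k l : κ), ∫ ω', g s k ω' * g t l ω' ∂P = ∫ ω', g t l ω' * g s k ω' ∂P :=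
    fun s t k l => by congr 1; funext ω'; ring
  have m4 : ∫ ω', g t₃ k₃ ω' * (g t₄ k₄ ω' * (g t₁ k₁ ω' * g t₂ k₂ ω')) ∂P =
      ∫ ω', g t₁ k₁ ω' * (g t₂ k₂ ω' * (g t₃ k₃ ω' * g t₄ k₄ ω')) ∂P := by
    congr 1; funext ω'; ring
  rw [m4, sw t₄ t₂, sw t₃ t₂, sw t₄ t₁, sw t₃ t₁]
  linear_combination (a * (c * (∫ ω', g t₂ k₂ ω' * g t₄ k₄ ω' ∂P) +
      d * ∫ ω', g t₂ k₂ ω' * g t₃ k₃ ω' ∂P) + b * (c * (∫ ω', g t₁ k₁ ω' * g t₄ k₄ ω' ∂P) +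
      d * ∫ ω', g t₁ k₁ ω' * g t₃ k₃ ω' ∂P)) * Complex.I_mul_I

/-- Isserlis' formula for fourth moments. -/
lemma IsModeGaussian.isserlis (hg : IsModeGaussian g P) (t₁ t₂ t₃ t₄ : θ) (k₁ k₂ k₃ k₄ : κ) :
    ∫ ω, g t₁ k₁ ω * (g t₂ k₂ ω * (g t₃ k₃ ω * g t₄ k₄ ω)) ∂P =
      (∫ ω, g t₁ k₁ ω * g t₂ k₂ ω ∂P) * (∫ ω, g t₃ k₃ ω * g t₄ k₄ ω ∂P) +
      (∫ ω, g t₁ k₁ ω * g t₃ k₃ ω ∂P) * (∫ ω, g t₂ k₂ ω * g t₄ k₄ ω ∂P) +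
      (∫ ω, g t₁ k₁ ω * g t₄ k₄ ω ∂P) * (∫ ω, g t₂ k₂ ω * g t₃ k₃ ω ∂P) := by
  classical
  have := hg.isProbabilityMeasure
  have h := hg.circ_orthogonal (α := Fin 0) (β := Fin 4) (fun a => a.elim0)
    ![(t₁, k₁), (t₂, k₂), (t₃, k₃), (t₄, k₄)] k₁ (fun a => a.elim0) ⟨0, rfl⟩
  simp only [Finset.univ_eq_empty, Finset.prod_empty, one_mul] at h
  rw [integral_conj, ← map_zero (starRingEnd ℂ)] at h
  replace h := (starRingEnd ℂ).injective h
  simp only [Fin.prod_univ_four, Matrix.cons_val_zero, Matrix.cons_val_one,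
    Matrix.cons_val, mul_assoc] at h
  have hA := hg.allLp t₁ k₁
  have hB := hg.allLp t₂ k₂
  have hC := hg.allLp t₃ k₃
  have hD := hg.allLp t₄ k₄
  rw [integral_prod _ ((hg.allLp_circ t₁ k₁).mul ((hg.allLp_circ t₂ k₂).mul
    ((hg.allLp_circ t₃ k₃).mul (hg.allLp_circ t₄ k₄)))).integrable] at h
  simp_rw [integral_circ_four hg] at h
  have i1 := hA.mul (hB.mul (hC.mul hD))
  have m : ∀ {A B : Ω → ℂ} (c : ℂ), AllLp A P → AllLp B P → AllLp (fun ω => A ω * B ω * c) P :=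
    fun c h h' => (h.mul h').mul (AllLp.const c)
  have m12 := fun c => m c hA hB
  have m13 := fun c => m c hA hC
  have m14 := fun c => m c hA hD
  have m23 := fun c => m c hB hC
  have m24 := fun c => m c hB hD
  have m34 := fun c => m c hC hD
  rw [integral_add (i1.sub ((((((m12 _).add (m13 _)).add (m14 _)).add (m23 _)).add
      (m24 _)).add (m34 _))).integrable (AllLp.const _).integrable,
    integral_sub i1.integrable ((((((m12 _).add (m13 _)).add (m14 _)).add (m23 _)).add
      (m24 _)).add (m34 _)).integrable,
    integral_add (((((m12 _).add (m13 _)).add (m14 _)).add (m23 _)).add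
      (m24 _)).integrable (m34 _).integrable,
    integral_add ((((m12 _).add (m13 _)).add (m14 _)).add (m23 _)).integrable (m24 _).integrable,
    integral_add (((m12 _).add (m13 _)).add (m14 _)).integrable (m23 _).integrable,
    integral_add ((m12 _).add (m13 _)).integrable (m14 _).integrable,
    integral_add (m12 _).integrable (m13 _).integrable] at h
  simp only [integral_mul_const, integral_const, probReal_univ, one_smul] at h
  -- The fourth moment appears twice, once from the original and once from the copy with i⁴ = 1, and
  -- each of the three pairings appears twice among the six mixed terms.
  linear_combination h / 2

/-- Product of two Wick squares in terms of Wick products. -/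
lemma wick_product (hg : IsModeGaussian g P) (s t : θ) (k₁ k₂ k₃ k₄ : κ) (ω : Ω) :
    (g s k₁ ω * g s k₂ ω - ∫ ω', g s k₁ ω' * g s k₂ ω' ∂P) *
      (g t k₃ ω * g t k₄ ω - ∫ ω', g t k₃ ω' * g t k₄ ω' ∂P) =
    (∫ ω', circ g s k₁ (ω, ω') * (circ g s k₂ (ω, ω') *
      (circ g t k₃ (ω, ω') * circ g t k₄ (ω, ω'))) ∂P)
    + (∫ ω', g s k₂ ω' * g t k₄ ω' ∂P) * (∫ ω', circ g s k₁ (ω, ω') * circ g t k₃ (ω, ω') ∂P)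
    + (∫ ω', g s k₂ ω' * g t k₃ ω' ∂P) * (∫ ω', circ g s k₁ (ω, ω') * circ g t k₄ (ω, ω') ∂P)
    + (∫ ω', g s k₁ ω' * g t k₄ ω' ∂P) * (∫ ω', circ g s k₂ (ω, ω') * circ g t k₃ (ω, ω') ∂P)
    + (∫ ω', g s k₁ ω' * g t k₃ ω' ∂P) * (∫ ω', circ g s k₂ (ω, ω') * circ g t k₄ (ω, ω') ∂P)
    + (∫ ω', g s k₁ ω' * g t k₃ ω' ∂P) * (∫ ω', g s k₂ ω' * g t k₄ ω' ∂P)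
    + (∫ ω', g s k₁ ω' * g t k₄ ω' ∂P) * (∫ ω', g s k₂ ω' * g t k₃ ω' ∂P) := by
  rw [integral_circ_four hg, hg.isserlis]
  simp only [integral_circ_mul_right hg]
  ring

end Wick

/-! ### Moments of Wick polynomials of degree four in two times -/

section WickMoments

variable {Ω : Type*} [MeasurableSpace Ω] {P : Measure Ω}

/-- The bound c ≤ (1 + c)^{2m} avoids roots of the constants. -/
lemma eLpNorm_le_of_integral_pow_le {f : Ω → ℂ} (hf : AllLp f P) {m : ℕ} (hm : m ≠ 0) {c B : ℝ}
    (hc : 0 ≤ c) (hB : 0 ≤ B) (h : ∫ ω, ‖f ω‖ ^ (2 * m) ∂P ≤ c * B ^ (2 * m)) :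
    eLpNorm f ((2 * m : ℕ) : ℝ≥0∞) P ≤ ENNReal.ofReal ((1 + c) * B) := by
  have hm' : 2 * m ≠ 0 := by omega
  rw [(hf _ (ENNReal.natCast_ne_top _)).eLpNorm_eq_integral_rpow_norm (by exact_mod_cast hm')
    (ENNReal.natCast_ne_top _)]
  refine ENNReal.ofReal_le_ofReal ?_
  simp only [ENNReal.toReal_natCast, Real.rpow_natCast]
  rw [Real.rpow_inv_le_iff_of_pos (integral_nonneg fun ω => by positivity) (by positivity)
    (by positivity), Real.rpow_natCast, mul_pow]
  refine h.trans (mul_le_mul_of_nonneg_right ?_ (by positivity))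
  exact (by linarith : c ≤ 1 + c).trans (le_self_pow₀ (by linarith) hm')

lemma norm_integral_pow_le [IsProbabilityMeasure P] {f : Ω → ℂ} {n : ℕ}
    (h1 : Integrable f P) (hn : Integrable (fun ω => ‖f ω‖ ^ n) P) :
    ‖∫ ω, f ω ∂P‖ ^ n ≤ ∫ ω, ‖f ω‖ ^ n ∂P := by
  calc ‖∫ ω, f ω ∂P‖ ^ n ≤ (∫ ω, ‖f ω‖ ∂P) ^ n := by
        gcongr; exact norm_integral_le_integral_norm _
    _ ≤ ∫ ω, ‖f ω‖ ^ n ∂P :=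
        (convexOn_pow n).map_integral_le (by fun_prop) isClosed_Ici
          (ae_of_all _ fun ω => norm_nonneg _) h1.norm hn

/-- Jensen's inequality for the average over the copy, followed by Fubini. It transfers moment
bounds from the circular family to Wick products. -/
lemma integral_norm_integral_pow_le [IsProbabilityMeasure P] {H : Ω × Ω → ℂ}
    (hH : AllLp H (P.prod P)) (n : ℕ)
    (hint : Integrable (fun ω => ‖∫ ω', H (ω, ω') ∂P‖ ^ n) P) :
    ∫ ω, ‖∫ ω', H (ω, ω') ∂P‖ ^ n ∂P ≤ ∫ x, ‖H x‖ ^ n ∂(P.prod P) := by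
  have hn := hH.integrable_norm_pow n
  rw [integral_prod _ hn]
  refine integral_mono_ae hint hn.integral_prod_left ?_
  filter_upwards [hH.integrable.prod_right_ae, hn.prod_right_ae] with ω h1 h2
  exact norm_integral_pow_le h1 h2

lemma sum_fin_two_arrow {κ M : Type*} [Fintype κ] [DecidableEq κ] [AddCommMonoid M]
    (f : (Fin 2 → κ) → M) : ∑ τ, f τ = ∑ a, ∑ b, f ![a, b] := by
  rw [← Fintype.sum_prod_type' (f := fun a b => f ![a, b])]
  refine Fintype.sum_equiv (finTwoArrowEquiv κ) _ _ fun τ => ?_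
  congr 1
  ext i; fin_cases i <;> rfl

lemma sum_fin_four_arrow {κ M : Type*} [Fintype κ] [DecidableEq κ] [AddCommMonoid M]
    (f : (Fin 4 → κ) → M) : ∑ τ, f τ = ∑ a, ∑ b, ∑ c, ∑ d, f ![a, b, c, d] := by
  have e : ∑ a, ∑ b, ∑ c, ∑ d, f ![a, b, c, d] =
      ∑ x : κ × κ × κ × κ, f ![x.1, x.2.1, x.2.2.1, x.2.2.2] := by
    simp only [Fintype.sum_prod_type]
  rw [e]
  refine Fintype.sum_equiv
    { toFun := fun τ => (τ 0, τ 1, τ 2, τ 3)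
      invFun := fun x => ![x.1, x.2.1, x.2.2.1, x.2.2.2]
      left_inv := fun τ => by ext i; fin_cases i <;> rfl
      right_inv := fun x => rfl } _ _ fun τ => ?_
  congr 1
  ext i; fin_cases i <;> rfl

variable {θ κ : Type*} {g : θ → κ → Ω → ℂ}

/-- Correlations at two times are bounded by the common variance bound; no decay in `|s - t|` is
exploited. -/
lemma IsModeGaussian.norm_integral_mul_le (hg : IsModeGaussian g P) {σ : κ → ℝ}
    (hσ2 : ∀ t k, ∫ ω, ‖g t k ω‖ ^ 2 ∂P ≤ σ k ^ 2) (s t : θ) {k l : κ}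
    (hkl : σ l = σ k) : ‖∫ ω, g s k ω * g t l ω ∂P‖ ≤ σ k ^ 2 := by
  have := hg.isProbabilityMeasure
  have i1 := (hg.allLp s k).integrable_norm_pow 2
  have i2 := (hg.allLp t l).integrable_norm_pow 2
  calc ‖∫ ω, g s k ω * g t l ω ∂P‖ ≤ ∫ ω, ‖g s k ω * g t l ω‖ ∂P :=
        norm_integral_le_integral_norm _
    _ ≤ ∫ ω, (‖g s k ω‖ ^ 2 + ‖g t l ω‖ ^ 2) / 2 ∂P := by
        refine integral_mono ((hg.allLp s k).mul (hg.allLp t l)).integrable.norm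
          ((i1.add i2).div_const 2) fun ω => ?_
        simp only [norm_mul]
        nlinarith [sq_nonneg (‖g s k ω‖ - ‖g t l ω‖)]
    _ ≤ σ k ^ 2 := by
        rw [integral_div, integral_add i1 i2]
        have h1 := hσ2 s k
        have h2 := hσ2 t l
        rw [hkl] at h2
        linarith

variable [Fintype κ] [DecidableEq κ]

/-- The form is the average over the copy of a homogeneous circular polynomial of degree four, so
Jensen's inequality reduces it to `IsModeGaussian.integral_circ_chaos_le`. -/
lemma IsModeGaussian.eLpNorm_wick_four_le (hg : IsModeGaussian g P) {σ : κ → ℝ} (hσ : ∀ k, 0 < σ k)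
    (hσ2 : ∀ t k, ∫ ω, ‖g t k ω‖ ^ 2 ∂P ≤ σ k ^ 2) {m : ℕ} (hm : m ≠ 0) (s t : θ)
    (C : κ → κ → κ → κ → ℂ) {B : ℝ} (hB : 0 ≤ B)
    (h : ∑ a, ∑ b, ∑ c, ∑ d, ‖C a b c d‖ ^ 2 * (σ a ^ 2 * σ b ^ 2 * σ c ^ 2 * σ d ^ 2) ≤ B ^ 2) :
    eLpNorm (fun ω => ∑ a, ∑ b, ∑ c, ∑ d, C a b c d * ∫ ω', circ g s a (ω, ω') *
      (circ g s b (ω, ω') * (circ g t c (ω, ω') * circ g t d (ω, ω'))) ∂P)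
      ((2 * m : ℕ) : ℝ≥0∞) P ≤ ENNReal.ofReal ((1 + chaosConst (m * 4)) * B) := by
  have := hg.isProbabilityMeasure
  set T : Fin 4 → θ := ![s, s, t, t]
  let c4 : (Fin 4 → κ) → ℂ := fun τ => C (τ 0) (τ 1) (τ 2) (τ 3)
  let H : Ω × Ω → ℂ := fun x => ∑ τ, c4 τ * ∏ j, circ g (T j) (τ j) x
  have hH : AllLp H (P.prod P) := AllLp.sum _ fun τ _ =>
    (AllLp.prod _ fun j _ => hg.allLp_circ _ _).const_mul _
  have hfun : (fun ω => ∑ a, ∑ b, ∑ c, ∑ d, C a b c d * ∫ ω', circ g s a (ω, ω') *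
      (circ g s b (ω, ω') * (circ g t c (ω, ω') * circ g t d (ω, ω'))) ∂P) =
      fun ω => ∫ ω', H (ω, ω') ∂P := by
    funext ω
    have hz : ∀ t k, AllLp (fun ω' => circ g t k (ω, ω')) P := fun t k =>
      (AllLp.const (g t k ω)).add ((hg.allLp t k).const_mul Complex.I)
    rw [integral_finsetSum _ fun τ _ =>
      ((AllLp.prod _ fun j _ => hz _ _).const_mul _).integrable, sum_fin_four_arrow]
    simp only [integral_const_mul, Fin.prod_univ_four, c4, T, Matrix.cons_val_zero,
      Matrix.cons_val_one, Matrix.cons_val, mul_assoc]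
  have hA : AllLp (fun ω => ∫ ω', H (ω, ω') ∂P) P := by
    rw [← hfun]
    refine AllLp.sum _ fun a _ => AllLp.sum _ fun b _ => AllLp.sum _ fun c _ => AllLp.sum _
      fun d _ => ?_
    simp_rw [integral_circ_four hg]
    have hs := hg.allLp s
    have ht := hg.allLp t
    have m : ∀ {A B : Ω → ℂ} (c : ℂ), AllLp A P → AllLp B P → AllLp (fun ω => A ω * B ω * c) P :=
      fun c h h' => (h.mul h').mul (AllLp.const c)
    exact ((((hs a).mul ((hs b).mul ((ht c).mul (ht d)))).sub ((((((m _ (hs a) (hs b)).add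
      (m _ (hs a) (ht c))).add (m _ (hs a) (ht d))).add (m _ (hs b) (ht c))).add
      (m _ (hs b) (ht d))).add (m _ (ht c) (ht d)))).add (AllLp.const _)).const_mul _
  rw [hfun]
  refine eLpNorm_le_of_integral_pow_le hA hm (chaosConst_nonneg _) hB ?_
  refine (integral_norm_integral_pow_le hH _ (hA.integrable_norm_pow _)).trans ?_
  refine (hg.integral_circ_chaos_le hσ hσ2 4 m T c4).trans ?_
  rw [pow_mul]
  refine mul_le_mul_of_nonneg_left (pow_le_pow_left₀ (by positivity) ?_ m) (chaosConst_nonneg _)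
  rw [sum_fin_four_arrow]
  simpa only [c4, Fin.prod_univ_four, Matrix.cons_val_zero, Matrix.cons_val_one,
    Matrix.cons_val] using h

lemma IsModeGaussian.eLpNorm_wick_two_le (hg : IsModeGaussian g P) {σ : κ → ℝ} (hσ : ∀ k, 0 < σ k)
    (hσ2 : ∀ t k, ∫ ω, ‖g t k ω‖ ^ 2 ∂P ≤ σ k ^ 2) {m : ℕ} (hm : m ≠ 0) (s t : θ)
    (C : κ → κ → ℂ) {B : ℝ} (hB : 0 ≤ B)
    (h : ∑ a, ∑ b, ‖C a b‖ ^ 2 * (σ a ^ 2 * σ b ^ 2) ≤ B ^ 2) :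
    eLpNorm (fun ω => ∑ a, ∑ b, C a b * ∫ ω', circ g s a (ω, ω') * circ g t b (ω, ω') ∂P)
      ((2 * m : ℕ) : ℝ≥0∞) P ≤ ENNReal.ofReal ((1 + chaosConst (m * 2)) * B) := by
  have := hg.isProbabilityMeasure
  set T : Fin 2 → θ := ![s, t]
  let c2 : (Fin 2 → κ) → ℂ := fun τ => C (τ 0) (τ 1)
  let H : Ω × Ω → ℂ := fun x => ∑ τ, c2 τ * ∏ j, circ g (T j) (τ j) x
  have hH : AllLp H (P.prod P) := AllLp.sum _ fun τ _ =>
    (AllLp.prod _ fun j _ => hg.allLp_circ _ _).const_mul _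
  have hfun : (fun ω => ∑ a, ∑ b, C a b *
      ∫ ω', circ g s a (ω, ω') * circ g t b (ω, ω') ∂P) = fun ω => ∫ ω', H (ω, ω') ∂P := by
    funext ω
    have hz : ∀ t k, AllLp (fun ω' => circ g t k (ω, ω')) P := fun t k =>
      (AllLp.const (g t k ω)).add ((hg.allLp t k).const_mul Complex.I)
    rw [integral_finsetSum _ fun τ _ =>
      ((AllLp.prod _ fun j _ => hz _ _).const_mul _).integrable, sum_fin_two_arrow]
    simp only [integral_const_mul, Fin.prod_univ_two, c2, T, Matrix.cons_val_zero,
      Matrix.cons_val_one]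
  have hA : AllLp (fun ω => ∫ ω', H (ω, ω') ∂P) P := by
    rw [← hfun]
    refine AllLp.sum _ fun a _ => AllLp.sum _ fun b _ => ?_
    simp_rw [integral_circ_mul_right hg]
    exact (((hg.allLp s a).mul (hg.allLp t b)).sub (AllLp.const _)).const_mul _
  rw [hfun]
  refine eLpNorm_le_of_integral_pow_le hA hm (chaosConst_nonneg _) hB ?_
  refine (integral_norm_integral_pow_le hH _ (hA.integrable_norm_pow _)).trans ?_
  refine (hg.integral_circ_chaos_le hσ hσ2 2 m T c2).trans ?_
  rw [pow_mul]
  refine mul_le_mul_of_nonneg_left (pow_le_pow_left₀ (by positivity) ?_ m) (chaosConst_nonneg _)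
  rw [sum_fin_two_arrow]
  simpa only [c2, Fin.prod_univ_two, Matrix.cons_val_zero, Matrix.cons_val_one] using h

/-- The constant in `IsModeGaussian.eLpNorm_wick_product_le`. -/
def wickConst (m : ℕ) : ℝ := 7 + chaosConst (m * 4) + 4 * chaosConst (m * 2)

lemma wickConst_nonneg (m : ℕ) : 0 ≤ wickConst m := by
  have := chaosConst_nonneg (m * 4)
  have := chaosConst_nonneg (m * 2)
  unfold wickConst; positivity

/-- Moments of a quadratic form in the Wick squares of the family at two times. -/
theorem IsModeGaussian.eLpNorm_wick_product_le (hg : IsModeGaussian g P) {σ : κ → ℝ}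
    (hσ : ∀ k, 0 < σ k) (hσ2 : ∀ t k, ∫ ω, ‖g t k ω‖ ^ 2 ∂P ≤ σ k ^ 2) (ν : κ → κ)
    (hσν : ∀ k, σ (ν k) = σ k)
    (hpc : ∀ s t k l, l ≠ ν k → ∫ ω, g s k ω * g t l ω ∂P = 0) {m : ℕ} (hm : m ≠ 0) (s t : θ)
    (C : κ → κ → κ → κ → ℂ) (hC12 : ∀ a b c d, C a b c d = C b a c d)
    (hC34 : ∀ a b c d, C a b c d = C a b d c) {B : ℝ} (hB : 0 ≤ B)
    (h4 : ∑ a, ∑ b, ∑ c, ∑ d, ‖C a b c d‖ ^ 2 * (σ a ^ 2 * σ b ^ 2 * σ c ^ 2 * σ d ^ 2) ≤ B ^ 2)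
    (h2 : ∑ b, ∑ d, (∑ a, ‖C a b (ν a) d‖ * σ a ^ 2) ^ 2 * (σ b ^ 2 * σ d ^ 2) ≤ B ^ 2)
    (h0 : ∑ a, ∑ b, ‖C a b (ν a) (ν b)‖ * (σ a ^ 2 * σ b ^ 2) ≤ B) :
    eLpNorm (fun ω => ∑ a, ∑ b, ∑ c, ∑ d, C a b c d *
      ((g s a ω * g s b ω - ∫ ω', g s a ω' * g s b ω' ∂P) *
      (g t c ω * g t d ω - ∫ ω', g t c ω' * g t d ω' ∂P)))
      ((2 * m : ℕ) : ℝ≥0∞) P ≤ ENNReal.ofReal (wickConst m * B) := by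
  have := hg.isProbabilityMeasure
  have hm1 : (1 : ℝ≥0∞) ≤ ((2 * m : ℕ) : ℝ≥0∞) := by
    have : 1 ≤ 2 * m := by omega
    exact_mod_cast this
  set E : κ → κ → ℂ := fun a b => ∫ ω', g s a ω' * g t b ω' ∂P with hE
  have hE0 : ∀ a b, b ≠ ν a → E a b = 0 := fun a b h => hpc s t a b h
  have hEn : ∀ a, ‖E a (ν a)‖ ≤ σ a ^ 2 := fun a => hg.norm_integral_mul_le hσ2 s t (hσν a)
  set W : κ → κ → Ω → ℂ := fun a b ω => ∫ ω', circ g s a (ω, ω') * circ g t b (ω, ω') ∂P with hW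
  let c2 : κ → κ → ℂ := fun b d => ∑ a, C a b (ν a) d * E a (ν a)
  let c0 : ℂ := ∑ a, ∑ b, C a b (ν a) (ν b) * (E a (ν a) * E b (ν b))
  -- contraction of the first and third variables
  have con : ∀ (X : κ → κ → κ → ℂ), ∑ a, ∑ b, ∑ c, ∑ d, C a b c d * (E a c * X a b d) =
      ∑ a, ∑ b, ∑ d, C a b (ν a) d * (E a (ν a) * X a b d) := by
    intro X
    refine Finset.sum_congr rfl fun a _ => Finset.sum_congr rfl fun b _ => ?_
    rw [Finset.sum_eq_single (ν a)]
    · intro c _ hc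
      simp [hE0 a c hc]
    · simp
  have swap12 : ∀ f : κ → κ → κ → κ → ℂ, ∑ a, ∑ b, ∑ c, ∑ d, f a b c d =
      ∑ a, ∑ b, ∑ c, ∑ d, f b a c d := fun f => Finset.sum_comm
  have swap34 : ∀ f : κ → κ → κ → κ → ℂ, ∑ a, ∑ b, ∑ c, ∑ d, f a b c d =
      ∑ a, ∑ b, ∑ c, ∑ d, f a b d c := fun f =>
    Finset.sum_congr rfl fun a _ => Finset.sum_congr rfl fun b _ => Finset.sum_comm
  have two : ∀ ω, ∑ a, ∑ b, ∑ c, ∑ d, C a b c d * (E a c * W b d ω) =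
      ∑ b, ∑ d, c2 b d * W b d ω := by
    intro ω
    rw [con fun a b d => W b d ω, Finset.sum_comm]
    refine Finset.sum_congr rfl fun b _ => ?_
    rw [Finset.sum_comm]
    refine Finset.sum_congr rfl fun d _ => ?_
    simp only [c2, Finset.sum_mul, mul_assoc]
  have zero : ∑ a, ∑ b, ∑ c, ∑ d, C a b c d * (E a c * E b d) = c0 := by
    rw [con fun a b d => E b d]
    refine Finset.sum_congr rfl fun a _ => Finset.sum_congr rfl fun b _ => ?_
    rw [Finset.sum_eq_single (ν b)]
    · intro d _ hd
      simp [hE0 b d hd]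
    · simp
  set F4 : Ω → ℂ := fun ω => ∑ a, ∑ b, ∑ c, ∑ d, C a b c d * ∫ ω', circ g s a (ω, ω') *
      (circ g s b (ω, ω') * (circ g t c (ω, ω') * circ g t d (ω, ω'))) ∂P with hF4
  set F2 : Ω → ℂ := fun ω => ∑ b, ∑ d, c2 b d * W b d ω with hF2
  have hdec : (fun ω => ∑ a, ∑ b, ∑ c, ∑ d, C a b c d *
      ((g s a ω * g s b ω - ∫ ω', g s a ω' * g s b ω' ∂P) *
      (g t c ω * g t d ω - ∫ ω', g t c ω' * g t d ω' ∂P))) = F4 + ((4 : ℂ) • F2 + fun _ => 2 * c0)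
      := by
    funext ω
    have hF2ω : F2 ω = _ := (two ω).symm
    -- The symmetries of C in its first and in its last two arguments identify all four single
    -- contractions, and below both double contractions.
    have t1 : ∑ a, ∑ b, ∑ c, ∑ d, C a b c d * (E b d * W a c ω) = F2 ω := by
      rw [hF2ω, swap12, swap34]
      exact Finset.sum_congr rfl fun a _ => Finset.sum_congr rfl fun b _ => Finset.sum_congr rfl
        fun c _ => Finset.sum_congr rfl fun d _ => by rw [hC12 b a, hC34 a b d c]
    have t2 : ∑ a, ∑ b, ∑ c, ∑ d, C a b c d * (E b c * W a d ω) = F2 ω := by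
      rw [hF2ω, swap12]
      exact Finset.sum_congr rfl fun a _ => Finset.sum_congr rfl fun b _ => Finset.sum_congr rfl
        fun c _ => Finset.sum_congr rfl fun d _ => by rw [hC12 b a]
    have t3 : ∑ a, ∑ b, ∑ c, ∑ d, C a b c d * (E a d * W b c ω) = F2 ω := by
      rw [hF2ω, swap34]
      exact Finset.sum_congr rfl fun a _ => Finset.sum_congr rfl fun b _ => Finset.sum_congr rfl
        fun c _ => Finset.sum_congr rfl fun d _ => by rw [hC34 a b d c]
    have t5 : ∑ a, ∑ b, ∑ c, ∑ d, C a b c d * (E a d * E b c) = c0 := by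
      rw [← zero, swap34]
      exact Finset.sum_congr rfl fun a _ => Finset.sum_congr rfl fun b _ => Finset.sum_congr rfl
        fun c _ => Finset.sum_congr rfl fun d _ => by rw [hC34 a b d c]
    have e : ∀ a b c d, C a b c d * ((g s a ω * g s b ω - ∫ ω', g s a ω' * g s b ω' ∂P) *
        (g t c ω * g t d ω - ∫ ω', g t c ω' * g t d ω' ∂P)) =
        C a b c d * (∫ ω', circ g s a (ω, ω') *
      (circ g s b (ω, ω') * (circ g t c (ω, ω') * circ g t d (ω, ω'))) ∂P) +
        C a b c d * (E b d * W a c ω) + C a b c d * (E b c * W a d ω) +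
        C a b c d * (E a d * W b c ω) + C a b c d * (E a c * W b d ω) +
        C a b c d * (E a c * E b d) + C a b c d * (E a d * E b c) := by
      intro a b c d
      rw [wick_product hg]
      ring
    simp_rw [e, Finset.sum_add_distrib]
    rw [t1, t2, t3, two ω, zero, t5]
    simp only [Pi.add_apply, Pi.smul_apply, smul_eq_mul, hF4, hF2]
    ring
  have hz4 := hg.eLpNorm_wick_four_le hσ hσ2 hm s t C hB h4
  have hc2 : ∀ b d, ‖c2 b d‖ ≤ ∑ a, ‖C a b (ν a) d‖ * σ a ^ 2 := fun b d =>
    (norm_sum_le _ _).trans (Finset.sum_le_sum fun a _ => by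
      rw [norm_mul]; gcongr; exact hEn a)
  have hz2 := hg.eLpNorm_wick_two_le hσ hσ2 hm s t c2 hB ((Finset.sum_le_sum fun b _ =>
    Finset.sum_le_sum fun d _ => by gcongr; exact hc2 b d).trans h2)
  have hc0 : ‖c0‖ ≤ B := by
    refine ((norm_sum_le _ _).trans (Finset.sum_le_sum fun a _ => (norm_sum_le _ _).trans
      (Finset.sum_le_sum fun b _ => ?_))).trans h0
    rw [norm_mul, norm_mul]
    gcongr
    exacts [hEn a, hEn b]
  have a4 : AllLp F4 P := by
    refine AllLp.sum _ fun a _ => AllLp.sum _ fun b _ => AllLp.sum _ fun c _ => AllLp.sum _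
      fun d _ => ?_
    simp_rw [integral_circ_four hg]
    have hs := hg.allLp s
    have ht := hg.allLp t
    have m : ∀ {A B : Ω → ℂ} (c : ℂ), AllLp A P → AllLp B P → AllLp (fun ω => A ω * B ω * c) P :=
      fun c h h' => (h.mul h').mul (AllLp.const c)
    exact ((((hs a).mul ((hs b).mul ((ht c).mul (ht d)))).sub ((((((m _ (hs a) (hs b)).add
      (m _ (hs a) (ht c))).add (m _ (hs a) (ht d))).add (m _ (hs b) (ht c))).add
      (m _ (hs b) (ht d))).add (m _ (ht c) (ht d)))).add (AllLp.const _)).const_mul _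
  have a2 : AllLp F2 P := by
    refine AllLp.sum _ fun a _ => AllLp.sum _ fun b _ => ?_
    simp_rw [hW, integral_circ_mul_right hg]
    exact (((hg.allLp s a).mul (hg.allLp t b)).sub (AllLp.const _)).const_mul _
  have a2' : AEStronglyMeasurable ((4 : ℂ) • F2) P := a2.integrable.aestronglyMeasurable.const_smul _
  rw [hdec]
  refine (eLpNorm_add_le a4.integrable.aestronglyMeasurable (a2'.add aestronglyMeasurable_const)
    hm1).trans ((add_le_add hz4 ((eLpNorm_add_le a2' aestronglyMeasurable_const hm1).trans
      (add_le_add ((eLpNorm_const_smul_le).trans (mul_le_mul_right hz2 _))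
        (le_of_eq (eLpNorm_const _ (by
          have : 2 * m ≠ 0 := by omega
          exact_mod_cast this) (IsProbabilityMeasure.ne_zero P)))))).trans ?_)
  have hcc : ‖2 * c0‖ₑ ≤ ENNReal.ofReal (2 * B) := by
    rw [← ofReal_norm]
    refine ENNReal.ofReal_le_ofReal ?_
    rw [norm_mul]; simpa using hc0
  have h4e : ‖(4 : ℂ)‖ₑ = ENNReal.ofReal 4 := by
    rw [← ofReal_norm]; norm_num
  have k4 := chaosConst_nonneg (m * 4)
  have k2 := chaosConst_nonneg (m * 2)
  simp only [measure_univ, ENNReal.one_rpow, mul_one]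
  rw [h4e]
  refine (add_le_add_right (add_le_add_right hcc _) _).trans ?_
  rw [← ENNReal.ofReal_mul (by norm_num), ← ENNReal.ofReal_add (by positivity) (by positivity),
    ← ENNReal.ofReal_add (by positivity) (by positivity)]
  -- One term of fourth order, four of second order and two constants: (1 + c₄) + 4(1 + c₂) + 2.
  refine ENNReal.ofReal_le_ofReal (le_of_eq ?_)
  rw [wickConst]; ring

end WickMoments

/-! ### Almost sure limits of Gaussian processes -/

section GaussianLimits

variable {Ω : Type*} [MeasurableSpace Ω] {P : Measure Ω}

/-- An almost sure limit of centred Gaussian variables is Gaussian. -/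
lemma hasGaussianLaw_of_tendsto_ae [IsProbabilityMeasure P] {X : ℕ → Ω → ℝ} {Y : Ω → ℝ}
    (hX : ∀ n, HasGaussianLaw (X n) P) (h0 : ∀ n, ∫ ω, X n ω ∂P = 0)
    (hY : ∀ᵐ ω ∂P, Tendsto (fun n => X n ω) atTop (𝓝 (Y ω))) : HasGaussianLaw Y P := by
  have hYm : AEMeasurable Y P := aemeasurable_of_tendsto_metrizable_ae' (fun n =>
    (hX n).aemeasurable) hY
  have := Measure.isProbabilityMeasure_map hYm
  set v : ℕ → ℝ := fun n => Var[X n; P] with hv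
  have hv0 : ∀ n, 0 ≤ v n := fun n => variance_nonneg _ _
  have hcf : ∀ (Z : Ω → ℝ), AEMeasurable Z P → ∀ ξ : ℝ,
      charFun (P.map Z) ξ = ∫ ω, Complex.exp (ξ * Z ω * Complex.I) ∂P := by
    intro Z hZ ξ
    rw [charFun_apply_real, integral_map hZ (by fun_prop)]
  have hcn : ∀ n ξ, charFun (P.map (X n)) ξ = ((Real.exp (-(v n * ξ ^ 2 / 2)) : ℝ) : ℂ) := by
    intro n ξ
    rw [(hX n).map_eq_gaussianReal, h0, charFun_gaussianReal]
    push_cast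
    congr 1
    rw [Real.coe_toNNReal _ (hv0 n)]
    simp [hv]
  have hlim : ∀ ξ : ℝ, Tendsto (fun n => ((Real.exp (-(v n * ξ ^ 2 / 2)) : ℝ) : ℂ)) atTop
      (𝓝 (charFun (P.map Y) ξ)) := by
    intro ξ
    simp_rw [← hcn, fun n => hcf _ (hX n).aemeasurable ξ, hcf _ hYm ξ]
    refine tendsto_integral_of_dominated_convergence (fun _ => (1 : ℝ)) (fun n => ?_)
      (integrable_const _) (fun n => ae_of_all _ fun ω => ?_) ?_
    · have := (hX n).aemeasurable.aestronglyMeasurable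
      fun_prop
    · rw [show (ξ * X n ω * Complex.I : ℂ) = ((ξ * X n ω : ℝ) : ℂ) * Complex.I by push_cast; ring,
        Complex.norm_exp_ofReal_mul_I]
    · filter_upwards [hY] with ω hω
      have : Continuous fun y : ℝ => Complex.exp (ξ * y * Complex.I) := by fun_prop
      exact (this.tendsto _).comp hω
  -- At a point where the limiting characteristic function does not vanish, taking logarithms shows
  -- that the variances converge; in particular they cannot escape to infinity.
  obtain ⟨ξ₀, hξ₀, hne⟩ : ∃ ξ₀ : ℝ, 0 < ξ₀ ∧ charFun (P.map Y) ξ₀ ≠ 0 := by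
    have hc : ContinuousAt (charFun (P.map Y)) 0 := continuous_charFun.continuousAt
    have h1 : ∀ᶠ ξ in 𝓝 (0 : ℝ), charFun (P.map Y) ξ ≠ 0 :=
      hc.eventually_ne (by simp)
    obtain ⟨ε, hε, h⟩ := Metric.eventually_nhds_iff.1 h1
    exact ⟨ε / 2, by positivity, h (by simp [abs_of_pos hε]; exact hε)⟩
  set r : ℝ := (charFun (P.map Y) ξ₀).re with hr
  have hre : ∀ ξ : ℝ, Tendsto (fun n => Real.exp (-(v n * ξ ^ 2 / 2))) atTop
      (𝓝 (charFun (P.map Y) ξ).re) := fun ξ => by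
    refine Tendsto.congr (fun n => ?_) ((Complex.continuous_re.tendsto _).comp (hlim ξ))
    exact Complex.ofReal_re _
  have him : ∀ ξ : ℝ, charFun (P.map Y) ξ = ((charFun (P.map Y) ξ).re : ℂ) := fun ξ =>
    tendsto_nhds_unique (hlim ξ) ((Complex.continuous_ofReal.tendsto _).comp (hre ξ))
  have hrne : r ≠ 0 := fun h => hne (by rw [him ξ₀, ← hr, h]; simp)
  have hvlim : Tendsto v atTop (𝓝 (-(2 * Real.log r / ξ₀ ^ 2))) := by
    have h := ((Real.continuousAt_log hrne).tendsto.comp (hre ξ₀))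
    have h2 := ((h.const_mul 2).div_const (ξ₀ ^ 2)).neg
    refine h2.congr fun n => ?_
    simp only [Function.comp_apply, Real.log_exp]
    field_simp
  set w : ℝ := -(2 * Real.log r / ξ₀ ^ 2) with hw
  have hw0 : 0 ≤ w := ge_of_tendsto' hvlim hv0
  have hlaw : P.map Y = gaussianReal 0 w.toNNReal := by
    refine Measure.ext_of_charFun (funext fun ξ => ?_)
    rw [charFun_gaussianReal, him ξ]
    have : Tendsto (fun n => Real.exp (-(v n * ξ ^ 2 / 2))) atTop
      (𝓝 (Real.exp (-(w * ξ ^ 2 / 2)))) :=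
      (Real.continuous_exp.tendsto _).comp ((hvlim.mul_const _).div_const _).neg
    rw [tendsto_nhds_unique (hre ξ) this, Real.coe_toNNReal _ hw0]
    push_cast
    congr 1
    simp
  exact ⟨by rw [hlaw]; infer_instance⟩

/-- An almost sure limit of centred Gaussian processes is a Gaussian process. -/
lemma isGaussianProcess_of_tendsto_ae [IsProbabilityMeasure P] {T : Type*} {X : ℕ → T → Ω → ℂ}
    {Y : T → Ω → ℂ} (hX : ∀ n, IsGaussianProcess (X n) P) (h0 : ∀ n t, ∫ ω, X n t ω ∂P = 0)
    (hY : ∀ t, ∀ᵐ ω ∂P, Tendsto (fun n => X n t ω) atTop (𝓝 (Y t ω))) :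
    IsGaussianProcess Y P := by
  refine ⟨fun I => ⟨?_⟩⟩
  have hYm : ∀ t, AEMeasurable (Y t) P := fun t => aemeasurable_of_tendsto_metrizable_ae' (fun n =>
    (hX n).aemeasurable t) (hY t)
  have hYI : AEMeasurable (fun ω => I.restrict (Y · ω)) P := aemeasurable_pi_lambda _ fun t => hYm t
  refine isGaussian_of_isGaussian_map fun L => ?_
  rw [AEMeasurable.map_map_of_aemeasurable (by fun_prop) hYI]
  refine (hasGaussianLaw_of_tendsto_ae (X := fun n ω => L (I.restrict (X n · ω)))
    (fun n => ((hX n).hasGaussianLaw I).map_fun L) (fun n => ?_) ?_).isGaussian_map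
  · have hi := (AllLp.of_gaussian ((hX n).hasGaussianLaw I)).integrable
    rw [L.integral_comp_comm hi]
    have : ∫ ω, I.restrict (X n · ω) ∂P = 0 := by
      ext a
      have := (ContinuousLinearMap.proj (R := ℝ) (φ := fun _ : I => ℂ) a).integral_comp_comm hi
      simpa [h0] using this.symm
    rw [this, map_zero]
  · have : ∀ᵐ ω ∂P, ∀ t : I, Tendsto (fun n => X n t ω) atTop (𝓝 (Y t ω)) :=
      ae_all_iff.2 fun t => hY t
    filter_upwards [this] with ω hω
    exact (L.continuous.tendsto _).comp (tendsto_pi_nhds.2 fun t => hω t)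

lemma tendsto_riemann_sum {h : ℝ → ℂ} (hh : Continuous h) :
    Tendsto (fun n : ℕ => ∑ j ∈ Finset.range (n + 1),
      ((1 / (n + 1 : ℝ) : ℝ) : ℂ) * h (j / (n + 1 : ℝ))) atTop (𝓝 (∫ v in (0 : ℝ)..1, h v)) := by
  have huc := isCompact_Icc.uniformContinuousOn_of_continuous
    (hh.continuousOn (s := Set.Icc (0 : ℝ) 1))
  rw [Metric.tendsto_atTop]
  intro ε hε
  obtain ⟨δ, hδ, hd⟩ := Metric.uniformContinuousOn_iff.1 huc (ε / 2) (by positivity)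
  obtain ⟨n₀, hn₀⟩ := exists_nat_one_div_lt hδ
  refine ⟨n₀, fun n hn => ?_⟩
  have hn1 : (0 : ℝ) < n + 1 := by positivity
  have hlt : 1 / (n + 1 : ℝ) < δ := lt_of_le_of_lt (by gcongr) hn₀
  have hsum : ∫ v in (0 : ℝ)..1, h v =
      ∑ j ∈ Finset.range (n + 1), ∫ v in (j / (n + 1 : ℝ))..((j + 1 : ℕ) / (n + 1 : ℝ)), h v := by
    have := intervalIntegral.sum_integral_adjacent_intervals (μ := volume) (f := h)
      (a := fun j : ℕ => (j : ℝ) / (n + 1)) (n := n + 1) fun k _ => hh.intervalIntegrable _ _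
    rw [this]
    congr 1
    · simp
    · push_cast; field_simp
  rw [hsum, dist_eq_norm, ← Finset.sum_sub_distrib]
  have hterm : ∀ j ∈ Finset.range (n + 1), ‖((1 / (n + 1 : ℝ) : ℝ) : ℂ) * h (j / (n + 1 : ℝ)) -
      ∫ v in (j / (n + 1 : ℝ))..((j + 1 : ℕ) / (n + 1 : ℝ)), h v‖ ≤ ε / 2 * (1 / (n + 1)) := by
    intro j hj
    have hj' : (j : ℝ) + 1 ≤ n + 1 := by
      have := Finset.mem_range.1 hj
      exact_mod_cast this
    have hlen : ((j + 1 : ℕ) / (n + 1 : ℝ)) - j / (n + 1 : ℝ) = 1 / (n + 1) := by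
      push_cast; field_simp; ring
    have hle : (j / (n + 1 : ℝ)) ≤ ((j + 1 : ℕ) / (n + 1 : ℝ)) := by
      gcongr; simp
    have hc : ((1 / (n + 1 : ℝ) : ℝ) : ℂ) * h (j / (n + 1 : ℝ)) =
        ∫ _ in (j / (n + 1 : ℝ))..((j + 1 : ℕ) / (n + 1 : ℝ)), h (j / (n + 1 : ℝ)) := by
      rw [intervalIntegral.integral_const, hlen, Complex.real_smul]
    rw [hc, ← intervalIntegral.integral_sub (by simp) (hh.intervalIntegrable _ _)]
    refine (intervalIntegral.norm_integral_le_of_norm_le_const (C := ε / 2) fun v hv => ?_).trans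
      (le_of_eq ?_)
    · rw [Set.uIoc_of_le hle] at hv
      rw [← dist_eq_norm]
      have hv1 : v ≤ 1 := hv.2.trans (by rw [div_le_one hn1]; exact_mod_cast hj')
      have hj0 : (0 : ℝ) ≤ j / (n + 1 : ℝ) := by positivity
      refine (hd _ ⟨hj0, hv.1.le.trans hv1⟩ _ ⟨hj0.trans hv.1.le, hv1⟩ ?_).le
      rw [dist_comm, Real.dist_eq, abs_of_nonneg (by linarith [hv.1])]
      linarith [hv.2]
    · rw [hlen, abs_of_pos (by positivity)]
  refine lt_of_le_of_lt ((norm_sum_le _ _).trans (Finset.sum_le_sum hterm)) ?_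
  rw [Finset.sum_const, Finset.card_range, nsmul_eq_mul]
  push_cast
  field_simp
  linarith

end GaussianLimits

/-! ### The Wiener integral as an exponential average of increments -/

section ExpLaw

/-- The exponential law with rate `c`. -/
def expLaw (c : ℝ) : Measure ℝ :=
  (volume.restrict (Set.Ioi 0)).withDensity fun τ => ENNReal.ofReal (c * Real.exp (-(c * τ)))

lemma integral_expLaw {E : Type*} [NormedAddCommGroup E] [NormedSpace ℝ E] {c : ℝ} (hc : 0 < c)
    (f : ℝ → E) : ∫ τ, f τ ∂(expLaw c) = ∫ τ in Set.Ioi 0, (c * Real.exp (-(c * τ))) • f τ := by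
  rw [expLaw, integral_withDensity_eq_integral_toReal_smul (by fun_prop) (by simp)]
  refine integral_congr_ae (ae_of_all _ fun τ => ?_)
  simp only
  rw [ENNReal.toReal_ofReal (by positivity)]

lemma integrable_expLaw_iff {E : Type*} [NormedAddCommGroup E] [NormedSpace ℝ E] {c : ℝ}
    (hc : 0 < c) (f : ℝ → E) : Integrable f (expLaw c) ↔
      IntegrableOn (fun τ => (c * Real.exp (-(c * τ))) • f τ) (Set.Ioi 0) := by
  rw [expLaw, integrable_withDensity_iff_integrable_smul' (by fun_prop) (by simp), IntegrableOn]
  refine integrable_congr (ae_of_all _ fun τ => ?_)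
  simp only
  rw [ENNReal.toReal_ofReal (by positivity)]

lemma isProbabilityMeasure_expLaw {c : ℝ} (hc : 0 < c) : IsProbabilityMeasure (expLaw c) := by
  constructor
  rw [expLaw, withDensity_apply _ MeasurableSet.univ, Measure.restrict_univ,
    ← ofReal_integral_eq_lintegral_ofReal]
  · rw [integral_const_mul]
    have := integral_exp_mul_Ioi (a := -c) (by linarith) 0
    simp only [neg_mul] at this
    rw [this]
    simp [hc.ne']
  · have := integrableOn_exp_mul_Ioi (a := -c) (by linarith) 0
    simp only [neg_mul] at this
    exact this.const_mul c
  · exact ae_of_all _ fun τ => by positivity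

lemma ae_expLaw_pos (c : ℝ) : ∀ᵐ τ ∂(expLaw c), 0 < τ := by
  refine (withDensity_absolutelyContinuous _ _).ae_le ?_
  exact ae_restrict_mem measurableSet_Ioi

lemma integrable_id_expLaw {c : ℝ} (hc : 0 < c) : Integrable (fun τ => |τ|) (expLaw c) := by
  rw [integrable_expLaw_iff hc]
  have := integrableOn_rpow_mul_exp_neg_mul_rpow (s := 1) (p := 1) (b := c) (by norm_num)
    one_pos hc
  refine (this.const_mul c).congr ?_
  refine (ae_restrict_mem measurableSet_Ioi).mono fun τ (hτ : 0 < τ) => ?_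
  simp only [Real.rpow_one, smul_eq_mul, abs_of_pos hτ, neg_mul]
  ring

/-- The domain is split at τ, where the minimum changes from x to τ. -/
lemma integral_min_expLaw {c : ℝ} (hc : 0 < c) {τ : ℝ} (hτ : 0 < τ) :
    ∫ x, min τ x ∂(expLaw c) = (1 - Real.exp (-(c * τ))) / c := by
  rw [integral_expLaw hc]
  simp only [smul_eq_mul]
  have hE : IntegrableOn (fun x => Real.exp (-(c * x))) (Set.Ioi τ) := by
    have := integrableOn_exp_mul_Ioi (a := -c) (by linarith) τ
    simpa only [neg_mul] using this
  have hI2 : IntegrableOn (fun x => c * Real.exp (-(c * x)) * min τ x) (Set.Ioi τ) := by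
    refine (hE.const_mul (c * τ)).congr ((ae_restrict_mem measurableSet_Ioi).mono
      fun x (hx : τ < x) => ?_)
    simp only [min_eq_left hx.le]; ring
  have hI1 : IntegrableOn (fun x => c * Real.exp (-(c * x)) * min τ x) (Set.Ioc 0 τ) :=
    (by fun_prop : Continuous fun x => c * Real.exp (-(c * x)) * min τ x).integrableOn_Ioc
  rw [← Set.Ioc_union_Ioi_eq_Ioi hτ.le, setIntegral_union (Set.Ioc_disjoint_Ioi le_rfl)
    measurableSet_Ioi hI1 hI2]
  have e2 : ∫ x in Set.Ioi τ, c * Real.exp (-(c * x)) * min τ x = τ * Real.exp (-(c * τ)) := by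
    rw [setIntegral_congr_fun measurableSet_Ioi (g := fun x => c * τ * Real.exp (-(c * x)))
      (fun x (hx : τ < x) => by simp only [min_eq_left hx.le]; ring), integral_const_mul]
    have := integral_exp_mul_Ioi (a := -c) (by linarith) τ
    simp only [neg_mul] at this
    rw [this]; field_simp
  have e1 : ∫ x in Set.Ioc 0 τ, c * Real.exp (-(c * x)) * min τ x =
      1 / c - (τ + 1 / c) * Real.exp (-(c * τ)) := by
    rw [setIntegral_congr_fun measurableSet_Ioc (g := fun x => c * x * Real.exp (-(c * x)))
      (fun x hx => by simp only [min_eq_right hx.2]; ring), ← intervalIntegral.integral_of_le hτ.le,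
      intervalIntegral.integral_eq_sub_of_hasDerivAt
        (f := fun x => -((x + 1 / c) * Real.exp (-(c * x))))]
    · simp; ring
    · intro x _
      have h1 : HasDerivAt (fun x => Real.exp (-(c * x))) (Real.exp (-(c * x)) * (-(c * 1))) x :=
        (((hasDerivAt_id x).const_mul c).neg).exp
      have h2 := (((hasDerivAt_id x).add_const (1 / c)).mul h1).neg
      convert! h2 using 1
      simp only [id]
      field_simp
      ring
    · exact (by fun_prop : Continuous fun x => c * x * Real.exp (-(c * x))).intervalIntegrable _ _
  rw [e1, e2]; field_simp; ring

/-- Brownian increments of lengths τ and x ending at the same time have covariance min(τ, x), so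
this is the stationary variance of the Ornstein–Uhlenbeck process with rate c. -/
lemma integral_integral_min_expLaw {c : ℝ} (hc : 0 < c) :
    ∫ τ, ∫ x, min τ x ∂(expLaw c) ∂(expLaw c) = 1 / (2 * c) := by
  have h : ∀ᵐ τ ∂(expLaw c), ∫ x, min τ x ∂(expLaw c) = (1 - Real.exp (-(c * τ))) / c :=
    (ae_expLaw_pos c).mono fun τ hτ => integral_min_expLaw hc hτ
  rw [integral_congr_ae h, integral_expLaw hc]
  have e : ∀ τ : ℝ, (c * Real.exp (-(c * τ))) • ((1 - Real.exp (-(c * τ))) / c) =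
      Real.exp (-c * τ) - Real.exp ((-(2 * c)) * τ) := by
    intro τ
    rw [smul_eq_mul, show -(2 * c) * τ = -(c * τ) + -(c * τ) by ring, Real.exp_add, neg_mul]
    field_simp
  simp_rw [e]
  rw [integral_sub (integrableOn_exp_mul_Ioi (by linarith) 0)
    (integrableOn_exp_mul_Ioi (by linarith) 0), integral_exp_mul_Ioi (by linarith),
    integral_exp_mul_Ioi (by linarith)]
  simp
  field_simp
  norm_num

/-- The Wiener integral as an average of increments. -/
lemma wienerConv_eq_integral {c : ℝ} (hc : 0 < c) {b : ℝ → ℂ} {t : ℝ}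
    (hb : Integrable (fun τ => b t - b (t - τ)) (expLaw c)) :
    wienerConv c b t = ∫ τ, (b t - b (t - τ)) ∂(expLaw c) := by
  have := isProbabilityMeasure_expLaw hc
  have hb' : Integrable (fun τ => b (t - τ)) (expLaw c) := by
    refine ((integrable_const (b t)).sub hb).congr (ae_of_all _ fun τ => ?_)
    simp
  rw [integral_sub (integrable_const _) hb', integral_const, integral_expLaw hc, wienerConv]
  have hpre : (fun x : ℝ => t - x) ⁻¹' Set.Iic t = Set.Ici 0 := by
    ext x; simp
  have := (Measure.measurePreserving_sub_left volume t).setIntegral_preimage_emb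
    (MeasurableEquiv.subLeft t).measurableEmbedding
    (fun s => (Real.exp (-(c * (t - s))) : ℂ) * b s) (Set.Iic t)
  rw [hpre, integral_Ici_eq_integral_Ioi] at this
  rw [← this, ← integral_const_mul]
  simp only [probReal_univ, one_smul, sub_sub_cancel]
  congr 2
  funext x
  rw [Complex.real_smul]; push_cast; ring

end ExpLaw

/-! ### Regular versions of the noise and covariances of averages -/

section Noise

variable {Ω : Type*} [MeasurableSpace Ω] {P : Measure Ω} {W : ℝ → Freq → Ω → ℂ}

/-- A countable family of processes with almost surely continuous paths has a version that is
measurable and has only continuous paths. -/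
lemma exists_continuous_version {κ : Type*} [Countable κ] {V : ℝ → κ → Ω → ℂ}
    (hm : ∀ s k, AEMeasurable (V s k) P) (hV : ∀ᵐ ω ∂P, ∀ k, Continuous fun s => V s k ω) :
    ∃ V' : ℝ → κ → Ω → ℂ, (∀ s k, Measurable (V' s k)) ∧
      (∀ k ω, Continuous fun s => V' s k ω) ∧ ∀ᵐ ω ∂P, ∀ s k, V s k ω = V' s k ω := by
  classical
  have hgood : ∀ᵐ ω ∂P, ∀ k, (Continuous fun s => V s k ω) ∧
      ∀ q : ℚ, V q k ω = (hm q k).mk (V q k) ω := by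
    refine ae_all_iff.2 fun k => ?_
    have h1 : ∀ᵐ ω ∂P, ∀ q : ℚ, V q k ω = (hm q k).mk (V q k) ω :=
      ae_all_iff.2 fun q => (hm q k).ae_eq_mk
    filter_upwards [hV, h1] with ω h1 h2 using ⟨h1 k, h2⟩
  set bad := {ω | ¬ ∀ k, (Continuous fun s => V s k ω) ∧ ∀ q : ℚ, V q k ω = (hm q k).mk (V q k) ω}
  set S := toMeasurable P bad with hS
  have hS0 : P S = 0 := by rw [hS, measure_toMeasurable]; exact hgood
  have hSm : MeasurableSet S := measurableSet_toMeasurable _ _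
  have hSg : ∀ ω, ω ∉ S → ∀ k, (Continuous fun s => V s k ω) ∧
      ∀ q : ℚ, V q k ω = (hm q k).mk (V q k) ω := by
    intro ω hω
    by_contra h
    exact hω (subset_toMeasurable P bad h)
  -- The paths are killed on a measurable null set that contains every discontinuous path and every
  -- disagreement with a measurable representative at a rational time. Measurability at real times
  -- then follows by limits along rationals.
  let V' : ℝ → κ → Ω → ℂ := fun s k ω => if ω ∈ S then 0 else V s k ω
  have hc : ∀ k ω, Continuous fun s => V' s k ω := by
    intro k ω
    by_cases h : ω ∈ S
    · simp only [V', if_pos h]; exact continuous_const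
    · simp only [V', if_neg h]
      exact (hSg ω h k).1
  have hq : ∀ (q : ℚ) k, Measurable (V' q k) := by
    intro q k
    have : V' q k = S.indicator 0 + Sᶜ.indicator ((hm q k).mk (V q k)) := by
      funext ω
      by_cases h : ω ∈ S
      · simp [V', h]
      · simp [V', h, (hSg ω h k).2 q]
    rw [this]
    exact (measurable_zero.indicator hSm).add ((hm q k).measurable_mk.indicator hSm.compl)
  refine ⟨V', fun s k => ?_, hc, ?_⟩
  · obtain ⟨u, hu, hlim⟩ := mem_closure_iff_seq_limit.1 (Rat.denseRange_cast (𝕜 := ℝ) s)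
    choose q hqu using hu
    refine measurable_of_tendsto_metrizable (fun n => hq (q n) k) ?_
    rw [tendsto_pi_nhds]
    intro ω
    have h := ((hc k ω).tendsto s).comp hlim
    refine h.congr fun n => ?_
    simp [← hqu n]
  · have : ∀ᵐ ω ∂P, ω ∉ S := measure_eq_zero_iff_ae_notMem.1 hS0
    filter_upwards [this] with ω hω s k
    simp [V', hω]

/-- The noise modes have a version that is measurable and has only continuous paths. -/
lemma IsWienerModes.exists_version (hW : IsWienerModes P W) :
    ∃ W' : ℝ → Freq → Ω → ℂ, (∀ s k, Measurable (W' s k)) ∧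
      (∀ k ω, Continuous fun s => W' s k ω) ∧
      ∀ᵐ ω ∂P, ∀ k, k ≠ 0 → ∀ s, W s k ω = W' s k ω := by
  classical
  obtain ⟨V', h1, h2, h3⟩ := exists_continuous_version (P := P)
    (V := fun s (k : Freq) ω => if k = 0 then 0 else W s k ω) (fun s k => by
      by_cases hk : k = 0
      · simp only [hk, if_true]; exact aemeasurable_const
      · simp only [hk, if_false]; exact hW.gaussian.aemeasurable (s, ⟨k, hk⟩))
    (ae_all_iff.2 fun k => by
      by_cases hk : k = 0
      · simp only [hk, if_true]; exact ae_of_all _ fun _ => continuous_const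
      · simpa only [hk, if_false] using hW.continuous k hk)
  refine ⟨V', h1, h2, ?_⟩
  filter_upwards [h3] with ω h k hk s
  have := h s k
  rwa [if_neg hk] at this

lemma IsWienerModes.congr (hW : IsWienerModes P W) {W' : ℝ → Freq → Ω → ℂ}
    (h : ∀ᵐ ω ∂P, ∀ k, k ≠ 0 → ∀ s, W s k ω = W' s k ω) : IsWienerModes P W' where
  gaussian := hW.gaussian.congr fun p => by
    filter_upwards [h] with ω hω using hω _ p.2.2 _
  mean t k hk := by
    rw [← hW.mean t k hk]
    refine integral_congr_ae ?_
    filter_upwards [h] with ω hω using (hω k hk t).symm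
  reality t k hk := by
    filter_upwards [h, hW.reality t k hk] with ω hω h'
    rw [← hω k hk, ← hω (-k) (by simpa using hk), h']
  cov s t k l hk hl := by
    rw [← hW.cov s t k l hk hl]
    refine integral_congr_ae ?_
    filter_upwards [h] with ω hω
    rw [hω k hk, hω l hl]
  continuous k hk := by
    filter_upwards [h, hW.continuous k hk] with ω hω h'
    simpa only [← hω k hk] using h'

lemma IsWienerModes.allLp (hW : IsWienerModes P W) {k : Freq} (hk : k ≠ 0) (t : ℝ) :
    AllLp (W t k) P :=
  AllLp.of_gaussian (hW.gaussian.hasGaussianLaw_eval (t, ⟨k, hk⟩))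

lemma IsWienerModes.integral_increment (hW : IsWienerModes P W) {k l : Freq} (hk : k ≠ 0)
    (hl : l ≠ 0) (a b c d : ℝ) :
    ∫ ω, (W a k ω - W b k ω) * conj (W c l ω - W d l ω) ∂P =
      if k = l then (((|a - d| + |b - c| - |a - c| - |b - d|) / 2 : ℝ) : ℂ) else 0 := by
  have e : ∀ ω, (W a k ω - W b k ω) * conj (W c l ω - W d l ω) =
      (W a k ω * conj (W c l ω) - W a k ω * conj (W d l ω)) -
        (W b k ω * conj (W c l ω) - W b k ω * conj (W d l ω)) := by
    intro ω; rw [map_sub]; ring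
  have i : ∀ x y, AllLp (fun ω => W x k ω * conj (W y l ω)) P := fun x y =>
    (hW.allLp hk x).mul (hW.allLp hl y).conj
  simp_rw [e]
  rw [integral_sub ((i a c).sub (i a d)).integrable ((i b c).sub (i b d)).integrable,
    integral_sub (i a c).integrable (i a d).integrable,
    integral_sub (i b c).integrable (i b d).integrable]
  simp only [hW.cov _ _ _ _ hk hl]
  split_ifs
  · rw [← Complex.ofReal_sub, ← Complex.ofReal_sub, ← Complex.ofReal_sub]
    congr 1; ring
  · simp

lemma IsWienerModes.integral_norm_increment_sq (hW : IsWienerModes P W) {k : Freq} (hk : k ≠ 0)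
    (a b : ℝ) : ∫ ω, ‖W a k ω - W b k ω‖ ^ 2 ∂P = |a - b| := by
  have h := hW.integral_increment hk hk a b a b
  simp only [Complex.mul_conj, Complex.normSq_eq_norm_sq, integral_complex_ofReal, if_true] at h
  have h' := Complex.ofReal_injective h
  rw [h', abs_sub_comm b a]; simp

section Average

variable [IsProbabilityMeasure P] {μ ν : Measure ℝ} [IsProbabilityMeasure μ]
  [IsProbabilityMeasure ν] {Y Z : ℝ → Ω → ℂ} {v w : ℝ → ℝ}

/-- An integrable bound for the second moments dominates the first moments through y ≤ 1 + y², which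
is what Fubini's theorem needs for averages over τ. -/
lemma integrable_of_average (hY : Measurable (Function.uncurry Y)) (hYL : ∀ τ, AllLp (Y τ) P)
    (hv : ∀ τ, ∫ ω, ‖Y τ ω‖ ^ 2 ∂P ≤ v τ) (hvi : Integrable v μ) :
    Integrable (Function.uncurry Y) (μ.prod P) := by
  refine (integrable_prod_iff hY.aestronglyMeasurable).2
    ⟨ae_of_all _ fun τ => (hYL τ).integrable, ?_⟩
  refine Integrable.mono' ((integrable_const (1 : ℝ)).add hvi) ?_ (ae_of_all _ fun τ => ?_)
  · exact hY.norm.stronglyMeasurable.integral_prod_right.aestronglyMeasurable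
  · rw [Real.norm_of_nonneg (integral_nonneg fun ω => norm_nonneg _)]
    calc ∫ ω, ‖Y τ ω‖ ∂P ≤ ∫ ω, (1 + ‖Y τ ω‖ ^ 2) ∂P :=
          integral_mono (hYL τ).integrable.norm ((integrable_const _).add
            ((hYL τ).integrable_norm_pow 2)) fun ω => by
              simp only; nlinarith [sq_nonneg (‖Y τ ω‖ - 1), norm_nonneg (Y τ ω)]
      _ = 1 + ∫ ω, ‖Y τ ω‖ ^ 2 ∂P := by
          rw [integral_add (integrable_const _) ((hYL τ).integrable_norm_pow 2)]; simp
      _ ≤ _ := by simpa using hv τ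

lemma ae_integrable_of_average (hY : Measurable (Function.uncurry Y))
    (hYL : ∀ τ, AllLp (Y τ) P) (hv : ∀ τ, ∫ ω, ‖Y τ ω‖ ^ 2 ∂P ≤ v τ) (hvi : Integrable v μ) :
    ∀ᵐ ω ∂P, Integrable (fun τ => Y τ ω) μ :=
  (integrable_of_average hY hYL hv hvi).prod_left_ae

lemma integral_average (hY : Measurable (Function.uncurry Y)) (hYL : ∀ τ, AllLp (Y τ) P)
    (hv : ∀ τ, ∫ ω, ‖Y τ ω‖ ^ 2 ∂P ≤ v τ) (hvi : Integrable v μ) :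
    ∫ ω, ∫ τ, Y τ ω ∂μ ∂P = ∫ τ, ∫ ω, Y τ ω ∂P ∂μ :=
  (integral_integral_swap (integrable_of_average hY hYL hv hvi)).symm

lemma integral_average_mul_conj (hY : Measurable (Function.uncurry Y))
    (hZ : Measurable (Function.uncurry Z)) (hYL : ∀ τ, AllLp (Y τ) P) (hZL : ∀ τ, AllLp (Z τ) P)
    (hv : ∀ τ, ∫ ω, ‖Y τ ω‖ ^ 2 ∂P ≤ v τ) (hw : ∀ τ, ∫ ω, ‖Z τ ω‖ ^ 2 ∂P ≤ w τ)
    (hvi : Integrable v μ) (hwi : Integrable w ν) :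
    ∫ ω, (∫ τ, Y τ ω ∂μ) * conj (∫ τ, Z τ ω ∂ν) ∂P =
      ∫ p, ∫ ω, Y p.1 ω * conj (Z p.2 ω) ∂P ∂(μ.prod ν) := by
  have e : ∀ ω, (∫ τ, Y τ ω ∂μ) * conj (∫ τ, Z τ ω ∂ν) =
      ∫ p, Y p.1 ω * conj (Z p.2 ω) ∂(μ.prod ν) := by
    intro ω
    rw [← integral_conj, integral_prod_mul (fun τ => Y τ ω) (fun τ => conj (Z τ ω))]
  simp_rw [e]
  have hm : Measurable (Function.uncurry fun (p : ℝ × ℝ) ω => Y p.1 ω * conj (Z p.2 ω)) := by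
    have h1 : Measurable fun q : (ℝ × ℝ) × Ω => Y q.1.1 q.2 :=
      hY.comp (f := fun q : (ℝ × ℝ) × Ω => (q.1.1, q.2)) (by fun_prop)
    have h2 : Measurable fun q : (ℝ × ℝ) × Ω => Z q.1.2 q.2 :=
      hZ.comp (f := fun q : (ℝ × ℝ) × Ω => (q.1.2, q.2)) (by fun_prop)
    exact h1.mul (Complex.continuous_conj.measurable.comp h2)
  refine (integral_integral_swap ?_).symm
  refine (integrable_prod_iff hm.aestronglyMeasurable).2
    ⟨ae_of_all _ fun p => ((hYL p.1).mul (hZL p.2).conj).integrable, ?_⟩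
  refine Integrable.mono' ((hvi.comp_fst ν).add (hwi.comp_snd μ)) ?_ (ae_of_all _ fun p => ?_)
  · exact hm.norm.stronglyMeasurable.integral_prod_right.aestronglyMeasurable
  · rw [Real.norm_of_nonneg (integral_nonneg fun ω => norm_nonneg _)]
    calc ∫ ω, ‖Y p.1 ω * conj (Z p.2 ω)‖ ∂P ≤ ∫ ω, (‖Y p.1 ω‖ ^ 2 + ‖Z p.2 ω‖ ^ 2) ∂P :=
          integral_mono ((hYL p.1).mul (hZL p.2).conj).integrable.norm
            (((hYL p.1).integrable_norm_pow 2).add ((hZL p.2).integrable_norm_pow 2)) fun ω => by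
              simp only [norm_mul, RCLike.norm_conj]
              nlinarith [sq_nonneg (‖Y p.1 ω‖ - ‖Z p.2 ω‖), sq_nonneg (‖Y p.1 ω‖),
                sq_nonneg (‖Z p.2 ω‖)]
      _ ≤ _ := by
          rw [integral_add ((hYL p.1).integrable_norm_pow 2) ((hZL p.2).integrable_norm_pow 2)]
          exact add_le_add (hv p.1) (hw p.2)

end Average

end Noise

/-! ### The stationary Ornstein–Uhlenbeck modes -/

section OrnsteinUhlenbeck

variable {Ω : Type*} [MeasurableSpace Ω] {P : Measure Ω} [IsProbabilityMeasure P]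
  {W : ℝ → Freq → Ω → ℂ}

set_option linter.unusedSectionVars false

lemma measurable_increment (hm : ∀ s k, Measurable (W s k))
    (hcont : ∀ k ω, Continuous fun s => W s k ω) (t : ℝ) (k : Freq) :
    Measurable (Function.uncurry fun τ ω => W t k ω - W (t - τ) k ω) := by
  refine measurable_uncurry_of_continuous_of_measurable (fun ω => ?_) fun τ =>
    (hm t k).sub (hm (t - τ) k)
  exact continuous_const.sub ((hcont k ω).comp (by fun_prop))

lemma IsWienerModes.allLp_increment (hW : IsWienerModes P W) {k : Freq} (hk : k ≠ 0) (t τ : ℝ) :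
    AllLp (fun ω => W t k ω - W (t - τ) k ω) P := (hW.allLp hk t).sub (hW.allLp hk (t - τ))

lemma IsWienerModes.increment_le (hW : IsWienerModes P W) {k : Freq} (hk : k ≠ 0) (t τ : ℝ) :
    ∫ ω, ‖W t k ω - W (t - τ) k ω‖ ^ 2 ∂P ≤ |τ| := by
  rw [hW.integral_norm_increment_sq hk]; simp

lemma IsWienerModes.ae_integrable_increment (hW : IsWienerModes P W)
    (hm : ∀ s k, Measurable (W s k)) (hcont : ∀ k ω, Continuous fun s => W s k ω)
    {k : Freq} (hk : k ≠ 0) {c : ℝ} (hc : 0 < c) (t : ℝ) :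
    ∀ᵐ ω ∂P, Integrable (fun τ => W t k ω - W (t - τ) k ω) (expLaw c) := by
  have := isProbabilityMeasure_expLaw hc
  exact ae_integrable_of_average (measurable_increment hm hcont t k)
    (hW.allLp_increment hk t) (hW.increment_le hk t) (integrable_id_expLaw hc)

lemma IsWienerModes.wienerConv_ae (hW : IsWienerModes P W)
    (hm : ∀ s k, Measurable (W s k)) (hcont : ∀ k ω, Continuous fun s => W s k ω)
    {k : Freq} (hk : k ≠ 0) {c : ℝ} (hc : 0 < c) (t : ℝ) :
    ∀ᵐ ω ∂P, wienerConv c (fun s => W s k ω) t =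
      ∫ τ, (W t k ω - W (t - τ) k ω) ∂(expLaw c) := by
  filter_upwards [hW.ae_integrable_increment hm hcont hk hc t] with ω hω
  exact wienerConv_eq_integral (b := fun s => W s k ω) hc hω

lemma isGaussianProcess_finset_sum {S T ι : Type*} {X : T → Ω → ℂ} (hX : IsGaussianProcess X P)
    (J : S → Finset ι) (a : S → ι → ℂ) (f : S → ι → T) :
    IsGaussianProcess (fun s ω => ∑ j ∈ J s, a s j * X (f s j) ω) P := by
  classical
  refine hX.of_isGaussianProcess fun s => ⟨(J s).image (f s),
    ∑ j ∈ (J s).attach, (ContinuousLinearMap.mul ℝ ℂ (a s j)).comp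
      (ContinuousLinearMap.proj (R := ℝ) (φ := fun _ : ((J s).image (f s)) => ℂ)
        ⟨f s j, Finset.mem_image_of_mem _ j.2⟩), fun ω => ?_⟩
  simp only [FunLike.coe_sum, Finset.sum_apply, ContinuousLinearMap.coe_comp,
    Function.comp_apply, ContinuousLinearMap.proj_apply, ContinuousLinearMap.mul_apply',
    Finset.restrict]
  exact (Finset.sum_attach (J s) fun j => a s j * X (f s j) ω).symm

/-- Riemann sums of the truncated average are linear combinations of increments, hence jointly
Gaussian. Two successive almost sure limits, refining the mesh and then removing the truncation,
preserve Gaussianity. -/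
lemma IsWienerModes.isGaussianProcess_wienerConv (hW : IsWienerModes P W)
    (hm : ∀ s k, Measurable (W s k)) (hcont : ∀ k ω, Continuous fun s => W s k ω)
    {κ : Type*} (ι : κ → Freq) (hι : ∀ k, ι k ≠ 0) (c : κ → ℝ) (hc : ∀ k, 0 < c k) :
    IsGaussianProcess (fun (p : ℝ × κ) ω =>
      wienerConv (c p.2) (fun s => W s (ι p.2) ω) p.1) P := by
  -- truncated averages of increments
  let H : ℝ → ℝ × κ → Ω → ℝ → ℂ := fun R p ω v =>
    ((R * (c p.2 * Real.exp (-(c p.2 * (R * v)))) : ℝ) : ℂ) *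
      (W p.1 (ι p.2) ω - W (p.1 - R * v) (ι p.2) ω)
  have hH : ∀ R p ω, Continuous (H R p ω) := by
    intro R p ω
    refine Continuous.mul (by fun_prop) (continuous_const.sub ?_)
    exact (hcont (ι p.2) ω).comp (f := fun v => p.1 - R * v) (by fun_prop)
  let X : ℝ → ℕ → ℝ × κ → Ω → ℂ := fun R n p ω =>
    ∑ j ∈ Finset.range (n + 1), ((1 / (n + 1 : ℝ) : ℝ) : ℂ) * H R p ω (j / (n + 1 : ℝ))
  have hXg : ∀ R n, IsGaussianProcess (X R n) P := by
    intro R n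
    have hd : IsGaussianProcess (fun (q : ℝ × ℝ × κ) ω =>
        W q.2.1 (ι q.2.2) ω - W (q.2.1 - q.1) (ι q.2.2) ω) P := by
      have := isGaussianProcess_finset_sum (S := ℝ × ℝ × κ) (ι := Bool) hW.gaussian
        (fun _ => Finset.univ) (fun _ b => if b then 1 else -1)
        (fun q b => (if b then q.2.1 else q.2.1 - q.1, ⟨ι q.2.2, hι _⟩))
      convert this using 3 with q ω
      simp [sub_eq_add_neg]
    have := isGaussianProcess_finset_sum hd (S := ℝ × κ) (ι := ℕ)
      (fun _ => Finset.range (n + 1)) (fun p j => ((1 / (n + 1 : ℝ) : ℝ) : ℂ) *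
        ((R * (c p.2 * Real.exp (-(c p.2 * (R * (j / (n + 1 : ℝ)))))) : ℝ) : ℂ))
      (fun p j => (R * (j / (n + 1 : ℝ)), p))
    convert this using 3 with p ω
    simp only [X, H]
    refine Finset.sum_congr rfl fun j _ => by ring
  have hX0 : ∀ R n p, ∫ ω, X R n p ω ∂P = 0 := by
    intro R n p
    have hi : ∀ t, Integrable (W t (ι p.2)) P := fun t => (hW.allLp (hι _) t).integrable
    simp only [X]
    have hH' : ∀ v, Integrable (fun ω => H R p ω v) P := fun v =>
      ((hi _).sub (hi (p.1 - R * v))).const_mul _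
    rw [integral_finsetSum _ fun j _ => (hH' _).const_mul _]
    refine Finset.sum_eq_zero fun j _ => ?_
    simp only [H]
    rw [integral_const_mul, integral_const_mul, integral_sub (hi _) (hi _), hW.mean _ _ (hι _),
      hW.mean _ _ (hι _)]
    simp
  let Y : ℝ → ℝ × κ → Ω → ℂ := fun R p ω => ∫ v in (0 : ℝ)..1, H R p ω v
  have hYg : ∀ R, IsGaussianProcess (Y R) P := fun R =>
    isGaussianProcess_of_tendsto_ae (hXg R) (hX0 R) fun p => ae_of_all _ fun ω =>
      tendsto_riemann_sum (hH R p ω)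
  -- The integral over [0, R] had been rescaled to [0, 1] so that a single Riemann sum statement
  -- suffices.
  have hYe : ∀ R p ω, Y R p ω = ∫ τ in (0 : ℝ)..R, (c p.2 * Real.exp (-(c p.2 * τ))) •
      (W p.1 (ι p.2) ω - W (p.1 - τ) (ι p.2) ω) := by
    intro R p ω
    have := intervalIntegral.smul_integral_comp_mul_left (a := 0) (b := 1)
      (fun τ => (c p.2 * Real.exp (-(c p.2 * τ))) •
        (W p.1 (ι p.2) ω - W (p.1 - τ) (ι p.2) ω)) R
    simp only [mul_zero, mul_one] at this
    rw [← this, ← intervalIntegral.integral_smul]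
    refine intervalIntegral.integral_congr fun v _ => ?_
    simp only [H, Complex.real_smul]
    push_cast; ring
  have hY0 : ∀ (n : ℕ) p, ∫ ω, Y n p ω ∂P = 0 := by
    intro n p
    generalize (n : ℝ) = R
    have hYm : Measurable (Function.uncurry fun v ω => H R p ω v) :=
      measurable_uncurry_of_continuous_of_measurable (fun ω => hH R p ω) fun v =>
        ((hm _ _).sub (hm _ _)).const_mul _
    have hprob : IsProbabilityMeasure (volume.restrict (Set.Ioc (0 : ℝ) 1)) := ⟨by simp⟩
    have hL : ∀ v, AllLp (fun ω => H R p ω v) P := fun v =>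
      ((hW.allLp_increment (hι p.2) p.1 (R * v))).const_mul _
    have := integral_average (P := P) (μ := volume.restrict (Set.Ioc (0 : ℝ) 1))
      (Y := fun v ω => H R p ω v) hYm hL (v := fun v =>
        (R * (c p.2 * Real.exp (-(c p.2 * (R * v))))) ^ 2 * |R * v|) ?_ ?_
    · simp only [Y]
      simp_rw [intervalIntegral.integral_of_le zero_le_one]
      rw [this]
      have h0 : ∀ v, ∫ ω, H R p ω v ∂P = 0 := fun v => by
        have hi : ∀ t, Integrable (W t (ι p.2)) P := fun t => (hW.allLp (hι _) t).integrable
        simp only [H]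
        rw [integral_const_mul, integral_sub (hi _) (hi _), hW.mean _ _ (hι _),
          hW.mean _ _ (hι _)]
        simp
      simp [h0]
    · intro v
      simp only [H, norm_mul, mul_pow]
      rw [integral_const_mul]
      simp only [Complex.norm_real, Real.norm_eq_abs, sq_abs]
      rw [← mul_pow (c p.2), ← mul_pow R]
      have := hW.increment_le (hι p.2) p.1 (R * v)
      gcongr
    · have : Continuous fun v : ℝ =>
          (R * (c p.2 * Real.exp (-(c p.2 * (R * v))))) ^ 2 * |R * v| := by fun_prop
      exact (this.integrableOn_Icc (a := 0) (b := 1)).mono_set Set.Ioc_subset_Icc_self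
  refine isGaussianProcess_of_tendsto_ae (X := fun n : ℕ => Y n) (fun n => hYg n) hY0 fun p => ?_
  filter_upwards [hW.ae_integrable_increment hm hcont (hι p.2) (hc p.2) p.1] with ω hω
  rw [wienerConv_eq_integral (b := fun s => W s (ι p.2) ω) (hc p.2) hω, integral_expLaw (hc p.2)]
  simp only [hYe]
  exact intervalIntegral_tendsto_integral_Ioi 0 ((integrable_expLaw_iff (hc p.2) _).1 hω)
    tendsto_natCast_atTop_atTop

lemma IsWienerModes.integral_wienerConv (hW : IsWienerModes P W)
    (hm : ∀ s k, Measurable (W s k)) (hcont : ∀ k ω, Continuous fun s => W s k ω)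
    {k : Freq} (hk : k ≠ 0) {c : ℝ} (hc : 0 < c) (t : ℝ) :
    ∫ ω, wienerConv c (fun s => W s k ω) t ∂P = 0 := by
  have := isProbabilityMeasure_expLaw hc
  rw [integral_congr_ae (hW.wienerConv_ae hm hcont hk hc t),
    integral_average (measurable_increment hm hcont t k)
    (hW.allLp_increment hk t) (hW.increment_le hk t) (integrable_id_expLaw hc)]
  have h0 : ∀ τ, ∫ ω, (W t k ω - W (t - τ) k ω) ∂P = 0 := fun τ => by
    rw [integral_sub (hW.allLp hk _).integrable (hW.allLp hk _).integrable, hW.mean _ _ hk,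
      hW.mean _ _ hk, sub_zero]
  simp [h0]

lemma IsWienerModes.integral_wienerConv_mul_conj (hW : IsWienerModes P W)
    (hm : ∀ s k, Measurable (W s k)) (hcont : ∀ k ω, Continuous fun s => W s k ω)
    {k l : Freq} (hk : k ≠ 0) (hl : l ≠ 0) {c d : ℝ} (hc : 0 < c) (hd : 0 < d) (s t : ℝ) :
    ∫ ω, wienerConv c (fun s => W s k ω) s * conj (wienerConv d (fun s => W s l ω) t) ∂P =
      ∫ p : ℝ × ℝ, ∫ ω, (W s k ω - W (s - p.1) k ω) * conj (W t l ω - W (t - p.2) l ω) ∂P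
        ∂((expLaw c).prod (expLaw d)) := by
  have := isProbabilityMeasure_expLaw hc
  have := isProbabilityMeasure_expLaw hd
  rw [← integral_average_mul_conj (measurable_increment hm hcont s k)
    (measurable_increment hm hcont t l)
    (hW.allLp_increment hk s) (hW.allLp_increment hl t) (hW.increment_le hk s)
    (hW.increment_le hl t) (integrable_id_expLaw hc) (integrable_id_expLaw hd)]
  refine integral_congr_ae ?_
  filter_upwards [hW.wienerConv_ae hm hcont hk hc s, hW.wienerConv_ae hm hcont hl hd t]
    with ω h1 h2
  rw [h1, h2]

lemma IsWienerModes.integral_wienerConv_cross (hW : IsWienerModes P W)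
    (hm : ∀ s k, Measurable (W s k)) (hcont : ∀ k ω, Continuous fun s => W s k ω)
    {k l : Freq} (hk : k ≠ 0) (hl : l ≠ 0) (hkl : k ≠ l) {c d : ℝ} (hc : 0 < c) (hd : 0 < d)
    (s t : ℝ) :
    ∫ ω, wienerConv c (fun s => W s k ω) s * conj (wienerConv d (fun s => W s l ω) t) ∂P = 0 := by
  rw [hW.integral_wienerConv_mul_conj hm hcont hk hl hc hd]
  simp_rw [hW.integral_increment hk hl]
  simp [hkl]

lemma IsWienerModes.integral_norm_wienerConv_sq (hW : IsWienerModes P W)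
    (hm : ∀ s k, Measurable (W s k)) (hcont : ∀ k ω, Continuous fun s => W s k ω)
    {k : Freq} (hk : k ≠ 0) {c : ℝ} (hc : 0 < c) (t : ℝ) :
    ∫ ω, ‖wienerConv c (fun s => W s k ω) t‖ ^ 2 ∂P = 1 / (2 * c) := by
  have := isProbabilityMeasure_expLaw hc
  have h := hW.integral_wienerConv_mul_conj hm hcont hk hk hc hc t t
  simp_rw [hW.integral_increment hk hk, if_true, Complex.mul_conj, Complex.normSq_eq_norm_sq,
    integral_complex_ofReal] at h
  rw [Complex.ofReal_injective h, ← integral_integral_min_expLaw hc, integral_prod]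
  · refine integral_congr_ae ?_
    filter_upwards [ae_expLaw_pos c] with τ hτ
    refine integral_congr_ae ?_
    filter_upwards [ae_expLaw_pos c] with x hx
    have e1 : t - (t - x) = x := by ring
    have e2 : t - τ - t = -τ := by ring
    have e3 : t - τ - (t - x) = x - τ := by ring
    simp only [e1, e2, e3, sub_self, abs_zero, abs_neg, abs_of_pos hx, abs_of_pos hτ]
    rcases le_total τ x with h | h
    · rw [min_eq_left h, abs_of_nonneg (by linarith)]; ring
    · rw [min_eq_right h, abs_of_nonpos (by linarith)]; ring
  · refine Integrable.mono' (((integrable_id_expLaw hc).comp_fst _).add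
      ((integrable_id_expLaw hc).comp_snd _)) ?_ (ae_of_all _ fun p => ?_)
    · refine Continuous.aestronglyMeasurable (by fun_prop)
    · have e1 : t - (t - p.2) = p.2 := by ring
      have e2 : t - p.1 - t = -p.1 := by ring
      have e3 : t - p.1 - (t - p.2) = p.2 - p.1 := by ring
      simp only [e1, e2, e3, sub_self, abs_zero, abs_neg, Real.norm_eq_abs, Pi.add_apply]
      rw [abs_le]
      have h1 := abs_sub p.2 p.1
      have h2 := abs_nonneg (p.2 - p.1)
      have h3 := abs_nonneg p.1
      have h4 := abs_nonneg p.2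
      constructor <;> linarith

/-- For every τ the integrand is a difference of two Brownian increments over intervals of length |t
- s|, and averaging over τ does not increase the bound. The constant is thus independent of the rate
c, and so later of N and k. -/
lemma IsWienerModes.integral_norm_wienerConv_sub_sq_le (hW : IsWienerModes P W)
    (hm : ∀ s k, Measurable (W s k)) (hcont : ∀ k ω, Continuous fun s => W s k ω)
    {k : Freq} (hk : k ≠ 0) {c : ℝ} (hc : 0 < c) (s t : ℝ) :
    ∫ ω, ‖wienerConv c (fun s => W s k ω) t - wienerConv c (fun s => W s k ω) s‖ ^ 2 ∂P ≤
      4 * |t - s| := by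
  have := isProbabilityMeasure_expLaw hc
  let Y : ℝ → Ω → ℂ := fun τ ω => (W t k ω - W (t - τ) k ω) - (W s k ω - W (s - τ) k ω)
  have hYm : Measurable (Function.uncurry Y) :=
    (measurable_increment hm hcont t k).sub (measurable_increment hm hcont s k)
  have hYL : ∀ τ, AllLp (Y τ) P := fun τ =>
    (hW.allLp_increment hk t τ).sub (hW.allLp_increment hk s τ)
  have hYv : ∀ τ, ∫ ω, ‖Y τ ω‖ ^ 2 ∂P ≤ 4 * |t - s| := by
    intro τ
    have i1 := (((hW.allLp hk t).sub (hW.allLp hk s)).integrable_norm_pow 2).const_mul 2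
    have i2 := (((hW.allLp hk (t - τ)).sub (hW.allLp hk (s - τ))).integrable_norm_pow 2).const_mul 2
    calc ∫ ω, ‖Y τ ω‖ ^ 2 ∂P ≤ ∫ ω, (2 * ‖W t k ω - W s k ω‖ ^ 2 +
          2 * ‖W (t - τ) k ω - W (s - τ) k ω‖ ^ 2) ∂P := by
          refine integral_mono ((hYL τ).integrable_norm_pow 2) (i1.add i2) fun ω => ?_
          have e : Y τ ω = (W t k ω - W s k ω) - (W (t - τ) k ω - W (s - τ) k ω) := by
            simp only [Y]; ring
          simp only [e]
          have h1 := norm_sub_le (W t k ω - W s k ω) (W (t - τ) k ω - W (s - τ) k ω)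
          have h2 := norm_nonneg ((W t k ω - W s k ω) - (W (t - τ) k ω - W (s - τ) k ω))
          nlinarith [sq_nonneg (‖W t k ω - W s k ω‖ - ‖W (t - τ) k ω - W (s - τ) k ω‖)]
      _ = 4 * |t - s| := by
          rw [integral_add i1 i2, integral_const_mul, integral_const_mul,
            hW.integral_norm_increment_sq hk, hW.integral_norm_increment_sq hk]
          have : t - τ - (s - τ) = t - s := by ring
          rw [this]; ring
  have h := integral_average_mul_conj (μ := expLaw c) (ν := expLaw c) hYm hYm hYL hYL hYv hYv
    (integrable_const _) (integrable_const _)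
  have hle : ‖∫ p : ℝ × ℝ, ∫ ω, Y p.1 ω * conj (Y p.2 ω) ∂P ∂((expLaw c).prod (expLaw c))‖ ≤
      4 * |t - s| := by
    refine (norm_integral_le_of_norm_le_const (C := 4 * |t - s|) (ae_of_all _ fun p => ?_)).trans
      (by simp)
    calc ‖∫ ω, Y p.1 ω * conj (Y p.2 ω) ∂P‖ ≤ ∫ ω, ‖Y p.1 ω * conj (Y p.2 ω)‖ ∂P :=
          norm_integral_le_integral_norm _
      _ ≤ ∫ ω, (2⁻¹ * ‖Y p.1 ω‖ ^ 2 + 2⁻¹ * ‖Y p.2 ω‖ ^ 2) ∂P := by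
          refine integral_mono ((hYL p.1).mul (hYL p.2).conj).integrable.norm
            ((((hYL p.1).integrable_norm_pow 2).const_mul _).add
              (((hYL p.2).integrable_norm_pow 2).const_mul _)) fun ω => ?_
          simp only [norm_mul, RCLike.norm_conj]
          nlinarith [sq_nonneg (‖Y p.1 ω‖ - ‖Y p.2 ω‖)]
      _ ≤ 4 * |t - s| := by
          rw [integral_add (((hYL p.1).integrable_norm_pow 2).const_mul _)
              (((hYL p.2).integrable_norm_pow 2).const_mul _), integral_const_mul,
            integral_const_mul]
          linarith [hYv p.1, hYv p.2]
  rw [← h] at hle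
  have e : ∫ ω, ‖wienerConv c (fun s => W s k ω) t - wienerConv c (fun s => W s k ω) s‖ ^ 2 ∂P =
      ∫ ω, ‖∫ τ, Y τ ω ∂(expLaw c)‖ ^ 2 ∂P := by
    refine integral_congr_ae ?_
    filter_upwards [hW.wienerConv_ae hm hcont hk hc s, hW.wienerConv_ae hm hcont hk hc t,
      hW.ae_integrable_increment hm hcont hk hc t, hW.ae_integrable_increment hm hcont hk hc s]
      with ω h1 h2 h3 h4
    rw [h1, h2, ← integral_sub h3 h4]
  rw [e]
  simp_rw [Complex.mul_conj, Complex.normSq_eq_norm_sq, integral_complex_ofReal] at hle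
  rw [Complex.norm_real, Real.norm_eq_abs] at hle
  exact (le_abs_self _).trans hle

/-- Factoring e^{-ct} out of the convolution leaves a primitive of a continuous function, started
from a fixed integral over the negative half-line. -/
lemma continuous_wienerConv {c : ℝ} {b : ℝ → ℂ} (hb : Continuous b)
    (hi : IntegrableOn (fun s => (Real.exp (c * s) : ℂ) * b s) (Set.Iic 0)) :
    Continuous (wienerConv c b) := by
  have hF : Continuous fun s => (Real.exp (c * s) : ℂ) * b s :=
    Continuous.mul (by fun_prop) hb
  have hIic : ∀ t : ℝ, IntegrableOn (fun s => (Real.exp (c * s) : ℂ) * b s) (Set.Iic t) := by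
    intro t
    rcases le_total t 0 with h | h
    · exact hi.mono_set (Set.Iic_subset_Iic.2 h)
    · rw [← Set.Iic_union_Icc_eq_Iic h]
      exact hi.union hF.integrableOn_Icc
  have e : wienerConv c b = fun t => b t - c * ((Real.exp (-(c * t)) : ℂ) *
      ((∫ s in Set.Iic (0 : ℝ), (Real.exp (c * s) : ℂ) * b s) +
        ∫ s in (0 : ℝ)..t, (Real.exp (c * s) : ℂ) * b s)) := by
    funext t
    rw [wienerConv, ← intervalIntegral.integral_Iic_sub_Iic (hIic 0) (hIic t)]
    have : ∫ s in Set.Iic t, (Real.exp (-(c * (t - s))) : ℂ) * b s =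
        (Real.exp (-(c * t)) : ℂ) * ∫ s in Set.Iic t, (Real.exp (c * s) : ℂ) * b s := by
      rw [← integral_const_mul]
      refine integral_congr_ae (ae_of_all _ fun s => ?_)
      simp only
      rw [← mul_assoc, ← Complex.ofReal_mul, ← Real.exp_add]
      congr 4; ring
    rw [add_sub_cancel, this]
  rw [e]
  have : Continuous fun t => ∫ s in (0 : ℝ)..t, (Real.exp (c * s) : ℂ) * b s :=
    intervalIntegral.continuous_primitive (fun a b => hF.intervalIntegrable a b) 0
  fun_prop

lemma IsWienerModes.ae_continuous_wienerConv (hW : IsWienerModes P W)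
    (hm : ∀ s k, Measurable (W s k)) (hcont : ∀ k ω, Continuous fun s => W s k ω)
    {k : Freq} (hk : k ≠ 0) {c : ℝ} (hc : 0 < c) :
    ∀ᵐ ω ∂P, Continuous fun t => wienerConv c (fun s => W s k ω) t := by
  have := isProbabilityMeasure_expLaw hc
  filter_upwards [hW.ae_integrable_increment hm hcont hk hc 0] with ω hω
  refine continuous_wienerConv (hcont k ω) ?_
  have h1 : Integrable (fun τ => W (0 - τ) k ω) (expLaw c) := by
    refine ((integrable_const (W 0 k ω)).sub hω).congr (ae_of_all _ fun τ => by simp)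
  rw [integrable_expLaw_iff hc] at h1
  have h2 := (h1.congr_set_ae Ioi_ae_eq_Ici.symm).const_mul ((c⁻¹ : ℝ) : ℂ)
  have hpre : (fun x : ℝ => (0 : ℝ) - x) ⁻¹' Set.Iic 0 = Set.Ici 0 := by ext x; simp
  rw [← (Measure.measurePreserving_sub_left volume (0 : ℝ)).integrableOn_comp_preimage
    (MeasurableEquiv.subLeft (0 : ℝ)).measurableEmbedding, hpre]
  refine h2.congr (ae_of_all _ fun x => ?_)
  simp only [Function.comp, Complex.real_smul, zero_sub, mul_neg]
  push_cast
  have : (c : ℂ) ≠ 0 := by exact_mod_cast hc.ne'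
  field_simp

end OrnsteinUhlenbeck

/-! ### Bounds for the symbol of the discrete Laplacian -/

section Rate

lemma norm_toE_sq (k : Freq) : ‖toE k‖ ^ 2 = ∑ j, (k j : ℝ) ^ 2 := by
  simp [EuclideanSpace.norm_sq_eq, toE]

lemma toE_eq_zero {k : Freq} : toE k = 0 ↔ k = 0 := by
  constructor
  · intro h
    funext j
    have := congrArg (fun v : EuclideanSpace ℝ (Fin 3) => v j) h
    simpa [toE] using this
  · rintro rfl
    ext j; simp [toE]

lemma eps_pos (N : ℕ) : 0 < eps N := by unfold eps; positivity

/-- The sine of πx/2 is at least x on [0, 1] and at least 2 - x on [1, 1.8]. The latter is at least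
0.2 = 1.8/9, which explains the slope 1/9 and its square 1/81. The margin below 2, where the sine
vanishes, is provided by the support of the smooth cutoff. -/
lemma sq_le_sin_sq {x : ℝ} (hx : |x| ≤ 1.8) :
    x ^ 2 / 81 ≤ Real.sin (Real.pi * x / 2) ^ 2 := by
  wlog h : 0 ≤ x generalizing x
  · have := this (x := -x) (by rwa [abs_neg]) (by linarith)
    have e : Real.pi * -x / 2 = -(Real.pi * x / 2) := by ring
    rw [e, Real.sin_neg] at this
    simpa using this
  rw [abs_of_nonneg h] at hx
  have hpi := Real.pi_pos
  have key : x / 9 ≤ Real.sin (Real.pi * x / 2) := by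
    rcases le_total x 1 with h1 | h1
    · have := Real.mul_le_sin (x := Real.pi * x / 2) (by positivity) (by nlinarith)
      have e : 2 / Real.pi * (Real.pi * x / 2) = x := by field_simp
      rw [e] at this
      linarith
    · have := Real.mul_le_sin (x := Real.pi * (2 - x) / 2)
        (div_nonneg (mul_nonneg hpi.le (by linarith)) (by norm_num)) (by nlinarith)
      have e : 2 / Real.pi * (Real.pi * (2 - x) / 2) = 2 - x := by field_simp
      have e' : Real.pi * (2 - x) / 2 = Real.pi - Real.pi * x / 2 := by ring
      rw [e, e', Real.sin_pi_sub] at this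
      norm_num at hx
      linarith
  calc x ^ 2 / 81 = (x / 9) ^ 2 := by ring
    _ ≤ _ := pow_le_pow_left₀ (by positivity) key 2

lemma rate_eq (N : ℕ) {k : Freq} (hk : k ≠ 0) :
    rate N k = 4 / eps N ^ 2 * ∑ j, Real.sin (Real.pi * (eps N * k j) / 2) ^ 2 := by
  have h0 : ‖toE k‖ ≠ 0 := by simpa [toE_eq_zero] using hk
  have he := (eps_pos N).ne'
  rw [rate, fSymb, norm_smul, Real.norm_of_nonneg (eps_pos N).le]
  have : ∀ j, (eps N • toE k) j = eps N * k j := fun j => by simp [toE]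
  simp only [this]
  field_simp

lemma le_rate {N : ℕ} {k : Freq} (h : ∀ j, |eps N * k j| ≤ 1.8) :
    4 / 81 * ‖toE k‖ ^ 2 ≤ rate N k := by
  by_cases hk : k = 0
  · subst hk
    simp [rate, toE_eq_zero.2 rfl]
  have he := (eps_pos N).ne'
  rw [rate_eq N hk, norm_toE_sq]
  calc 4 / 81 * ∑ j, (k j : ℝ) ^ 2 = 4 / eps N ^ 2 * ∑ j, (eps N * k j) ^ 2 / 81 := by
        rw [Finset.mul_sum, Finset.mul_sum]
        refine Finset.sum_congr rfl fun j _ => ?_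
        field_simp
    _ ≤ _ := by
        gcongr with j
        exact sq_le_sin_sq (h j)

lemma abs_eps_mul_le {N : ℕ} {k : Freq} (h : inBox N k) (j : Fin 3) : |eps N * k j| ≤ 1 := by
  have h1 : |(k j : ℝ)| ≤ N := by exact_mod_cast h j
  rw [abs_mul, abs_of_pos (eps_pos N), eps, div_mul_eq_mul_div, div_le_one (by positivity)]
  linarith

lemma le_rate_of_inBox {N : ℕ} {k : Freq} (h : inBox N k) :
    4 / 81 * ‖toE k‖ ^ 2 ≤ rate N k :=
  le_rate fun j => (abs_eps_mul_le h j).trans (by norm_num)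

lemma one_le_norm_toE_sq {k : Freq} (hk : k ≠ 0) : 1 ≤ ‖toE k‖ ^ 2 := by
  rw [norm_toE_sq]
  obtain ⟨j, hj⟩ := Function.ne_iff.1 hk
  have h1 : (1 : ℝ) ≤ (k j : ℝ) ^ 2 := by
    have : (1 : ℤ) ≤ (k j) ^ 2 := by
      have hj' : k j ≠ 0 := hj
      have : 0 < (k j) ^ 2 := by positivity
      omega
    exact_mod_cast this
  exact h1.trans (Finset.single_le_sum (f := fun j => (k j : ℝ) ^ 2) (fun _ _ => sq_nonneg _)
    (Finset.mem_univ j))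

lemma rate_pos {N : ℕ} {k : Freq} (hk : k ≠ 0) (h : inBox N k) : 0 < rate N k := by
  have := one_le_norm_toE_sq hk
  linarith [le_rate_of_inBox h]

lemma rate_nonneg (N : ℕ) (k : Freq) : 0 ≤ rate N k := by
  unfold rate fSymb
  positivity

lemma rate_neg (N : ℕ) (k : Freq) : rate N (-k) = rate N k := by
  by_cases hk : k = 0
  · simp [hk]
  rw [rate_eq N hk, rate_eq N (neg_ne_zero.2 hk)]
  congr 1
  refine Finset.sum_congr rfl fun j _ => ?_
  have : Real.pi * (eps N * ((-k) j : ℤ)) / 2 = -(Real.pi * (eps N * k j) / 2) := by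
    push_cast [Pi.neg_apply]; ring
  rw [this, Real.sin_neg, neg_sq]

end Rate

/-! ### The linear solution as a finite Gaussian family -/

section Modes

/-- The Fourier modes of the noise that are seen by the cutoff at level `N`. -/
abbrev Mode (N : ℕ) : Type := {k : Freq // k ≠ 0 ∧ inBox N k}

/-- The nonzero frequencies in a box. -/
def modes (N : ℕ) : Finset Freq :=
  (Finset.Icc (fun _ => -(N : ℤ) : Freq) (fun _ => (N : ℤ))).erase 0

lemma mem_Icc_iff_inBox {N : ℕ} {k : Freq} :
    k ∈ Finset.Icc (fun _ => -(N : ℤ) : Freq) (fun _ => (N : ℤ)) ↔ inBox N k := by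
  simp only [Finset.mem_Icc, Pi.le_def, inBox, abs_le, forall_and]

lemma mem_modes {N : ℕ} {k : Freq} : k ∈ modes N ↔ k ≠ 0 ∧ inBox N k := by
  rw [modes, Finset.mem_erase, mem_Icc_iff_inBox]

instance (N : ℕ) : Fintype (Mode N) := Fintype.subtype (modes N) fun _ => mem_modes

lemma inBox_neg {N : ℕ} {k : Freq} (h : inBox N k) : inBox N (-k) := fun j => by
  simpa using h j

/-- Reflection of modes. -/
def Mode.neg {N : ℕ} (k : Mode N) : Mode N := ⟨-k.1, neg_ne_zero.2 k.2.1, inBox_neg k.2.2⟩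

lemma sum_modes {N : ℕ} {E : Type*} [AddCommMonoid E] (f : Freq → E) :
    ∑ k ∈ modes N, f k = ∑ k : Mode N, f k.1 :=
  Finset.sum_subtype (modes N) (fun _ => mem_modes) f

variable {Ω : Type*} [MeasurableSpace Ω] {P : Measure Ω} [IsProbabilityMeasure P]
  {W : ℝ → Freq → Ω → ℂ}

set_option linter.unusedSectionVars false

/-- The modes of the stationary linear solution. -/
def ouMode (N : ℕ) (W : ℝ → Freq → Ω → ℂ) (t : ℝ) (k : Mode N) (ω : Ω) : ℂ :=
  (((2 : ℝ) ^ (-(3 / 2) : ℝ) : ℝ) : ℂ) * wienerConv (rate N k.1) (fun s => W s k.1 ω) t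

lemma u1_mode {N : ℕ} (ω : Ω) (t : ℝ) (k : Mode N) :
    u1 N (fun s l => W s l ω) t k.1 = ouMode N W t k ω := if_pos k.2

lemma normConst_sq : ((2 : ℝ) ^ (-(3 / 2) : ℝ)) ^ 2 = 1 / 8 := by
  rw [← Real.rpow_natCast, ← Real.rpow_mul (by norm_num)]
  norm_num

/-- The stationary linear solution, as a family of Gaussian modes. -/
structure IsOUModes (N : ℕ) (U : ℝ → Mode N → Ω → ℂ) (P : Measure Ω) : Prop where
  isModeGaussian : IsModeGaussian U P
  variance : ∀ t k, ∫ ω, ‖U t k ω‖ ^ 2 ∂P = 1 / (16 * rate N k.1)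
  increment : ∀ s t k, ∫ ω, ‖U t k ω - U s k ω‖ ^ 2 ∂P ≤ |t - s|
  continuous : ∀ᵐ ω ∂P, ∀ k, Continuous fun t => U t k ω
  reality : ∀ᵐ ω ∂P, ∀ t k, U t k.neg ω = conj (U t k ω)

theorem IsWienerModes.isOUModes (hW : IsWienerModes P W) (N : ℕ) : IsOUModes N (ouMode N W) P := by
  obtain ⟨W', hm, hcont, hae⟩ := hW.exists_version
  have hW' := hW.congr hae
  have hr : ∀ k : Mode N, 0 < rate N k.1 := fun k => rate_pos k.2.1 k.2.2
  set a : ℝ := (2 : ℝ) ^ (-(3 / 2) : ℝ) with ha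
  have ha2 : a ^ 2 = 1 / 8 := normConst_sq
  have heq : ∀ᵐ ω ∂P, ∀ t k, ouMode N W t k ω = ouMode N W' t k ω := by
    filter_upwards [hae] with ω hω t k
    have : (fun s => W s k.1 ω) = fun s => W' s k.1 ω := funext fun s => hω _ k.2.1 s
    rw [ouMode, ouMode, this]
  have hsmul : ∀ t k ω, ouMode N W' t k ω = (a : ℂ) * wienerConv (rate N k.1)
    (fun s => W' s k.1 ω) t := fun _ _ _ => rfl
  refine ⟨⟨?_, ?_, ?_⟩, ?_, ?_, ?_, ?_⟩
  · have h1 := hW'.isGaussianProcess_wienerConv hm hcont (κ := Mode N) (fun k => k.1)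
      (fun k => k.2.1) (fun k => rate N k.1) hr
    have h2 := h1.smul fun _ => a
    refine h2.congr fun p => ?_
    filter_upwards [heq] with ω hω
    rw [hω, hsmul]
    simp [Complex.real_smul]
  · intro t k
    rw [integral_congr_ae (heq.mono fun ω h => h t k)]
    simp only [hsmul]
    rw [integral_const_mul, hW'.integral_wienerConv hm hcont k.2.1 (hr k), mul_zero]
  · intro s t k l hkl
    have : (fun ω => ouMode N W s k ω * conj (ouMode N W t l ω)) =ᵐ[P] fun ω =>
        ((a ^ 2 : ℝ) : ℂ) * (wienerConv (rate N k.1) (fun s => W' s k.1 ω) s *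
          conj (wienerConv (rate N l.1) (fun s => W' s l.1 ω) t)) := by
      filter_upwards [heq] with ω hω
      rw [hω, hω, hsmul, hsmul, map_mul, Complex.conj_ofReal]
      push_cast; ring
    rw [integral_congr_ae this, integral_const_mul, hW'.integral_wienerConv_cross hm hcont k.2.1
      l.2.1 (fun h => hkl (Subtype.ext h)) (hr k) (hr l), mul_zero]
  · intro t k
    have : (fun ω => ‖ouMode N W t k ω‖ ^ 2) =ᵐ[P] fun ω =>
        a ^ 2 * ‖wienerConv (rate N k.1) (fun s => W' s k.1 ω) t‖ ^ 2 := by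
      filter_upwards [heq] with ω hω
      rw [hω, hsmul, norm_mul, mul_pow, Complex.norm_real, Real.norm_eq_abs, sq_abs]
    rw [integral_congr_ae this, integral_const_mul, hW'.integral_norm_wienerConv_sq hm hcont k.2.1
      (hr k), ha2]
    have := (hr k).ne'
    field_simp
    norm_num
  · intro s t k
    have : (fun ω => ‖ouMode N W t k ω - ouMode N W s k ω‖ ^ 2) =ᵐ[P] fun ω =>
        a ^ 2 * ‖wienerConv (rate N k.1) (fun s => W' s k.1 ω) t -
          wienerConv (rate N k.1) (fun s => W' s k.1 ω) s‖ ^ 2 := by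
      filter_upwards [heq] with ω hω
      rw [hω, hω, hsmul, hsmul, ← mul_sub, norm_mul, mul_pow, Complex.norm_real,
        Real.norm_eq_abs, sq_abs]
    rw [integral_congr_ae this, integral_const_mul, ha2]
    have := hW'.integral_norm_wienerConv_sub_sq_le hm hcont k.2.1 (hr k) s t
    have h0 := abs_nonneg (t - s)
    linarith
  · have : ∀ᵐ ω ∂P, ∀ k : Mode N,
        Continuous fun t => wienerConv (rate N k.1) (fun s => W' s k.1 ω) t :=
      ae_all_iff.2 fun k => hW'.ae_continuous_wienerConv hm hcont k.2.1 (hr k)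
    filter_upwards [heq, this] with ω h1 h2 k
    simp only [h1, hsmul]
    exact continuous_const.mul (h2 k)
  · have h1 : ∀ᵐ ω ∂P, ∀ (k : Mode N) (q : ℚ), W' q (-k.1) ω = conj (W' q k.1 ω) :=
      ae_all_iff.2 fun k => ae_all_iff.2 fun q => hW'.reality q k.1 k.2.1
    filter_upwards [heq, h1] with ω hω h1 t k
    -- Reality is assumed for each time almost surely; a common null set for rational times and
    -- continuity give it for all times at once.
    have h2 : (fun s => W' s (-k.1) ω) = fun s => conj (W' s k.1 ω) := by
      refine Continuous.ext_on Rat.isDenseEmbedding_coe_real.dense (hcont _ ω)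
        (Complex.continuous_conj.comp (hcont _ ω)) ?_
      rintro _ ⟨q, rfl⟩
      exact h1 k q
    rw [hω, hω, hsmul, hsmul, map_mul, Complex.conj_ofReal]
    congr 1
    simp only [Mode.neg, h2, rate_neg]
    simp only [wienerConv, map_sub, map_mul, Complex.conj_ofReal]
    congr 2
    rw [← integral_conj]
    simp only [map_mul, Complex.conj_ofReal]

/-- By reality, the pseudo-covariance of the modes k and l is the covariance of the modes k and -l.
-/
lemma IsOUModes.pseudoCov {N : ℕ} {U : ℝ → Mode N → Ω → ℂ} (hU : IsOUModes N U P) (s t : ℝ)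
    (k l : Mode N) (h : l ≠ k.neg) : ∫ ω, U s k ω * U t l ω ∂P = 0 := by
  have hl : l.neg.neg = l := Subtype.ext (neg_neg _)
  have hne : k ≠ l.neg := fun e => h (by rw [e, hl])
  rw [← hU.isModeGaussian.cov s t k l.neg hne]
  refine integral_congr_ae ?_
  filter_upwards [hU.reality] with ω hω
  rw [hω t l, Complex.conj_conj]

lemma IsOUModes.pseudoCov_neg {N : ℕ} {U : ℝ → Mode N → Ω → ℂ} (hU : IsOUModes N U P) (t : ℝ)
    (k : Mode N) : ∫ ω, U t k ω * U t k.neg ω ∂P = ((1 / (16 * rate N k.1) : ℝ) : ℂ) := by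
  rw [← hU.variance t k, ← integral_complex_ofReal]
  refine integral_congr_ae ?_
  filter_upwards [hU.reality] with ω hω
  rw [hω t k, Complex.mul_conj, Complex.normSq_eq_norm_sq]

end Modes

/-! ### Supports and sizes of the Littlewood–Paley symbols -/

section LittlewoodPaley

/-- The finite box `|k|_∞ ≤ M`. -/
def boxF (M : ℕ) : Finset Freq := Finset.Icc (fun _ => -(M : ℤ)) (fun _ => (M : ℤ))

lemma mem_boxF {M : ℕ} {k : Freq} : k ∈ boxF M ↔ inBox M k := mem_Icc_iff_inBox

lemma card_boxF (M : ℕ) : (boxF M).card = (2 * M + 1) ^ 3 := by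
  rw [boxF, Pi.card_Icc]
  simp only [Int.card_Icc, Finset.prod_const, Finset.card_univ, Fintype.card_fin]
  congr 1
  omega

lemma abs_le_norm_toE (k : Freq) (j : Fin 3) : |(k j : ℝ)| ≤ ‖toE k‖ := by
  refine abs_le_of_sq_le_sq ?_ (norm_nonneg _) |>.trans_eq' rfl
  rw [norm_toE_sq]
  exact Finset.single_le_sum (f := fun j => (k j : ℝ) ^ 2) (fun _ _ => sq_nonneg _)
    (Finset.mem_univ j)

lemma inBox_of_norm_le {M : ℕ} {k : Freq} (h : ‖toE k‖ ≤ M) : inBox M k := fun j => by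
  have := (abs_le_norm_toE k j).trans h
  exact_mod_cast this

lemma norm_toE_le {M : ℕ} {k : Freq} (h : inBox M k) : ‖toE k‖ ≤ 2 * M := by
  refine abs_le_of_sq_le_sq' ?_ (by positivity) |>.2
  rw [norm_toE_sq]
  have : ∀ j, (k j : ℝ) ^ 2 ≤ (M : ℝ) ^ 2 := fun j => by
    have h1 : |(k j : ℝ)| ≤ M := by exact_mod_cast h j
    exact sq_le_sq' (abs_le.1 h1).1 (abs_le.1 h1).2
  calc ∑ j, (k j : ℝ) ^ 2 ≤ ∑ _j : Fin 3, (M : ℝ) ^ 2 := Finset.sum_le_sum fun j _ => this j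
    _ ≤ (2 * M) ^ 2 := by simp; nlinarith [sq_nonneg (M : ℝ)]

variable (D : DyadicPartition)

lemma DyadicPartition.symbol_nonneg (n : ℕ) (z : EuclideanSpace ℝ (Fin 3)) :
    0 ≤ D.symbol n z := by
  cases n
  · exact D.χ_nonneg z
  · exact D.θ_nonneg _

/-- `A` controls the supports of the Littlewood–Paley symbols. -/
structure DyadicPartition.Bound (A : ℕ) : Prop where
  one_le : 1 ≤ A
  upper : ∀ n z, D.symbol n z ≠ 0 → ‖z‖ ≤ A * 2 ^ n
  lower : ∀ n z, D.symbol (n + 1) z ≠ 0 → 2 ^ (n + 1) ≤ A * ‖z‖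

lemma DyadicPartition.exists_bound : ∃ A, D.Bound A := by
  obtain ⟨R, hR⟩ := D.χ_ball
  obtain ⟨a, b, ha, hab⟩ := D.θ_annulus
  -- The term 2/a serves the lower bound: on the support of the annulus symbol at scale 2ⁿ, 2^{n+1}
  -- = (2/a)·a2ⁿ ≤ (2/a)‖z‖. The shift by one comes from numbering the blocks from zero.
  obtain ⟨A, hA⟩ := exists_nat_ge (max 1 (max R (max b (2 / a))))
  have h1 : (1 : ℝ) ≤ A := (le_max_left _ _).trans hA
  have h2 : R ≤ A := (le_max_left _ _).trans ((le_max_right _ _).trans hA)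
  have h3 : b ≤ A := (le_max_left _ _).trans ((le_max_right _ _).trans
    ((le_max_right _ _).trans hA))
  have h4 : 2 / a ≤ A := (le_max_right _ _).trans ((le_max_right _ _).trans
    ((le_max_right _ _).trans hA))
  have hθ : ∀ (n : ℕ) (z : EuclideanSpace ℝ (Fin 3)), D.θ (((2 : ℝ) ^ n)⁻¹ • z) ≠ 0 →
      a * 2 ^ n ≤ ‖z‖ ∧ ‖z‖ ≤ b * 2 ^ n := by
    intro n z hz
    have := hab (subset_tsupport _ (Function.mem_support.2 hz))
    simp only [Set.mem_ofPred_eq, norm_smul, norm_inv, norm_pow, Real.norm_ofNat] at this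
    have hp : (0 : ℝ) < 2 ^ n := by positivity
    rw [inv_mul_eq_div, le_div_iff₀ hp, div_le_iff₀ hp] at this
    exact this
  refine ⟨A, by exact_mod_cast h1, ?_, ?_⟩
  · intro n z hz
    cases n with
    | zero =>
      have := hR (subset_tsupport _ (Function.mem_support.2 hz))
      simp only [Metric.mem_closedBall, dist_zero_right] at this
      simpa using this.trans h2
    | succ n =>
      have := (hθ n z hz).2
      refine this.trans ?_
      have hp : (2 : ℝ) ^ n ≤ 2 ^ (n + 1) := pow_le_pow_right₀ (by norm_num) (by omega)
      exact mul_le_mul h3 hp (by positivity) (by positivity)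
  · intro n z hz
    have := (hθ n z hz).1
    rw [div_le_iff₀ ha] at h4
    have hp : (0 : ℝ) < 2 ^ n := by positivity
    rw [pow_succ]
    nlinarith

variable {D}

/-- At a given point only finitely many symbols are nonzero, so the series in the partition of unity
is a finite sum, and partial sums of nonnegative terms are at most one. -/
lemma DyadicPartition.sum_symbol_le_one (s : Finset ℕ) (z : EuclideanSpace ℝ (Fin 3)) :
    ∑ n ∈ s, D.symbol n z ≤ 1 := by
  obtain ⟨A, hA⟩ := D.exists_bound
  obtain ⟨J, hJ⟩ := pow_unbounded_of_one_lt (A * ‖z‖) (one_lt_two)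
  have h0 : ∀ n, J ≤ n → D.θ (((2 : ℝ) ^ n)⁻¹ • z) = 0 := by
    intro n hn
    by_contra h
    have := hA.lower n z h
    have h2 : (2 : ℝ) ^ J ≤ 2 ^ (n + 1) := pow_le_pow_right₀ (by norm_num) (by omega)
    linarith
  have hs := D.sum_eq_one z
  rw [tsum_eq_sum (s := Finset.range J) (fun n hn => h0 n (by simpa using hn))] at hs
  set K := max J (s.sup id) with hK
  calc ∑ n ∈ s, D.symbol n z ≤ ∑ n ∈ Finset.range (K + 1), D.symbol n z := by
        refine Finset.sum_le_sum_of_subset_of_nonneg (fun n hn => ?_)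
          fun n _ _ => D.symbol_nonneg n z
        have : n ≤ s.sup id := Finset.le_sup (f := id) hn
        simp only [Finset.mem_range]
        omega
    _ = D.χ z + ∑ n ∈ Finset.range K, D.θ (((2 : ℝ) ^ n)⁻¹ • z) := by
        rw [Finset.sum_range_succ', add_comm]; rfl
    _ = D.χ z + ∑ n ∈ Finset.range J, D.θ (((2 : ℝ) ^ n)⁻¹ • z) := by
        congr 1
        refine (Finset.sum_subset (Finset.range_subset_range.2 (le_max_left _ _)) ?_).symm
        intro n _ hn
        exact h0 n (by simpa using hn)
    _ ≤ 1 := hs.le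

lemma DyadicPartition.symbol_le_one (n : ℕ) (z : EuclideanSpace ℝ (Fin 3)) :
    D.symbol n z ≤ 1 := by
  simpa using D.sum_symbol_le_one {n} z

lemma DyadicPartition.Bound.block_eq_zero {A : ℕ} (hA : D.Bound A) {i : ℕ} {f : Coeff} {k : Freq}
    (hk : k ∉ boxF (A * 2 ^ i)) : block D i f k = 0 := by
  rw [block]
  by_cases h : D.symbol i (toE k) = 0
  · simp [h]
  · exact absurd (mem_boxF.2 (inBox_of_norm_le (by push_cast; exact hA.upper _ _ h))) hk

end LittlewoodPaley

/-! ### Bessel's inequality on the torus of side two -/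

section Parseval

attribute [local instance] instMeasureSpaceUnitAddCircle
  instIsProbabilityMeasureUnitAddCircleVolume

lemma mFourier_half (k : Freq) (x : Fin 3 → ℝ) :
    UnitAddTorus.mFourier k (fun j => ((x j / 2 : ℝ) : UnitAddCircle)) = char k x := by
  simp only [UnitAddTorus.mFourier, ContinuousMap.coe_mk, fourier_coe_apply]
  rw [← Complex.exp_sum, char]
  congr 1
  push_cast
  rw [Finset.mul_sum, Finset.mul_sum]
  refine Finset.sum_congr rfl fun j _ => ?_
  ring

lemma norm_char (k : Freq) (x : Fin 3 → ℝ) : ‖char k x‖ = 1 := by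
  rw [char, mul_comm, Complex.norm_exp_ofReal_mul_I]

lemma char_add (k l : Freq) (x : Fin 3 → ℝ) : char (k + l) x = char k x * char l x := by
  rw [char, char, char, ← Complex.exp_add]
  congr 1
  push_cast [Pi.add_apply]
  simp only [add_mul, Finset.sum_add_distrib]
  ring

/-- Bessel's inequality for trigonometric polynomials. -/
lemma sum_norm_sq_le_of_supNorm_le {u : Coeff} {S : Finset Freq} (hu : ∀ k ∉ S, u k = 0) {M : ℝ}
    (hM : 0 ≤ M) (h : supNorm u ≤ ENNReal.ofReal M) : ∑ k ∈ S, ‖u k‖ ^ 2 ≤ M ^ 2 := by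
  set F : C(UnitAddTorus (Fin 3), ℂ) := ∑ k ∈ S, u k • UnitAddTorus.mFourier k with hF
  have hFle : ‖F‖ ≤ M := by
    refine (ContinuousMap.norm_le _ hM).2 fun y => ?_
    -- The torus [-1,1]³ is rescaled by one half to the product of unit circles, on which the
    -- characters are orthonormal for the probability measure.
    have hsurj : ∃ x : Fin 3 → ℝ, y = fun j => ((x j / 2 : ℝ) : UnitAddCircle) := by
      choose z hz using fun j => QuotientAddGroup.mk_surjective (y j)
      refine ⟨fun j => 2 * z j, funext fun j => ?_⟩
      rw [mul_div_cancel_left₀ _ (two_ne_zero)]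
      exact (hz j).symm
    obtain ⟨x, rfl⟩ := hsurj
    have h1 : ‖∑' k, u k * char k x‖ₑ ≤ ENNReal.ofReal M :=
      (le_iSup (fun x : Fin 3 → ℝ => ‖∑' k, u k * char k x‖ₑ) x).trans h
    rw [tsum_eq_sum (s := S) (fun k hk => by rw [hu k hk, zero_mul])] at h1
    have h2 : F (fun j => ((x j / 2 : ℝ) : UnitAddCircle)) = ∑ k ∈ S, u k * char k x := by
      simp only [hF, ContinuousMap.coe_sum, Finset.sum_apply, ContinuousMap.coe_smul,
        Pi.smul_apply, mFourier_half, smul_eq_mul]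
    rw [h2]
    rw [← ofReal_norm] at h1
    exact (ENNReal.ofReal_le_ofReal_iff hM).1 h1
  have hL : ContinuousMap.toLp 2 volume ℂ F = ∑ k ∈ S, u k • UnitAddTorus.mFourierLp 2 k := by
    rw [hF, map_sum]
    refine Finset.sum_congr rfl fun k _ => ?_
    rw [map_smul]
  have hn : ‖ContinuousMap.toLp (E := ℂ) 2 (volume : Measure (UnitAddTorus (Fin 3))) ℂ F‖ ≤ M := by
    refine (ContinuousLinearMap.le_opNorm _ _).trans ?_
    have := ContinuousMap.toLp_norm_le (𝕜 := ℂ) (E := ℂ) (p := 2)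
      (volume : Measure (UnitAddTorus (Fin 3)))
    calc _ ≤ 1 * M := mul_le_mul (this.trans (by simp [measureUnivNNReal])) hFle (norm_nonneg _) zero_le_one
      _ = M := one_mul M
  have hip : (‖ContinuousMap.toLp (E := ℂ) 2 (volume : Measure (UnitAddTorus (Fin 3))) ℂ F‖ : ℝ) ^ 2
      = ∑ k ∈ S, ‖u k‖ ^ 2 := by
    have := UnitAddTorus.orthonormal_mFourier (d := Fin 3) |>.inner_sum u u S
    rw [← hL, inner_self_eq_norm_sq_to_K] at this
    have h3 : ∀ k, conj (u k) * u k = ((‖u k‖ ^ 2 : ℝ) : ℂ) := fun k => by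
      rw [mul_comm, Complex.mul_conj, Complex.normSq_eq_norm_sq]
    simp only [h3, ← Complex.ofReal_sum] at this
    refine Complex.ofReal_injective (Eq.trans ?_ this)
    push_cast; rfl
  rw [← hip]
  exact pow_le_pow_left₀ (norm_nonneg _) hn 2

end Parseval

/-! ### Kernel representation and reduction to square functions -/

section Representation

variable {D : DyadicPartition}

lemma mul_eq_sum {u v : Coeff} {B : Finset Freq} (hv : ∀ k ∉ B, v k = 0) (k : Freq) :
    mul u v k = ∑ l ∈ B, u (k - l) * v l := by
  rw [mul, ← (Equiv.subLeft k).tsum_eq]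
  simp only [Equiv.subLeft_apply, sub_sub_cancel]
  exact tsum_eq_sum fun l hl => by rw [hv l hl, mul_zero]

/-- The symbol, in the second variable, of the paraproduct with the `i`-th block. -/
def lowCoef (D : DyadicPartition) (J i : ℕ) (k : Freq) : ℝ :=
  ∑ j ∈ (Finset.range J).filter (fun j => i + 1 < j), D.symbol j (toE k)

/-- The symbol of the resonant product. -/
def resCoef (D : DyadicPartition) (J : ℕ) (k l : Freq) : ℝ :=
  ∑ j ∈ Finset.range J, ∑ i ∈ (Finset.range (j + 2)).filter (fun i => j ≤ i + 1),
    D.symbol i (toE k) * D.symbol j (toE l)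

lemma lowCoef_nonneg (J i : ℕ) (k : Freq) : 0 ≤ lowCoef D J i k :=
  Finset.sum_nonneg fun _ _ => D.symbol_nonneg _ _

lemma lowCoef_le_one (J i : ℕ) (k : Freq) : lowCoef D J i k ≤ 1 := D.sum_symbol_le_one _ _

lemma resCoef_nonneg (J : ℕ) (k l : Freq) : 0 ≤ resCoef D J k l :=
  Finset.sum_nonneg fun _ _ => Finset.sum_nonneg fun _ _ =>
    mul_nonneg (D.symbol_nonneg _ _) (D.symbol_nonneg _ _)

lemma resCoef_le_one (J : ℕ) (k l : Freq) : resCoef D J k l ≤ 1 := by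
  calc resCoef D J k l ≤ ∑ j ∈ Finset.range J, D.symbol j (toE l) := by
        refine Finset.sum_le_sum fun j _ => ?_
        rw [← Finset.sum_mul]
        exact mul_le_of_le_one_left (D.symbol_nonneg _ _) (D.sum_symbol_le_one _ _)
    _ ≤ 1 := D.sum_symbol_le_one _ _

/-- Finite support of `g` makes the infinite sums finite with no assumption on `f`; a block of `f`
with index at least J meets no higher block of `g` and drops out. -/
lemma paraLt_eq_sum {J : ℕ} {B : Finset Freq} (hB : ∀ k ∈ B, ∀ n, J ≤ n → D.symbol n (toE k) = 0)
    {g : Coeff} (hg : ∀ k ∉ B, g k = 0) (f : Coeff) (k : Freq) :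
    paraLt D f g k = ∑ i ∈ Finset.range J, ∑ l ∈ B,
      (lowCoef D J i l : ℂ) * (block D i f (k - l) * g l) := by
  have hblock : ∀ j, ∀ l ∉ B, block D j g l = 0 := fun j l hl => by
    rw [block, hg l hl, mul_zero]
  have hmul : ∀ i j, mul (block D i f) (block D j g) k =
      ∑ l ∈ B, block D i f (k - l) * block D j g l := fun i j => mul_eq_sum (hblock j) k
  rw [paraLt, tsum_eq_sum (s := Finset.range J)]
  · simp only [hmul]
    have : ∀ j ∈ Finset.range J, ∑ i ∈ (Finset.range j).filter (fun i => i + 1 < j),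
        ∑ l ∈ B, block D i f (k - l) * block D j g l = ∑ i ∈ Finset.range J, if i + 1 < j then
        ∑ l ∈ B, block D i f (k - l) * block D j g l else 0 := by
      intro j hj
      rw [← Finset.sum_filter]
      refine Finset.sum_congr ?_ fun _ _ => rfl
      ext i
      simp only [Finset.mem_filter, Finset.mem_range] at hj ⊢
      omega
    rw [Finset.sum_congr rfl this, Finset.sum_comm]
    refine Finset.sum_congr rfl fun i _ => ?_
    rw [← Finset.sum_filter, Finset.sum_comm]
    refine Finset.sum_congr rfl fun l _ => ?_
    rw [lowCoef, Complex.ofReal_sum, Finset.sum_mul]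
    refine Finset.sum_congr rfl fun j _ => ?_
    have : block D j g l = D.symbol j (toE l) * g l := rfl
    rw [this]
    ring
  · intro j hj
    refine Finset.sum_eq_zero fun i _ => ?_
    rw [hmul]
    refine Finset.sum_eq_zero fun l hl => ?_
    have : block D j g l = D.symbol j (toE l) * g l := rfl
    rw [this, hB l hl j (by simpa using hj)]
    simp

lemma paraRes_eq_sum {J : ℕ} {B : Finset Freq} (hB : ∀ k ∈ B, ∀ n, J ≤ n → D.symbol n (toE k) = 0)
    {g : Coeff} (hg : ∀ k ∉ B, g k = 0) (h : Coeff) (k : Freq) :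
    paraRes D h g k = ∑ l ∈ B, (resCoef D J (k - l) l : ℂ) * (h (k - l) * g l) := by
  have hblock : ∀ j, ∀ l ∉ B, block D j g l = 0 := fun j l hl => by
    rw [block, hg l hl, mul_zero]
  have hmul : ∀ i j, mul (block D i h) (block D j g) k =
      ∑ l ∈ B, block D i h (k - l) * block D j g l := fun i j => mul_eq_sum (hblock j) k
  rw [paraRes, tsum_eq_sum (s := Finset.range J)]
  · simp only [hmul]
    have : ∀ j, ∑ i ∈ (Finset.range (j + 2)).filter (fun i => j ≤ i + 1),
        ∑ l ∈ B, block D i h (k - l) * block D j g l = ∑ l ∈ B,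
        ∑ i ∈ (Finset.range (j + 2)).filter (fun i => j ≤ i + 1),
          block D i h (k - l) * block D j g l := fun j => Finset.sum_comm
    simp only [this]
    rw [Finset.sum_comm]
    refine Finset.sum_congr rfl fun l _ => ?_
    rw [resCoef, Complex.ofReal_sum, Finset.sum_mul]
    refine Finset.sum_congr rfl fun j _ => ?_
    rw [Complex.ofReal_sum, Finset.sum_mul]
    refine Finset.sum_congr rfl fun i _ => ?_
    rw [block, block]
    push_cast; ring
  · intro j hj
    refine Finset.sum_eq_zero fun i _ => ?_
    rw [hmul]
    refine Finset.sum_eq_zero fun l hl => ?_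
    have : block D j g l = D.symbol j (toE l) * g l := rfl
    rw [this, hB l hl j (by simpa using hj)]
    simp

/-- The common form of the two operators. -/
def genOp (D : DyadicPartition) (m₁ m₂ : Freq → ℂ) (ψ X f : Coeff) : Coeff :=
  paraRes D (fun k => m₁ k * paraLt D f (fun k => m₂ k * ψ k) k) X

/-- The trilinear symbol of the operator, for the `i`-th block of the argument and the `q`-th
block of the result. -/
def kern (D : DyadicPartition) (J : ℕ) (m₁ m₂ : Freq → ℂ) (q i : ℕ) (k₁ k₂ k₃ : Freq) : ℂ :=
  (D.symbol q (toE (k₁ + k₂ + k₃)) * resCoef D J (k₁ + k₂) k₃ * lowCoef D J i k₂ : ℝ) *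
    (m₁ (k₁ + k₂) * m₂ k₂)

/-- The kernel acting on the Fourier coefficients of the `i`-th block. -/
def gker (c : ℕ → ℕ → Freq → Freq → Freq → ℂ) (B : Finset Freq) (M : Freq → Freq → ℂ)
    (q i : ℕ) (x : Fin 3 → ℝ) (k₁ : Freq) : ℂ :=
  ∑ k₂ ∈ B, ∑ k₃ ∈ B, c q i k₁ k₂ k₃ * (M k₂ k₃ * char (k₁ + k₂ + k₃) x)

/-- The operator `L` has kernel `gker c B M`. -/
def HasKernel (D : DyadicPartition) (A J : ℕ) (c : ℕ → ℕ → Freq → Freq → Freq → ℂ)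
    (B : Finset Freq) (M : Freq → Freq → ℂ) (L : Coeff → Coeff) : Prop :=
  ∀ (f : Coeff) (q : ℕ) (x : Fin 3 → ℝ), HasSum (fun k => block D q (L f) k * char k x)
    (∑ i ∈ Finset.range J, ∑ k₁ ∈ boxF (A * 2 ^ i), block D i f k₁ * gker c B M q i x k₁)

lemma HasKernel.sub {A J : ℕ} {c : ℕ → ℕ → Freq → Freq → Freq → ℂ} {B : Finset Freq}
    {M M' : Freq → Freq → ℂ} {L L' : Coeff → Coeff} (h : HasKernel D A J c B M L)
    (h' : HasKernel D A J c B M' L') :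
    HasKernel D A J c B (fun k l => M k l - M' k l) fun f => L f - L' f := by
  intro f q x
  have e : ∀ k, block D q ((fun f => L f - L' f) f) k * char k x =
      block D q (L f) k * char k x - block D q (L' f) k * char k x := fun k => by
    simp only [block, Pi.sub_apply]; ring
  have e' : ∑ i ∈ Finset.range J, ∑ k₁ ∈ boxF (A * 2 ^ i),
      block D i f k₁ * gker c B (fun k l => M k l - M' k l) q i x k₁ =
      ∑ i ∈ Finset.range J, ∑ k₁ ∈ boxF (A * 2 ^ i), block D i f k₁ * gker c B M q i x k₁ -
      ∑ i ∈ Finset.range J, ∑ k₁ ∈ boxF (A * 2 ^ i), block D i f k₁ * gker c B M' q i x k₁ := by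
    simp only [← Finset.sum_sub_distrib, ← mul_sub, gker, sub_mul]
  simp only [e]
  rw [e']
  exact (h f q x).sub (h' f q x)

/-- For fixed k₂ and k₃ the output frequency k corresponds to k₁ = k - k₂ - k₃. Translating the
summation to k₁ leaves a finite sum, because a block of `f` has finite spectrum. -/
theorem hasKernel_genOp {A J : ℕ} (hA : D.Bound A) {B : Finset Freq}
    (hB : ∀ k ∈ B, ∀ n, J ≤ n → D.symbol n (toE k) = 0) {m₁ m₂ : Freq → ℂ} {ψ X : Coeff}
    (hψ : ∀ k ∉ B, m₂ k = 0) (hX : ∀ k ∉ B, X k = 0) :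
    HasKernel D A J (kern D J m₁ m₂) B (fun k l => ψ k * X l) (genOp D m₁ m₂ ψ X) := by
  intro f q x
  have hterm : ∀ k, block D q (genOp D m₁ m₂ ψ X f) k * char k x = ∑ i ∈ Finset.range J,
      ∑ k₂ ∈ B, ∑ k₃ ∈ B, (fun k₁ => block D i f k₁ * (kern D J m₁ m₂ q i k₁ k₂ k₃ *
        (ψ k₂ * X k₃ * char (k₁ + k₂ + k₃) x))) (k - (k₂ + k₃)) := by
    intro k
    rw [block, genOp, paraRes_eq_sum hB hX]
    simp only [paraLt_eq_sum hB (g := fun k => m₂ k * ψ k) (fun k hk => by simp [hψ k hk])]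
    simp only [Finset.mul_sum, Finset.sum_mul]
    rw [Finset.sum_comm]
    refine Finset.sum_congr rfl fun i _ => ?_
    rw [Finset.sum_comm]
    refine Finset.sum_congr rfl fun k₂ _ => Finset.sum_congr rfl fun k₃ _ => ?_
    have e1 : k - (k₂ + k₃) = k - k₃ - k₂ := by abel
    have e2 : k - (k₂ + k₃) + k₂ = k - k₃ := by abel
    have e3 : k - (k₂ + k₃) + k₂ + k₃ = k := by abel
    rw [kern, e3, e2, e1]
    push_cast
    ring
  simp only [hterm]
  refine hasSum_sum fun i _ => ?_
  have hG : ∀ k₁, block D i f k₁ * gker (kern D J m₁ m₂) B (fun k l => ψ k * X l) q i x k₁ =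
      ∑ k₂ ∈ B, ∑ k₃ ∈ B, block D i f k₁ * (kern D J m₁ m₂ q i k₁ k₂ k₃ *
        (ψ k₂ * X k₃ * char (k₁ + k₂ + k₃) x)) := fun k₁ => by
    simp only [gker, Finset.mul_sum]
  simp only [hG]
  rw [Finset.sum_comm]
  refine hasSum_sum fun k₂ _ => ?_
  rw [Finset.sum_comm]
  refine hasSum_sum fun k₃ _ => ?_
  refine (Equiv.subRight (k₂ + k₃)).hasSum_iff (f := fun k₁ => block D i f k₁ *
    (kern D J m₁ m₂ q i k₁ k₂ k₃ * (ψ k₂ * X k₃ * char (k₁ + k₂ + k₃) x))) |>.2 ?_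
  refine hasSum_sum_of_ne_finset_zero fun k₁ hk₁ => ?_
  rw [hA.block_eq_zero hk₁, zero_mul]

lemma HasKernel.tsum_block {A J : ℕ} {c : ℕ → ℕ → Freq → Freq → Freq → ℂ} {B : Finset Freq}
    {M : Freq → Freq → ℂ} {L : Coeff → Coeff} (h : HasKernel D A J c B M L) (f : Coeff) (q : ℕ)
    (x : Fin 3 → ℝ) : ∑' k, block D q (L f) k * char k x =
      ∑ i ∈ Finset.range J, ∑ k₁ ∈ boxF (A * 2 ^ i), block D i f k₁ * gker c B M q i x k₁ :=
  (h f q x).tsum_eq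

/-- The bound for the operator norm by the square function of the kernel. -/
def squareFun (A J : ℕ) (α : ℝ) (c : ℕ → ℕ → Freq → Freq → Freq → ℂ) (B : Finset Freq)
    (M : Freq → Freq → ℂ) (q : ℕ) (x : Fin 3 → ℝ) : ℝ :=
  ∑ i ∈ Finset.range J, (2 : ℝ) ^ (-(((i : ℝ) - 1) * α)) *
    √(∑ k₁ ∈ boxF (A * 2 ^ i), ‖gker c B M q i x k₁‖ ^ 2)

lemma supNorm_block_le {α : ℝ} {f : Coeff} (hf : holderNorm D α f ≤ 1) (i : ℕ) :
    supNorm (block D i f) ≤ ENNReal.ofReal ((2 : ℝ) ^ (-(((i : ℝ) - 1) * α))) := by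
  have h := (le_iSup (fun n : ℕ => ENNReal.ofReal ((2 : ℝ) ^ (((n : ℝ) - 1) * α)) *
    supNorm (block D n f)) i).trans hf
  have hp : (0 : ℝ) < (2 : ℝ) ^ (((i : ℝ) - 1) * α) := by positivity
  rw [Real.rpow_neg (by norm_num), ENNReal.ofReal_inv_of_pos hp]
  rw [mul_comm] at h
  rw [← one_div]
  exact (ENNReal.le_div_iff_mul_le (Or.inl (by simpa using hp)) (Or.inl ENNReal.ofReal_ne_top)).2 h

/-- The argument enters only through the coefficients of its blocks, whose ℓ² norm is controlled by
the sup norm of the block. The right-hand side no longer contains f, so the supremum over the unit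
ball costs nothing in the probabilistic estimates. -/
theorem HasKernel.opNorm_le {A J : ℕ} (hA : D.Bound A) {c : ℕ → ℕ → Freq → Freq → Freq → ℂ}
    {B : Finset Freq} {M : Freq → Freq → ℂ} {L : Coeff → Coeff} (h : HasKernel D A J c B M L)
    (α β : ℝ) : opNorm D α β L ≤ ⨆ (q : ℕ) (x : Fin 3 → ℝ),
      ENNReal.ofReal ((2 : ℝ) ^ (((q : ℝ) - 1) * β) * squareFun A J α c B M q x) := by
  refine iSup₂_le fun f hf => iSup_le fun q => ?_
  rw [supNorm, ENNReal.mul_iSup]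
  refine iSup_le fun x => le_iSup_of_le q (le_iSup_of_le x ?_)
  rw [ENNReal.ofReal_mul (by positivity), h.tsum_block, ← ofReal_norm]
  gcongr
  refine (norm_sum_le _ _).trans (Finset.sum_le_sum fun i _ => ?_)
  refine (norm_sum_le _ _).trans ?_
  simp only [norm_mul]
  -- Cauchy–Schwarz in k₁; Bessel's inequality then bounds the factor that contains f by
  -- 2^{-(i-1)α}.
  refine (Real.sum_mul_le_sqrt_mul_sqrt _ _ _).trans ?_
  gcongr
  rw [Real.sqrt_le_left (by positivity)]
  exact sum_norm_sq_le_of_supNorm_le (fun k hk => hA.block_eq_zero hk) (by positivity)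
    (supNorm_block_le hf i)

end Representation

/-! ### The Wick square and its heat evolution in terms of the modes -/

section Paths

/-- The covariance `E[u(a)u(b)]` of the modes of the linear solution. -/
def modeCov (N : ℕ) (a b : Mode N) : ℂ :=
  if b = a.neg then ((1 / (16 * rate N a.1) : ℝ) : ℂ) else 0

/-- Wick product of two modes. -/
def wick2 (N : ℕ) (p : Mode N → ℂ) (a b : Mode N) : ℂ := p a * p b - modeCov N a b

/-- Fourier coefficients of the Wick square, in terms of the modes. -/
def qCoef (N : ℕ) (p : Mode N → ℂ) (k : Freq) : ℂ :=
  ∑ a : Mode N, ∑ b : Mode N, if a.1 + b.1 = k then wick2 N p a b else 0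

/-- Fourier coefficients of the Wick square and its aliases. -/
def xCoef (N : ℕ) (p : Mode N → ℂ) (k : Freq) : ℂ :=
  ∑ i ∈ Finset.Icc (-1 : Freq) 1, qCoef N p (k + (2 * (N : ℤ) + 1) • i)

/-- Fourier coefficients of the solution of the heat equation with right-hand side `xCoef`. -/
def iCoef (N : ℕ) (p : ℝ → Mode N → ℂ) (t : ℝ) (k : Freq) : ℂ :=
  ∫ s in (0 : ℝ)..t, (Real.exp (-((t - s) * rate N k)) : ℂ) * xCoef N (p s) k

/-- The counterterm is the sum of the mode variances 2⁻³/(2·rate) over antipodal pairs, which only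
meet the zero frequency. The global renormalisation is therefore Wick ordering of each product of
two modes. -/
lemma wickSq_eq (N : ℕ) (w : ℝ → Freq → ℂ) (t : ℝ) (k : Freq) :
    wickSq N w t k = qCoef N (fun a => u1 N w t a.1) k := by
  have hz : ∀ k ∉ modes N, u1 N w t k = 0 := fun k hk => if_neg (mt mem_modes.2 hk)
  have h1 : mul (u1 N w t) (u1 N w t) k = ∑ a : Mode N, ∑ b : Mode N,
      if a.1 + b.1 = k then u1 N w t a.1 * u1 N w t b.1 else 0 := by
    rw [mul_eq_sum hz, sum_modes (fun l => u1 N w t (k - l) * u1 N w t l), Finset.sum_comm]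
    refine Finset.sum_congr rfl fun b _ => ?_
    by_cases hk : k - b.1 ∈ modes N
    · rw [Finset.sum_eq_single (⟨k - b.1, mem_modes.1 hk⟩ : Mode N)]
      · simp
      · intro a _ ha
        rw [if_neg]
        intro e
        exact ha (Subtype.ext (eq_sub_of_add_eq e))
      · simp
    · rw [hz _ hk, zero_mul, Finset.sum_eq_zero]
      intro a _
      rw [if_neg]
      intro e
      exact hk (mem_modes.2 (by rw [← eq_sub_of_add_eq e]; exact a.2))
  have h2 : (∑ a : Mode N, ∑ b : Mode N, if a.1 + b.1 = k then modeCov N a b else 0) =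
      if k = 0 then (C0 N : ℂ) else 0 := by
    have h3 : ∀ a : Mode N, (∑ b : Mode N, if a.1 + b.1 = k then modeCov N a b else 0) =
        if k = 0 then ((1 / (16 * rate N a.1) : ℝ) : ℂ) else 0 := by
      intro a
      rw [Finset.sum_eq_single a.neg]
      · simp [modeCov, Mode.neg, eq_comm]
      · intro b _ hb
        simp [modeCov, hb]
      · simp
    simp only [h3]
    split_ifs
    · rw [C0]
      have : (Finset.Icc (fun _ => -(N : ℤ) : Freq) (fun _ => (N : ℤ))).erase 0 = modes N := rfl
      rw [this, sum_modes (fun k => 1 / (2 * rate N k)), ← Complex.ofReal_sum, Finset.mul_sum]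
      congr 1
      refine Finset.sum_congr rfl fun a _ => ?_
      have := (rate_pos a.2.1 a.2.2).ne'
      field_simp
      norm_num
    · simp
  rw [wickSq, h1, ← h2, qCoef, ← Finset.sum_sub_distrib]
  refine Finset.sum_congr rfl fun a _ => ?_
  rw [← Finset.sum_sub_distrib]
  refine Finset.sum_congr rfl fun b _ => ?_
  split_ifs <;> simp [wick2]

lemma wickFull_eq (N : ℕ) (w : ℝ → Freq → ℂ) (t : ℝ) (k : Freq) :
    wickFull N w t k = xCoef N (fun a => u1 N w t a.1) k := by
  simp only [wickFull, Pi.add_apply, fold, wickSq_eq, xCoef]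
  rw [← Finset.add_sum_erase (Finset.Icc (-1 : Freq) 1) _ (a := 0)]
  · simp
  · rw [Finset.mem_Icc]
    constructor <;> intro j <;> simp

/-- Sums of two modes have size at most 2N and aliasing shifts them by at most 2N + 1; the total 4N
+ 1 is at most 5N. -/
lemma xCoef_eq_zero {N : ℕ} (hN : 1 ≤ N) (p : Mode N → ℂ) {k : Freq} (hk : k ∉ boxF (5 * N)) :
    xCoef N p k = 0 := by
  refine Finset.sum_eq_zero fun i hi => Finset.sum_eq_zero fun a _ => Finset.sum_eq_zero
    fun b _ => if_neg fun e => hk (mem_boxF.2 fun j => ?_)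
  have h1 := a.2.2 j
  have h2 := b.2.2 j
  have e' := congrFun e j
  simp only [Pi.add_apply, Pi.smul_apply, smul_eq_mul] at e'
  have h3 := (Finset.mem_Icc.1 hi).1 j
  have h4 := (Finset.mem_Icc.1 hi).2 j
  simp only [Pi.neg_apply, Pi.one_apply] at h3 h4
  have h5 : |(2 * (N : ℤ) + 1) * i j| ≤ 2 * N + 1 := by
    rw [abs_mul, abs_of_nonneg (by positivity : (0 : ℤ) ≤ 2 * N + 1)]
    exact mul_le_of_le_one_right (by positivity) (abs_le.2 ⟨h3, h4⟩)
  rw [abs_le] at *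
  push_cast
  constructor <;> omega

lemma continuous_qCoef {N : ℕ} {p : ℝ → Mode N → ℂ} (hp : ∀ a, Continuous fun s => p s a)
    (k : Freq) : Continuous fun s => qCoef N (p s) k := by
  refine continuous_finsetSum _ fun a _ => continuous_finsetSum _ fun b _ => ?_
  split_ifs
  · exact ((hp a).mul (hp b)).sub continuous_const
  · exact continuous_const

lemma continuous_xCoef {N : ℕ} {p : ℝ → Mode N → ℂ} (hp : ∀ a, Continuous fun s => p s a)
    (k : Freq) : Continuous fun s => xCoef N (p s) k :=
  continuous_finsetSum _ fun _ _ => continuous_qCoef hp _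

/-- The factor `m` is 1 for the sharp semigroup and φ(εk) for the smoothly cut off one, so that both
solutions are multiples of the same `iCoef`. -/
lemma integral_add_fold {N : ℕ} {w : ℝ → Freq → ℂ}
    (hp : ∀ a : Mode N, Continuous fun s => u1 N w s a.1) (t : ℝ) (k : Freq) (m : ℂ) :
    (∫ s in (0 : ℝ)..t, (Real.exp (-((t - s) * rate N k)) : ℂ) * m * wickSq N w s k) +
      (∫ s in (0 : ℝ)..t, (Real.exp (-((t - s) * rate N k)) : ℂ) * m * fold N (wickSq N w s) k) =
      m * iCoef N (fun s a => u1 N w s a.1) t k := by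
  have h1 : Continuous fun s => wickSq N w s k := by
    simp only [wickSq_eq]; exact continuous_qCoef hp k
  have h2 : Continuous fun s => fold N (wickSq N w s) k := by
    simp only [fold, wickSq_eq]
    exact continuous_finsetSum _ fun _ _ => continuous_qCoef hp _
  have he : Continuous fun s : ℝ => (Real.exp (-((t - s) * rate N k)) : ℂ) := by fun_prop
  rw [← intervalIntegral.integral_add, iCoef, ← intervalIntegral.integral_const_mul]
  · refine intervalIntegral.integral_congr fun s _ => ?_
    simp only [← wickFull_eq, wickFull, Pi.add_apply]
    ring
  · exact ((he.mul continuous_const).mul h1).intervalIntegrable _ _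
  · exact ((he.mul continuous_const).mul h2).intervalIntegrable _ _

lemma K_add_K1 {N : ℕ} {w : ℝ → Freq → ℂ}
    (hp : ∀ a : Mode N, Continuous fun s => u1 N w s a.1) (t : ℝ) (k : Freq) (hk : inBox N k) :
    K N w t k + K1 N w t k = iCoef N (fun s a => u1 N w s a.1) t k := by
  have := integral_add_fold hp t k 1
  simpa [K, K1, duhamel, heat, hk] using this

lemma Kt_add_Kt1 (φ : EuclideanSpace ℝ (Fin 3) → ℝ) {N : ℕ} {w : ℝ → Freq → ℂ}
    (hp : ∀ a : Mode N, Continuous fun s => u1 N w s a.1) (t : ℝ) (k : Freq) :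
    Kt φ N w t k + Kt1 φ N w t k =
      (φ (eps N • toE k) : ℂ) * iCoef N (fun s a => u1 N w s a.1) t k := by
  have := integral_add_fold hp t k (φ (eps N • toE k))
  simpa [Kt, Kt1, duhamel, heatTilde] using this

end Paths

/-! ### Frequency constraints on the trilinear symbols -/

section Kernels

/-- Fourier multiplier of `I - P_N`. -/
def mulHigh (N : ℕ) (k : Freq) : ℂ := if inBox N k then 0 else 1

/-- Fourier multiplier of `P_N`. -/
def mulLow (N : ℕ) (k : Freq) : ℂ := if inBox N k then 1 else 0

/-- Fourier multiplier of `(P_{3N} - P_N) φ(ε ·)`. -/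
def mulMid (φ : EuclideanSpace ℝ (Fin 3) → ℝ) (N : ℕ) (k : Freq) : ℂ :=
  if inBox (3 * N) k ∧ ¬ inBox N k then (φ (eps N • toE k) : ℂ) else 0

lemma inBox_mono {M M' : ℕ} (h : M ≤ M') {k : Freq} (hk : inBox M k) : inBox M' k := fun j =>
  (hk j).trans (by exact_mod_cast h)

variable {D : DyadicPartition}

/-- Only the product of multiplier and coefficient matters. This permits moving φ(ε·) into the
multiplier, and ignoring the heat solution where the multiplier vanishes. -/
lemma genOp_congr {m₁ m₂ : Freq → ℂ} {m₂' : Freq → ℂ} {ψ ψ' X : Coeff}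
    (h : ∀ k, m₂ k * ψ k = m₂' k * ψ' k) : genOp D m₁ m₂ ψ X = genOp D m₁ m₂' ψ' X := by
  funext f
  simp only [genOp, h]

lemma A1_eq (N : ℕ) (ψ X : Coeff) : A1 D N ψ X = genOp D (mulHigh N) (mulLow N) ψ X := by
  funext f
  have h : proj N ψ = fun k => mulLow N k * ψ k := by
    funext k; simp only [proj, mulLow]; split_ifs <;> simp
  rw [A1, genOp, h]
  congr 1
  funext k
  simp only [Pi.sub_apply, proj, mulHigh]
  split_ifs <;> simp

lemma A2_eq (N : ℕ) (ψ X : Coeff) : A2 D N ψ X = genOp D (mulLow N) (mulMid (fun _ => 1) N) ψ X := by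
  funext f
  have h : proj (3 * N) ψ - proj N ψ = fun k => mulMid (fun _ => 1) N k * ψ k := by
    funext k
    simp only [Pi.sub_apply, proj, mulMid]
    by_cases h1 : inBox N k
    · have h3 : inBox (3 * N) k := inBox_mono (by omega) h1
      simp [h1, h3]
    · by_cases h3 : inBox (3 * N) k <;> simp [h1, h3]
  rw [A2, genOp, h]
  congr 1
  funext k
  simp only [proj, mulLow]
  split_ifs <;> simp

theorem hasKernel_op1 {A J N : ℕ} (hN : 1 ≤ N) (hA : D.Bound A)
    (hB : ∀ k ∈ boxF (5 * N), ∀ n, J ≤ n → D.symbol n (toE k) = 0) {w : ℝ → Freq → ℂ}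
    (hp : ∀ a : Mode N, Continuous fun s => u1 N w s a.1) (t : ℝ) :
    HasKernel D A J (kern D J (mulHigh N) (mulLow N)) (boxF (5 * N))
      (fun k l => iCoef N (fun s a => u1 N w s a.1) t k * xCoef N (fun a => u1 N w t a.1) l)
      (op1 D N w t) := by
  have hX : wickFull N w t = xCoef N (fun a => u1 N w t a.1) := funext fun k => wickFull_eq N w t k
  rw [op1, A1_eq, hX, genOp_congr (m₂' := mulLow N)
    (ψ' := iCoef N (fun s a => u1 N w s a.1) t)]
  · refine hasKernel_genOp hA hB (fun k hk => ?_) fun k hk => xCoef_eq_zero hN _ hk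
    rw [mulLow, if_neg]
    exact fun h => hk (mem_boxF.2 (inBox_mono (by omega) h))
  · intro k
    by_cases hk : inBox N k
    · rw [← K_add_K1 hp t k hk]; rfl
    · simp [mulLow, hk]

theorem hasKernel_op2 (φ : EuclideanSpace ℝ (Fin 3) → ℝ) {A J N : ℕ} (hN : 1 ≤ N) (hA : D.Bound A)
    (hB : ∀ k ∈ boxF (5 * N), ∀ n, J ≤ n → D.symbol n (toE k) = 0) {w : ℝ → Freq → ℂ}
    (hp : ∀ a : Mode N, Continuous fun s => u1 N w s a.1) (t : ℝ) :
    HasKernel D A J (kern D J (mulLow N) (mulMid φ N)) (boxF (5 * N))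
      (fun k l => iCoef N (fun s a => u1 N w s a.1) t k * xCoef N (fun a => u1 N w t a.1) l)
      (op2 D φ N w t) := by
  have hX : wickFull N w t = xCoef N (fun a => u1 N w t a.1) := funext fun k => wickFull_eq N w t k
  rw [op2, A2_eq, hX, genOp_congr (m₂' := mulMid φ N)
    (ψ' := iCoef N (fun s a => u1 N w s a.1) t)]
  · refine hasKernel_genOp hA hB (fun k hk => ?_) fun k hk => xCoef_eq_zero hN _ hk
    rw [mulMid, if_neg]
    exact fun h => hk (mem_boxF.2 (inBox_mono (by omega) h.1))
  · intro k
    rw [Pi.add_apply, Kt_add_Kt1 φ hp t k, mulMid, mulMid]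
    split_ifs <;> simp

/-- The properties of the trilinear symbols used for the estimates. -/
structure GoodKernel (N J Γ A : ℕ) (B : Finset Freq)
    (c : ℕ → ℕ → Freq → Freq → Freq → ℂ) : Prop where
  norm_le : ∀ q i k₁ k₂ k₃, ‖c q i k₁ k₂ k₃‖ ≤ Γ
  out : ∀ q i k₁ k₂ k₃, c q i k₁ k₂ k₃ ≠ 0 → inBox (Γ * 2 ^ q) (k₁ + k₂ + k₃)
  level : ∀ q i k₁ k₂ k₃, c q i k₁ k₂ k₃ ≠ 0 → i < J → k₁ ∈ boxF (A * 2 ^ i) → k₂ ∈ B → k₃ ∈ B →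
    2 ^ q ≤ Γ * N
  slab : ∀ q i k₁ k₂ k₃, c q i k₁ k₂ k₃ ≠ 0 → k₁ ∈ boxF (A * 2 ^ i) →
    ∃ d, |k₂ d - N| ≤ (Γ * 2 ^ i : ℕ) ∨ |k₂ d + N| ≤ (Γ * 2 ^ i : ℕ)
  rate : ∀ q i k₁ k₂ k₃, c q i k₁ k₂ k₃ ≠ 0 → k₁ ∈ boxF (A * 2 ^ i) →
    (N : ℝ) ^ 2 ≤ Γ * LatticePhi.rate N k₂

lemma not_inBox {N : ℕ} {k : Freq} (h : ¬ inBox N k) : ∃ j, (N : ℤ) < |k j| := by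
  simpa [inBox] using h

lemma kern_ne_zero {J : ℕ} {m₁ m₂ : Freq → ℂ} {q i : ℕ} {k₁ k₂ k₃ : Freq}
    (h : kern D J m₁ m₂ q i k₁ k₂ k₃ ≠ 0) : D.symbol q (toE (k₁ + k₂ + k₃)) ≠ 0 ∧
      lowCoef D J i k₂ ≠ 0 ∧ m₁ (k₁ + k₂) ≠ 0 ∧ m₂ k₂ ≠ 0 := by
  refine ⟨?_, ?_, ?_, ?_⟩ <;> (intro e; apply h; simp [kern, e])

lemma norm_kern_le {J : ℕ} {m₁ m₂ : Freq → ℂ} {C : ℝ} (h₁ : ∀ k, ‖m₁ k‖ ≤ 1)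
    (h₂ : ∀ k, ‖m₂ k‖ ≤ C) (q i : ℕ) (k₁ k₂ k₃ : Freq) :
    ‖kern D J m₁ m₂ q i k₁ k₂ k₃‖ ≤ C := by
  have hs := D.symbol_nonneg q (toE (k₁ + k₂ + k₃))
  have hs1 := D.symbol_le_one q (toE (k₁ + k₂ + k₃))
  have hr := resCoef_nonneg (D := D) J (k₁ + k₂) k₃
  have hr1 := resCoef_le_one (D := D) J (k₁ + k₂) k₃
  have hl := lowCoef_nonneg (D := D) J i k₂
  have hl1 := lowCoef_le_one (D := D) J i k₂
  rw [kern, norm_mul, norm_mul, Complex.norm_real, Real.norm_of_nonneg (by positivity)]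
  calc _ ≤ (1 * 1 * 1) * (1 * C) := by
        gcongr
        · exact h₁ _
        · exact h₂ _
    _ = C := by ring

/-- In the paraproduct the second factor sits at least two dyadic levels above the first, so its
frequency dominates that of the i-th block. -/
lemma le_norm_of_lowCoef {A : ℕ} (hA : D.Bound A) {J i : ℕ} {k : Freq}
    (h : lowCoef D J i k ≠ 0) : (2 : ℝ) ^ (i + 2) ≤ A * ‖toE k‖ := by
  obtain ⟨j, hj, hj'⟩ := Finset.exists_ne_zero_of_sum_ne_zero h
  simp only [Finset.mem_filter] at hj
  obtain ⟨n, rfl⟩ : ∃ n, j = n + 1 := ⟨j - 1, by omega⟩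
  exact (pow_le_pow_right₀ (by norm_num) (by omega)).trans (hA.lower n _ hj')

/-- The two alternatives in `hm` are the two operators: passing from k₂ to k₁+k₂ crosses the
boundary of the box outwards or inwards. A displacement of size A·2^i can only do so close to a
face, which gives the slab, and the position near or beyond the boundary gives the lower bound for
the rate. -/
theorem goodKernel_of {A J N Γ : ℕ} (hN : 1 ≤ N) (hA : D.Bound A)
    (hJ : 2 ^ J ≤ 20 * A * N) {m₁ m₂ : Freq → ℂ} (h₁ : ∀ k, ‖m₁ k‖ ≤ 1) (h₂ : ∀ k, ‖m₂ k‖ ≤ Γ)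
    (hΓ : 100 * A ^ 4 ≤ Γ) (hm : ∀ k₁ k₂, m₁ (k₁ + k₂) ≠ 0 → m₂ k₂ ≠ 0 →
      (inBox N k₂ ∧ ¬ inBox N (k₁ + k₂)) ∨
      (¬ inBox N k₂ ∧ inBox N (k₁ + k₂) ∧ ∀ j, |eps N * k₂ j| ≤ 1.8)) :
    GoodKernel N J Γ A (boxF (5 * N)) (kern D J m₁ m₂) := by
  have hA1 := hA.one_le
  have hA4 : A ≤ A ^ 4 := Nat.le_self_pow (by norm_num) A
  have hA3 : A ^ 3 ≤ A ^ 4 := Nat.pow_le_pow_right hA1 (by norm_num)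
  have hAΓ : A ≤ Γ := by omega
  refine ⟨fun q i k₁ k₂ k₃ => norm_kern_le h₁ h₂ q i k₁ k₂ k₃, ?_, ?_, ?_, ?_⟩
  · intro q i k₁ k₂ k₃ h
    have := hA.upper _ _ (kern_ne_zero h).1
    refine inBox_mono (Nat.mul_le_mul_right _ hAΓ) (inBox_of_norm_le (M := A * 2 ^ q) ?_)
    push_cast; exact this
  · intro q i k₁ k₂ k₃ h hi hk₁ hk₂ hk₃
    have hs := (kern_ne_zero h).1
    cases q with
    | zero => nlinarith
    | succ q =>
      have h1 := hA.lower _ _ hs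
      have h2 : inBox (30 * A ^ 2 * N) (k₁ + k₂ + k₃) := by
        intro j
        have a1 := mem_boxF.1 hk₁ j
        have a2 := mem_boxF.1 hk₂ j
        have a3 := mem_boxF.1 hk₃ j
        have a4 : A * 2 ^ i ≤ 20 * A ^ 2 * N := by
          calc A * 2 ^ i ≤ A * 2 ^ J := Nat.mul_le_mul_left _
                (Nat.pow_le_pow_right (by norm_num) hi.le)
            _ ≤ A * (20 * A * N) := Nat.mul_le_mul_left _ hJ
            _ = _ := by ring
        have a5 : 10 * N ≤ 10 * A ^ 2 * N := by
          have : 1 ≤ A ^ 2 := Nat.one_le_pow _ _ hA1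
          nlinarith
        have a6 : |(k₁ + k₂ + k₃) j| ≤ |k₁ j| + |k₂ j| + |k₃ j| := by
          simp only [Pi.add_apply]
          exact abs_add_three _ _ _
        zify at a4 a5
        push_cast at *
        linarith
      have h3 := norm_toE_le h2
      have h4 : (2 : ℝ) ^ (q + 1) ≤ A * (2 * (30 * A ^ 2 * N : ℕ)) :=
        h1.trans (mul_le_mul_of_nonneg_left h3 (by positivity))
      have h5 : 2 ^ (q + 1) ≤ A * (2 * (30 * A ^ 2 * N)) := by exact_mod_cast h4
      calc 2 ^ (q + 1) ≤ A * (2 * (30 * A ^ 2 * N)) := h5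
        _ = 60 * A ^ 3 * N := by ring
        _ ≤ Γ * N := Nat.mul_le_mul_right _ (by omega)
  · intro q i k₁ k₂ k₃ h hk₁
    obtain ⟨-, -, hm₁, hm₂⟩ := kern_ne_zero h
    have hle : A * 2 ^ i ≤ Γ * 2 ^ i := Nat.mul_le_mul_right _ hAΓ
    zify at hle
    push_cast
    rcases hm k₁ k₂ hm₁ hm₂ with ⟨ha, hb⟩ | ⟨ha, hb, -⟩
    · obtain ⟨d, hd⟩ := not_inBox hb
      have b1 := mem_boxF.1 hk₁ d
      have b2 := ha d
      refine ⟨d, ?_⟩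
      push_cast at b1
      simp only [Pi.add_apply, lt_abs] at hd
      rw [abs_le] at b1 b2
      rw [abs_le, abs_le]
      rcases hd with hd | hd
      · left; constructor <;> linarith
      · right; constructor <;> linarith
    · obtain ⟨d, hd⟩ := not_inBox ha
      have b1 := mem_boxF.1 hk₁ d
      have b2 := hb d
      refine ⟨d, ?_⟩
      push_cast at b1
      simp only [lt_abs] at hd
      simp only [Pi.add_apply] at b2
      rw [abs_le] at b1 b2
      rw [abs_le, abs_le]
      rcases hd with hd | hd
      · left; constructor <;> linarith
      · right; constructor <;> linarith
  · intro q i k₁ k₂ k₃ h hk₁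
    obtain ⟨-, hlow, hm₁, hm₂⟩ := kern_ne_zero h
    -- When k₁+k₂ leaves the box, a coordinate satisfies N < |k₁| + |k₂|, and the paraproduct bounds
    -- |k₁| by A²‖k₂‖. When k₂ itself is outside, the bound is immediate.
    have hk2 : (N : ℝ) ≤ 2 * A ^ 2 * ‖toE k₂‖ := by
      have hAr : (1 : ℝ) ≤ A := by exact_mod_cast hA1
      have hA2 : (1 : ℝ) ≤ (A : ℝ) ^ 2 := one_le_pow₀ hAr
      have n0 := norm_nonneg (toE k₂)
      rcases hm k₁ k₂ hm₁ hm₂ with ⟨ha, hb⟩ | ⟨ha, hb, -⟩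
      · obtain ⟨d, hd⟩ := not_inBox hb
        have b1 := mem_boxF.1 hk₁ d
        have b3 := abs_le_norm_toE k₂ d
        have b4 := le_norm_of_lowCoef hA hlow
        have b1' : |(k₁ d : ℝ)| ≤ A * 2 ^ i := by exact_mod_cast b1
        have hd' : (N : ℝ) < |(k₁ d : ℝ)| + |(k₂ d : ℝ)| := by
          have : (N : ℝ) < |(k₁ d : ℝ) + k₂ d| := by exact_mod_cast hd
          exact this.trans_le (abs_add_le _ _)
        have b5 : A * 2 ^ i ≤ A ^ 2 * ‖toE k₂‖ := by
          rw [pow_add] at b4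
          have : (0 : ℝ) ≤ 2 ^ i := by positivity
          nlinarith
        nlinarith
      · obtain ⟨d, hd⟩ := not_inBox ha
        have b3 := abs_le_norm_toE k₂ d
        have hd' : (N : ℝ) < |(k₂ d : ℝ)| := by exact_mod_cast hd
        nlinarith
    have hr : 4 / 81 * ‖toE k₂‖ ^ 2 ≤ rate N k₂ := by
      rcases hm k₁ k₂ hm₁ hm₂ with ⟨ha, hb⟩ | ⟨ha, hb, hc⟩
      · exact le_rate_of_inBox ha
      · exact le_rate hc
    have hΓ' : (100 : ℝ) * A ^ 4 ≤ Γ := by exact_mod_cast hΓ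
    calc (N : ℝ) ^ 2 ≤ (2 * A ^ 2 * ‖toE k₂‖) ^ 2 := pow_le_pow_left₀ (by positivity) hk2 2
      _ = 4 * A ^ 4 * ‖toE k₂‖ ^ 2 := by ring
      _ ≤ Γ * (4 / 81 * ‖toE k₂‖ ^ 2) := by nlinarith [sq_nonneg ‖toE k₂‖]
      _ ≤ Γ * rate N k₂ := by gcongr

/-- The number of relevant Littlewood–Paley blocks. -/
def levels (A N : ℕ) : ℕ := Nat.log 2 (10 * A * N) + 1

lemma two_pow_levels_le {A N : ℕ} (hA : 1 ≤ A) (hN : 1 ≤ N) : 2 ^ levels A N ≤ 20 * A * N := by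
  have h0 : 10 * A * N ≠ 0 := by positivity
  have := Nat.pow_log_le_self 2 h0
  rw [levels, pow_succ]
  nlinarith

lemma symbol_levels {A N : ℕ} (hA : D.Bound A) {k : Freq} (hk : k ∈ boxF (5 * N)) {n : ℕ}
    (hn : levels A N ≤ n) : D.symbol n (toE k) = 0 := by
  by_contra h
  obtain ⟨m, rfl⟩ : ∃ m, n = m + 1 := ⟨n - 1, by rw [levels] at hn; omega⟩
  have h1 := hA.lower _ _ h
  have h2 := norm_toE_le (mem_boxF.1 hk)
  have h3 : (2 : ℝ) ^ (m + 1) ≤ A * (2 * (5 * N : ℕ)) :=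
    h1.trans (mul_le_mul_of_nonneg_left h2 (by positivity))
  have h4 : 2 ^ (m + 1) ≤ A * (2 * (5 * N)) := by exact_mod_cast h3
  have h5 := Nat.lt_pow_succ_log_self (b := 2) (by norm_num) (10 * A * N)
  have h6 : 2 ^ (Nat.log 2 (10 * A * N) + 1) ≤ 2 ^ (m + 1) :=
    Nat.pow_le_pow_right (by norm_num) hn
  have h7 : A * (2 * (5 * N)) = 10 * A * N := by ring
  omega

/-- Both operators have good kernels, uniformly in `N`. -/
theorem exists_goodKernel (D : DyadicPartition) {φ : EuclideanSpace ℝ (Fin 3) → ℝ}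
    (hφ : IsCutoff φ) {A : ℕ} (hA : D.Bound A) : ∃ Γ : ℕ, 20 * A ≤ Γ ∧ ∀ N, 1 ≤ N →
      GoodKernel N (levels A N) Γ A (boxF (5 * N))
        (kern D (levels A N) (mulHigh N) (mulLow N)) ∧
      GoodKernel N (levels A N) Γ A (boxF (5 * N))
        (kern D (levels A N) (mulLow N) (mulMid φ N)) := by
  have hc : HasCompactSupport φ := IsCompact.of_isClosed_subset
    (isCompact_closedBall (0 : EuclideanSpace ℝ (Fin 3)) 1.8) (isClosed_tsupport φ) fun x hx => by
      have := hφ.supp hx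
      simpa using this
  obtain ⟨C, hC⟩ := hc.exists_bound_of_continuous hφ.smooth.continuous
  obtain ⟨Γ, hΓ⟩ := exists_nat_ge (max C (100 * A ^ 4))
  have hΓ1 : C ≤ Γ := (le_max_left _ _).trans hΓ
  have hΓ2 : 100 * A ^ 4 ≤ Γ := by exact_mod_cast (le_max_right _ _).trans hΓ
  have hA4 : A ≤ A ^ 4 := Nat.le_self_pow (by norm_num) A
  have hA1 := hA.one_le
  have hΓ3 : (1 : ℝ) ≤ Γ := by
    have : 1 ≤ Γ := by omega
    exact_mod_cast this
  have hlow : ∀ N k, ‖mulLow N k‖ ≤ 1 := fun N k => by rw [mulLow]; split_ifs <;> simp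
  have hhigh : ∀ N k, ‖mulHigh N k‖ ≤ 1 := fun N k => by rw [mulHigh]; split_ifs <;> simp
  refine ⟨Γ, by omega, fun N hN => ⟨?_, ?_⟩⟩
  · refine goodKernel_of hN hA (two_pow_levels_le hA1 hN) (hhigh N)
      (fun k => (hlow N k).trans hΓ3) hΓ2 fun k₁ k₂ h1 h2 => Or.inl ⟨?_, ?_⟩
    · by_contra h; simp [mulLow, h] at h2
    · intro h; simp [mulHigh, h] at h1
  · refine goodKernel_of hN hA (two_pow_levels_le hA1 hN) (hlow N) (fun k => ?_) hΓ2
      fun k₁ k₂ h1 h2 => Or.inr ⟨?_, ?_, ?_⟩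
    · rw [mulMid]
      split_ifs
      · rw [Complex.norm_real]; exact (hC _).trans hΓ1
      · simp
    · intro h; simp [mulMid, h] at h2
    · by_contra h; simp [mulLow, h] at h1
    · have h3 : φ (eps N • toE k₂) ≠ 0 := by
        intro h; simp [mulMid, h] at h2
      have h4 : ‖eps N • toE k₂‖ ≤ 1.8 := hφ.supp (subset_tsupport _ (Function.mem_support.2 h3))
      intro j
      rw [norm_smul, Real.norm_of_nonneg (eps_pos N).le] at h4
      rw [abs_mul, abs_of_pos (eps_pos N)]
      exact (mul_le_mul_of_nonneg_left (abs_le_norm_toE k₂ j) (eps_pos N).le).trans h4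

end Kernels

/-! ### Weights, convolutions and sums over windows and slabs -/

section LatticeSums

/-- The weight `(1+|x|)^{-2/3}`. -/
def wt (x : ℤ) : ℝ := (1 + |(x : ℝ)|) ^ (-(2 / 3) : ℝ)

/-- The weight `(1+|x|)^{-1/3}`. -/
def wt' (x : ℤ) : ℝ := (1 + |(x : ℝ)|) ^ (-(1 / 3) : ℝ)

/-- The logarithmically diverging sum `∑_{|x| ≤ N} (1+|x|)^{-1}`. -/
def logSum (N : ℕ) : ℝ := ∑ x ∈ Finset.Icc (-(N : ℤ)) N, (1 + |(x : ℝ)|)⁻¹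

lemma wt_pos (x : ℤ) : 0 < wt x := by unfold wt; positivity

lemma wt'_pos (x : ℤ) : 0 < wt' x := by unfold wt'; positivity

lemma logSum_nonneg (N : ℕ) : 0 ≤ logSum N := Finset.sum_nonneg fun _ _ => by positivity

lemma one_le_logSum (N : ℕ) : 1 ≤ logSum N := by
  have : (1 + |((0 : ℤ) : ℝ)|)⁻¹ ≤ logSum N := Finset.single_le_sum
    (f := fun x : ℤ => (1 + |(x : ℝ)|)⁻¹) (fun _ _ => by positivity) (by simp)
  simpa using this

/-- The factorisation (y - x)(y² + xy + x²) = 1 gives the telescoping form of the sums of n^{-2/3}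
and n^{-1/3}. -/
lemma cube_root_step {x y : ℝ} (hx : 0 ≤ x) (hy : 0 < y) (h : y ^ 3 = x ^ 3 + 1) :
    (y ^ 2)⁻¹ ≤ 3 * (y - x) ∧ y⁻¹ ≤ 3 * (y ^ 2 - x ^ 2) := by
  have hxy : x < y := lt_of_pow_lt_pow_left₀ 3 hy.le (by linarith)
  have h1 : 1 ≤ 3 * (y - x) * y ^ 2 := by
    have : (y - x) * (y ^ 2 + x * y + x ^ 2) = 1 := by ring_nf; linarith
    have h2 : y ^ 2 + x * y + x ^ 2 ≤ 3 * y ^ 2 := by nlinarith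
    nlinarith
  constructor
  · rw [inv_le_iff_one_le_mul₀ (by positivity)]; exact h1
  · rw [inv_le_iff_one_le_mul₀ hy]
    nlinarith

lemma sum_range_rpow (m : ℕ) :
    ∑ n ∈ Finset.range m, ((n : ℝ) + 1) ^ (-(2 / 3) : ℝ) ≤ 3 * (m : ℝ) ^ (1 / 3 : ℝ) ∧
    ∑ n ∈ Finset.range m, ((n : ℝ) + 1) ^ (-(1 / 3) : ℝ) ≤ 3 * (m : ℝ) ^ (2 / 3 : ℝ) := by
  induction m with
  | zero => simp
  | succ m ih =>
    set x := (m : ℝ) ^ (1 / 3 : ℝ) with hx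
    set y := ((m : ℝ) + 1) ^ (1 / 3 : ℝ) with hy
    have hx3 : x ^ 3 = m := by
      rw [hx, ← Real.rpow_natCast, ← Real.rpow_mul (by positivity)]; norm_num
    have hy3 : y ^ 3 = m + 1 := by
      rw [hy, ← Real.rpow_natCast, ← Real.rpow_mul (by positivity)]; norm_num
    have hx2 : (m : ℝ) ^ (2 / 3 : ℝ) = x ^ 2 := by
      rw [hx, ← Real.rpow_natCast, ← Real.rpow_mul (by positivity)]; norm_num
    have hy2 : ((m : ℝ) + 1) ^ (2 / 3 : ℝ) = y ^ 2 := by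
      rw [hy, ← Real.rpow_natCast, ← Real.rpow_mul (by positivity)]; norm_num
    have hy0 : 0 < y := by positivity
    obtain ⟨h1, h2⟩ := cube_root_step (x := x) (y := y) (by positivity) hy0 (by rw [hx3, hy3])
    rw [Finset.sum_range_succ, Finset.sum_range_succ]
    push_cast
    rw [Real.rpow_neg (by positivity), Real.rpow_neg (by positivity), hy2, ← hy]
    rw [hx2] at ih
    constructor <;> linarith [ih.1, ih.2]

/-- Points with |x| ≤ m take each absolute value at most twice; at all other points the weight is at
most F(m). The bound does not depend on the centre, as is required for aliased windows. -/
lemma sum_window_le {F : ℕ → ℝ} (hF : Antitone F) (hF0 : ∀ n, 0 ≤ F n) (m : ℕ) (z : ℤ) :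
    ∑ x ∈ Finset.Icc (z - m) (z + m), F x.natAbs ≤
      2 * ∑ n ∈ Finset.range (m + 1), F n + (2 * m + 1) * F m := by
  classical
  rw [← Finset.sum_filter_add_sum_filter_not _ (fun x : ℤ => x.natAbs ≤ m)]
  refine add_le_add ?_ ?_
  · rw [← Finset.sum_fiberwise_of_maps_to (g := Int.natAbs) (t := Finset.range (m + 1))
      (fun x hx => by simp only [Finset.mem_filter] at hx; simp; omega), Finset.mul_sum]
    refine Finset.sum_le_sum fun n _ => ?_
    rw [Finset.sum_congr rfl (g := fun _ => F n) fun x hx => by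
      simp only [Finset.mem_filter] at hx; rw [hx.2]]
    rw [Finset.sum_const, nsmul_eq_mul]
    refine mul_le_mul_of_nonneg_right ?_ (hF0 n)
    have : (Finset.filter (fun i : ℤ => i.natAbs = n)
        (Finset.filter (fun x : ℤ => x.natAbs ≤ m) (Finset.Icc (z - m) (z + m)))) ⊆ {(n : ℤ), -(n : ℤ)} := by
      intro x hx
      simp only [Finset.mem_filter] at hx
      simp only [Finset.mem_insert, Finset.mem_singleton]
      omega
    exact_mod_cast (Finset.card_le_card this).trans Finset.card_le_two
  · calc ∑ x ∈ (Finset.Icc (z - m) (z + m)).filter (fun x : ℤ => ¬ x.natAbs ≤ m), F x.natAbs ≤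
        ∑ x ∈ (Finset.Icc (z - m) (z + m)).filter (fun x : ℤ => ¬ x.natAbs ≤ m), F m :=
          Finset.sum_le_sum fun x hx => hF (by simp only [Finset.mem_filter] at hx; omega)
      _ ≤ ∑ x ∈ Finset.Icc (z - m) (z + m), F m :=
          Finset.sum_le_sum_of_subset_of_nonneg (Finset.filter_subset _ _) fun _ _ _ => hF0 m
      _ = (2 * m + 1) * F m := by
          rw [Finset.sum_const, nsmul_eq_mul, Int.card_Icc]
          congr 1
          have : (z + m + 1 - (z - m)).toNat = 2 * m + 1 := by omega
          rw [this]; push_cast; ring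

lemma antitone_weight {s : ℝ} (hs : 0 ≤ s) : Antitone fun n : ℕ => ((n : ℝ) + 1) ^ (-s) := by
  intro a b hab
  exact Real.rpow_le_rpow_of_nonpos (by positivity) (by gcongr) (by linarith)

lemma wt'_natAbs (x : ℤ) : wt' x = ((x.natAbs : ℝ) + 1) ^ (-(1 / 3) : ℝ) := by
  rw [wt', add_comm, Nat.cast_natAbs, Int.cast_abs]

lemma wt_natAbs (x : ℤ) : wt x = ((x.natAbs : ℝ) + 1) ^ (-(2 / 3) : ℝ) := by
  rw [wt, add_comm, Nat.cast_natAbs, Int.cast_abs]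

lemma succ_rpow_le {m : ℕ} (hm : 1 ≤ m) {s : ℝ} (hs : 0 ≤ s) (hs1 : s ≤ 1) :
    ((m : ℝ) + 1) ^ s ≤ 2 * (m : ℝ) ^ s := by
  have hm' : (1 : ℝ) ≤ m := by exact_mod_cast hm
  calc ((m : ℝ) + 1) ^ s ≤ (2 * m) ^ s := Real.rpow_le_rpow (by positivity) (by linarith) hs
    _ = 2 ^ s * (m : ℝ) ^ s := Real.mul_rpow (by norm_num) (by positivity)
    _ ≤ 2 * (m : ℝ) ^ s := by
        gcongr
        exact (Real.rpow_le_rpow_of_exponent_le (by norm_num) hs1).trans (by simp)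

lemma sum_wt'_window_le {m : ℕ} (hm : 1 ≤ m) (z : ℤ) :
    ∑ x ∈ Finset.Icc (z - m) (z + m), wt' x ≤ 16 * (m : ℝ) ^ (2 / 3 : ℝ) := by
  simp only [wt'_natAbs]
  refine (sum_window_le (antitone_weight (s := 1 / 3) (by norm_num)) (fun n => by positivity) m z).trans ?_
  have h1 := (sum_range_rpow (m + 1)).2
  have h2 := succ_rpow_le hm (s := 2 / 3) (by norm_num) (by norm_num)
  have h3 : (2 * (m : ℝ) + 1) * ((m : ℝ) + 1) ^ (-(1 / 3) : ℝ) ≤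
      2 * ((m : ℝ) + 1) ^ (2 / 3 : ℝ) := by
    have : ((m : ℝ) + 1) ^ (2 / 3 : ℝ) = ((m : ℝ) + 1) * ((m : ℝ) + 1) ^ (-(1 / 3) : ℝ) := by
      rw [← Real.rpow_one_add' (by positivity) (by norm_num)]; norm_num
    rw [this]
    have : 0 ≤ ((m : ℝ) + 1) ^ (-(1 / 3) : ℝ) := by positivity
    nlinarith
  push_cast at h1
  linarith

lemma sum_wt_le {N : ℕ} (hN : 1 ≤ N) :
    ∑ x ∈ Finset.Icc (-(N : ℤ)) N, wt x ≤ 16 * (N : ℝ) ^ (1 / 3 : ℝ) := by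
  simp only [wt_natAbs]
  have := sum_window_le (antitone_weight (s := 2 / 3) (by norm_num)) (fun n => by positivity) N 0
  simp only [zero_sub, zero_add] at this
  refine this.trans ?_
  have h1 := (sum_range_rpow (N + 1)).1
  have h2 := succ_rpow_le hN (s := 1 / 3) (by norm_num) (by norm_num)
  have h3 : (2 * (N : ℝ) + 1) * ((N : ℝ) + 1) ^ (-(2 / 3) : ℝ) ≤
      2 * ((N : ℝ) + 1) ^ (1 / 3 : ℝ) := by
    have : ((N : ℝ) + 1) ^ (1 / 3 : ℝ) = ((N : ℝ) + 1) * ((N : ℝ) + 1) ^ (-(2 / 3) : ℝ) := by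
      rw [← Real.rpow_one_add' (by positivity) (by norm_num)]; norm_num
    rw [this]
    have : 0 ≤ ((N : ℝ) + 1) ^ (-(2 / 3) : ℝ) := by positivity
    nlinarith
  push_cast at h1
  linarith

/-- The larger of the two arguments is at least half of 1 + |k|. One third of its decay yields the
weight in k; the other third is given to the smaller argument, whose exponent becomes exactly -1 and
sums to a logarithm. -/
lemma wt_mul_wt_le (x k : ℤ) : wt x * wt (k - x) ≤
    2 * wt' k * ((1 + |(x : ℝ)|)⁻¹ + (1 + |((k - x : ℤ) : ℝ)|)⁻¹) := by
  set a : ℝ := 1 + |(x : ℝ)| with ha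
  set b : ℝ := 1 + |((k - x : ℤ) : ℝ)| with hb
  set K : ℝ := 1 + |(k : ℝ)| with hK
  have ha0 : 0 < a := by positivity
  have hb0 : 0 < b := by positivity
  have hK0 : 0 < K := by positivity
  have hab : K ≤ a + b := by
    have : |(k : ℝ)| ≤ |(x : ℝ)| + |((k - x : ℤ) : ℝ)| := by
      have := abs_add_le (x : ℝ) ((k - x : ℤ) : ℝ)
      push_cast at this ⊢
      simpa using this
    linarith
  have key : ∀ u v : ℝ, 0 < u → 0 < v → v ≤ u → K ≤ u + v →
      u ^ (-(2 / 3) : ℝ) * v ^ (-(2 / 3) : ℝ) ≤ 2 * K ^ (-(1 / 3) : ℝ) * v⁻¹ := by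
    intro u v hu hv huv hKuv
    have e1 : u ^ (-(2 / 3) : ℝ) = u ^ (-(1 / 3) : ℝ) * u ^ (-(1 / 3) : ℝ) := by
      rw [← Real.rpow_add hu]; norm_num
    have e2 : v⁻¹ = v ^ (-(1 / 3) : ℝ) * v ^ (-(2 / 3) : ℝ) := by
      rw [← Real.rpow_add hv, ← Real.rpow_neg_one]; norm_num
    have h1 : u ^ (-(1 / 3) : ℝ) ≤ v ^ (-(1 / 3) : ℝ) :=
      Real.rpow_le_rpow_of_nonpos hv huv (by norm_num)
    have h2 : u ^ (-(1 / 3) : ℝ) ≤ 2 * K ^ (-(1 / 3) : ℝ) := by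
      calc u ^ (-(1 / 3) : ℝ) ≤ (2⁻¹ * K) ^ (-(1 / 3) : ℝ) :=
            Real.rpow_le_rpow_of_nonpos (by positivity) (by linarith) (by norm_num)
        _ = (2⁻¹ : ℝ) ^ (-(1 / 3) : ℝ) * K ^ (-(1 / 3) : ℝ) :=
            Real.mul_rpow (by norm_num) hK0.le
        _ ≤ 2 * K ^ (-(1 / 3) : ℝ) := by
            gcongr
            rw [Real.rpow_neg (by norm_num), Real.inv_rpow (by norm_num), inv_inv]
            exact (Real.rpow_le_rpow_of_exponent_le (by norm_num) (by norm_num :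
              (1 / 3 : ℝ) ≤ 1)).trans (by simp)
    rw [e1, e2]
    have hv2 : 0 ≤ v ^ (-(2 / 3) : ℝ) := by positivity
    have hu1 : 0 ≤ u ^ (-(1 / 3) : ℝ) := by positivity
    calc u ^ (-(1 / 3) : ℝ) * u ^ (-(1 / 3) : ℝ) * v ^ (-(2 / 3) : ℝ) ≤
        (2 * K ^ (-(1 / 3) : ℝ)) * v ^ (-(1 / 3) : ℝ) * v ^ (-(2 / 3) : ℝ) := by gcongr
      _ = _ := by ring
  have hK' : 0 ≤ 2 * K ^ (-(1 / 3) : ℝ) := by positivity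
  simp only [wt, wt', ← ha, ← hb, ← hK]
  rcases le_total b a with h | h
  · refine (key a b ha0 hb0 h hab).trans ?_
    gcongr
    have : 0 ≤ a⁻¹ := by positivity
    linarith
  · rw [mul_comm]
    refine (key b a hb0 ha0 h (by linarith)).trans ?_
    gcongr
    have : 0 ≤ b⁻¹ := by positivity
    linarith

lemma conv_wt_le (N : ℕ) (k : ℤ) :
    ∑ x ∈ (Finset.Icc (-(N : ℤ)) N).filter (fun x => k - x ∈ Finset.Icc (-(N : ℤ)) N),
      wt x * wt (k - x) ≤ 4 * logSum N * wt' k := by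
  classical
  set S := (Finset.Icc (-(N : ℤ)) N).filter (fun x => k - x ∈ Finset.Icc (-(N : ℤ)) N) with hS
  have h1 : ∑ x ∈ S, (1 + |(x : ℝ)|)⁻¹ ≤ logSum N :=
    Finset.sum_le_sum_of_subset_of_nonneg (Finset.filter_subset _ _) fun _ _ _ => by positivity
  have h2 : ∑ x ∈ S, (1 + |((k - x : ℤ) : ℝ)|)⁻¹ ≤ logSum N := by
    have : ∑ x ∈ S, (1 + |((k - x : ℤ) : ℝ)|)⁻¹ =
        ∑ x ∈ S.image (fun x => k - x), (1 + |(x : ℝ)|)⁻¹ :=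
      (Finset.sum_image (f := fun y : ℤ => (1 + |(y : ℝ)|)⁻¹) (g := fun x => k - x)
        fun x _ y _ h => by simpa using h).symm
    rw [this]
    refine Finset.sum_le_sum_of_subset_of_nonneg ?_ fun _ _ _ => by positivity
    intro y hy
    obtain ⟨x, hx, rfl⟩ := Finset.mem_image.1 hy
    exact (Finset.mem_filter.1 hx).2
  calc ∑ x ∈ S, wt x * wt (k - x) ≤ ∑ x ∈ S, 2 * wt' k * ((1 + |(x : ℝ)|)⁻¹ +
        (1 + |((k - x : ℤ) : ℝ)|)⁻¹) := Finset.sum_le_sum fun x _ => wt_mul_wt_le x k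
    _ = 2 * wt' k * (∑ x ∈ S, (1 + |(x : ℝ)|)⁻¹ + ∑ x ∈ S, (1 + |((k - x : ℤ) : ℝ)|)⁻¹) := by
        rw [← Finset.mul_sum, Finset.sum_add_distrib]
    _ ≤ 2 * wt' k * (logSum N + logSum N) := by
        have := (wt'_pos k).le
        gcongr
    _ = _ := by ring

/-- Three-dimensional weights. -/
def wt3 (k : Freq) : ℝ := ∏ j, wt (k j)

/-- Three-dimensional weights. -/
def wt3' (k : Freq) : ℝ := ∏ j, wt' (k j)

lemma wt3_nonneg (k : Freq) : 0 ≤ wt3 k := Finset.prod_nonneg fun _ _ => (wt_pos _).le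

lemma wt3'_nonneg (k : Freq) : 0 ≤ wt3' k := Finset.prod_nonneg fun _ _ => (wt'_pos _).le

lemma sum_prod_le {S : Finset Freq} {t : Fin 3 → Finset ℤ} (hS : ∀ k ∈ S, ∀ j, k j ∈ t j)
    {f : Fin 3 → ℤ → ℝ} (hf : ∀ j x, 0 ≤ f j x) :
    ∑ k ∈ S, ∏ j, f j (k j) ≤ ∏ j, ∑ x ∈ t j, f j x := by
  rw [Finset.prod_univ_sum]
  refine Finset.sum_le_sum_of_subset_of_nonneg (fun k hk => ?_) fun _ _ _ =>
    Finset.prod_nonneg fun _ _ => hf _ _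
  exact Fintype.mem_piFinset.2 (hS k hk)

lemma sum_wt3'_window_le {m : ℕ} (hm : 1 ≤ m) (z : Freq) {S : Finset Freq}
    (hS : ∀ k ∈ S, inBox m (k - z)) : ∑ k ∈ S, wt3' k ≤ 4096 * (m : ℝ) ^ 2 := by
  calc ∑ k ∈ S, wt3' k ≤ ∏ j : Fin 3, ∑ x ∈ Finset.Icc (z j - m) (z j + m), wt' x :=
        sum_prod_le (fun k hk j => by
          have := hS k hk j
          simp only [Pi.sub_apply, abs_le] at this
          rw [Finset.mem_Icc]; omega) fun _ _ => (wt'_pos _).le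
    _ ≤ ∏ _j : Fin 3, (16 * (m : ℝ) ^ (2 / 3 : ℝ)) :=
        Finset.prod_le_prod (fun _ _ => Finset.sum_nonneg fun _ _ => (wt'_pos _).le)
          fun j _ => sum_wt'_window_le hm (z j)
    _ = 4096 * (m : ℝ) ^ 2 := by
        simp only [Finset.prod_const, Finset.card_univ, Fintype.card_fin, mul_pow]
        rw [← Real.rpow_natCast ((m : ℝ) ^ (2 / 3 : ℝ)), ← Real.rpow_mul (by positivity)]
        norm_num

/-- The weights factorise over the coordinates: the constrained one contributes m^{2/3}, each of the
two free ones M^{2/3}. -/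
lemma sum_wt3'_slab_le {m M : ℕ} (hm : 1 ≤ m) (hM : 1 ≤ M) (d : Fin 3) (y : ℤ) {S : Finset Freq}
    (hS : ∀ k ∈ S, inBox M k ∧ |k d - y| ≤ m) :
    ∑ k ∈ S, wt3' k ≤ 4096 * ((m : ℝ) ^ (2 / 3 : ℝ) * (M : ℝ) ^ (4 / 3 : ℝ)) := by
  classical
  let t : Fin 3 → Finset ℤ := fun j => if j = d then Finset.Icc (y - m) (y + m) else
    Finset.Icc ((0 : ℤ) - M) (0 + M)
  calc ∑ k ∈ S, wt3' k ≤ ∏ j : Fin 3, ∑ x ∈ t j, wt' x := by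
        refine sum_prod_le (fun k hk j => ?_) fun _ _ => (wt'_pos _).le
        obtain ⟨h1, h2⟩ := hS k hk
        simp only [t]
        split_ifs with h
        · subst h
          rw [abs_le] at h2
          rw [Finset.mem_Icc]; omega
        · have := h1 j
          rw [abs_le] at this
          rw [Finset.mem_Icc]; omega
    _ ≤ ∏ j : Fin 3, (if j = d then 16 * (m : ℝ) ^ (2 / 3 : ℝ) else
          16 * (M : ℝ) ^ (2 / 3 : ℝ)) := by
        refine Finset.prod_le_prod (fun _ _ => Finset.sum_nonneg fun _ _ => (wt'_pos _).le)
          fun j _ => ?_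
        simp only [t]
        split_ifs
        · exact sum_wt'_window_le hm y
        · exact sum_wt'_window_le hM 0
    _ = 4096 * ((m : ℝ) ^ (2 / 3 : ℝ) * (M : ℝ) ^ (4 / 3 : ℝ)) := by
        rw [Finset.prod_ite, Finset.prod_const, Finset.prod_const]
        have h1 : (Finset.univ.filter fun j : Fin 3 => j = d).card = 1 := by
          rw [Finset.filter_eq' Finset.univ d]; simp
        have h2 : (Finset.univ.filter fun j : Fin 3 => ¬ j = d).card = 2 := by
          have := Finset.card_filter_add_card_filter_not (s := (Finset.univ : Finset (Fin 3)))
            (fun j => j = d)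
          rw [h1] at this
          simp at this
          omega
        rw [h1, h2, mul_pow, mul_pow, ← Real.rpow_natCast ((M : ℝ) ^ (2 / 3 : ℝ)),
          ← Real.rpow_mul (by positivity)]
        norm_num
        ring

/-- Stationary variance of a mode. -/
def modeVar (N : ℕ) (k : Mode N) : ℝ := 1 / (16 * rate N k.1)

lemma modeVar_pos {N : ℕ} (k : Mode N) : 0 < modeVar N k := by
  have := rate_pos k.2.1 k.2.2
  unfold modeVar; positivity

/-- Every coordinate satisfies 1 + |k_j| ≤ 2‖k‖, so the product of three powers -2/3 is at least
(2‖k‖)⁻². In this way the isotropic variance is dominated by a tensor product. -/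
lemma one_le_wt3_mul {k : Freq} (hk : k ≠ 0) : 1 ≤ 4 * ‖toE k‖ ^ 2 * wt3 k := by
  have hmax : ∀ j, 1 + |(k j : ℝ)| ≤ 2 * ‖toE k‖ := fun j => by
    have h1 := abs_le_norm_toE k j
    have h2 : 1 ≤ ‖toE k‖ := by
      have := one_le_norm_toE_sq hk
      nlinarith [norm_nonneg (toE k)]
    linarith
  have hpos : 0 < 2 * ‖toE k‖ := lt_of_lt_of_le (by positivity) (hmax 0)
  have h1 : ∏ _j : Fin 3, (2 * ‖toE k‖) ^ (-(2 / 3) : ℝ) ≤ wt3 k := by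
    refine Finset.prod_le_prod (fun _ _ => by positivity) fun j _ => ?_
    exact Real.rpow_le_rpow_of_nonpos (by positivity) (hmax j) (by norm_num)
  simp only [Finset.prod_const, Finset.card_univ, Fintype.card_fin] at h1
  rw [← Real.rpow_natCast, ← Real.rpow_mul hpos.le] at h1
  have h2 : (2 * ‖toE k‖) ^ (-(2 / 3) * (3 : ℕ) : ℝ) = ((2 * ‖toE k‖) ^ 2)⁻¹ := by
    rw [← Real.rpow_natCast, ← Real.rpow_neg hpos.le]; norm_num
  rw [h2] at h1
  calc (1 : ℝ) = (2 * ‖toE k‖) ^ 2 * ((2 * ‖toE k‖) ^ 2)⁻¹ := by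
        rw [mul_inv_cancel₀ (by positivity)]
    _ ≤ (2 * ‖toE k‖) ^ 2 * wt3 k := by gcongr
    _ = _ := by ring

lemma modeVar_le {N : ℕ} (k : Mode N) : modeVar N k ≤ 6 * wt3 k.1 := by
  have h1 := le_rate_of_inBox k.2.2
  have h2 := one_le_wt3_mul k.2.1
  have h3 := wt3_nonneg k.1
  rw [modeVar, div_le_iff₀ (by have := rate_pos k.2.1 k.2.2; positivity)]
  have h4 : 4 / 81 * ‖toE k.1‖ ^ 2 * wt3 k.1 ≤ rate N k.1 * wt3 k.1 := by gcongr
  nlinarith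

lemma sum_modeVar_le {N : ℕ} (hN : 1 ≤ N) : ∑ k : Mode N, modeVar N k ≤ 24576 * N := by
  calc ∑ k : Mode N, modeVar N k ≤ ∑ k : Mode N, 6 * wt3 k.1 :=
        Finset.sum_le_sum fun k _ => modeVar_le k
    _ = 6 * ∑ k ∈ modes N, wt3 k := by rw [← Finset.mul_sum, sum_modes wt3]
    _ ≤ 6 * ∏ _j : Fin 3, ∑ x ∈ Finset.Icc (-(N : ℤ)) N, wt x := by
        gcongr
        refine sum_prod_le (fun k hk j => ?_) fun _ _ => (wt_pos _).le
        have := (mem_modes.1 hk).2 j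
        rwa [abs_le, ← Finset.mem_Icc] at this
    _ ≤ 6 * ∏ _j : Fin 3, (16 * (N : ℝ) ^ (1 / 3 : ℝ)) := by
        gcongr with j
        · exact fun _ _ => Finset.sum_nonneg fun _ _ => (wt_pos _).le
        · exact sum_wt_le hN
    _ = 24576 * N := by
        simp only [Finset.prod_const, Finset.card_univ, Fintype.card_fin, mul_pow]
        rw [← Real.rpow_natCast ((N : ℝ) ^ (1 / 3 : ℝ)), ← Real.rpow_mul (by positivity)]
        norm_num
        ring

/-- Convolution estimate for the variances of the modes. -/
lemma sum_modeVar_conv_le {N : ℕ} {F : Freq → ℝ} (hF : ∀ k, 0 ≤ F k) :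
    ∑ a : Mode N, ∑ b : Mode N, modeVar N a * modeVar N b * F (a.1 + b.1) ≤
      2304 * logSum N ^ 3 * ∑ k ∈ boxF (2 * N), wt3' k * F k := by
  classical
  have h1 : ∀ a b : Mode N, modeVar N a * modeVar N b * F (a.1 + b.1) =
      ∑ k ∈ boxF (2 * N), if a.1 + b.1 = k then modeVar N a * modeVar N b * F k else 0 := by
    intro a b
    rw [Finset.sum_ite_eq, if_pos]
    refine mem_boxF.2 fun j => ?_
    have h1 := a.2.2 j
    have h2 := b.2.2 j
    rw [abs_le] at *
    simp only [Pi.add_apply]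
    push_cast
    constructor <;> linarith
  simp only [h1]
  have h2 : ∀ a : Mode N, (∑ b : Mode N, ∑ k ∈ boxF (2 * N),
      if a.1 + b.1 = k then modeVar N a * modeVar N b * F k else 0) = ∑ k ∈ boxF (2 * N),
      ∑ b : Mode N, if a.1 + b.1 = k then modeVar N a * modeVar N b * F k else 0 :=
    fun a => Finset.sum_comm
  simp only [h2]
  rw [Finset.sum_comm, Finset.mul_sum]
  refine Finset.sum_le_sum fun k _ => ?_
  have h3 : ∀ a : Mode N, (∑ b : Mode N,
      if a.1 + b.1 = k then modeVar N a * modeVar N b * F k else 0) ≤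
      if k - a.1 ∈ modes N then 36 * (wt3 a.1 * wt3 (k - a.1)) * F k else 0 := by
    intro a
    split_ifs with hk
    · rw [Finset.sum_eq_single (⟨k - a.1, mem_modes.1 hk⟩ : Mode N)]
      · rw [if_pos (by simp)]
        have e1 := modeVar_le a
        have e2 := modeVar_le (⟨k - a.1, mem_modes.1 hk⟩ : Mode N)
        refine mul_le_mul_of_nonneg_right ?_ (hF k)
        calc _ ≤ (6 * wt3 a.1) * (6 * wt3 (k - a.1)) :=
              mul_le_mul e1 e2 (modeVar_pos _).le (by have := wt3_nonneg a.1; positivity)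
          _ = _ := by ring
      · intro b _ hb
        rw [if_neg]
        intro e
        exact hb (Subtype.ext (eq_sub_of_add_eq' e))
      · simp
    · refine (Finset.sum_eq_zero fun b _ => if_neg fun e => hk ?_).le
      rw [← eq_sub_of_add_eq' e]
      exact mem_modes.2 b.2
  refine (Finset.sum_le_sum fun a _ => h3 a).trans ?_
  rw [← sum_modes (fun a => if k - a ∈ modes N then 36 * (wt3 a * wt3 (k - a)) * F k else 0),
    ← Finset.sum_filter, ← Finset.sum_mul, ← Finset.mul_sum]
  -- The three-dimensional convolution is a product of three one-dimensional ones, hence the cube of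
  -- the logarithm.
  have h4 : ∑ a ∈ (modes N).filter (fun a => k - a ∈ modes N), wt3 a * wt3 (k - a) ≤
      ∏ j, (4 * logSum N * wt' (k j)) := by
    have e : ∀ a : Freq, wt3 a * wt3 (k - a) = ∏ j, wt (a j) * wt (k j - a j) := fun a => by
      rw [Finset.prod_mul_distrib]; rfl
    simp only [e]
    refine (sum_prod_le (t := fun j => (Finset.Icc (-(N : ℤ)) N).filter
      (fun x => k j - x ∈ Finset.Icc (-(N : ℤ)) N)) (fun a ha j => ?_)
      (f := fun j x => wt x * wt (k j - x)) fun j x => mul_nonneg (wt_pos _).le (wt_pos _).le).trans ?_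
    · obtain ⟨ha1, ha2⟩ := Finset.mem_filter.1 ha
      have b1 := (mem_modes.1 ha1).2 j
      have b2 := (mem_modes.1 ha2).2 j
      rw [abs_le] at b1 b2
      simp only [Finset.mem_filter, Finset.mem_Icc]
      exact ⟨b1, b2⟩
    · exact Finset.prod_le_prod (fun j _ => Finset.sum_nonneg fun x _ =>
        mul_nonneg (wt_pos _).le (wt_pos _).le) fun j _ => conv_wt_le N (k j)
  have h5 : ∏ j, (4 * logSum N * wt' (k j)) = 64 * logSum N ^ 3 * wt3' k := by
    rw [Finset.prod_mul_distrib, wt3']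
    simp only [Finset.prod_const, Finset.card_univ, Fintype.card_fin]
    ring
  rw [h5] at h4
  calc _ ≤ 36 * (64 * logSum N ^ 3 * wt3' k) * F k := by
        have := hF k
        gcongr
    _ = _ := by ring

end LatticeSums

/-! ### Quadratic forms in the Wick square at two fixed times -/

section QuadraticMoments

variable {Ω : Type*} [MeasurableSpace Ω] {P : Measure Ω} [IsProbabilityMeasure P]

/-- The aliasing shift `(2N+1) i`. -/
def shift (N : ℕ) (i : Freq) : Freq := (2 * (N : ℤ) + 1) • i

/-- The bound for the size of a quadratic expression in the Wick square. -/
def quadBound (N m ρ : ℕ) (k : Freq) : ℝ :=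
  10 ^ 9 * logSum N ^ 3 * (N * m + if inBox m k then
    (ρ : ℝ) ^ (2 / 3 : ℝ) * (N : ℝ) ^ (4 / 3 : ℝ) else 0)

lemma quadBound_nonneg (N m ρ : ℕ) (k : Freq) : 0 ≤ quadBound N m ρ k := by
  have := logSum_nonneg N
  unfold quadBound
  split_ifs <;> positivity

lemma IsOUModes.modeCov_eq {N : ℕ} {U : ℝ → Mode N → Ω → ℂ} (hU : IsOUModes N U P) (t : ℝ)
    (a b : Mode N) : ∫ ω, U t a ω * U t b ω ∂P = modeCov N a b := by
  rw [modeCov]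
  split_ifs with h
  · rw [h, hU.pseudoCov_neg]
  · exact hU.pseudoCov t t a b h

/-- The support condition on `e` removes the restriction to B, so the sums over output frequencies
turn into free sums over modes, to which Gaussian estimates apply. -/
lemma sum_xCoef_mul {N : ℕ} (B : Finset Freq) (e : Freq → Freq → ℂ)
    (he : ∀ k l, e k l ≠ 0 → k ∈ B ∧ l ∈ B) (p p' : Mode N → ℂ) :
    ∑ k ∈ B, ∑ l ∈ B, e k l * (xCoef N p k * xCoef N p' l) =
      ∑ i ∈ Finset.Icc (-1 : Freq) 1, ∑ i' ∈ Finset.Icc (-1 : Freq) 1,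
        ∑ a : Mode N, ∑ b : Mode N, ∑ c : Mode N, ∑ d : Mode N,
          e (a.1 + b.1 - shift N i) (c.1 + d.1 - shift N i') * (wick2 N p a b * wick2 N p' c d) := by
  classical
  have hx : ∀ (p : Mode N → ℂ) (F : Freq → ℂ), (∀ k, F k ≠ 0 → k ∈ B) →
      ∑ k ∈ B, F k * xCoef N p k = ∑ i ∈ Finset.Icc (-1 : Freq) 1, ∑ a : Mode N, ∑ b : Mode N,
        F (a.1 + b.1 - shift N i) * wick2 N p a b := by
    intro p F hF
    simp only [xCoef, qCoef, Finset.mul_sum]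
    rw [Finset.sum_comm]
    refine Finset.sum_congr rfl fun i _ => ?_
    rw [Finset.sum_comm]
    refine Finset.sum_congr rfl fun a _ => ?_
    rw [Finset.sum_comm]
    refine Finset.sum_congr rfl fun b _ => ?_
    have : ∀ k, (F k * if a.1 + b.1 = k + (2 * (N : ℤ) + 1) • i then wick2 N p a b else 0) =
        if a.1 + b.1 - shift N i = k then F k * wick2 N p a b else 0 := by
      intro k
      have : a.1 + b.1 = k + (2 * (N : ℤ) + 1) • i ↔ a.1 + b.1 - shift N i = k := by
        rw [sub_eq_iff_eq_add, shift]
      simp only [this, mul_ite, mul_zero]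
    simp only [this, Finset.sum_ite_eq]
    split_ifs with h
    · rfl
    · by_cases h0 : F (a.1 + b.1 - shift N i) = 0
      · rw [h0, zero_mul]
      · exact absurd (hF _ h0) h
  have h1 : ∀ k, ∑ l ∈ B, e k l * (xCoef N p k * xCoef N p' l) =
      (∑ l ∈ B, e k l * xCoef N p' l) * xCoef N p k := fun k => by
    rw [Finset.sum_mul]
    exact Finset.sum_congr rfl fun l _ => by ring
  simp only [h1]
  rw [hx p (fun k => ∑ l ∈ B, e k l * xCoef N p' l) fun k hk => by
    obtain ⟨l, -, hl⟩ := Finset.exists_ne_zero_of_sum_ne_zero hk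
    exact (he k l (left_ne_zero_of_mul hl)).1]
  refine Finset.sum_congr rfl fun i _ => ?_
  have h2 : ∀ k, ∑ l ∈ B, e k l * xCoef N p' l = ∑ i' ∈ Finset.Icc (-1 : Freq) 1,
      ∑ c : Mode N, ∑ d : Mode N, e k (c.1 + d.1 - shift N i') * wick2 N p' c d := fun k =>
    hx p' (e k) fun l hl => (he k l hl).2
  simp only [h2, Finset.sum_mul]
  have h3 : ∀ a : Mode N, (∑ b : Mode N, ∑ i' ∈ Finset.Icc (-1 : Freq) 1, ∑ c : Mode N,
      ∑ d : Mode N, e (a.1 + b.1 - shift N i) (c.1 + d.1 - shift N i') * wick2 N p' c d *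
        wick2 N p a b) = ∑ i' ∈ Finset.Icc (-1 : Freq) 1, ∑ b : Mode N, ∑ c : Mode N,
      ∑ d : Mode N, e (a.1 + b.1 - shift N i) (c.1 + d.1 - shift N i') * wick2 N p' c d *
        wick2 N p a b := fun a => Finset.sum_comm
  simp only [h3]
  rw [Finset.sum_comm]
  refine Finset.sum_congr rfl fun i' _ => Finset.sum_congr rfl fun a _ =>
    Finset.sum_congr rfl fun b _ => Finset.sum_congr rfl fun c _ =>
    Finset.sum_congr rfl fun d _ => by ring

/-- Slabs around the faces of the box of size `N`. -/
def inSlab (N ρ : ℕ) (k : Freq) : Prop := ∃ d, |k d - N| ≤ ρ ∨ |k d + N| ≤ ρ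

/-- The slab is covered by six pieces, one for each face of the box, and each is estimated on its
own. -/
lemma sum_wt3'_inSlab_le {N ρ : ℕ} (hN : 1 ≤ N) (hρ : 1 ≤ ρ) (z : Freq) {S : Finset Freq}
    (hS : ∀ k ∈ S, inBox (2 * N) k ∧ inSlab N ρ (k - z)) :
    ∑ k ∈ S, wt3' k ≤ 98304 * ((ρ : ℝ) ^ (2 / 3 : ℝ) * (N : ℝ) ^ (4 / 3 : ℝ)) := by
  classical
  let R : Fin 3 × Bool → Freq → Prop := fun p k =>
    |k p.1 - (z p.1 + if p.2 then (N : ℤ) else -N)| ≤ ρ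
  have hR : ∀ k ∈ S, wt3' k ≤ ∑ p, if R p k then wt3' k else 0 := by
    intro k hk
    obtain ⟨p, hp⟩ : ∃ p, R p k := by
      obtain ⟨d, hd⟩ := (hS k hk).2
      simp only [Pi.sub_apply] at hd
      rcases hd with hd | hd
      · refine ⟨(d, true), ?_⟩
        simp only [R, if_true]
        rwa [← sub_sub]
      · refine ⟨(d, false), ?_⟩
        simp only [R, Bool.false_eq_true, if_false]
        rwa [← sub_sub, sub_neg_eq_add]
    have := Finset.single_le_sum (f := fun p => if R p k then wt3' k else 0)
      (fun p _ => by split_ifs <;> simp [wt3'_nonneg]) (Finset.mem_univ p)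
    simpa [hp] using this
  have hM : ((2 * N : ℕ) : ℝ) ^ (4 / 3 : ℝ) ≤ 4 * (N : ℝ) ^ (4 / 3 : ℝ) := by
    push_cast
    rw [Real.mul_rpow (by norm_num) (by positivity)]
    gcongr
    calc (2 : ℝ) ^ (4 / 3 : ℝ) ≤ 2 ^ (2 : ℝ) :=
          Real.rpow_le_rpow_of_exponent_le (by norm_num) (by norm_num)
      _ = 4 := by norm_num
  calc ∑ k ∈ S, wt3' k ≤ ∑ k ∈ S, ∑ p, if R p k then wt3' k else 0 := Finset.sum_le_sum hR
    _ = ∑ p, ∑ k ∈ S.filter (R p), wt3' k := by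
        rw [Finset.sum_comm]
        exact Finset.sum_congr rfl fun p _ => (Finset.sum_filter _ _).symm
    _ ≤ ∑ _p : Fin 3 × Bool, 4096 * ((ρ : ℝ) ^ (2 / 3 : ℝ) * ((2 * N : ℕ) : ℝ) ^ (4 / 3 : ℝ)) := by
        refine Finset.sum_le_sum fun p _ => ?_
        refine sum_wt3'_slab_le hρ (by omega) p.1 (z p.1 + if p.2 then (N : ℤ) else -N) fun k hk => ?_
        obtain ⟨h1, h2⟩ := Finset.mem_filter.1 hk
        exact ⟨(hS k h1).1, h2⟩
    _ = 24576 * ((ρ : ℝ) ^ (2 / 3 : ℝ) * ((2 * N : ℕ) : ℝ) ^ (4 / 3 : ℝ)) := by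
        simp only [Finset.sum_const, Finset.card_univ, Fintype.card_prod, Fintype.card_fin,
          Fintype.card_bool, nsmul_eq_mul]
        push_cast; ring
    _ ≤ 24576 * ((ρ : ℝ) ^ (2 / 3 : ℝ) * (4 * (N : ℝ) ^ (4 / 3 : ℝ))) := by gcongr
    _ = _ := by ring

lemma sq_quadBound_ge {E : ℝ} (hE0 : 0 ≤ E) (N m ρ : ℕ) (k : Freq) :
    (10 ^ 9 * logSum N ^ 3 * (N * m) * E) ^ 2 ≤ (E * quadBound N m ρ k) ^ 2 := by
  have hL := logSum_nonneg N
  have hq1 : 10 ^ 9 * logSum N ^ 3 * (N * m) ≤ quadBound N m ρ k := by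
    unfold quadBound
    gcongr
    split_ifs
    · have : 0 ≤ (ρ : ℝ) ^ (2 / 3 : ℝ) * (N : ℝ) ^ (4 / 3 : ℝ) := by positivity
      linarith
    · simp
  refine pow_le_pow_left₀ (by positivity) ?_ 2
  rw [mul_comm E]
  gcongr

/-- The variance of the component of a quadratic expression in the fourth chaos. -/
lemma sum_four_modes_le {N : ℕ} (hN : 1 ≤ N) {e : Freq → Freq → ℂ} {E : ℝ}
    (hE : ∀ k l, ‖e k l‖ ≤ E) {m ρ : ℕ} (hm : 1 ≤ m) (z i i' : Freq)
    (hout : ∀ k l, e k l ≠ 0 → inBox m (z + k + l)) :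
    ∑ a : Mode N, ∑ b : Mode N, ∑ c : Mode N, ∑ d : Mode N,
      ‖e (a.1 + b.1 - i) (c.1 + d.1 - i')‖ ^ 2 *
        (modeVar N a * modeVar N b * modeVar N c * modeVar N d) ≤
      (E * quadBound N m ρ (z - (i + i'))) ^ 2 := by
  classical
  have hE0 : 0 ≤ E := (norm_nonneg _).trans (hE 0 0)
  have hL := logSum_nonneg N
  have hL1 := one_le_logSum N
  have hN' : (1 : ℝ) ≤ N := by exact_mod_cast hN
  have hbase := sq_quadBound_ge hE0 N m ρ (z - (i + i'))
  let F : Freq → Freq → ℝ := fun k l => if inBox m (z + k + l - (i + i')) then 1 else 0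
  have hF0 : ∀ k l, 0 ≤ F k l := fun k l => by simp only [F]; split_ifs <;> norm_num
  have hle : ∀ k l, ‖e (k - i) (l - i')‖ ^ 2 ≤ E ^ 2 * F k l := by
    intro k l
    by_cases h : e (k - i) (l - i') = 0
    · rw [h, norm_zero, zero_pow two_ne_zero]
      exact mul_nonneg (sq_nonneg E) (hF0 k l)
    · have h1 := hout _ _ h
      have e1 : z + (k - i) + (l - i') = z + k + l - (i + i') := by abel
      rw [e1] at h1
      simp only [F, if_pos h1, mul_one]
      exact pow_le_pow_left₀ (norm_nonneg _) (hE _ _) 2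
  -- With the first frequency fixed, the second is confined to a window of radius m. This gives m²,
  -- and the unconstrained sum over the first gives N².
  have hwin : ∀ k, ∑ l ∈ boxF (2 * N), wt3' l * F k l ≤ 4096 * (m : ℝ) ^ 2 := by
    intro k
    have : ∀ l, wt3' l * F k l = if inBox m (z + k + l - (i + i')) then wt3' l else 0 := by
      intro l; simp only [F]; split_ifs <;> simp
    simp only [this, ← Finset.sum_filter]
    refine sum_wt3'_window_le hm (i + i' - z - k) fun l hl => ?_
    have := (Finset.mem_filter.1 hl).2
    have e1 : z + k + l - (i + i') = l - (i + i' - z - k) := by abel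
    rwa [e1] at this
  have hbox : ∑ k ∈ boxF (2 * N), wt3' k ≤ 4096 * ((2 * N : ℕ) : ℝ) ^ 2 :=
    sum_wt3'_window_le (by omega) 0 fun k hk => by simpa using mem_boxF.1 hk
  calc ∑ a : Mode N, ∑ b : Mode N, ∑ c : Mode N, ∑ d : Mode N,
        ‖e (a.1 + b.1 - i) (c.1 + d.1 - i')‖ ^ 2 *
          (modeVar N a * modeVar N b * modeVar N c * modeVar N d)
      ≤ ∑ a : Mode N, ∑ b : Mode N, ∑ c : Mode N, ∑ d : Mode N,
        E ^ 2 * F (a.1 + b.1) (c.1 + d.1) *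
          (modeVar N a * modeVar N b * modeVar N c * modeVar N d) := by
        refine Finset.sum_le_sum fun a _ => Finset.sum_le_sum fun b _ =>
          Finset.sum_le_sum fun c _ => Finset.sum_le_sum fun d _ => ?_
        refine mul_le_mul_of_nonneg_right (hle _ _) ?_
        have h1 := (modeVar_pos a).le
        have h2 := (modeVar_pos b).le
        have h3 := (modeVar_pos c).le
        have h4 := (modeVar_pos d).le
        positivity
    _ = E ^ 2 * ∑ a : Mode N, ∑ b : Mode N, modeVar N a * modeVar N b *
        ∑ c : Mode N, ∑ d : Mode N, modeVar N c * modeVar N d * F (a.1 + b.1) (c.1 + d.1) := by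
        simp only [Finset.mul_sum]
        refine Finset.sum_congr rfl fun a _ => Finset.sum_congr rfl fun b _ =>
          Finset.sum_congr rfl fun c _ => Finset.sum_congr rfl fun d _ => by ring
    _ ≤ E ^ 2 * ∑ a : Mode N, ∑ b : Mode N, modeVar N a * modeVar N b *
        (2304 * logSum N ^ 3 * (4096 * (m : ℝ) ^ 2)) := by
        refine mul_le_mul_of_nonneg_left ?_ (by positivity)
        refine Finset.sum_le_sum fun a _ => Finset.sum_le_sum fun b _ => ?_
        refine mul_le_mul_of_nonneg_left ?_ (mul_nonneg (modeVar_pos a).le (modeVar_pos b).le)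
        refine (sum_modeVar_conv_le (F := F (a.1 + b.1)) (hF0 _)).trans ?_
        gcongr
        exact hwin _
    _ = E ^ 2 * (2304 * logSum N ^ 3 * (4096 * (m : ℝ) ^ 2)) *
        ∑ a : Mode N, ∑ b : Mode N, modeVar N a * modeVar N b * 1 := by
        simp only [Finset.mul_sum]
        refine Finset.sum_congr rfl fun a _ => Finset.sum_congr rfl fun b _ => by ring
    _ ≤ E ^ 2 * (2304 * logSum N ^ 3 * (4096 * (m : ℝ) ^ 2)) *
        (2304 * logSum N ^ 3 * (4096 * ((2 * N : ℕ) : ℝ) ^ 2)) := by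
        gcongr
        refine (sum_modeVar_conv_le (F := fun _ => 1) fun _ => zero_le_one).trans ?_
        simp only [mul_one]
        gcongr
    _ ≤ (10 ^ 9 * logSum N ^ 3 * (N * m) * E) ^ 2 := by
        push_cast
        have : 0 ≤ (logSum N ^ 3 * (N * m) * E) ^ 2 := by positivity
        nlinarith
    _ ≤ _ := hbase

/-- The variance of the component of a quadratic expression in the second chaos. -/
lemma sum_two_modes_le {N : ℕ} (hN : 1 ≤ N) {e : Freq → Freq → ℂ} {E : ℝ}
    (hE : ∀ k l, ‖e k l‖ ≤ E) {m ρ : ℕ} (hm : 1 ≤ m) (z i i' : Freq)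
    (hout : ∀ k l, e k l ≠ 0 → inBox m (z + k + l)) :
    ∑ b : Mode N, ∑ d : Mode N,
      (∑ a : Mode N, ‖e (a.1 + b.1 - i) (a.neg.1 + d.1 - i')‖ * modeVar N a) ^ 2 *
        (modeVar N b * modeVar N d) ≤ (E * quadBound N m ρ (z - (i + i'))) ^ 2 := by
  classical
  have hE0 : 0 ≤ E := (norm_nonneg _).trans (hE 0 0)
  have hL := logSum_nonneg N
  have hL1 := one_le_logSum N
  have hN' : (1 : ℝ) ≤ N := by exact_mod_cast hN
  have hbase := sq_quadBound_ge hE0 N m ρ (z - (i + i'))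
  let F : Freq → ℝ := fun k => if inBox m (z + k - (i + i')) then 1 else 0
  have hF0 : ∀ k, 0 ≤ F k := fun k => by simp only [F]; split_ifs <;> norm_num
  -- The contracted mode a enters with opposite signs and cancels in the output frequency. The
  -- window therefore constrains b + d, and the sum over a is the full variance sum of order N.
  have hle : ∀ a b d : Mode N,
      ‖e (a.1 + b.1 - i) (a.neg.1 + d.1 - i')‖ ≤ E * F (b.1 + d.1) := by
    intro a b d
    by_cases h : e (a.1 + b.1 - i) (a.neg.1 + d.1 - i') = 0
    · rw [h, norm_zero]
      exact mul_nonneg hE0 (hF0 _)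
    · have h1 := hout _ _ h
      have e1 : z + (a.1 + b.1 - i) + (a.neg.1 + d.1 - i') = z + (b.1 + d.1) - (i + i') := by
        simp only [Mode.neg]; abel
      rw [e1] at h1
      simp only [F, if_pos h1, mul_one]
      exact hE _ _
  have hwin : ∑ k ∈ boxF (2 * N), wt3' k * F k ≤ 4096 * (m : ℝ) ^ 2 := by
    have : ∀ l, wt3' l * F l = if inBox m (z + l - (i + i')) then wt3' l else 0 := by
      intro l; simp only [F]; split_ifs <;> simp
    simp only [this, ← Finset.sum_filter]
    refine sum_wt3'_window_le hm (i + i' - z) fun l hl => ?_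
    have := (Finset.mem_filter.1 hl).2
    have e1 : z + l - (i + i') = l - (i + i' - z) := by abel
    rwa [e1] at this
  have hFF : ∀ k, F k ^ 2 = F k := fun k => by simp only [F]; split_ifs <;> norm_num
  calc ∑ b : Mode N, ∑ d : Mode N,
        (∑ a : Mode N, ‖e (a.1 + b.1 - i) (a.neg.1 + d.1 - i')‖ * modeVar N a) ^ 2 *
          (modeVar N b * modeVar N d)
      ≤ ∑ b : Mode N, ∑ d : Mode N, (E * F (b.1 + d.1) * (24576 * N)) ^ 2 *
          (modeVar N b * modeVar N d) := by
        refine Finset.sum_le_sum fun b _ => Finset.sum_le_sum fun d _ => ?_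
        refine mul_le_mul_of_nonneg_right ?_ (mul_nonneg (modeVar_pos b).le (modeVar_pos d).le)
        refine pow_le_pow_left₀ (Finset.sum_nonneg fun a _ =>
          mul_nonneg (norm_nonneg _) (modeVar_pos a).le) ?_ 2
        calc _ ≤ ∑ a : Mode N, E * F (b.1 + d.1) * modeVar N a :=
              Finset.sum_le_sum fun a _ =>
                mul_le_mul_of_nonneg_right (hle a b d) (modeVar_pos a).le
          _ = E * F (b.1 + d.1) * ∑ a : Mode N, modeVar N a := by rw [Finset.mul_sum]
          _ ≤ _ := mul_le_mul_of_nonneg_left (sum_modeVar_le hN) (mul_nonneg hE0 (hF0 _))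
    _ = (E * (24576 * N)) ^ 2 * ∑ b : Mode N, ∑ d : Mode N,
          modeVar N b * modeVar N d * F (b.1 + d.1) := by
        simp only [Finset.mul_sum]
        refine Finset.sum_congr rfl fun a _ => Finset.sum_congr rfl fun b _ => ?_
        rw [mul_pow, mul_pow E, hFF]; ring
    _ ≤ (E * (24576 * N)) ^ 2 * (2304 * logSum N ^ 3 * (4096 * (m : ℝ) ^ 2)) := by
        gcongr
        refine (sum_modeVar_conv_le hF0).trans ?_
        gcongr
    -- Only three logarithms occur here; three more are inserted to match the bound for the fourth
    -- chaos.
    _ ≤ (E * (24576 * N)) ^ 2 * (2304 * (logSum N ^ 3 * logSum N ^ 3) *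
          (4096 * (m : ℝ) ^ 2)) := by
        gcongr
        exact le_mul_of_one_le_left (by positivity) (one_le_pow₀ hL1)
    _ ≤ (10 ^ 9 * logSum N ^ 3 * (N * m) * E) ^ 2 := by
        have : 0 ≤ (logSum N ^ 3 * (N * m) * E) ^ 2 := by positivity
        nlinarith
    _ ≤ _ := hbase

/-- The expectation of a quadratic expression. -/
lemma sum_no_modes_le {N : ℕ} (hN : 1 ≤ N) {e : Freq → Freq → ℂ} {E : ℝ}
    (hE : ∀ k l, ‖e k l‖ ≤ E) {m ρ : ℕ} (hm : 1 ≤ m) (z i i' : Freq)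
    (hout : ∀ k l, e k l ≠ 0 → inBox m (z + k + l)) (hρ : 1 ≤ ρ)
    (hslab : ∀ k l, e k l ≠ 0 → inSlab N ρ k) :
    ∑ a : Mode N, ∑ b : Mode N, ‖e (a.1 + b.1 - i) (a.neg.1 + b.neg.1 - i')‖ *
      (modeVar N a * modeVar N b) ≤ E * quadBound N m ρ (z - (i + i')) := by
  classical
  have hE0 : 0 ≤ E := (norm_nonneg _).trans (hE 0 0)
  have hL := logSum_nonneg N
  have hL1 := one_le_logSum N
  have hN' : (1 : ℝ) ≤ N := by exact_mod_cast hN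
  have hq := quadBound_nonneg N m ρ (z - (i + i'))
  -- Once both pairs are contracted, no mode is left in the output frequency, which equals z up to
  -- aliases. The expectation thus vanishes unless this point lies in the window, and otherwise only
  -- the slab restricts the sum.
  by_cases hz : inBox m (z - (i + i'))
  · let F : Freq → ℝ := fun k => if inSlab N ρ (k - i) then 1 else 0
    have hF0 : ∀ k, 0 ≤ F k := fun k => by simp only [F]; split_ifs <;> norm_num
    have hslabsum : ∑ k ∈ boxF (2 * N), wt3' k * F k ≤
        98304 * ((ρ : ℝ) ^ (2 / 3 : ℝ) * (N : ℝ) ^ (4 / 3 : ℝ)) := by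
      have : ∀ l, wt3' l * F l = if inSlab N ρ (l - i) then wt3' l else 0 := by
        intro l; simp only [F]; split_ifs <;> simp
      simp only [this, ← Finset.sum_filter]
      refine sum_wt3'_inSlab_le hN hρ i fun l hl => ?_
      obtain ⟨h1, h2⟩ := Finset.mem_filter.1 hl
      exact ⟨mem_boxF.1 h1, h2⟩
    calc ∑ a : Mode N, ∑ b : Mode N, ‖e (a.1 + b.1 - i) (a.neg.1 + b.neg.1 - i')‖ *
          (modeVar N a * modeVar N b)
        ≤ ∑ a : Mode N, ∑ b : Mode N, E * F (a.1 + b.1) * (modeVar N a * modeVar N b) := by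
          refine Finset.sum_le_sum fun a _ => Finset.sum_le_sum fun b _ => ?_
          refine mul_le_mul_of_nonneg_right ?_ (mul_nonneg (modeVar_pos a).le (modeVar_pos b).le)
          by_cases h : e (a.1 + b.1 - i) (a.neg.1 + b.neg.1 - i') = 0
          · rw [h, norm_zero]
            exact mul_nonneg hE0 (hF0 _)
          · simp only [F, if_pos (hslab _ _ h), mul_one]
            exact hE _ _
      _ = E * ∑ a : Mode N, ∑ b : Mode N, modeVar N a * modeVar N b * F (a.1 + b.1) := by
          simp only [Finset.mul_sum]
          refine Finset.sum_congr rfl fun a _ => Finset.sum_congr rfl fun b _ => by ring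
      _ ≤ E * (2304 * logSum N ^ 3 *
            (98304 * ((ρ : ℝ) ^ (2 / 3 : ℝ) * (N : ℝ) ^ (4 / 3 : ℝ)))) := by
          gcongr
          refine (sum_modeVar_conv_le hF0).trans ?_
          gcongr
      _ ≤ E * quadBound N m ρ (z - (i + i')) := by
          unfold quadBound
          rw [if_pos hz]
          gcongr E * ?_
          have h1 : 0 ≤ logSum N ^ 3 * ((ρ : ℝ) ^ (2 / 3 : ℝ) * (N : ℝ) ^ (4 / 3 : ℝ)) := by
            positivity
          have h2 : 0 ≤ logSum N ^ 3 * (N * m : ℝ) := by positivity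
          nlinarith
  · refine (Finset.sum_nonpos fun a _ => Finset.sum_nonpos fun b _ => ?_).trans (by positivity)
    have h : e (a.1 + b.1 - i) (a.neg.1 + b.neg.1 - i') = 0 := by
      by_contra h
      have h1 := hout _ _ h
      have e1 : z + (a.1 + b.1 - i) + (a.neg.1 + b.neg.1 - i') = z - (i + i') := by
        simp only [Mode.neg]; abel
      rw [e1] at h1
      exact hz h1
    rw [h, norm_zero, zero_mul]

/-- Moments of quadratic expressions in the Wick square, at two fixed times, for one pair of
aliases. -/
lemma IsOUModes.eLpNorm_alias_le {N : ℕ} (hN : 1 ≤ N) {U : ℝ → Mode N → Ω → ℂ}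
    (hU : IsOUModes N U P) {n : ℕ} (hn : n ≠ 0) (s t : ℝ) (e : Freq → Freq → ℂ) {E : ℝ}
    (hE : ∀ k l, ‖e k l‖ ≤ E) {m ρ : ℕ} (hm : 1 ≤ m) (hρ : 1 ≤ ρ) (z i i' : Freq)
    (hout : ∀ k l, e k l ≠ 0 → inBox m (z + k + l)) (hslab : ∀ k l, e k l ≠ 0 → inSlab N ρ k) :
    eLpNorm (fun ω => ∑ a : Mode N, ∑ b : Mode N, ∑ c : Mode N, ∑ d : Mode N,
      e (a.1 + b.1 - i) (c.1 + d.1 - i') *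
        (wick2 N (fun a => U s a ω) a b * wick2 N (fun a => U t a ω) c d))
      ((2 * n : ℕ) : ℝ≥0∞) P ≤
      ENNReal.ofReal (wickConst n * (E * quadBound N m ρ (z - (i + i')))) := by
  have hE0 : 0 ≤ E := (norm_nonneg _).trans (hE 0 0)
  have hσ2 : ∀ k : Mode N, √(modeVar N k) ^ 2 = modeVar N k := fun k =>
    Real.sq_sqrt (modeVar_pos k).le
  have hq := quadBound_nonneg N m ρ (z - (i + i'))
  -- Contractions pair a mode with its reflection because of reality, and the coefficients are
  -- symmetric because they depend only on a + b and c + d.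
  have key := hU.isModeGaussian.eLpNorm_wick_product_le (σ := fun k => √(modeVar N k))
    (fun k => Real.sqrt_pos.2 (modeVar_pos k))
    (fun t k => by rw [hσ2, hU.variance, modeVar]) Mode.neg
    (fun k => by simp only [modeVar, Mode.neg, rate_neg])
    (fun s t k l h => hU.pseudoCov s t k l h) hn s t
    (fun a b c d => e (a.1 + b.1 - i) (c.1 + d.1 - i')) (fun a b c d => by rw [add_comm a.1])
    (fun a b c d => by rw [add_comm c.1])
    (B := E * quadBound N m ρ (z - (i + i'))) (by positivity)
    (by simp only [hσ2]; exact sum_four_modes_le hN hE hm z i i' hout)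
    (by simp only [hσ2]; exact sum_two_modes_le hN hE hm z i i' hout)
    (by simp only [hσ2]; exact sum_no_modes_le hN hE hm z i i' hout hρ hslab)
  simpa only [wick2, hU.modeCov_eq] using key

/-- Moments of quadratic expressions in the Wick square, at two fixed times. -/
theorem IsOUModes.eLpNorm_quad_le {N : ℕ} (hN : 1 ≤ N) {U : ℝ → Mode N → Ω → ℂ}
    (hU : IsOUModes N U P) {n : ℕ} (hn : n ≠ 0) (s t : ℝ) (B : Finset Freq)
    (e : Freq → Freq → ℂ) (he : ∀ k l, e k l ≠ 0 → k ∈ B ∧ l ∈ B) {E : ℝ}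
    (hE : ∀ k l, ‖e k l‖ ≤ E) {m ρ : ℕ} (hm : 1 ≤ m) (hρ : 1 ≤ ρ) (z : Freq)
    (hout : ∀ k l, e k l ≠ 0 → inBox m (z + k + l)) (hslab : ∀ k l, e k l ≠ 0 → inSlab N ρ k) :
    eLpNorm (fun ω => ∑ k ∈ B, ∑ l ∈ B, e k l * (LatticePhi.xCoef N (fun a => U s a ω) k *
      LatticePhi.xCoef N (fun a => U t a ω) l)) ((2 * n : ℕ) : ℝ≥0∞) P ≤
      ENNReal.ofReal (wickConst n * (E * ∑ i ∈ Finset.Icc (-1 : Freq) 1,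
        ∑ i' ∈ Finset.Icc (-1 : Freq) 1, quadBound N m ρ (z - (shift N i + shift N i')))) := by
  have hE0 : 0 ≤ E := (norm_nonneg _).trans (hE 0 0)
  have hw := wickConst_nonneg n
  have h1n : (1 : ℝ≥0∞) ≤ ((2 * n : ℕ) : ℝ≥0∞) := by
    have : 1 ≤ 2 * n := by omega
    exact_mod_cast this
  have hL : ∀ t a, AllLp (U t a) P := fun t a => hU.isModeGaussian.allLp t a
  have hLw : ∀ t a b, AllLp (fun ω => wick2 N (fun a => U t a ω) a b) P := fun t a b =>
    ((hL t a).mul (hL t b)).sub (AllLp.const _)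
  have hterm : ∀ i i' : Freq, AllLp (fun ω => ∑ a : Mode N, ∑ b : Mode N, ∑ c : Mode N,
      ∑ d : Mode N, e (a.1 + b.1 - shift N i) (c.1 + d.1 - shift N i') *
        (wick2 N (fun a => U s a ω) a b * wick2 N (fun a => U t a ω) c d)) P := fun i i' =>
    AllLp.sum _ fun a _ => AllLp.sum _ fun b _ => AllLp.sum _ fun c _ => AllLp.sum _ fun d _ =>
      ((hLw s a b).mul (hLw t c d)).const_mul _
  simp only [sum_xCoef_mul B e he]
  simp only [Finset.mul_sum]
  rw [ENNReal.ofReal_sum_of_nonneg fun i _ => Finset.sum_nonneg fun i' _ =>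
    mul_nonneg hw (mul_nonneg hE0 (quadBound_nonneg _ _ _ _))]
  have hsum : ∀ i : Freq, AllLp (fun ω => ∑ i' ∈ Finset.Icc (-1 : Freq) 1, ∑ a : Mode N,
      ∑ b : Mode N, ∑ c : Mode N,
      ∑ d : Mode N, e (a.1 + b.1 - shift N i) (c.1 + d.1 - shift N i') *
        (wick2 N (fun a => U s a ω) a b * wick2 N (fun a => U t a ω) c d)) P := fun i =>
    AllLp.sum _ fun i' _ => hterm i i'
  have e1 := eLpNorm_sum_le (μ := P) (s := Finset.Icc (-1 : Freq) 1) (p := ((2 * n : ℕ) : ℝ≥0∞))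
    (f := fun i ω => ∑ i' ∈ Finset.Icc (-1 : Freq) 1, ∑ a : Mode N,
      ∑ b : Mode N, ∑ c : Mode N,
      ∑ d : Mode N, e (a.1 + b.1 - shift N i) (c.1 + d.1 - shift N i') *
        (wick2 N (fun a => U s a ω) a b * wick2 N (fun a => U t a ω) c d))
    (fun i _ => (hsum i).integrable.aestronglyMeasurable) h1n
  refine (le_of_eq rfl).trans (e1.trans (Finset.sum_le_sum fun i _ => ?_))
  rw [ENNReal.ofReal_sum_of_nonneg fun i' _ =>
    mul_nonneg hw (mul_nonneg hE0 (quadBound_nonneg _ _ _ _))]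
  have e2 := eLpNorm_sum_le (μ := P) (s := Finset.Icc (-1 : Freq) 1) (p := ((2 * n : ℕ) : ℝ≥0∞))
    (f := fun i' ω => ∑ a : Mode N, ∑ b : Mode N, ∑ c : Mode N,
      ∑ d : Mode N, e (a.1 + b.1 - shift N i) (c.1 + d.1 - shift N i') *
        (wick2 N (fun a => U s a ω) a b * wick2 N (fun a => U t a ω) c d))
    (fun i' _ => (hterm i i').integrable.aestronglyMeasurable) h1n
  refine (le_of_eq rfl).trans (e2.trans (Finset.sum_le_sum fun i' _ => ?_))
  exact hU.eLpNorm_alias_le hN hn s t e hE hm hρ z _ _ hout hslab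

end QuadraticMoments

/-! ### Minkowski inequalities for time averages and square functions -/

section Averages

variable {Ω : Type*} [MeasurableSpace Ω] {P : Measure Ω}

lemma eLpNorm_nat_le_iff {E : Type*} [NormedAddCommGroup E] {f : Ω → E} {k : ℕ} (hk : k ≠ 0)
    {b : ℝ≥0∞} : eLpNorm f (k : ℝ≥0∞) P ≤ b ↔ ∫⁻ ω, ‖f ω‖ₑ ^ k ∂P ≤ b ^ k := by
  have hk' : (0 : ℝ) < k := by exact_mod_cast Nat.pos_of_ne_zero hk
  rw [eLpNorm_eq_lintegral_rpow_enorm_toReal (by exact_mod_cast hk) (by simp)]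
  simp only [ENNReal.toReal_natCast, ENNReal.rpow_natCast, one_div]
  rw [ENNReal.rpow_inv_le_iff hk', ENNReal.rpow_natCast]

/-- Hölder's inequality against the constant one; the power of the total mass is k times 1 - 1/k. -/
lemma lintegral_pow_le {α : Type*} [MeasurableSpace α] {μ : Measure α} {f : α → ℝ≥0∞}
    (hf : AEMeasurable f μ) {k : ℕ} (hk : 2 ≤ k) :
    (∫⁻ s, f s ∂μ) ^ k ≤ μ Set.univ ^ (k - 1) * ∫⁻ s, f s ^ k ∂μ := by
  have hk1 : (1 : ℝ) < k := by exact_mod_cast hk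
  have hk0 : (0 : ℝ) < k := by linarith
  have hpq := Real.HolderConjugate.conjExponent hk1
  have h := ENNReal.lintegral_mul_le_Lp_mul_Lq μ hpq hf (g := fun _ => 1) aemeasurable_const
  simp only [Pi.mul_apply, mul_one, ENNReal.one_rpow, lintegral_const, one_mul,
    ENNReal.rpow_natCast] at h
  calc (∫⁻ s, f s ∂μ) ^ k ≤ ((∫⁻ s, f s ^ k ∂μ) ^ (1 / (k : ℝ)) *
        μ Set.univ ^ (1 / Real.conjExponent k)) ^ k := by gcongr
    _ = _ := by
        rw [mul_pow, ← ENNReal.rpow_natCast, ← ENNReal.rpow_natCast, ← ENNReal.rpow_mul,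
          ← ENNReal.rpow_mul, one_div_mul_cancel hk0.ne', ENNReal.rpow_one, mul_comm]
        congr 1
        rw [← ENNReal.rpow_natCast]
        congr 1
        rw [Real.conjExponent, Nat.cast_sub (by omega)]
        have : (k : ℝ) - 1 ≠ 0 := by linarith
        field_simp
        simp

/-- Minkowski's inequality for averages. -/
lemma eLpNorm_average_le [SFinite P] {μ : Measure ℝ} [IsFiniteMeasure μ] {Y : ℝ → Ω → ℂ}
    (hY : Measurable (Function.uncurry Y)) {k : ℕ} (hk : 2 ≤ k) {b : ℝ≥0∞}
    (hb : ∀ᵐ s ∂μ, eLpNorm (Y s) (k : ℝ≥0∞) P ≤ b) :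
    eLpNorm (fun ω => ∫ s, Y s ω ∂μ) (k : ℝ≥0∞) P ≤ μ Set.univ * b := by
  have hk0 : k ≠ 0 := by omega
  rw [eLpNorm_nat_le_iff hk0]
  have hYω : ∀ ω, Measurable fun s => ‖Y s ω‖ₑ := fun ω =>
    (hY.comp (measurable_id.prodMk measurable_const)).enorm
  calc ∫⁻ ω, ‖∫ s, Y s ω ∂μ‖ₑ ^ k ∂P ≤ ∫⁻ ω, (∫⁻ s, ‖Y s ω‖ₑ ∂μ) ^ k ∂P :=
        lintegral_mono fun ω => by
          simp only
          gcongr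
          exact enorm_integral_le_lintegral_enorm _
    _ ≤ ∫⁻ ω, μ Set.univ ^ (k - 1) * ∫⁻ s, ‖Y s ω‖ₑ ^ k ∂μ ∂P :=
        lintegral_mono fun ω => lintegral_pow_le (hYω ω).aemeasurable hk
    _ = μ Set.univ ^ (k - 1) * ∫⁻ s, ∫⁻ ω, ‖Y s ω‖ₑ ^ k ∂P ∂μ := by
        rw [lintegral_const_mul' _ _ (by finiteness), lintegral_lintegral_swap]
        have : Measurable (Function.uncurry fun ω s => ‖Y s ω‖ₑ ^ k) :=
          ((hY.comp measurable_swap).enorm).pow_const k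
        exact this.aemeasurable
    _ ≤ μ Set.univ ^ (k - 1) * ∫⁻ _s, b ^ k ∂μ := by
        gcongr 1
        refine lintegral_mono_ae ?_
        filter_upwards [hb] with s hs using (eLpNorm_nat_le_iff hk0).1 hs
    _ = (μ Set.univ * b) ^ k := by
        rw [lintegral_const, mul_pow, mul_comm (b ^ k), ← mul_assoc, ← pow_succ]
        congr 3
        omega

/-- The measure `e^{-λ(t-s)} ds` on `(0,t]`. -/
def expWeight (lam t : ℝ) : Measure ℝ :=
  (volume.restrict (Set.Ioc 0 t)).withDensity fun s => ENNReal.ofReal (Real.exp (-((t - s) * lam)))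

lemma expWeight_univ_le {lam t : ℝ} (hlam : 0 < lam) (ht : 0 ≤ t) :
    expWeight lam t Set.univ ≤ ENNReal.ofReal (1 / lam) := by
  have hc : Continuous fun s => Real.exp (-((t - s) * lam)) := by fun_prop
  rw [expWeight, withDensity_apply _ MeasurableSet.univ, Measure.restrict_univ,
    ← ofReal_integral_eq_lintegral_ofReal
      ((hc.integrableOn_Icc (a := 0) (b := t)).mono_set Set.Ioc_subset_Icc_self)
      (ae_of_all _ fun s => by positivity), ← intervalIntegral.integral_of_le ht]
  refine ENNReal.ofReal_le_ofReal ?_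
  have hd : ∀ s ∈ Set.uIcc 0 t, HasDerivAt (fun s => Real.exp (-((t - s) * lam)) / lam)
      (Real.exp (-((t - s) * lam))) s := by
    intro s _
    have h1 : HasDerivAt (fun s => -((t - s) * lam)) lam s := by
      have := (((hasDerivAt_id s).const_sub t).mul_const lam).neg
      exact this.congr_deriv (by simp)
    have h2 := h1.exp.div_const lam
    exact h2.congr_deriv (by field_simp)
  rw [intervalIntegral.integral_eq_sub_of_hasDerivAt hd (hc.intervalIntegrable _ _)]
  have h0 : 0 ≤ Real.exp (-((t - 0) * lam)) / lam := by positivity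
  simp only [sub_self, zero_mul, neg_zero, Real.exp_zero]
  linarith

lemma isFiniteMeasure_expWeight {lam t : ℝ} (hlam : 0 < lam) (ht : 0 ≤ t) :
    IsFiniteMeasure (expWeight lam t) :=
  ⟨(expWeight_univ_le hlam ht).trans_lt ENNReal.ofReal_lt_top⟩

lemma integral_expWeight {lam t : ℝ} (ht : 0 ≤ t) (f : ℝ → ℂ) :
    ∫ s, f s ∂(expWeight lam t) = ∫ s in (0 : ℝ)..t, (Real.exp (-((t - s) * lam)) : ℂ) * f s := by
  rw [expWeight, integral_withDensity_eq_integral_toReal_smul (by fun_prop) (by simp),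
    intervalIntegral.integral_of_le ht]
  refine integral_congr_ae (ae_of_all _ fun s => ?_)
  simp only
  rw [ENNReal.toReal_ofReal (by positivity), Complex.real_smul]

lemma ae_expWeight_mem {lam t : ℝ} : ∀ᵐ s ∂(expWeight lam t), s ∈ Set.Ioc 0 t :=
  (withDensity_absolutelyContinuous _ _).ae_le (ae_restrict_mem measurableSet_Ioc)

/-- Moments of square functions. -/
lemma eLpNorm_sqrt_sum_le {ι : Type*} (S : Finset ι) {g : ι → Ω → ℂ}
    (hg : ∀ k ∈ S, AEStronglyMeasurable (g k) P) {n : ℕ} (hn : n ≠ 0) {b : ι → ℝ}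
    (hb : ∀ k ∈ S, 0 ≤ b k)
    (h : ∀ k ∈ S, eLpNorm (g k) ((2 * n : ℕ) : ℝ≥0∞) P ≤ ENNReal.ofReal (b k)) :
    eLpNorm (fun ω => √(∑ k ∈ S, ‖g k ω‖ ^ 2)) ((2 * n : ℕ) : ℝ≥0∞) P ≤
      ENNReal.ofReal (√(∑ k ∈ S, b k ^ 2)) := by
  have h2n : ((n : ℕ) : ℝ≥0∞) * ENNReal.ofReal 2 = ((2 * n : ℕ) : ℝ≥0∞) := by
    rw [ENNReal.ofReal_ofNat]; push_cast; ring
  have key : eLpNorm (fun ω => √(∑ k ∈ S, ‖g k ω‖ ^ 2)) ((2 * n : ℕ) : ℝ≥0∞) P ^ (2 : ℝ) ≤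
      ENNReal.ofReal (√(∑ k ∈ S, b k ^ 2)) ^ (2 : ℝ) := by
    rw [← h2n, ← eLpNorm_norm_rpow _ (by norm_num)]
    have e1 : (fun ω => ‖√(∑ k ∈ S, ‖g k ω‖ ^ 2)‖ ^ (2 : ℝ)) =
        fun ω => ∑ k ∈ S, ‖g k ω‖ ^ (2 : ℝ) := by
      funext ω
      rw [Real.norm_of_nonneg (Real.sqrt_nonneg _)]
      simp only [Real.rpow_ofNat]
      rw [Real.sq_sqrt (Finset.sum_nonneg fun _ _ => sq_nonneg _)]
    rw [e1]
    have h1n : (1 : ℝ≥0∞) ≤ (n : ℝ≥0∞) := by exact_mod_cast Nat.one_le_iff_ne_zero.2 hn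
    have e2 := eLpNorm_sum_le (μ := P) (s := S) (p := (n : ℝ≥0∞))
      (f := fun k ω => ‖g k ω‖ ^ (2 : ℝ))
      (fun k hk => ((hg k hk).norm.aemeasurable.pow_const _).aestronglyMeasurable) h1n
    refine (le_of_eq (by congr 1; funext ω; simp)).trans (e2.trans ?_)
    rw [ENNReal.ofReal_rpow_of_nonneg (Real.sqrt_nonneg _) (by norm_num)]
    simp only [Real.rpow_ofNat]
    rw [Real.sq_sqrt (Finset.sum_nonneg fun _ _ => sq_nonneg _),
      ENNReal.ofReal_sum_of_nonneg fun _ _ => sq_nonneg _]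
    refine Finset.sum_le_sum fun k hk => ?_
    have e3 := eLpNorm_norm_rpow (p := (n : ℝ≥0∞)) (μ := P) (g k) (q := 2) (by norm_num)
    simp only [Real.rpow_ofNat] at e3
    rw [e3, h2n, ENNReal.ofReal_pow (hb k hk)]
    have := h k hk
    calc _ ≤ ENNReal.ofReal (b k) ^ (2 : ℝ) := by gcongr
      _ = _ := by simp
  exact (ENNReal.rpow_le_rpow_iff (by norm_num)).1 key

end Averages

/-! ### Moments of the random kernel -/

section KernelMoments

variable {Ω : Type*} [MeasurableSpace Ω] {P : Measure Ω} [IsProbabilityMeasure P]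

/-- The coefficients of the bilinear form in the Wick squares at times `t` and `s`. -/
def timeCoef (c : ℕ → ℕ → Freq → Freq → Freq → ℂ) (B : Finset Freq) (N : ℕ) (lam : ℝ) (q i : ℕ)
    (x : Fin 3 → ℝ) (k₁ : Freq) (τ : ℝ) (k l : Freq) : ℂ :=
  if k ∈ B ∧ l ∈ B then c q i k₁ k l * ((Real.exp (-(τ * (rate N k - lam))) : ℂ) *
    char (k₁ + k + l) x) else 0

/-- A common exponential e^{-(t-s)λ} is split off as a weight on time. The remaining exponentials
are harmless coefficients as soon as λ is below every rate that occurs. -/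
lemma gker_eq_integral {N : ℕ} (c : ℕ → ℕ → Freq → Freq → Freq → ℂ) (B : Finset Freq) (lam : ℝ)
    (q i : ℕ) (x : Fin 3 → ℝ) (k₁ : Freq) {p : ℝ → Mode N → ℂ}
    (hp : ∀ a, Continuous fun s => p s a) {t : ℝ} (ht : 0 ≤ t) :
    gker c B (fun k l => iCoef N p t k * xCoef N (p t) l) q i x k₁ =
      ∫ s, ∑ k ∈ B, ∑ l ∈ B, timeCoef c B N lam q i x k₁ (t - s) k l *
        (xCoef N (p s) k * xCoef N (p t) l) ∂(expWeight lam t) := by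
  rw [integral_expWeight ht]
  have hX := fun k => continuous_xCoef hp k
  have hcont : ∀ k l, Continuous fun s => c q i k₁ k l *
      ((Real.exp (-((t - s) * rate N k)) : ℂ) * xCoef N (p s) k * xCoef N (p t) l *
        char (k₁ + k + l) x) := fun k l => by
    have := hX k
    fun_prop
  have e : ∀ s, (Real.exp (-((t - s) * lam)) : ℂ) * ∑ k ∈ B, ∑ l ∈ B,
      timeCoef c B N lam q i x k₁ (t - s) k l * (xCoef N (p s) k * xCoef N (p t) l) =
      ∑ k ∈ B, ∑ l ∈ B, c q i k₁ k l *
      ((Real.exp (-((t - s) * rate N k)) : ℂ) * xCoef N (p s) k * xCoef N (p t) l *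
        char (k₁ + k + l) x) := by
    intro s
    rw [Finset.mul_sum]
    refine Finset.sum_congr rfl fun k hk => ?_
    rw [Finset.mul_sum]
    refine Finset.sum_congr rfl fun l hl => ?_
    rw [timeCoef, if_pos ⟨hk, hl⟩]
    have : (Real.exp (-((t - s) * rate N k)) : ℂ) = (Real.exp (-((t - s) * lam)) : ℂ) *
        (Real.exp (-((t - s) * (rate N k - lam))) : ℂ) := by
      rw [← Complex.ofReal_mul, ← Real.exp_add]
      congr 2; ring
    rw [this]; ring
  simp only [e]
  rw [intervalIntegral.integral_finsetSum fun k _ =>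
    (continuous_finsetSum _ fun l _ => hcont k l).intervalIntegrable _ _, gker]
  refine Finset.sum_congr rfl fun k _ => ?_
  rw [intervalIntegral.integral_finsetSum fun l _ => (hcont k l).intervalIntegrable _ _]
  refine Finset.sum_congr rfl fun l _ => ?_
  rw [intervalIntegral.integral_const_mul, intervalIntegral.integral_mul_const,
    intervalIntegral.integral_mul_const, iCoef]

lemma norm_timeCoef_le {N J Γ A : ℕ} {B : Finset Freq} {c : ℕ → ℕ → Freq → Freq → Freq → ℂ}
    (hc : GoodKernel N J Γ A B c) (hΓ : 1 ≤ Γ) {q i : ℕ} {k₁ : Freq} (hk₁ : k₁ ∈ boxF (A * 2 ^ i))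
    (x : Fin 3 → ℝ) {τ : ℝ} (hτ : 0 ≤ τ) (k l : Freq) :
    ‖timeCoef c B N ((N : ℝ) ^ 2 / Γ) q i x k₁ τ k l‖ ≤ Γ := by
  rw [timeCoef]
  split_ifs with h
  · by_cases h0 : c q i k₁ k l = 0
    · simp [h0]
    · rw [norm_mul, norm_mul, norm_char, Complex.norm_real, Real.norm_of_nonneg (by positivity),
        mul_one]
      have h1 := hc.rate _ _ _ _ _ h0 hk₁
      have hΓ' : (0 : ℝ) < Γ := by exact_mod_cast hΓ
      have h2 : (N : ℝ) ^ 2 / Γ ≤ rate N k := by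
        rw [div_le_iff₀ hΓ']; linarith
      have h3 : Real.exp (-(τ * (rate N k - (N : ℝ) ^ 2 / Γ))) ≤ 1 := by
        rw [Real.exp_le_one_iff]
        have := mul_nonneg hτ (sub_nonneg.2 h2)
        linarith
      calc _ ≤ (Γ : ℝ) * 1 := mul_le_mul (hc.norm_le _ _ _ _ _) h3 (by positivity) (by positivity)
        _ = Γ := mul_one _
  · simp

lemma timeCoef_ne_zero {N : ℕ} {B : Finset Freq} {c : ℕ → ℕ → Freq → Freq → Freq → ℂ} {lam : ℝ}
    {q i : ℕ} {k₁ : Freq} {x : Fin 3 → ℝ} {τ : ℝ} {k l : Freq}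
    (h : timeCoef c B N lam q i x k₁ τ k l ≠ 0) : (k ∈ B ∧ l ∈ B) ∧ c q i k₁ k l ≠ 0 := by
  rw [timeCoef] at h
  split_ifs at h with h'
  · exact ⟨h', left_ne_zero_of_mul h⟩
  · exact absurd rfl h

/-- Sum of the bounds over all pairs of aliases. -/
def aliasBound (N m ρ : ℕ) (k : Freq) : ℝ :=
  ∑ i ∈ Finset.Icc (-1 : Freq) 1, ∑ i' ∈ Finset.Icc (-1 : Freq) 1,
    quadBound N m ρ (k - (shift N i + shift N i'))

lemma aliasBound_nonneg (N m ρ : ℕ) (k : Freq) : 0 ≤ aliasBound N m ρ k :=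
  Finset.sum_nonneg fun _ _ => Finset.sum_nonneg fun _ _ => quadBound_nonneg _ _ _ _

/-- The stochastic data: measurable modes with continuous paths. -/
structure IsRegularOU (N : ℕ) (U : ℝ → Mode N → Ω → ℂ) (P : Measure Ω) : Prop
    extends IsOUModes N U P where
  measurable : ∀ t a, Measurable (U t a)
  continuous_path : ∀ a ω, Continuous fun t => U t a ω

lemma measurable_xCoef {N : ℕ} {U : Mode N → Ω → ℂ} (hU : ∀ a, Measurable (U a)) (k : Freq) :
    Measurable fun ω => xCoef N (fun a => U a ω) k := by
  refine Finset.measurable_fun_sum _ fun i _ => Finset.measurable_fun_sum _ fun a _ =>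
    Finset.measurable_fun_sum _ fun b _ => ?_
  split_ifs
  · exact ((hU a).mul (hU b)).sub measurable_const
  · exact measurable_const

/-- With λ = N²/Γ the time weight has mass at most Γ/N², which is the only source of the factor N⁻².
For each s the integrand is a quadratic form at two times with coefficients at most Γ, output window
Γ2^q and slab width Γ2^i. -/
theorem IsRegularOU.eLpNorm_gker_le {N J Γ A : ℕ} (hN : 1 ≤ N) {U : ℝ → Mode N → Ω → ℂ}
    (hU : IsRegularOU N U P) {B : Finset Freq} {c : ℕ → ℕ → Freq → Freq → Freq → ℂ}
    (hc : GoodKernel N J Γ A B c) (hΓ : 1 ≤ Γ) {n : ℕ} (hn : n ≠ 0) {t : ℝ} (ht : 0 ≤ t)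
    (q i : ℕ) (x : Fin 3 → ℝ) {k₁ : Freq} (hk₁ : k₁ ∈ boxF (A * 2 ^ i)) :
    eLpNorm (fun ω => gker c B (fun k l => iCoef N (fun s a => U s a ω) t k *
      xCoef N (fun a => U t a ω) l) q i x k₁) ((2 * n : ℕ) : ℝ≥0∞) P ≤
      ENNReal.ofReal (Γ ^ 2 * wickConst n * aliasBound N (Γ * 2 ^ q) (Γ * 2 ^ i) k₁ /
        (N : ℝ) ^ 2) := by
  have hΓ' : (0 : ℝ) < Γ := by exact_mod_cast hΓ
  have hN' : (0 : ℝ) < N := by exact_mod_cast hN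
  set lam : ℝ := (N : ℝ) ^ 2 / Γ with hlam
  have hlam0 : 0 < lam := by positivity
  have hw := wickConst_nonneg n
  have ha := aliasBound_nonneg N (Γ * 2 ^ q) (Γ * 2 ^ i) k₁
  have := isFiniteMeasure_expWeight hlam0 ht
  have e : ∀ ω, gker c B (fun k l => iCoef N (fun s a => U s a ω) t k *
      xCoef N (fun a => U t a ω) l) q i x k₁ = ∫ s, ∑ k ∈ B, ∑ l ∈ B,
        timeCoef c B N lam q i x k₁ (t - s) k l * (xCoef N (fun a => U s a ω) k *
          xCoef N (fun a => U t a ω) l) ∂(expWeight lam t) := fun ω =>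
    gker_eq_integral c B lam q i x k₁ (fun a => hU.continuous_path a ω) ht
  simp only [e]
  have hmeas : Measurable (Function.uncurry fun s ω => ∑ k ∈ B, ∑ l ∈ B,
        timeCoef c B N lam q i x k₁ (t - s) k l * (xCoef N (fun a => U s a ω) k *
          xCoef N (fun a => U t a ω) l)) := by
    refine measurable_uncurry_of_continuous_of_measurable (fun ω => ?_) fun s => ?_
    · refine continuous_finsetSum _ fun k _ => continuous_finsetSum _ fun l _ => ?_
      have h1 := continuous_xCoef (fun a => hU.continuous_path a ω) k
      have h2 : Continuous fun s => timeCoef c B N lam q i x k₁ (t - s) k l := by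
        unfold timeCoef
        split_ifs <;> fun_prop
      exact h2.mul (h1.mul continuous_const)
    · exact Finset.measurable_fun_sum _ fun k _ => Finset.measurable_fun_sum _ fun l _ =>
        ((measurable_xCoef (hU.measurable s) k).mul (measurable_xCoef (hU.measurable t) l)).const_mul _
  refine (eLpNorm_average_le hmeas (b := ENNReal.ofReal (wickConst n * (Γ *
    aliasBound N (Γ * 2 ^ q) (Γ * 2 ^ i) k₁))) (by omega) ?_).trans ?_
  · filter_upwards [ae_expWeight_mem] with s hs
    refine hU.eLpNorm_quad_le hN hn s t B _ (fun k l h => (timeCoef_ne_zero h).1)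
      (fun k l => norm_timeCoef_le hc hΓ hk₁ x (by linarith [hs.2]) k l)
      (Nat.mul_pos hΓ (by positivity)) (Nat.mul_pos hΓ (by positivity)) k₁ (fun k l h => ?_)
      fun k l h => ?_
    · exact hc.out _ _ _ _ _ (timeCoef_ne_zero h).2
    · exact hc.slab _ _ _ _ _ (timeCoef_ne_zero h).2 hk₁
  · refine (mul_le_mul_left (expWeight_univ_le hlam0 ht) _).trans ?_
    rw [← ENNReal.ofReal_mul (by positivity)]
    refine ENNReal.ofReal_le_ofReal (le_of_eq ?_)
    rw [hlam]
    field_simp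

end KernelMoments

/-! ### Summation over the input frequency and power counting -/

section Exponents

/-- One coordinate is counted by the box and the other two by the window. This mixed count is what
produces Q R^{7/6} in the contribution of the expectation. -/
lemma card_window_le (a m : ℕ) (z : Freq) :
    (((boxF a).filter fun k => inBox m (k - z)).card : ℝ) ≤ (2 * a + 1) * (2 * m + 1) ^ 2 := by
  classical
  let t : Fin 3 → Finset ℤ := fun j => if j = 0 then Finset.Icc (-(a : ℤ)) a else
    Finset.Icc (z j - m) (z j + m)
  have h := sum_prod_le (S := (boxF a).filter fun k => inBox m (k - z)) (t := t)
    (f := fun _ _ => 1) (fun k hk j => by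
      obtain ⟨h1, h2⟩ := Finset.mem_filter.1 hk
      have h1 := mem_boxF.1 h1 j
      have h2 := h2 j
      simp only [Pi.sub_apply, abs_le] at h1 h2
      simp only [t]
      split_ifs
      · rw [Finset.mem_Icc]; omega
      · rw [Finset.mem_Icc]; omega) (fun _ _ => zero_le_one)
  simp only [Finset.prod_const_one, Finset.sum_const, nsmul_eq_mul, mul_one] at h
  refine h.trans (le_of_eq ?_)
  have e1 : ((Finset.Icc (-(a : ℤ)) a).card : ℝ) = 2 * a + 1 := by
    rw [Int.card_Icc]
    have : ((a : ℤ) + 1 - -(a : ℤ)).toNat = 2 * a + 1 := by omega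
    rw [this]; push_cast; ring
  have e2 : ∀ y : ℤ, ((Finset.Icc (y - m) (y + m)).card : ℝ) = 2 * m + 1 := by
    intro y
    rw [Int.card_Icc]
    have : (y + m + 1 - (y - m)).toNat = 2 * m + 1 := by omega
    rw [this]; push_cast; ring
  rw [Fin.prod_univ_three]
  simp only [t, if_true, Fin.reduceEq, if_false, e1, e2]
  ring

lemma card_aliases : (Finset.Icc (-1 : Freq) 1).card = 27 := by
  rw [Pi.card_Icc]
  simp

lemma quadBound_sq_le (N m ρ : ℕ) (k : Freq) : quadBound N m ρ k ^ 2 ≤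
    2 * 10 ^ 18 * logSum N ^ 6 * (((N : ℝ) * m) ^ 2 + if inBox m k then
      ((ρ : ℝ) ^ (2 / 3 : ℝ) * (N : ℝ) ^ (4 / 3 : ℝ)) ^ 2 else 0) := by
  unfold quadBound
  have hL : 0 ≤ logSum N ^ 6 := by have := logSum_nonneg N; positivity
  split_ifs
  · set a := (N : ℝ) * m
    set b := (ρ : ℝ) ^ (2 / 3 : ℝ) * (N : ℝ) ^ (4 / 3 : ℝ)
    calc _ = 10 ^ 18 * logSum N ^ 6 * (a + b) ^ 2 := by ring
      _ ≤ 10 ^ 18 * logSum N ^ 6 * (2 * (a ^ 2 + b ^ 2)) := by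
          gcongr
          nlinarith [sq_nonneg (a - b)]
      _ = _ := by ring
  · have : 0 ≤ logSum N ^ 6 * ((N : ℝ) * m) ^ 2 := by positivity
    nlinarith

lemma sum_quadBound_sq_le (N a m ρ : ℕ) (z : Freq) :
    ∑ k ∈ boxF a, quadBound N m ρ (k - z) ^ 2 ≤ 2 * 10 ^ 18 * logSum N ^ 6 *
      (((N : ℝ) * m) ^ 2 * (2 * a + 1) ^ 3 + (2 * a + 1) * (2 * m + 1) ^ 2 *
        ((ρ : ℝ) ^ (2 / 3 : ℝ) * (N : ℝ) ^ (4 / 3 : ℝ)) ^ 2) := by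
  have hL : 0 ≤ logSum N ^ 6 := by have := logSum_nonneg N; positivity
  calc ∑ k ∈ boxF a, quadBound N m ρ (k - z) ^ 2 ≤ ∑ k ∈ boxF a, 2 * 10 ^ 18 * logSum N ^ 6 *
        (((N : ℝ) * m) ^ 2 + if inBox m (k - z) then
          ((ρ : ℝ) ^ (2 / 3 : ℝ) * (N : ℝ) ^ (4 / 3 : ℝ)) ^ 2 else 0) :=
        Finset.sum_le_sum fun k _ => quadBound_sq_le N m ρ (k - z)
    _ = 2 * 10 ^ 18 * logSum N ^ 6 * (((N : ℝ) * m) ^ 2 * (2 * a + 1) ^ 3 +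
        ((boxF a).filter fun k => inBox m (k - z)).card *
        ((ρ : ℝ) ^ (2 / 3 : ℝ) * (N : ℝ) ^ (4 / 3 : ℝ)) ^ 2) := by
        rw [← Finset.mul_sum, Finset.sum_add_distrib, ← Finset.sum_filter, Finset.sum_const,
          Finset.sum_const, card_boxF, nsmul_eq_mul, nsmul_eq_mul]
        push_cast
        ring
    _ ≤ _ := by
        gcongr
        exact card_window_le a m z

lemma aliasBound_sq_le (N m ρ : ℕ) (k : Freq) : aliasBound N m ρ k ^ 2 ≤
    729 * ∑ i ∈ Finset.Icc (-1 : Freq) 1, ∑ i' ∈ Finset.Icc (-1 : Freq) 1,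
      quadBound N m ρ (k - (shift N i + shift N i')) ^ 2 := by
  rw [aliasBound]
  refine (sq_sum_le_card_mul_sum_sq (s := Finset.Icc (-1 : Freq) 1)).trans ?_
  rw [card_aliases]
  have : ∀ i, (∑ i' ∈ Finset.Icc (-1 : Freq) 1,
      quadBound N m ρ (k - (shift N i + shift N i'))) ^ 2 ≤ 27 * ∑ i' ∈ Finset.Icc (-1 : Freq) 1,
      quadBound N m ρ (k - (shift N i + shift N i')) ^ 2 := fun i => by
    have := sq_sum_le_card_mul_sum_sq (s := Finset.Icc (-1 : Freq) 1)
      (f := fun i' => quadBound N m ρ (k - (shift N i + shift N i')))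
    rwa [card_aliases] at this
  calc _ ≤ (27 : ℝ) * ∑ i ∈ Finset.Icc (-1 : Freq) 1, 27 * ∑ i' ∈ Finset.Icc (-1 : Freq) 1,
        quadBound N m ρ (k - (shift N i + shift N i')) ^ 2 := by
        push_cast
        gcongr with i
        exact this i
    _ = _ := by rw [← Finset.mul_sum]; ring

lemma sum_aliasBound_sq_le_of_forall {N a m ρ : ℕ} {S : ℝ}
    (hS : ∀ z, ∑ k ∈ boxF a, quadBound N m ρ (k - z) ^ 2 ≤ S) :
    ∑ k ∈ boxF a, aliasBound N m ρ k ^ 2 ≤ 729 * (729 * S) := by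
  refine (Finset.sum_le_sum fun k _ => aliasBound_sq_le N m ρ k).trans ?_
  rw [← Finset.mul_sum, Finset.sum_comm]
  refine mul_le_mul_of_nonneg_left ?_ (by norm_num)
  have h : ∀ j ∈ Finset.Icc (-1 : Freq) 1, ∑ k ∈ boxF a, ∑ j' ∈ Finset.Icc (-1 : Freq) 1,
      quadBound N m ρ (k - (shift N j + shift N j')) ^ 2 ≤ 27 * S := fun j _ => by
    rw [Finset.sum_comm]
    refine (Finset.sum_le_sum fun j' _ => hS (shift N j + shift N j')).trans (le_of_eq ?_)
    rw [Finset.sum_const, card_aliases, nsmul_eq_mul]; norm_num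
  refine (Finset.sum_le_sum h).trans (le_of_eq ?_)
  rw [Finset.sum_const, card_aliases, nsmul_eq_mul]; push_cast; ring

/-- Write R = 2^i and Q = 2^q. The uniform part NQ is summed over R³ frequencies, giving N Q R^{3/2}
in ℓ². The expectation R^{2/3} N^{4/3} lives on R Q² frequencies, giving R^{1/2} Q · R^{2/3}
N^{4/3}. -/
lemma sum_aliasBound_sq_le {N Γ A q i : ℕ} (hΓ : 1 ≤ Γ) (hA : A ≤ Γ) :
    ∑ k ∈ boxF (A * 2 ^ i), aliasBound N (Γ * 2 ^ q) (Γ * 2 ^ i) k ^ 2 ≤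
      (10 ^ 13 * Γ ^ 3 * logSum N ^ 3 * 2 ^ q * (N * ((2 : ℝ) ^ i) ^ (3 / 2 : ℝ) +
        ((2 : ℝ) ^ i) ^ (7 / 6 : ℝ) * (N : ℝ) ^ (4 / 3 : ℝ))) ^ 2 := by
  have hL := logSum_nonneg N
  have hΓ' : (1 : ℝ) ≤ Γ := by exact_mod_cast hΓ
  have hA' : (A : ℝ) ≤ Γ := by exact_mod_cast hA
  set R : ℝ := (2 : ℝ) ^ i with hR
  set Q : ℝ := (2 : ℝ) ^ q with hQ
  have hR1 : 1 ≤ R := one_le_pow₀ (by norm_num)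
  have hQ1 : 1 ≤ Q := one_le_pow₀ (by norm_num)
  have hR0 : 0 < R := by linarith
  set S : ℝ := 2 * 10 ^ 18 * logSum N ^ 6 * (((N : ℝ) * (Γ * Q)) ^ 2 * (3 * Γ * R) ^ 3 +
      (3 * Γ * R) * (3 * Γ * Q) ^ 2 * ((Γ * R) ^ (2 / 3 : ℝ) * (N : ℝ) ^ (4 / 3 : ℝ)) ^ 2) with hS
  have h1 : ∀ z, ∑ k ∈ boxF (A * 2 ^ i), quadBound N (Γ * 2 ^ q) (Γ * 2 ^ i) (k - z) ^ 2 ≤ S := by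
    intro z
    refine (sum_quadBound_sq_le N _ _ _ z).trans ?_
    push_cast
    rw [← hR, ← hQ, hS]
    have hAR : 2 * (A * R) + 1 ≤ 3 * Γ * R := by nlinarith
    have hm : 2 * (Γ * Q) + 1 ≤ 3 * Γ * Q := by nlinarith
    gcongr
  refine (sum_aliasBound_sq_le_of_forall h1).trans ?_
  set a : ℝ := N * R ^ (3 / 2 : ℝ) with ha
  set b : ℝ := R ^ (7 / 6 : ℝ) * (N : ℝ) ^ (4 / 3 : ℝ) with hb
  have ha0 : 0 ≤ a := by positivity
  have hb0 : 0 ≤ b := by positivity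
  have ea : (N : ℝ) ^ 2 * R ^ 3 = a ^ 2 := by
    rw [ha, mul_pow, ← Real.rpow_natCast (R ^ (3 / 2 : ℝ)), ← Real.rpow_mul hR0.le]
    norm_num
  have eb : R * (R ^ (2 / 3 : ℝ) * (N : ℝ) ^ (4 / 3 : ℝ)) ^ 2 = b ^ 2 := by
    have : R = (R ^ (1 / 2 : ℝ)) ^ 2 := by
      rw [← Real.rpow_natCast, ← Real.rpow_mul hR0.le]; norm_num
    rw [hb]
    nth_rw 1 [this]
    rw [← mul_pow, ← mul_assoc, ← Real.rpow_add hR0]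
    norm_num
  have hg : (Γ * R) ^ (2 / 3 : ℝ) ≤ Γ * R ^ (2 / 3 : ℝ) := by
    rw [Real.mul_rpow (by positivity) hR0.le]
    gcongr
    exact (Real.rpow_le_rpow_of_exponent_le hΓ' (by norm_num : (2 / 3 : ℝ) ≤ 1)).trans
      (Real.rpow_one _).le
  have hS' : S ≤ 54 * 10 ^ 18 * Γ ^ 5 * logSum N ^ 6 * Q ^ 2 * (a + b) ^ 2 := by
    calc S ≤ 2 * 10 ^ 18 * logSum N ^ 6 * (((N : ℝ) * (Γ * Q)) ^ 2 * (3 * Γ * R) ^ 3 +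
        (3 * Γ * R) * (3 * Γ * Q) ^ 2 * (Γ * R ^ (2 / 3 : ℝ) * (N : ℝ) ^ (4 / 3 : ℝ)) ^ 2) := by
          rw [hS]
          gcongr
      _ = 54 * 10 ^ 18 * Γ ^ 5 * logSum N ^ 6 * Q ^ 2 * ((N : ℝ) ^ 2 * R ^ 3 +
          R * (R ^ (2 / 3 : ℝ) * (N : ℝ) ^ (4 / 3 : ℝ)) ^ 2) := by ring
      _ = 54 * 10 ^ 18 * Γ ^ 5 * logSum N ^ 6 * Q ^ 2 * (a ^ 2 + b ^ 2) := by rw [ea, eb]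
      _ ≤ _ := by
          gcongr
          nlinarith [mul_nonneg ha0 hb0]
  calc 729 * (729 * S) ≤ 729 * (729 * (54 * 10 ^ 18 * Γ ^ 5 * logSum N ^ 6 * Q ^ 2 * (a + b) ^ 2)) := by
        gcongr
    -- The exponent of Γ is raised from 5 to 6 to complete a square.
    _ ≤ 729 * (729 * (54 * 10 ^ 18 * Γ ^ 6 * logSum N ^ 6 * Q ^ 2 * (a + b) ^ 2)) := by
        gcongr
        norm_num
    _ ≤ 10 ^ 26 * (Γ ^ 6 * logSum N ^ 6 * Q ^ 2 * (a + b) ^ 2) := by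
        have : 0 ≤ (Γ : ℝ) ^ 6 * logSum N ^ 6 * Q ^ 2 * (a + b) ^ 2 := by positivity
        nlinarith
    _ = _ := by ring

/-- After combining powers, the exponents of Q and R, namely 1/2 - 2δ, 1/2 + δ and 1/6 + δ, all lie
in [0, 1], so Q and R may be replaced by ΓN. Both terms then equal N^{(1/2 - 2δ) + (3/2 + δ) - 2} =
N^{-δ}. Positivity of 1/2 - 2δ is where δ < 1/4 is needed. -/
lemma exponent_bound {N Γ : ℕ} (hN : 1 ≤ N) (hΓ : 1 ≤ Γ) {δ R Q : ℝ} (hδ : 0 < δ) (hδ' : δ < 1 / 4)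
    (hR : 1 ≤ R) (hQ : 1 ≤ Q) (hRN : R ≤ Γ * N) (hQN : Q ≤ Γ * N) :
    Q ^ (-1 / 2 - 2 * δ) * (R ^ (-(1 - δ)) * (Q * (N * R ^ (3 / 2 : ℝ) +
      R ^ (7 / 6 : ℝ) * (N : ℝ) ^ (4 / 3 : ℝ))) / (N : ℝ) ^ 2) ≤ 2 * Γ ^ 2 * (N : ℝ) ^ (-δ) := by
  have hN' : (1 : ℝ) ≤ N := by exact_mod_cast hN
  have hΓ' : (1 : ℝ) ≤ Γ := by exact_mod_cast hΓ
  have hN0 : (0 : ℝ) < N := by linarith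
  have hR0 : 0 < R := by linarith
  have hQ0 : 0 < Q := by linarith
  have hup : ∀ (X s : ℝ), 1 ≤ X → X ≤ Γ * N → 0 ≤ s → s ≤ 1 → X ^ s ≤ Γ * (N : ℝ) ^ s := by
    intro X s hX hXN hs hs1
    calc X ^ s ≤ (Γ * N) ^ s := Real.rpow_le_rpow (by linarith) hXN hs
      _ = (Γ : ℝ) ^ s * (N : ℝ) ^ s := Real.mul_rpow (by positivity) (by positivity)
      _ ≤ Γ * (N : ℝ) ^ s := by
          gcongr
          exact (Real.rpow_le_rpow_of_exponent_le hΓ' hs1).trans (by simp)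
  have eQ : Q ^ (-1 / 2 - 2 * δ) * Q = Q ^ (1 / 2 - 2 * δ) := by
    rw [← Real.rpow_add_one hQ0.ne']; congr 1; ring
  have eR1 : R ^ (-(1 - δ)) * R ^ (3 / 2 : ℝ) = R ^ (1 / 2 + δ) := by
    rw [← Real.rpow_add hR0]; congr 1; ring
  have eR2 : R ^ (-(1 - δ)) * R ^ (7 / 6 : ℝ) = R ^ (1 / 6 + δ) := by
    rw [← Real.rpow_add hR0]; congr 1; ring
  have e : Q ^ (-1 / 2 - 2 * δ) * (R ^ (-(1 - δ)) * (Q * (N * R ^ (3 / 2 : ℝ) +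
      R ^ (7 / 6 : ℝ) * (N : ℝ) ^ (4 / 3 : ℝ))) / (N : ℝ) ^ 2) =
      Q ^ (1 / 2 - 2 * δ) * (N * R ^ (1 / 2 + δ) + R ^ (1 / 6 + δ) * (N : ℝ) ^ (4 / 3 : ℝ)) /
        (N : ℝ) ^ 2 := by
    rw [← eQ, ← eR1, ← eR2]; ring
  rw [e]
  have f1 : (N : ℝ) * (N : ℝ) ^ (1 / 2 + δ) = (N : ℝ) ^ (3 / 2 + δ) := by
    rw [← Real.rpow_one_add' (by positivity) (by linarith)]; congr 1; ring
  have f2 : (N : ℝ) ^ (1 / 6 + δ) * (N : ℝ) ^ (4 / 3 : ℝ) = (N : ℝ) ^ (3 / 2 + δ) := by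
    rw [← Real.rpow_add hN0]; congr 1; ring
  have f3 : (N : ℝ) ^ (1 / 2 - 2 * δ) * (N : ℝ) ^ (3 / 2 + δ) = (N : ℝ) ^ (-δ) * (N : ℝ) ^ 2 := by
    rw [← Real.rpow_natCast, ← Real.rpow_add hN0, ← Real.rpow_add hN0]; congr 1; push_cast; ring
  rw [div_le_iff₀ (by positivity)]
  calc _ ≤ (Γ * (N : ℝ) ^ (1 / 2 - 2 * δ)) * (N * (Γ * (N : ℝ) ^ (1 / 2 + δ)) +
        (Γ * (N : ℝ) ^ (1 / 6 + δ)) * (N : ℝ) ^ (4 / 3 : ℝ)) := by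
        gcongr
        · exact hup Q _ hQ hQN (by linarith) (by linarith)
        · exact hup R _ hR hRN (by linarith) (by linarith)
        · exact hup R _ hR hRN (by linarith) (by linarith)
    _ = Γ ^ 2 * ((N : ℝ) ^ (1 / 2 - 2 * δ) * (N * (N : ℝ) ^ (1 / 2 + δ) +
        (N : ℝ) ^ (1 / 6 + δ) * (N : ℝ) ^ (4 / 3 : ℝ))) := by ring
    _ = Γ ^ 2 * (2 * ((N : ℝ) ^ (1 / 2 - 2 * δ) * (N : ℝ) ^ (3 / 2 + δ))) := by
        rw [f1, f2]; ring
    _ = _ := by rw [f3]; ring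

end Exponents

/-! ### Moments of the square function at a fixed time and point -/

section SquareFunction

variable {Ω : Type*} [MeasurableSpace Ω] {P : Measure Ω} [IsProbabilityMeasure P]

/-- The bilinear coefficients `I_t(k) X_t(l)` of a path. -/
def mCoef (N : ℕ) (p : ℝ → Mode N → ℂ) (t : ℝ) (k l : Freq) : ℂ :=
  iCoef N p t k * xCoef N (p t) l

lemma measurable_iCoef {N : ℕ} {U : ℝ → Mode N → Ω → ℂ} (hm : ∀ t a, Measurable (U t a))
    (hc : ∀ a ω, Continuous fun t => U t a ω) (t : ℝ) (k : Freq) :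
    Measurable fun ω => iCoef N (fun s a => U s a ω) t k := by
  have hmeas : Measurable (Function.uncurry fun (ω : Ω) (s : ℝ) =>
      (Real.exp (-((t - s) * rate N k)) : ℂ) * xCoef N (fun a => U s a ω) k) := by
    have : Measurable (Function.uncurry fun (s : ℝ) (ω : Ω) =>
        (Real.exp (-((t - s) * rate N k)) : ℂ) * xCoef N (fun a => U s a ω) k) := by
      refine measurable_uncurry_of_continuous_of_measurable (fun ω => ?_) fun s => ?_
      · have h1 := continuous_xCoef (fun a => hc a ω) k
        exact Continuous.mul (by fun_prop) h1
      · exact (measurable_xCoef (hm s) k).const_mul _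
    exact this.comp measurable_swap
  simp only [iCoef, intervalIntegral]
  exact (hmeas.stronglyMeasurable.integral_prod_right (ν := volume.restrict (Set.Ioc 0 t))).measurable.sub
    (hmeas.stronglyMeasurable.integral_prod_right (ν := volume.restrict (Set.Ioc t 0))).measurable

lemma measurable_mCoef {N : ℕ} {U : ℝ → Mode N → Ω → ℂ} (hm : ∀ t a, Measurable (U t a))
    (hc : ∀ a ω, Continuous fun t => U t a ω) (t : ℝ) (k l : Freq) :
    Measurable fun ω => mCoef N (fun s a => U s a ω) t k l :=
  (measurable_iCoef hm hc t k).mul (measurable_xCoef (hm t) l)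

lemma measurable_gker {c : ℕ → ℕ → Freq → Freq → Freq → ℂ} {B : Finset Freq}
    {M : Ω → Freq → Freq → ℂ} (hM : ∀ k l, Measurable fun ω => M ω k l) (q i : ℕ)
    (x : Fin 3 → ℝ) (k₁ : Freq) : Measurable fun ω => gker c B (M ω) q i x k₁ :=
  Finset.measurable_fun_sum _ fun k _ => Finset.measurable_fun_sum _ fun l _ =>
    ((hM k l).mul_const _).const_mul _

lemma measurable_squareFun {A J : ℕ} {α : ℝ} {c : ℕ → ℕ → Freq → Freq → Freq → ℂ}
    {B : Finset Freq} {M : Ω → Freq → Freq → ℂ} (hM : ∀ k l, Measurable fun ω => M ω k l) (q : ℕ)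
    (x : Fin 3 → ℝ) : Measurable fun ω => squareFun A J α c B (M ω) q x :=
  Finset.measurable_fun_sum _ fun _ _ => (Measurable.sqrt (Finset.measurable_fun_sum _ fun k _ =>
    (measurable_gker hM _ _ x k).norm.pow_const 2)).const_mul _

/-- All three frequencies are of order at most N, so high output blocks vanish and the supremum over
q is effectively finite. -/
lemma GoodKernel.squareFun_eq_zero {N J Γ A : ℕ} {B : Finset Freq}
    {c : ℕ → ℕ → Freq → Freq → Freq → ℂ} (hc : GoodKernel N J Γ A B c) {q : ℕ}
    (hq : Γ * N < 2 ^ q) (α : ℝ) (M : Freq → Freq → ℂ) (x : Fin 3 → ℝ) :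
    squareFun A J α c B M q x = 0 := by
  refine Finset.sum_eq_zero fun i hi => ?_
  have : ∑ k₁ ∈ boxF (A * 2 ^ i), ‖gker c B M q i x k₁‖ ^ 2 = 0 := by
    refine Finset.sum_eq_zero fun k₁ hk₁ => ?_
    have : gker c B M q i x k₁ = 0 := by
      refine Finset.sum_eq_zero fun k₂ hk₂ => Finset.sum_eq_zero fun k₃ hk₃ => ?_
      by_cases h : c q i k₁ k₂ k₃ = 0
      · rw [h, zero_mul]
      · exact absurd (hc.level _ _ _ _ _ h (Finset.mem_range.1 hi) hk₁ hk₂ hk₃) (by omega)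
    simp [this]
  rw [this]; simp

/-- Moments of the square function at a fixed point. -/
theorem IsRegularOU.eLpNorm_squareFun_le {N J Γ A : ℕ} (hN : 1 ≤ N) {U : ℝ → Mode N → Ω → ℂ}
    (hU : IsRegularOU N U P) {B : Finset Freq} {c : ℕ → ℕ → Freq → Freq → Freq → ℂ}
    (hc : GoodKernel N J Γ A B c) (hΓ : 1 ≤ Γ) (hA : A ≤ Γ) (hJ : 2 ^ J ≤ Γ * N)
    {n : ℕ} (hn : n ≠ 0) {t : ℝ} (ht : 0 ≤ t) {δ : ℝ} (hδ : 0 < δ) (hδ' : δ < 1 / 4)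
    (q : ℕ) (x : Fin 3 → ℝ) :
    eLpNorm (fun ω => (2 : ℝ) ^ (((q : ℝ) - 1) * (-1 / 2 - 2 * δ)) *
      squareFun A J (1 - δ) c B (mCoef N (fun s a => U s a ω) t) q x) ((2 * n : ℕ) : ℝ≥0∞) P ≤
      ENNReal.ofReal (10 ^ 14 * Γ ^ 7 * wickConst n * (J * logSum N ^ 3) * (N : ℝ) ^ (-δ)) := by
  have hw := wickConst_nonneg n
  have hL := logSum_nonneg N
  have hN0 : (0 : ℝ) < N := by exact_mod_cast hN
  have hΓ' : (1 : ℝ) ≤ Γ := by exact_mod_cast hΓ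
  by_cases hq : Γ * N < 2 ^ q
  · simp only [hc.squareFun_eq_zero hq, mul_zero]
    simp
  have hQN : (2 : ℝ) ^ q ≤ Γ * N := by
    have : 2 ^ q ≤ Γ * N := by omega
    exact_mod_cast this
  have h1n : (1 : ℝ≥0∞) ≤ ((2 * n : ℕ) : ℝ≥0∞) := by
    have : 1 ≤ 2 * n := by omega
    exact_mod_cast this
  have hM := measurable_mCoef hU.measurable hU.continuous_path t
  set Q : ℝ := (2 : ℝ) ^ q with hQ
  have hQ1 : 1 ≤ Q := one_le_pow₀ (by norm_num)
  set F : ℕ → Ω → ℝ := fun i ω => (2 : ℝ) ^ (((q : ℝ) - 1) * (-1 / 2 - 2 * δ)) *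
    ((2 : ℝ) ^ (-(((i : ℝ) - 1) * (1 - δ))) * √(∑ k₁ ∈ boxF (A * 2 ^ i),
      ‖gker c B (mCoef N (fun s a => U s a ω) t) q i x k₁‖ ^ 2)) with hF
  have hFm : ∀ i, Measurable (F i) := fun i => ((Measurable.sqrt (Finset.measurable_fun_sum _
    fun k _ => (measurable_gker hM _ _ x k).norm.pow_const 2)).const_mul _).const_mul _
  have hFi : ∀ i ∈ Finset.range J, eLpNorm (F i) ((2 * n : ℕ) : ℝ≥0∞) P ≤
      ENNReal.ofReal (10 ^ 14 * Γ ^ 7 * wickConst n * logSum N ^ 3 * (N : ℝ) ^ (-δ)) := by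
    intro i hi
    set R : ℝ := (2 : ℝ) ^ i with hR
    have hR1 : 1 ≤ R := one_le_pow₀ (by norm_num)
    have hRN : R ≤ Γ * N := by
      have h1 : 2 ^ i ≤ 2 ^ J := Nat.pow_le_pow_right (by norm_num) (Finset.mem_range.1 hi).le
      have : 2 ^ i ≤ Γ * N := h1.trans hJ
      rw [hR]
      exact_mod_cast this
    have e1 := eLpNorm_sqrt_sum_le (P := P) (boxF (A * 2 ^ i))
      (g := fun k₁ ω => gker c B (mCoef N (fun s a => U s a ω) t) q i x k₁)
      (fun k _ => (measurable_gker hM q i x k).aestronglyMeasurable) hn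
      (b := fun k₁ => Γ ^ 2 * wickConst n * aliasBound N (Γ * 2 ^ q) (Γ * 2 ^ i) k₁ / (N : ℝ) ^ 2)
      (fun k _ => by have := aliasBound_nonneg N (Γ * 2 ^ q) (Γ * 2 ^ i) k; positivity)
      (fun k hk => hU.eLpNorm_gker_le hN hc hΓ hn ht q i x hk)
    set Y : ℝ := N * R ^ (3 / 2 : ℝ) + R ^ (7 / 6 : ℝ) * (N : ℝ) ^ (4 / 3 : ℝ) with hY
    have hY0 : 0 ≤ Y := by positivity
    have e2 : √(∑ k₁ ∈ boxF (A * 2 ^ i), (Γ ^ 2 * wickConst n *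
        aliasBound N (Γ * 2 ^ q) (Γ * 2 ^ i) k₁ / (N : ℝ) ^ 2) ^ 2) ≤
        Γ ^ 2 * wickConst n / (N : ℝ) ^ 2 * (10 ^ 13 * Γ ^ 3 * logSum N ^ 3 * Q * Y) := by
      rw [Real.sqrt_le_left (by positivity)]
      have : ∀ k₁, (Γ ^ 2 * wickConst n * aliasBound N (Γ * 2 ^ q) (Γ * 2 ^ i) k₁ /
          (N : ℝ) ^ 2) ^ 2 = (Γ ^ 2 * wickConst n / (N : ℝ) ^ 2) ^ 2 *
          aliasBound N (Γ * 2 ^ q) (Γ * 2 ^ i) k₁ ^ 2 := fun k₁ => by ring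
      simp only [this]
      rw [← Finset.mul_sum, mul_pow]
      gcongr
      exact sum_aliasBound_sq_le hΓ hA
    -- The factor 2 absorbs the index shift, since 1/2 + 2δ ≤ 1; the same holds below with 1 - δ ≤
    -- 1.
    have eq : (2 : ℝ) ^ (((q : ℝ) - 1) * (-1 / 2 - 2 * δ)) ≤ 2 * Q ^ (-1 / 2 - 2 * δ) := by
      rw [hQ, ← Real.rpow_natCast, ← Real.rpow_mul (by norm_num), sub_mul,
        Real.rpow_sub (by norm_num), one_mul, div_eq_mul_inv, mul_comm]
      gcongr
      rw [← Real.rpow_neg (by norm_num)]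
      exact (Real.rpow_le_rpow_of_exponent_le (by norm_num) (by linarith :
        -(-1 / 2 - 2 * δ) ≤ 1)).trans (by simp)
    have er : (2 : ℝ) ^ (-(((i : ℝ) - 1) * (1 - δ))) ≤ 2 * R ^ (-(1 - δ)) := by
      rw [hR, ← Real.rpow_natCast, ← Real.rpow_mul (by norm_num),
        show -(((i : ℝ) - 1) * (1 - δ)) = (i : ℝ) * -(1 - δ) + (1 - δ) by ring,
        Real.rpow_add (by norm_num), mul_comm]
      gcongr
      exact (Real.rpow_le_rpow_of_exponent_le (by norm_num) (by linarith :
        (1 - δ) ≤ 1)).trans (by simp)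
    have e3 : F i = ((2 : ℝ) ^ (((q : ℝ) - 1) * (-1 / 2 - 2 * δ)) *
        (2 : ℝ) ^ (-(((i : ℝ) - 1) * (1 - δ)))) • fun ω => √(∑ k₁ ∈ boxF (A * 2 ^ i),
        ‖gker c B (mCoef N (fun s a => U s a ω) t) q i x k₁‖ ^ 2) := by
      funext ω; simp only [hF, Pi.smul_apply, smul_eq_mul]; ring
    rw [e3]
    refine (eLpNorm_const_smul_le).trans ?_
    rw [Real.enorm_of_nonneg (by positivity)]
    refine (mul_le_mul_right e1 _).trans ?_
    rw [← ENNReal.ofReal_mul (by positivity)]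
    refine ENNReal.ofReal_le_ofReal ?_
    have hb := exponent_bound hN hΓ hδ hδ' hR1 hQ1 hRN hQN
    rw [← hY] at hb
    calc _ ≤ (2 * Q ^ (-1 / 2 - 2 * δ)) * (2 * R ^ (-(1 - δ))) *
          (Γ ^ 2 * wickConst n / (N : ℝ) ^ 2 * (10 ^ 13 * Γ ^ 3 * logSum N ^ 3 * Q * Y)) := by
          gcongr
      _ = 4 * 10 ^ 13 * Γ ^ 5 * wickConst n * logSum N ^ 3 *
          (Q ^ (-1 / 2 - 2 * δ) * (R ^ (-(1 - δ)) * (Q * Y) / (N : ℝ) ^ 2)) := by ring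
      _ ≤ 4 * 10 ^ 13 * Γ ^ 5 * wickConst n * logSum N ^ 3 * (2 * Γ ^ 2 * (N : ℝ) ^ (-δ)) := by
          gcongr
      _ ≤ _ := by
          have : 0 ≤ (Γ : ℝ) ^ 7 * wickConst n * logSum N ^ 3 * (N : ℝ) ^ (-δ) := by positivity
          nlinarith
  have e4 : (fun ω => (2 : ℝ) ^ (((q : ℝ) - 1) * (-1 / 2 - 2 * δ)) *
      squareFun A J (1 - δ) c B (mCoef N (fun s a => U s a ω) t) q x) =
      ∑ i ∈ Finset.range J, F i := by
    funext ω
    simp only [squareFun, Finset.mul_sum, Finset.sum_apply, hF]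
  rw [e4]
  refine (eLpNorm_sum_le (fun i _ => (hFm i).aestronglyMeasurable) h1n).trans ?_
  refine (Finset.sum_le_sum hFi).trans ?_
  rw [Finset.sum_const, Finset.card_range, nsmul_eq_mul, ← ENNReal.ofReal_natCast,
    ← ENNReal.ofReal_mul (by positivity)]
  refine ENNReal.ofReal_le_ofReal (le_of_eq ?_)
  ring

end SquareFunction

/-! ### Absorption of logarithms into small powers -/

section Logarithms

lemma sum_inv_le (n : ℕ) : ∑ m ∈ Finset.range n, ((m : ℝ) + 1)⁻¹ ≤ 1 + Real.log n := by
  have h := harmonic_le_one_add_log n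
  simpa [harmonic] using h

lemma logSum_le (N : ℕ) : logSum N ≤ 2 + 2 * (1 + Real.log (N + 1)) := by
  have e : logSum N = ∑ x ∈ Finset.Icc (-(N : ℤ)) N, ((x.natAbs : ℝ) + 1)⁻¹ := by
    refine Finset.sum_congr rfl fun x _ => ?_
    rw [add_comm, Nat.cast_natAbs, Int.cast_abs]
  have h := sum_window_le (F := fun n : ℕ => ((n : ℝ) + 1)⁻¹)
    (fun a b hab => by simp only; gcongr) (fun n => by positivity) N 0
  simp only [zero_sub, zero_add] at h
  have h1 := sum_inv_le (N + 1)
  have h2 : (2 * (N : ℝ) + 1) * ((N : ℝ) + 1)⁻¹ ≤ 2 := by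
    rw [← div_eq_mul_inv, div_le_iff₀ (by positivity)]; linarith
  push_cast at h1
  rw [e]
  linarith

lemma log_le_mul_rpow {κ x : ℝ} (hκ : 0 < κ) (hx : 1 ≤ x) : Real.log x ≤ κ⁻¹ * x ^ κ := by
  have := Real.log_le_rpow_div (by linarith : 0 ≤ x) hκ
  rwa [div_eq_inv_mul] at this

/-- The logarithmic losses are smaller than any power. -/
lemma exists_levels_mul_logSum_le {A : ℕ} (hA : 1 ≤ A) {κ : ℝ} (hκ : 0 < κ) :
    ∃ C : ℝ, 0 ≤ C ∧ ∀ N : ℕ, 1 ≤ N → (levels A N : ℝ) * logSum N ^ 3 ≤ C * (N : ℝ) ^ κ := by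
  -- There are four logarithmic factors, the number of levels and the cube of `logSum`, and each is
  -- given a quarter of the exponent.
  set ε := κ / 4 with hε
  have hε0 : 0 < ε := by positivity
  refine ⟨2 * ε⁻¹ * (20 * A : ℝ) ^ ε * (4 + 2 * (ε⁻¹ * 2 ^ ε)) ^ 3, by positivity, fun N hN => ?_⟩
  have hN' : (1 : ℝ) ≤ N := by exact_mod_cast hN
  have hA' : (1 : ℝ) ≤ A := by exact_mod_cast hA
  have hNe : 1 ≤ (N : ℝ) ^ ε := Real.one_le_rpow hN' hε0.le
  have hl : logSum N ≤ (4 + 2 * (ε⁻¹ * 2 ^ ε)) * (N : ℝ) ^ ε := by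
    have h2 : Real.log (N + 1) ≤ ε⁻¹ * 2 ^ ε * (N : ℝ) ^ ε := by
      refine (log_le_mul_rpow hε0 (by linarith : (1 : ℝ) ≤ N + 1)).trans ?_
      rw [mul_assoc, ← Real.mul_rpow (by norm_num) (by positivity)]
      gcongr
      linarith
    linarith [logSum_le N]
  have hJ : (levels A N : ℝ) ≤ 2 * ε⁻¹ * (20 * A : ℝ) ^ ε * (N : ℝ) ^ ε := by
    have h1 : ((2 : ℝ) ^ levels A N) ≤ 20 * A * N := by exact_mod_cast two_pow_levels_le hA hN
    have h2 : (levels A N : ℝ) * Real.log 2 ≤ Real.log (20 * A * N) := by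
      rw [← Real.log_pow]
      exact Real.log_le_log (by positivity) h1
    have h3 := log_le_mul_rpow hε0 (by nlinarith : (1 : ℝ) ≤ 20 * A * N)
    rw [Real.mul_rpow (by positivity) (by positivity)] at h3
    have h4 : (1 / 2 : ℝ) ≤ Real.log 2 := by linarith [Real.log_two_gt_d9]
    have h5 : (levels A N : ℝ) * (1 / 2) ≤ levels A N * Real.log 2 := by gcongr
    linarith
  calc (levels A N : ℝ) * logSum N ^ 3 ≤ (2 * ε⁻¹ * (20 * A : ℝ) ^ ε * (N : ℝ) ^ ε) *
        ((4 + 2 * (ε⁻¹ * 2 ^ ε)) * (N : ℝ) ^ ε) ^ 3 := by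
        have := logSum_nonneg N
        gcongr
    _ = 2 * ε⁻¹ * (20 * A : ℝ) ^ ε * (4 + 2 * (ε⁻¹ * 2 ^ ε)) ^ 3 * ((N : ℝ) ^ ε) ^ 4 := by ring
    _ = _ := by
        have : ((N : ℝ) ^ ε) ^ 4 = (N : ℝ) ^ κ := by
          rw [← Real.rpow_natCast, ← Real.rpow_mul (by positivity), hε]
          congr 1; push_cast; ring
        rw [this]

end Logarithms

/-! ### Regular versions of the modes and kernels of the two operators -/

section Version

variable {Ω : Type*} [MeasurableSpace Ω] {P : Measure Ω}

lemma IsOUModes.congr {N : ℕ} {U U' : ℝ → Mode N → Ω → ℂ} (hU : IsOUModes N U P)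
    (h : ∀ᵐ ω ∂P, ∀ t a, U t a ω = U' t a ω) : IsOUModes N U' P where
  isModeGaussian :=
    { gaussian := hU.isModeGaussian.gaussian.congr fun p => h.mono fun ω hω => hω _ _
      mean := fun t k => by
        rw [← hU.isModeGaussian.mean t k]
        exact integral_congr_ae (h.mono fun ω hω => (hω t k).symm)
      cov := fun s t k l hkl => by
        rw [← hU.isModeGaussian.cov s t k l hkl]
        refine integral_congr_ae (h.mono fun ω hω => ?_)
        simp only [hω] }
  variance t k := by
    rw [← hU.variance t k]
    refine integral_congr_ae (h.mono fun ω hω => ?_)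
    simp only [hω]
  increment s t k := by
    refine le_trans (le_of_eq ?_) (hU.increment s t k)
    refine integral_congr_ae (h.mono fun ω hω => ?_)
    simp only [hω]
  continuous := by
    filter_upwards [h, hU.continuous] with ω hω h' k
    simpa only [hω] using h' k
  reality := by
    filter_upwards [h, hU.reality] with ω hω h' t k
    simpa only [hω] using h' t k

variable [IsProbabilityMeasure P]

theorem IsWienerModes.exists_isRegularOU {W : ℝ → Freq → Ω → ℂ} (hW : IsWienerModes P W) (N : ℕ) :
    ∃ U : ℝ → Mode N → Ω → ℂ, IsRegularOU N U P ∧ ∀ᵐ ω ∂P, ∀ t a, ouMode N W t a ω = U t a ω := by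
  have h := hW.isOUModes N
  obtain ⟨U, h1, h2, h3⟩ := exists_continuous_version
    (fun s k => h.isModeGaussian.gaussian.aemeasurable (s, k)) h.continuous
  exact ⟨U, { h.congr h3 with measurable := h1, continuous_path := h2 }, h3⟩

/-- Both operator-valued processes are given by kernels, with the coefficients of a regular
version of the modes. -/
theorem IsWienerModes.ae_hasKernel {W : ℝ → Freq → Ω → ℂ} (hW : IsWienerModes P W)
    {D : DyadicPartition} {A : ℕ} (hA : D.Bound A) (φ : EuclideanSpace ℝ (Fin 3) → ℝ) {N : ℕ}
    (hN : 1 ≤ N) : ∃ U : ℝ → Mode N → Ω → ℂ, IsRegularOU N U P ∧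
      (∀ᵐ ω ∂P, ∀ t, HasKernel D A (levels A N) (kern D (levels A N) (mulHigh N) (mulLow N))
        (boxF (5 * N)) (mCoef N (fun s a => U s a ω) t) (op1 D N (fun s k => W s k ω) t)) ∧
      ∀ᵐ ω ∂P, ∀ t, HasKernel D A (levels A N) (kern D (levels A N) (mulLow N) (mulMid φ N))
        (boxF (5 * N)) (mCoef N (fun s a => U s a ω) t) (op2 D φ N (fun s k => W s k ω) t) := by
  obtain ⟨U, hU, h⟩ := hW.exists_isRegularOU N
  have hB : ∀ k ∈ boxF (5 * N), ∀ n, levels A N ≤ n → D.symbol n (toE k) = 0 :=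
    fun k hk n hn => symbol_levels hA hk hn
  have key : ∀ ω, (∀ t a, ouMode N W t a ω = U t a ω) →
      (fun s (a : Mode N) => u1 N (fun s k => W s k ω) s a.1) = fun s a => U s a ω :=
    fun ω hω => funext fun s => funext fun a => by rw [u1_mode, hω]
  refine ⟨U, hU, ?_, ?_⟩
  · filter_upwards [h] with ω hω t
    have e := key ω hω
    have hk := hasKernel_op1 hN hA hB (w := fun s k => W s k ω) (fun a => by
      have := hU.continuous_path a ω
      simp only [u1_mode, hω, this]) t
    rw [e, show (fun a : Mode N => u1 N (fun s k => W s k ω) t a.1) = fun a => U t a ω from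
      congrFun e t] at hk
    exact hk
  · filter_upwards [h] with ω hω t
    have e := key ω hω
    have hk := hasKernel_op2 φ hN hA hB (w := fun s k => W s k ω) (fun a => by
      have := hU.continuous_path a ω
      simp only [u1_mode, hω, this]) t
    rw [e, show (fun a : Mode N => u1 N (fun s k => W s k ω) t a.1) = fun a => U t a ω from
      congrFun e t] at hk
    exact hk

end Version

/-! ### Continuity of the paths in operator norm -/

section Continuity

lemma continuous_iCoef {N : ℕ} {p : ℝ → Mode N → ℂ} (hp : ∀ a, Continuous fun s => p s a)
    (k : Freq) : Continuous fun t => iCoef N p t k := by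
  have h := continuous_xCoef hp k
  refine intervalIntegral.continuous_parametric_intervalIntegral_of_continuous
    (f := fun t s => (Real.exp (-((t - s) * rate N k)) : ℂ) * xCoef N (p s) k) ?_ continuous_id
  have h' : Continuous fun z : ℝ × ℝ => xCoef N (p z.2) k := h.comp continuous_snd
  simp only [Function.uncurry_def]
  fun_prop

lemma continuous_mCoef {N : ℕ} {p : ℝ → Mode N → ℂ} (hp : ∀ a, Continuous fun s => p s a)
    (k l : Freq) : Continuous fun t => mCoef N p t k l :=
  (continuous_iCoef hp k).mul (continuous_xCoef hp l)

/-- The total size of the coefficients. -/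
def coefSum (B : Finset Freq) (M : Freq → Freq → ℂ) : ℝ := ∑ k ∈ B, ∑ l ∈ B, ‖M k l‖

lemma coefSum_nonneg (B : Finset Freq) (M : Freq → Freq → ℂ) : 0 ≤ coefSum B M :=
  Finset.sum_nonneg fun _ _ => Finset.sum_nonneg fun _ _ => norm_nonneg _

variable {N J Γ A : ℕ} {B : Finset Freq} {c : ℕ → ℕ → Freq → Freq → Freq → ℂ}

lemma GoodKernel.norm_gker_le (hc : GoodKernel N J Γ A B c) (M : Freq → Freq → ℂ) (q i : ℕ)
    (x : Fin 3 → ℝ) (k₁ : Freq) : ‖gker c B M q i x k₁‖ ≤ Γ * coefSum B M := by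
  rw [coefSum, Finset.mul_sum]
  refine (norm_sum_le _ _).trans (Finset.sum_le_sum fun k _ => ?_)
  rw [Finset.mul_sum]
  refine (norm_sum_le _ _).trans (Finset.sum_le_sum fun l _ => ?_)
  rw [norm_mul, norm_mul, norm_char, mul_one]
  exact mul_le_mul_of_nonneg_right (hc.norm_le _ _ _ _ _) (norm_nonneg _)

/-- A crude deterministic bound, polynomial in N. It suffices for continuity at fixed N and for
discretisation errors, which are made smaller than any given power. -/
lemma GoodKernel.squareFun_le (hc : GoodKernel N J Γ A B c) (hΓ : 1 ≤ Γ) (hA : A ≤ Γ)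
    (hJ : 2 ^ J ≤ Γ * N) {α : ℝ} (hα : 0 ≤ α) (hα' : α ≤ 1) (M : Freq → Freq → ℂ) (q : ℕ)
    (x : Fin 3 → ℝ) : squareFun A J α c B M q x ≤ 18 * Γ ^ 6 * N ^ 3 * coefSum B M := by
  have hV := coefSum_nonneg B M
  have hΓ' : (1 : ℝ) ≤ Γ := by exact_mod_cast hΓ
  have hN0 : 1 ≤ Γ * N := Nat.one_le_two_pow.trans hJ
  have hΓN : (1 : ℝ) ≤ Γ * N := by exact_mod_cast hN0
  have hi : ∀ i ∈ Finset.range J, (2 : ℝ) ^ (-(((i : ℝ) - 1) * α)) *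
      √(∑ k₁ ∈ boxF (A * 2 ^ i), ‖gker c B M q i x k₁‖ ^ 2) ≤
      18 * Γ ^ 5 * N ^ 2 * coefSum B M := by
    intro i hi
    have h1 : (2 : ℝ) ^ (-(((i : ℝ) - 1) * α)) ≤ 2 := by
      refine (Real.rpow_le_rpow_of_exponent_le (y := -(((i : ℝ) - 1) * α)) (z := 1) (by norm_num)
        ?_).trans (Real.rpow_one _).le
      nlinarith [mul_nonneg (Nat.cast_nonneg (α := ℝ) i) hα]
    have h2 : ((2 * (A * 2 ^ i) + 1 : ℕ) : ℝ) ≤ 3 * Γ ^ 2 * N := by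
      have h3 : 2 ^ i ≤ Γ * N :=
        (Nat.pow_le_pow_right (by norm_num) (Finset.mem_range.1 hi).le).trans hJ
      have h4 : A * 2 ^ i ≤ Γ * (Γ * N) := Nat.mul_le_mul hA h3
      have h5 : 1 ≤ Γ * (Γ * N) := Nat.mul_le_mul hΓ hN0
      have : 2 * (A * 2 ^ i) + 1 ≤ 3 * (Γ * (Γ * N)) := by omega
      calc ((2 * (A * 2 ^ i) + 1 : ℕ) : ℝ) ≤ (3 * (Γ * (Γ * N)) : ℕ) := by exact_mod_cast this
        _ = _ := by push_cast; ring
    have h6 : √(∑ k₁ ∈ boxF (A * 2 ^ i), ‖gker c B M q i x k₁‖ ^ 2) ≤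
        (3 * Γ ^ 2 * N) ^ 2 * (Γ * coefSum B M) := by
      rw [Real.sqrt_le_left (by positivity)]
      calc ∑ k₁ ∈ boxF (A * 2 ^ i), ‖gker c B M q i x k₁‖ ^ 2
          ≤ ∑ _k₁ ∈ boxF (A * 2 ^ i), (Γ * coefSum B M) ^ 2 :=
            Finset.sum_le_sum fun k _ =>
              pow_le_pow_left₀ (norm_nonneg _) (hc.norm_gker_le M q i x k) 2
        _ = ((2 * (A * 2 ^ i) + 1 : ℕ) : ℝ) ^ 3 * (Γ * coefSum B M) ^ 2 := by
            rw [Finset.sum_const, card_boxF, nsmul_eq_mul]; push_cast; ring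
        _ ≤ (3 * Γ ^ 2 * N) ^ 3 * (Γ * coefSum B M) ^ 2 := by gcongr
        -- The exponent 3 is raised to 4 so that the square root stays polynomial.
        _ ≤ (3 * Γ ^ 2 * N) ^ 4 * (Γ * coefSum B M) ^ 2 := by
            gcongr
            · nlinarith
            · norm_num
        _ = _ := by ring
    calc _ ≤ 2 * ((3 * Γ ^ 2 * N) ^ 2 * (Γ * coefSum B M)) := by gcongr
      _ = _ := by ring
  refine (Finset.sum_le_sum hi).trans ?_
  rw [Finset.sum_const, Finset.card_range, nsmul_eq_mul]
  have hJ' : (J : ℝ) ≤ Γ * N := by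
    have : J ≤ Γ * N := Nat.lt_two_pow_self.le.trans hJ
    exact_mod_cast this
  calc (J : ℝ) * (18 * Γ ^ 5 * N ^ 2 * coefSum B M) ≤
      (Γ * N) * (18 * Γ ^ 5 * N ^ 2 * coefSum B M) := by gcongr
    _ = _ := by ring

/-- The exponent is positive only for q = 0, the block Δ_{-1}, where it equals 1/2 + 2δ ≤ 1. -/
lemma two_rpow_le_two {δ : ℝ} (hδ : 0 < δ) (hδ' : δ < 1 / 4) (q : ℕ) :
    (2 : ℝ) ^ (((q : ℝ) - 1) * (-1 / 2 - 2 * δ)) ≤ 2 := by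
  refine (Real.rpow_le_rpow_of_exponent_le (y := ((q : ℝ) - 1) * (-1 / 2 - 2 * δ)) (z := 1)
    (by norm_num) ?_).trans (Real.rpow_one _).le
  have : (0 : ℝ) ≤ q := Nat.cast_nonneg q
  nlinarith

lemma GoodKernel.weighted_squareFun_le (hc : GoodKernel N J Γ A B c) (hΓ : 1 ≤ Γ) (hA : A ≤ Γ)
    (hJ : 2 ^ J ≤ Γ * N) {δ : ℝ} (hδ : 0 < δ) (hδ' : δ < 1 / 4) (M : Freq → Freq → ℂ) (q : ℕ)
    (x : Fin 3 → ℝ) : (2 : ℝ) ^ (((q : ℝ) - 1) * (-1 / 2 - 2 * δ)) *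
      squareFun A J (1 - δ) c B M q x ≤ 36 * Γ ^ 6 * N ^ 3 * coefSum B M := by
  have hV := coefSum_nonneg B M
  calc _ ≤ 2 * (18 * Γ ^ 6 * N ^ 3 * coefSum B M) :=
        mul_le_mul (two_rpow_le_two hδ hδ' q) (hc.squareFun_le hΓ hA hJ (by linarith)
          (by linarith) M q x) (Finset.sum_nonneg fun _ _ => by positivity) (by norm_num)
    _ = _ := by ring

/-- The difference of the operators at two times has the difference of the coefficients as its
kernel data. There are finitely many of these, each continuous in time. -/
theorem continuousInOpNorm_of_hasKernel {D : DyadicPartition} (hD : D.Bound A)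
    (hc : GoodKernel N J Γ A B c) (hΓ : 1 ≤ Γ) (hA : A ≤ Γ) (hJ : 2 ^ J ≤ Γ * N) {δ : ℝ}
    (hδ : 0 < δ) (hδ' : δ < 1 / 4) {p : ℝ → Mode N → ℂ} (hp : ∀ a, Continuous fun s => p s a)
    {L : ℝ → Coeff → Coeff} (hL : ∀ t, HasKernel D A J c B (mCoef N p t) (L t)) (T : ℝ) :
    ContinuousInOpNorm D (1 - δ) (-1 / 2 - 2 * δ) T L := by
  intro t _
  refine Tendsto.mono_left ?_ nhdsWithin_le_nhds
  have h1 : Continuous fun s => 36 * Γ ^ 6 * N ^ 3 *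
      coefSum B (fun k l => mCoef N p s k l - mCoef N p t k l) := by
    refine continuous_const.mul (continuous_finsetSum _ fun k _ => continuous_finsetSum _ fun l _ =>
      ((continuous_mCoef hp k l).sub continuous_const).norm)
  have h2 := ENNReal.tendsto_ofReal (h1.tendsto t)
  simp only [sub_self] at h2
  have h3 : coefSum B (fun _ _ => (0 : ℂ)) = 0 := by simp [coefSum]
  rw [h3, mul_zero, ENNReal.ofReal_zero] at h2
  refine tendsto_of_tendsto_of_tendsto_of_le_of_le tendsto_const_nhds h2 (fun _ => bot_le) ?_
  intro s
  refine (((hL s).sub (hL t)).opNorm_le hD _ _).trans (iSup₂_le fun q x => ?_)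
  exact ENNReal.ofReal_le_ofReal (hc.weighted_squareFun_le hΓ hA hJ hδ hδ' _ q x)

end Continuity

/-! ### Measurability of the operator norm -/

section Measurability

/-- The operator norm, as a function of the coefficients of the kernel. -/
def kernelNorm (D : DyadicPartition) (A J : ℕ) (c : ℕ → ℕ → Freq → Freq → Freq → ℂ)
    (B : Finset Freq) (α β : ℝ) (M : Freq → Freq → ℂ) : ℝ≥0∞ :=
  ⨆ (f : Coeff) (_ : holderNorm D α f ≤ 1) (q : ℕ) (x : Fin 3 → ℝ),
    ENNReal.ofReal ((2 : ℝ) ^ (((q : ℝ) - 1) * β)) * ‖∑ i ∈ Finset.range J,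
      ∑ k₁ ∈ boxF (A * 2 ^ i), block D i f k₁ * gker c B M q i x k₁‖ₑ

variable {D : DyadicPartition} {A J : ℕ} {c : ℕ → ℕ → Freq → Freq → Freq → ℂ} {B : Finset Freq}

lemma HasKernel.opNorm_eq {M : Freq → Freq → ℂ} {L : Coeff → Coeff} (h : HasKernel D A J c B M L)
    (α β : ℝ) : opNorm D α β L = kernelNorm D A J c B α β M := by
  simp only [opNorm, holderNorm, supNorm, kernelNorm, ENNReal.mul_iSup, h.tsum_block]

/-- A supremum of continuous functions of the coefficients; that the supremum is over an uncountable
set of arguments f and points x does no harm. -/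
lemma lowerSemicontinuous_kernelNorm (α β : ℝ) :
    LowerSemicontinuous (kernelNorm D A J c B α β) := by
  refine lowerSemicontinuous_iSup fun f => lowerSemicontinuous_iSup fun _ =>
    lowerSemicontinuous_iSup fun q => lowerSemicontinuous_iSup fun x => Continuous.lowerSemicontinuous
      ((ENNReal.continuous_const_mul ENNReal.ofReal_ne_top).comp ?_)
  refine (continuous_finsetSum _ fun i _ => continuous_finsetSum _ fun k₁ _ =>
    continuous_const.mul ?_).enorm
  exact continuous_finsetSum _ fun k _ => continuous_finsetSum _ fun l _ => by fun_prop

lemma iSup_rat_eq_of_lowerSemicontinuous {g : ℝ → ℝ≥0∞} (hg : LowerSemicontinuous g) :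
    ⨆ t, g t = ⨆ q : ℚ, g q := by
  refine le_antisymm (iSup_le fun t => le_of_forall_lt fun a ha => ?_)
    (iSup_le fun q => le_iSup g (q : ℝ))
  obtain ⟨q, hq⟩ := Rat.denseRange_cast.exists_mem_open (hg.isOpen_preimage a) ⟨t, ha⟩
  exact lt_of_lt_of_le hq (le_iSup (fun q : ℚ => g q) q)

variable {Ω : Type*} [MeasurableSpace Ω] {P : Measure Ω}

/-- Along a continuous path of coefficients the norm is lower semicontinuous in time, so the
supremum over [0, T] is a countable one. Time is first projected to [0, T] so that rationals of the
whole line can be used, also when T = 0. -/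
theorem aemeasurable_pathOpNorm {N : ℕ} {U : ℝ → Mode N → Ω → ℂ} (hU : IsRegularOU N U P)
    {L : Ω → ℝ → Coeff → Coeff}
    (hL : ∀ᵐ ω ∂P, ∀ t, HasKernel D A J c B (mCoef N (fun s a => U s a ω) t) (L ω t)) {T : ℝ}
    (hT : 0 ≤ T) (α β : ℝ) : AEMeasurable (fun ω => pathOpNorm D α β T (L ω)) P := by
  set g : Ω → ℝ → ℝ≥0∞ := fun ω t => kernelNorm D A J c B α β
    (mCoef N (fun s a => U s a ω) (Set.projIcc 0 T hT t)) with hg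
  refine ⟨fun ω => ⨆ q : ℚ, g ω q, Measurable.iSup fun q => ?_, ?_⟩
  · refine (lowerSemicontinuous_kernelNorm α β).measurable.comp ?_
    exact measurable_pi_lambda _ fun k => measurable_pi_lambda _ fun l =>
      measurable_mCoef hU.measurable hU.continuous_path _ k l
  · filter_upwards [hL] with ω hω
    have hcont : Continuous fun t => mCoef N (fun s a => U s a ω) (Set.projIcc 0 T hT t) :=
      continuous_pi fun k => continuous_pi fun l =>
        (continuous_mCoef (fun a => hU.continuous_path a ω) k l).comp
          (continuous_subtype_val.comp continuous_projIcc)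
    have hlsc : LowerSemicontinuous (g ω) := LowerSemicontinuous.comp
      (f := kernelNorm D A J c B α β) (lowerSemicontinuous_kernelNorm α β) hcont
    rw [← iSup_rat_eq_of_lowerSemicontinuous hlsc]
    simp only [pathOpNorm, (hω _).opNorm_eq]
    refine le_antisymm (iSup₂_le fun t ht => le_iSup_of_le t ?_) (iSup_le fun t => ?_)
    · simp only [hg, Set.projIcc_of_mem hT ht, le_refl]
    · exact le_iSup₂_of_le _ (Set.projIcc 0 T hT t).2 le_rfl

end Measurability

/-! ### Crude polynomial bounds and moduli of continuity for the coefficients -/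

section CoefficientBounds

lemma card_mode_le {N : ℕ} (hN : 1 ≤ N) : (Fintype.card (Mode N) : ℝ) ≤ 27 * N ^ 3 := by
  have h : Fintype.card (Mode N) ≤ (2 * N + 1) ^ 3 := by
    rw [← card_boxF]
    refine Finset.card_le_card_of_injOn (s := Finset.univ) (fun a : Mode N => a.1)
      (fun a _ => mem_boxF.2 a.2.2) fun a _ b _ hab => Subtype.ext hab
  have h2 : (2 * N + 1) ^ 3 ≤ (3 * N) ^ 3 := Nat.pow_le_pow_left (by omega) 3
  calc (Fintype.card (Mode N) : ℝ) ≤ ((3 * N) ^ 3 : ℕ) := by exact_mod_cast h.trans h2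
    _ = _ := by push_cast; ring

lemma modeVar_le_two {N : ℕ} (a : Mode N) : modeVar N a ≤ 2 := by
  have h1 := le_rate_of_inBox a.2.2
  have h2 := one_le_norm_toE_sq a.2.1
  have h3 : 4 / 81 ≤ rate N a.1 := by linarith
  rw [modeVar, div_le_iff₀ (by linarith)]
  linarith

lemma norm_modeCov_le {N : ℕ} (a b : Mode N) : ‖modeCov N a b‖ ≤ 2 := by
  rw [modeCov]
  split_ifs
  · rw [Complex.norm_real]
    exact (Real.norm_of_nonneg (modeVar_pos a).le).le.trans (modeVar_le_two a)
  · simp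

lemma rate_le {N : ℕ} (hN : 1 ≤ N) (k : Freq) : rate N k ≤ 27 * N ^ 2 := by
  by_cases hk : k = 0
  · subst hk
    have : rate N 0 = 0 := by
      have : toE 0 = 0 := by ext j; simp [toE]
      simp [rate, this]
    rw [this]; positivity
  have hN' : (1 : ℝ) ≤ N := by exact_mod_cast hN
  rw [rate_eq N hk]
  have h1 : ∑ j, Real.sin (Real.pi * (eps N * k j) / 2) ^ 2 ≤ 3 := by
    calc _ ≤ ∑ _j : Fin 3, (1 : ℝ) := Finset.sum_le_sum fun j _ => Real.sin_sq_le_one _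
      _ = 3 := by simp
  calc 4 / eps N ^ 2 * ∑ j, Real.sin (Real.pi * (eps N * k j) / 2) ^ 2 ≤ 4 / eps N ^ 2 * 3 := by
        gcongr
    _ = 3 * (2 * (N : ℝ) + 1) ^ 2 := by rw [eps]; field_simp; ring
    _ ≤ 27 * (N : ℝ) ^ 2 := by nlinarith

lemma norm_sum_modes_le {N : ℕ} (hN : 1 ≤ N) {F : Mode N → Mode N → ℂ} {R : ℝ}
    (hR : 0 ≤ R) (hF : ∀ a b, ‖F a b‖ ≤ R) (k : Freq) :
    ‖∑ a : Mode N, ∑ b : Mode N, if a.1 + b.1 = k then F a b else 0‖ ≤ 729 * N ^ 6 * R := by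
  have hc := card_mode_le hN
  have h : ∀ a b : Mode N, ‖if a.1 + b.1 = k then F a b else 0‖ ≤ R := fun a b => by
    split_ifs
    · exact hF a b
    · simpa using hR
  calc _ ≤ ∑ _a : Mode N, ∑ _b : Mode N, R := (norm_sum_le _ _).trans
        (Finset.sum_le_sum fun a _ => (norm_sum_le _ _).trans (Finset.sum_le_sum fun b _ => h a b))
    _ = Fintype.card (Mode N) * (Fintype.card (Mode N) * R) := by simp
    _ ≤ 27 * N ^ 3 * (27 * N ^ 3 * R) := by gcongr
    _ = _ := by ring

/-- A bound for the coefficients of the Wick square when the modes are bounded by `S`. -/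
def xBound (N : ℕ) (S : ℝ) : ℝ := 40000 * N ^ 6 * (1 + S) ^ 2

lemma xBound_nonneg (N : ℕ) (S : ℝ) : 0 ≤ xBound N S := by unfold xBound; positivity

lemma norm_sum_aliases_le {F : Freq → ℂ} {R : ℝ} (hF : ∀ i, ‖F i‖ ≤ R) :
    ‖∑ i ∈ Finset.Icc (-1 : Freq) 1, F i‖ ≤ 27 * R := by
  refine (norm_sum_le _ _).trans ((Finset.sum_le_sum fun i _ => hF i).trans (le_of_eq ?_))
  rw [Finset.sum_const, card_aliases, nsmul_eq_mul]; norm_num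

lemma norm_xCoef_le {N : ℕ} (hN : 1 ≤ N) {p : Mode N → ℂ} {S : ℝ} (hS : 0 ≤ S)
    (hp : ∀ a, ‖p a‖ ≤ S) (k : Freq) : ‖xCoef N p k‖ ≤ xBound N S := by
  have hq : ∀ k, ‖qCoef N p k‖ ≤ 729 * N ^ 6 * (S ^ 2 + 2) := fun k => by
    refine norm_sum_modes_le hN (by positivity) (fun a b => ?_) k
    rw [wick2]
    refine (norm_sub_le _ _).trans (add_le_add ?_ (norm_modeCov_le a b))
    rw [norm_mul, sq]
    exact mul_le_mul (hp a) (hp b) (norm_nonneg _) hS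
  refine (norm_sum_aliases_le fun i => hq _).trans ?_
  rw [xBound]
  have h1 : (0 : ℝ) ≤ (N : ℝ) ^ 6 := by positivity
  -- The constant in `xBound` only has to exceed 27 · 729 · 2 = 39366.
  have h2 : S ^ 2 + 2 ≤ 2 * (1 + S) ^ 2 := by nlinarith
  have h3 : (N : ℝ) ^ 6 * (S ^ 2 + 2) ≤ N ^ 6 * (2 * (1 + S) ^ 2) := by gcongr
  have h4 : (0 : ℝ) ≤ (N : ℝ) ^ 6 * (1 + S) ^ 2 := by positivity
  linarith

lemma norm_xCoef_sub_le {N : ℕ} (hN : 1 ≤ N) {p p' : Mode N → ℂ} {S h : ℝ} (hS : 0 ≤ S)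
    (hh : 0 ≤ h) (hp : ∀ a, ‖p a‖ ≤ S) (hp' : ∀ a, ‖p' a‖ ≤ S)
    (hpp : ∀ a, ‖p a - p' a‖ ≤ S * h) (k : Freq) :
    ‖xCoef N p k - xCoef N p' k‖ ≤ xBound N S * h := by
  have hq : ∀ k, ‖qCoef N p k - qCoef N p' k‖ ≤ 729 * N ^ 6 * (2 * S ^ 2 * h) := fun k => by
    rw [qCoef, qCoef, ← Finset.sum_sub_distrib]
    simp only [← Finset.sum_sub_distrib]
    have e : ∀ a b : Mode N, ((if a.1 + b.1 = k then wick2 N p a b else 0) -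
        if a.1 + b.1 = k then wick2 N p' a b else 0) =
        if a.1 + b.1 = k then wick2 N p a b - wick2 N p' a b else 0 := fun a b => by
      split_ifs <;> simp
    simp only [e]
    refine norm_sum_modes_le hN (by positivity) (fun a b => ?_) k
    have : wick2 N p a b - wick2 N p' a b = p a * (p b - p' b) + (p a - p' a) * p' b := by
      rw [wick2, wick2]; ring
    rw [this]
    refine (norm_add_le _ _).trans ?_
    rw [norm_mul, norm_mul]
    have h1 := mul_le_mul (hp a) (hpp b) (norm_nonneg _) hS
    have h2 := mul_le_mul (hpp a) (hp' b) (norm_nonneg _) (by positivity)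
    linarith
  rw [xCoef, xCoef, ← Finset.sum_sub_distrib]
  refine (norm_sum_aliases_le fun i => hq _).trans ?_
  rw [xBound]
  have h1 : (0 : ℝ) ≤ (N : ℝ) ^ 6 * h := by positivity
  have h2 : S ^ 2 ≤ (1 + S) ^ 2 := by nlinarith
  have h3 : (N : ℝ) ^ 6 * h * S ^ 2 ≤ N ^ 6 * h * (1 + S) ^ 2 := by gcongr
  have h4 : (0 : ℝ) ≤ (N : ℝ) ^ 6 * h * (1 + S) ^ 2 := by positivity
  linarith

lemma norm_iCoef_le {N : ℕ} (hN : 1 ≤ N) {p : ℝ → Mode N → ℂ} {S T : ℝ} (hS : 0 ≤ S)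
    (hp : ∀ s ∈ Set.Icc 0 T, ∀ a, ‖p s a‖ ≤ S) {t : ℝ} (ht : t ∈ Set.Icc 0 T) (k : Freq) :
    ‖iCoef N p t k‖ ≤ T * xBound N S := by
  have hX := xBound_nonneg N S
  refine (intervalIntegral.norm_integral_le_of_norm_le_const (C := xBound N S) fun s hs => ?_).trans
    ?_
  · rw [Set.uIoc_of_le ht.1] at hs
    rw [norm_mul, Complex.norm_real, Real.norm_of_nonneg (Real.exp_pos _).le]
    have h1 : Real.exp (-((t - s) * rate N k)) ≤ 1 := Real.exp_le_one_iff.2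
      (neg_nonpos.2 (mul_nonneg (by linarith [hs.2]) (rate_nonneg N k)))
    have h2 := norm_xCoef_le hN hS (hp s ⟨hs.1.le, hs.2.trans ht.2⟩) k
    calc _ ≤ 1 * xBound N S := mul_le_mul h1 h2 (norm_nonneg _) zero_le_one
      _ = _ := one_mul _
  · rw [sub_zero, abs_of_nonneg ht.1, mul_comm]
    exact mul_le_mul_of_nonneg_right ht.2 hX

/-- On [0, t'] the two exponentials differ by at most (t - t') times the rate, which is at most
27N²; the remaining interval [t', t] is short. -/
lemma norm_iCoef_sub_le {N : ℕ} (hN : 1 ≤ N) {p : ℝ → Mode N → ℂ}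
    (hc : ∀ a, Continuous fun s => p s a) {S T h : ℝ} (hS : 0 ≤ S) (hh : 0 ≤ h)
    (hp : ∀ s ∈ Set.Icc 0 T, ∀ a, ‖p s a‖ ≤ S) {t t' : ℝ} (ht : t ∈ Set.Icc 0 T)
    (ht' : t' ∈ Set.Icc 0 T) (htt : t' ≤ t) (hth : t - t' ≤ T * h) (k : Freq) :
    ‖iCoef N p t k - iCoef N p t' k‖ ≤ T * h * (1 + 27 * N ^ 2 * T) * xBound N S := by
  have hX := xBound_nonneg N S
  have hT : 0 ≤ T := ht.1.trans ht.2
  have hr := rate_nonneg N k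
  have hr' := rate_le hN k
  have hxc := continuous_xCoef hc k
  have hi : ∀ t a b : ℝ, IntervalIntegrable (fun s => (Real.exp (-((t - s) * rate N k)) : ℂ) *
      xCoef N (p s) k) volume a b := fun t a b => by
    refine Continuous.intervalIntegrable ?_ a b
    fun_prop
  have hx : ∀ s ∈ Set.Icc 0 T, ‖xCoef N (p s) k‖ ≤ xBound N S := fun s hs =>
    norm_xCoef_le hN hS (hp s hs) k
  have e : iCoef N p t k - iCoef N p t' k = (∫ s in (0 : ℝ)..t',
      ((Real.exp (-((t - s) * rate N k)) : ℂ) * xCoef N (p s) k -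
        (Real.exp (-((t' - s) * rate N k)) : ℂ) * xCoef N (p s) k)) +
      ∫ s in t'..t, (Real.exp (-((t - s) * rate N k)) : ℂ) * xCoef N (p s) k := by
    rw [intervalIntegral.integral_sub (hi _ _ _) (hi _ _ _), iCoef, iCoef,
      ← intervalIntegral.integral_add_adjacent_intervals (hi t 0 t') (hi t t' t)]
    ring
  have b1 : ‖∫ s in (0 : ℝ)..t', ((Real.exp (-((t - s) * rate N k)) : ℂ) * xCoef N (p s) k -
      (Real.exp (-((t' - s) * rate N k)) : ℂ) * xCoef N (p s) k)‖ ≤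
      (T * h * (27 * N ^ 2) * xBound N S) * T := by
    refine (intervalIntegral.norm_integral_le_of_norm_le_const
      (C := T * h * (27 * N ^ 2) * xBound N S) fun s hs => ?_).trans ?_
    · rw [Set.uIoc_of_le ht'.1] at hs
      rw [← sub_mul, norm_mul, ← Complex.ofReal_sub, Complex.norm_real]
      refine mul_le_mul ?_ (hx s ⟨hs.1.le, hs.2.trans ht'.2⟩) (norm_nonneg _) (by positivity)
      have e1 : Real.exp (-((t - s) * rate N k)) =
          Real.exp (-((t' - s) * rate N k)) * Real.exp (-((t - t') * rate N k)) := by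
        rw [← Real.exp_add]; congr 1; ring
      have h1 : Real.exp (-((t' - s) * rate N k)) ≤ 1 := Real.exp_le_one_iff.2
        (neg_nonpos.2 (mul_nonneg (by linarith [hs.2]) hr))
      have h2 : Real.exp (-((t - t') * rate N k)) ≤ 1 := Real.exp_le_one_iff.2
        (neg_nonpos.2 (mul_nonneg (by linarith) hr))
      have h3 := Real.add_one_le_exp (-((t - t') * rate N k))
      have h4 : (t - t') * rate N k ≤ T * h * (27 * N ^ 2) :=
        mul_le_mul hth hr' hr (by positivity)
      have h5 := Real.exp_pos (-((t' - s) * rate N k))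
      rw [e1, Real.norm_eq_abs, abs_le]
      constructor <;> nlinarith
    · rw [sub_zero, abs_of_nonneg ht'.1]
      exact mul_le_mul_of_nonneg_left ht'.2 (by positivity)
  have b2 : ‖∫ s in t'..t, (Real.exp (-((t - s) * rate N k)) : ℂ) * xCoef N (p s) k‖ ≤
      xBound N S * (T * h) := by
    refine (intervalIntegral.norm_integral_le_of_norm_le_const (C := xBound N S)
      fun s hs => ?_).trans ?_
    · rw [Set.uIoc_of_le htt] at hs
      rw [norm_mul, Complex.norm_real, Real.norm_of_nonneg (Real.exp_pos _).le]
      have h1 : Real.exp (-((t - s) * rate N k)) ≤ 1 := Real.exp_le_one_iff.2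
        (neg_nonpos.2 (mul_nonneg (by linarith [hs.2]) hr))
      have h2 := hx s ⟨ht'.1.trans hs.1.le, hs.2.trans ht.2⟩
      calc _ ≤ 1 * xBound N S := mul_le_mul h1 h2 (norm_nonneg _) zero_le_one
        _ = _ := one_mul _
    · rw [abs_of_nonneg (by linarith)]
      exact mul_le_mul_of_nonneg_left hth hX
  rw [e]
  refine (norm_add_le _ _).trans ((add_le_add b1 b2).trans (le_of_eq ?_))
  ring

lemma norm_mCoef_le {N : ℕ} (hN : 1 ≤ N) {p : ℝ → Mode N → ℂ} {S T : ℝ} (hS : 0 ≤ S)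
    (hp : ∀ s ∈ Set.Icc 0 T, ∀ a, ‖p s a‖ ≤ S) {t : ℝ} (ht : t ∈ Set.Icc 0 T) (k l : Freq) :
    ‖mCoef N p t k l‖ ≤ T * xBound N S ^ 2 := by
  have hX := xBound_nonneg N S
  have hT : 0 ≤ T := ht.1.trans ht.2
  rw [mCoef, norm_mul, sq, ← mul_assoc]
  exact mul_le_mul (norm_iCoef_le hN hS hp ht k) (norm_xCoef_le hN hS (hp t ht) l)
    (norm_nonneg _) (by positivity)

lemma norm_mCoef_sub_le {N : ℕ} (hN : 1 ≤ N) {p : ℝ → Mode N → ℂ}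
    (hc : ∀ a, Continuous fun s => p s a) {S T h : ℝ} (hS : 0 ≤ S) (hh : 0 ≤ h)
    (hp : ∀ s ∈ Set.Icc 0 T, ∀ a, ‖p s a‖ ≤ S) {t t' : ℝ} (ht : t ∈ Set.Icc 0 T)
    (ht' : t' ∈ Set.Icc 0 T) (htt : t' ≤ t) (hth : t - t' ≤ T * h)
    (hpp : ∀ a, ‖p t a - p t' a‖ ≤ S * h) (k l : Freq) :
    ‖mCoef N p t k l - mCoef N p t' k l‖ ≤ 27 * (1 + T) ^ 2 * N ^ 2 * xBound N S ^ 2 * h := by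
  have hX := xBound_nonneg N S
  have hT : 0 ≤ T := ht.1.trans ht.2
  have hN' : (1 : ℝ) ≤ N ^ 2 := one_le_pow₀ (by exact_mod_cast hN)
  have e : mCoef N p t k l - mCoef N p t' k l = (iCoef N p t k - iCoef N p t' k) *
      xCoef N (p t) l + iCoef N p t' k * (xCoef N (p t) l - xCoef N (p t') l) := by
    rw [mCoef, mCoef]; ring
  rw [e]
  refine (norm_add_le _ _).trans ?_
  rw [norm_mul, norm_mul]
  have h1 := mul_le_mul (norm_iCoef_sub_le hN hc hS hh hp ht ht' htt hth k)
    (norm_xCoef_le hN hS (hp t ht) l) (norm_nonneg _) (by positivity)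
  have h2 := mul_le_mul (norm_iCoef_le hN hS hp ht' k)
    (norm_xCoef_sub_le hN hS hh (hp t ht) (hp t' ht') hpp l) (norm_nonneg _) (by positivity)
  refine (add_le_add h1 h2).trans ?_
  have h3 : T * (2 + 27 * N ^ 2 * T) ≤ 27 * (1 + T) ^ 2 * (N : ℝ) ^ 2 := by
    nlinarith [mul_nonneg hT (by linarith : (0 : ℝ) ≤ (N : ℝ) ^ 2 - 1), mul_nonneg hT hT]
  calc _ = T * (2 + 27 * N ^ 2 * T) * (xBound N S ^ 2 * h) := by ring
    _ ≤ 27 * (1 + T) ^ 2 * (N : ℝ) ^ 2 * (xBound N S ^ 2 * h) := by gcongr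
    _ = _ := by ring

end CoefficientBounds

/-! ### Dyadic chaining -/

section Chaining

/-- The dyadic approximation of `τ` from below. -/
def dyadicFloor (n : ℕ) (τ : ℝ) : ℝ := (⌊(2 : ℝ) ^ n * τ⌋₊ : ℝ) / 2 ^ n

lemma dyadicFloor_nonneg (n : ℕ) (τ : ℝ) : 0 ≤ dyadicFloor n τ := by
  unfold dyadicFloor; positivity

lemma dyadicFloor_le (n : ℕ) {τ : ℝ} (hτ : 0 ≤ τ) : dyadicFloor n τ ≤ τ := by
  rw [dyadicFloor, div_le_iff₀ (by positivity), mul_comm τ]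
  exact Nat.floor_le (by positivity)

lemma sub_dyadicFloor_le (n : ℕ) (τ : ℝ) : τ - dyadicFloor n τ ≤ ((2 : ℝ) ^ n)⁻¹ := by
  have h := (Nat.lt_floor_add_one ((2 : ℝ) ^ n * τ)).le
  have h2 : (0 : ℝ) < 2 ^ n := by positivity
  rw [dyadicFloor, sub_le_iff_le_add, inv_eq_one_div, ← add_div, le_div_iff₀ h2]
  linarith

lemma tendsto_dyadicFloor {τ : ℝ} (hτ : 0 ≤ τ) :
    Tendsto (fun n => dyadicFloor n τ) atTop (𝓝 τ) := by
  have h : Tendsto (fun n : ℕ => τ - ((2 : ℝ) ^ n)⁻¹) atTop (𝓝 τ) := by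
    have : Tendsto (fun n : ℕ => ((2 : ℝ) ^ n)⁻¹) atTop (𝓝 0) := by
      simpa using tendsto_pow_atTop_nhds_zero_of_lt_one (r := (2 : ℝ)⁻¹) (by norm_num) (by norm_num)
    simpa using tendsto_const_nhds.sub this
  exact tendsto_of_tendsto_of_tendsto_of_le_of_le h tendsto_const_nhds
    (fun n => by have := sub_dyadicFloor_le n τ; simp only; linarith) fun n => dyadicFloor_le n hτ

variable {u : ℝ → ℂ} {M : ℝ}

lemma norm_dyadicFloor_succ_sub_le (hM : 0 ≤ M)
    (h : ∀ j l : ℕ, l < 2 ^ j → ‖u ((l + 1 : ℕ) / 2 ^ j) - u (l / 2 ^ j)‖ ≤ M * (4 / 5) ^ j)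
    {τ : ℝ} (hτ : τ ∈ Set.Icc (0 : ℝ) 1) (n : ℕ) :
    ‖u (dyadicFloor (n + 1) τ) - u (dyadicFloor n τ)‖ ≤ M * (4 / 5) ^ (n + 1) := by
  set m := ⌊(2 : ℝ) ^ n * τ⌋₊ with hm
  set m' := ⌊(2 : ℝ) ^ (n + 1) * τ⌋₊ with hm'
  have hpos : (0 : ℝ) ≤ 2 ^ n * τ := mul_nonneg (by positivity) hτ.1
  have h1 : (m : ℝ) ≤ 2 ^ n * τ := Nat.floor_le hpos
  have h2 : 2 ^ n * τ < m + 1 := Nat.lt_floor_add_one _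
  have hpos' : (0 : ℝ) ≤ 2 ^ (n + 1) * τ := mul_nonneg (by positivity) hτ.1
  have h3 : (m' : ℝ) ≤ 2 ^ (n + 1) * τ := Nat.floor_le hpos'
  have h5 : 2 * m ≤ m' := Nat.le_floor (by push_cast; rw [pow_succ]; linarith)
  have h6 : m' < 2 * m + 2 := by
    have : (m' : ℝ) < 2 * m + 2 := by rw [pow_succ] at h3; linarith
    exact_mod_cast this
  have e : dyadicFloor n τ = ((2 * m : ℕ) : ℝ) / 2 ^ (n + 1) := by
    rw [dyadicFloor, ← hm, pow_succ]; push_cast; field_simp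
  rw [e, dyadicFloor, ← hm']
  rcases (by omega : m' = 2 * m ∨ m' = 2 * m + 1) with h7 | h7
  · rw [h7, sub_self, norm_zero]; positivity
  · rw [h7]
    refine h (n + 1) (2 * m) ?_
    have : (m' : ℝ) ≤ 2 ^ (n + 1) := h3.trans (mul_le_of_le_one_right (by positivity) hτ.2)
    have : m' ≤ 2 ^ (n + 1) := by exact_mod_cast this
    omega

/-- Dyadic increments control the modulus of continuity. -/
theorem norm_sub_dyadicFloor_le (hu : Continuous u) (hM : 0 ≤ M)
    (h : ∀ j l : ℕ, l < 2 ^ j → ‖u ((l + 1 : ℕ) / 2 ^ j) - u (l / 2 ^ j)‖ ≤ M * (4 / 5) ^ j)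
    {τ : ℝ} (hτ : τ ∈ Set.Icc (0 : ℝ) 1) (n : ℕ) :
    ‖u τ - u (dyadicFloor n τ)‖ ≤ 4 * M * (4 / 5) ^ n := by
  -- Consecutive dyadic approximations coincide or are neighbours, so the increments form a
  -- geometric series: the sum of (4/5)^j over j > n is 4(4/5)ⁿ.
  have hr : ∀ r : ℕ, ‖u (dyadicFloor (r + n) τ) - u (dyadicFloor n τ)‖ ≤
      4 * M * (4 / 5) ^ n * (1 - (4 / 5) ^ r) := by
    intro r
    induction r with
    | zero => simp
    | succ r ih =>
      have h1 := norm_dyadicFloor_succ_sub_le hM h hτ (r + n)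
      have e : u (dyadicFloor (r + 1 + n) τ) - u (dyadicFloor n τ) =
          (u (dyadicFloor (r + n + 1) τ) - u (dyadicFloor (r + n) τ)) +
          (u (dyadicFloor (r + n) τ) - u (dyadicFloor n τ)) := by
        rw [show r + 1 + n = r + n + 1 by ring]; ring
      rw [e]
      refine (norm_add_le _ _).trans ((add_le_add h1 ih).trans (le_of_eq ?_))
      rw [pow_succ, pow_add, pow_succ]; ring
  have hlim : Tendsto (fun r => ‖u (dyadicFloor (r + n) τ) - u (dyadicFloor n τ)‖) atTop
      (𝓝 ‖u τ - u (dyadicFloor n τ)‖) :=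
    (((hu.tendsto τ).comp ((tendsto_dyadicFloor hτ.1).comp (tendsto_add_atTop_nat n))).sub
      tendsto_const_nhds).norm
  refine le_of_tendsto' hlim fun r => (hr r).trans ?_
  have : (0 : ℝ) ≤ (4 / 5) ^ r := by positivity
  have h2 : 0 ≤ 4 * M * (4 / 5 : ℝ) ^ n := by positivity
  nlinarith

/-- The approximation at level zero is u(0) or u(1), which costs M; the chain from there to τ costs
4M. -/
lemma norm_le_of_dyadic (hu : Continuous u) (hM : 0 ≤ M)
    (h : ∀ j l : ℕ, l < 2 ^ j → ‖u ((l + 1 : ℕ) / 2 ^ j) - u (l / 2 ^ j)‖ ≤ M * (4 / 5) ^ j)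
    {τ : ℝ} (hτ : τ ∈ Set.Icc (0 : ℝ) 1) : ‖u τ‖ ≤ ‖u 0‖ + 5 * M := by
  have h1 := norm_sub_dyadicFloor_le hu hM h hτ 0
  have h2 := h 0 0 (by norm_num)
  simp only [pow_zero, mul_one, zero_add, Nat.cast_one, Nat.cast_zero, div_one] at h1 h2
  have h3 : ‖u (dyadicFloor 0 τ)‖ ≤ ‖u 0‖ + M := by
    rw [dyadicFloor, pow_zero, one_mul, div_one]
    have h4 : ⌊τ⌋₊ ≤ 1 := Nat.floor_le_one_of_le_one hτ.2
    rcases (by omega : ⌊τ⌋₊ = 0 ∨ ⌊τ⌋₊ = 1) with h5 | h5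
    · rw [h5]; simpa using hM
    · rw [h5, Nat.cast_one]
      have := norm_le_norm_add_norm_sub' (u 1) (u 0)
      linarith
  have := norm_le_norm_add_norm_sub' (u τ) (u (dyadicFloor 0 τ))
  linarith

end Chaining

/-! ### Moments of the Hölder constants of the modes -/

section PathBound

set_option linter.unusedSectionVars false

variable {Ω : Type*} [MeasurableSpace Ω] {P : Measure Ω} [IsProbabilityMeasure P]

lemma lintegral_enorm_pow_eq {f : Ω → ℂ} (hf : AllLp f P) (k : ℕ) :
    ∫⁻ ω, ‖f ω‖ₑ ^ k ∂P = ENNReal.ofReal (∫ ω, ‖f ω‖ ^ k ∂P) := by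
  rw [ofReal_integral_eq_lintegral_ofReal (hf.integrable_norm_pow k)
    (ae_of_all _ fun ω => by positivity)]
  refine lintegral_congr fun ω => ?_
  rw [ENNReal.ofReal_pow (norm_nonneg _), ofReal_norm]

lemma eLpNorm_le_one_add {E : Type*} [NormedAddCommGroup E] {f : Ω → E} {k : ℕ} (hk : k ≠ 0)
    {c : ℝ} (hc : 0 ≤ c) (h : ∫⁻ ω, ‖f ω‖ₑ ^ k ∂P ≤ ENNReal.ofReal c) :
    eLpNorm f (k : ℝ≥0∞) P ≤ ENNReal.ofReal (1 + c) := by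
  rw [eLpNorm_nat_le_iff hk]
  refine h.trans ?_
  rw [← ENNReal.ofReal_pow (by linarith)]
  exact ENNReal.ofReal_le_ofReal ((by linarith : c ≤ 1 + c).trans
    (le_self_pow₀ (by linarith) hk))

/-- Moments of a Gaussian variable of unit variance, up to a factor. -/
def momentConst (n : ℕ) : ℝ := 2 ^ n * (2 * gaussMoment n)

lemma momentConst_nonneg (n : ℕ) : 0 ≤ momentConst n := by
  have := gaussMoment_nonneg n
  unfold momentConst; positivity

/-- Weighted moments of the dyadic increments of `τ ↦ U (T τ) a` on `[0, 1]`. -/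
def dyadicVar {N : ℕ} (U : ℝ → Mode N → Ω → ℂ) (T : ℝ) (n : ℕ) (a : Mode N) (ω : Ω) : ℝ≥0∞ :=
  ∑' j : ℕ, ∑ l ∈ Finset.range (2 ^ j), (ENNReal.ofReal ((5 / 4) ^ j) *
    ‖U (T * ((l + 1 : ℕ) / 2 ^ j)) a ω - U (T * (l / 2 ^ j)) a ω‖ₑ) ^ (2 * n)

lemma IsRegularOU.measurable_dyadicVar {N : ℕ} {U : ℝ → Mode N → Ω → ℂ} (hU : IsRegularOU N U P)
    (T : ℝ) (n : ℕ) (a : Mode N) : Measurable (dyadicVar U T n a) :=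
  Measurable.tsum fun _ => Finset.measurable_fun_sum _ fun _ _ =>
    (((hU.measurable _ a).sub (hU.measurable _ a)).enorm.const_mul _).pow_const _

/-- Kolmogorov's criterion. An increment over length T2^{-j} has 2n-th moment of order (T2^{-j})ⁿ,
so with the weight (5/4)^{2nj} and 2^j increments level j contributes (2(25/32)ⁿ)^j. -/
lemma IsRegularOU.lintegral_dyadicVar_le {N : ℕ} {U : ℝ → Mode N → Ω → ℂ} (hU : IsRegularOU N U P)
    {T : ℝ} (hT : 0 ≤ T) {n : ℕ} (hn : 3 ≤ n) (a : Mode N) :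
    ∫⁻ ω, dyadicVar U T n a ω ∂P ≤ ENNReal.ofReal (25 * (momentConst n * T ^ n)) := by
  have hG := momentConst_nonneg n
  have hm : ∀ s t, Measurable fun ω => ‖U s a ω - U t a ω‖ₑ := fun s t =>
    ((hU.measurable s a).sub (hU.measurable t a)).enorm
  have hinc : ∀ j l : ℕ, ∫⁻ ω, (ENNReal.ofReal ((5 / 4) ^ j) *
      ‖U (T * ((l + 1 : ℕ) / 2 ^ j)) a ω - U (T * (l / 2 ^ j)) a ω‖ₑ) ^ (2 * n) ∂P ≤
      ENNReal.ofReal (momentConst n * T ^ n * ((25 / 32) ^ n) ^ j) := by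
    intro j l
    simp only [mul_pow]
    rw [lintegral_const_mul _ ((hm _ _).pow_const _)]
    have h1 : HasGaussianLaw (fun ω => U (T * ((l + 1 : ℕ) / 2 ^ j)) a ω - U (T * (l / 2 ^ j)) a ω)
        P := hU.isModeGaussian.gaussian.hasGaussianLaw_fun_sub
          (s := (T * ((l + 1 : ℕ) / 2 ^ j), a)) (t := (T * (l / 2 ^ j), a))
    have h2 : ∫ ω, (U (T * ((l + 1 : ℕ) / 2 ^ j)) a ω - U (T * (l / 2 ^ j)) a ω) ∂P = 0 := by
      rw [integral_sub (hU.isModeGaussian.allLp _ a).integrable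
        (hU.isModeGaussian.allLp _ a).integrable, hU.isModeGaussian.mean, hU.isModeGaussian.mean,
        sub_zero]
    have h3 : ∫ ω, ‖U (T * ((l + 1 : ℕ) / 2 ^ j)) a ω - U (T * (l / 2 ^ j)) a ω‖ ^ 2 ∂P ≤
        T / 2 ^ j := by
      refine (hU.increment _ _ a).trans (le_of_eq ?_)
      rw [← mul_sub, ← sub_div]
      push_cast
      rw [add_sub_cancel_left, abs_of_nonneg (by positivity)]
      ring
    have h4 := integral_norm_pow_le_of_gaussian h1 h2 h3 n
    rw [lintegral_enorm_pow_eq (AllLp.of_gaussian h1), ← ENNReal.ofReal_pow (by positivity),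
      ← ENNReal.ofReal_mul (by positivity)]
    refine ENNReal.ofReal_le_ofReal ?_
    calc _ ≤ ((5 / 4 : ℝ) ^ j) ^ (2 * n) * (momentConst n * (T / 2 ^ j) ^ n) := by
          gcongr
          exact h4
      _ = momentConst n * T ^ n * (((25 / 16 : ℝ) ^ j) ^ n / ((2 : ℝ) ^ j) ^ n) := by
          have : ((5 / 4 : ℝ) ^ j) ^ (2 * n) = ((25 / 16 : ℝ) ^ j) ^ n := by
            rw [← pow_mul, ← pow_mul, show j * (2 * n) = 2 * (j * n) by ring, pow_mul]; norm_num
          rw [this, div_pow T]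
          ring
      _ = _ := by
          rw [← div_pow, ← div_pow, ← pow_mul, ← pow_mul, mul_comm n j]
          norm_num
  have hj : ∀ j : ℕ, ∫⁻ ω, ∑ l ∈ Finset.range (2 ^ j), (ENNReal.ofReal ((5 / 4) ^ j) *
      ‖U (T * ((l + 1 : ℕ) / 2 ^ j)) a ω - U (T * (l / 2 ^ j)) a ω‖ₑ) ^ (2 * n) ∂P ≤
      ENNReal.ofReal (momentConst n * T ^ n) * ENNReal.ofReal (24 / 25) ^ j := by
    intro j
    rw [lintegral_finsetSum _ fun l _ => ((hm _ _).const_mul _).pow_const _]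
    refine (Finset.sum_le_sum fun l _ => hinc j l).trans ?_
    rw [Finset.sum_const, Finset.card_range, nsmul_eq_mul, ← ENNReal.ofReal_natCast,
      ← ENNReal.ofReal_mul (by positivity), ← ENNReal.ofReal_pow (by norm_num),
      ← ENNReal.ofReal_mul (by positivity)]
    refine ENNReal.ofReal_le_ofReal ?_
    -- This is where n ≥ 3 is needed: n = 3 is the first value for which 2(25/32)ⁿ < 1. The ratio
    -- 24/25 yields the factor 25 in the sum.
    have h1 : (25 / 32 : ℝ) ^ n ≤ 12 / 25 :=
      (pow_le_pow_of_le_one (by norm_num) (by norm_num) hn).trans (by norm_num)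
    have h2 : (2 : ℝ) ^ j * ((25 / 32 : ℝ) ^ n) ^ j ≤ (24 / 25) ^ j := by
      rw [← mul_pow]
      exact pow_le_pow_left₀ (by positivity) (by linarith) j
    push_cast
    calc _ = momentConst n * T ^ n * ((2 : ℝ) ^ j * ((25 / 32 : ℝ) ^ n) ^ j) := by ring
      _ ≤ _ := by gcongr
  simp only [dyadicVar]
  rw [lintegral_tsum fun j => (Finset.measurable_fun_sum _ fun l _ =>
    ((hm _ _).const_mul _).pow_const _).aemeasurable]
  refine (ENNReal.tsum_le_tsum hj).trans ?_
  rw [ENNReal.tsum_mul_left, ENNReal.tsum_geometric, ← ENNReal.ofReal_one,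
    ← ENNReal.ofReal_sub _ (by norm_num), ← ENNReal.ofReal_inv_of_pos (by norm_num),
    ← ENNReal.ofReal_mul (by positivity)]
  refine ENNReal.ofReal_le_ofReal (le_of_eq ?_)
  norm_num; ring

/-- The Hölder constant of a mode. -/
def holderConst {N : ℕ} (U : ℝ → Mode N → Ω → ℂ) (T : ℝ) (n : ℕ) (a : Mode N) (ω : Ω) : ℝ :=
  (dyadicVar U T n a ω).toReal ^ ((2 * n : ℕ) : ℝ)⁻¹

lemma holderConst_nonneg {N : ℕ} (U : ℝ → Mode N → Ω → ℂ) (T : ℝ) (n : ℕ) (a : Mode N) (ω : Ω) :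
    0 ≤ holderConst U T n a ω := Real.rpow_nonneg ENNReal.toReal_nonneg _

/-- A single term of the series is bounded by its sum; the hypothesis of finiteness matters because
`holderConst` passes through `toReal`, which sends ∞ to 0. -/
lemma increment_le_holderConst {N : ℕ} {U : ℝ → Mode N → Ω → ℂ} {T : ℝ} {n : ℕ} (hn : n ≠ 0)
    {a : Mode N} {ω : Ω} (h : dyadicVar U T n a ω ≠ ∞) {j l : ℕ} (hl : l < 2 ^ j) :
    ‖U (T * ((l + 1 : ℕ) / 2 ^ j)) a ω - U (T * (l / 2 ^ j)) a ω‖ ≤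
      holderConst U T n a ω * (4 / 5) ^ j := by
  have hn' : 2 * n ≠ 0 := by omega
  set d := ‖U (T * ((l + 1 : ℕ) / 2 ^ j)) a ω - U (T * (l / 2 ^ j)) a ω‖ with hd
  have h1 : (ENNReal.ofReal ((5 / 4) ^ j) * ENNReal.ofReal d) ^ (2 * n) ≤ dyadicVar U T n a ω := by
    rw [hd, ofReal_norm]
    exact (Finset.single_le_sum (f := fun l : ℕ => (ENNReal.ofReal ((5 / 4) ^ j) *
      ‖U (T * ((l + 1 : ℕ) / 2 ^ j)) a ω - U (T * (l / 2 ^ j)) a ω‖ₑ) ^ (2 * n))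
      (fun _ _ => bot_le) (Finset.mem_range.2 hl)).trans (ENNReal.le_tsum j)
  rw [← ENNReal.ofReal_mul (by positivity), ← ENNReal.ofReal_pow (by positivity),
    ENNReal.ofReal_le_iff_le_toReal h] at h1
  have h2 : (5 / 4) ^ j * d ≤ holderConst U T n a ω := by
    rw [holderConst]
    calc (5 / 4) ^ j * d = (((5 / 4) ^ j * d) ^ (2 * n)) ^ ((2 * n : ℕ) : ℝ)⁻¹ :=
          (Real.pow_rpow_inv_natCast (by positivity) hn').symm
      _ ≤ _ := Real.rpow_le_rpow (by positivity) h1 (by positivity)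
  have h3 : (4 / 5 : ℝ) ^ j * (5 / 4) ^ j = 1 := by rw [← mul_pow]; norm_num
  calc d = (4 / 5 : ℝ) ^ j * ((5 / 4) ^ j * d) := by rw [← mul_assoc, h3, one_mul]
    _ ≤ (4 / 5 : ℝ) ^ j * holderConst U T n a ω := by gcongr
    _ = _ := mul_comm _ _

lemma IsRegularOU.measurable_holderConst {N : ℕ} {U : ℝ → Mode N → Ω → ℂ}
    (hU : IsRegularOU N U P) (T : ℝ) (n : ℕ) (a : Mode N) : Measurable (holderConst U T n a) :=
  (hU.measurable_dyadicVar T n a).ennreal_toReal.pow_const _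

lemma IsRegularOU.eLpNorm_holderConst_le {N : ℕ} {U : ℝ → Mode N → Ω → ℂ} (hU : IsRegularOU N U P)
    {T : ℝ} (hT : 0 ≤ T) {n : ℕ} (hn : 3 ≤ n) (a : Mode N) :
    eLpNorm (holderConst U T n a) ((2 * n : ℕ) : ℝ≥0∞) P ≤
      ENNReal.ofReal (1 + 25 * (momentConst n * T ^ n)) := by
  have hG := momentConst_nonneg n
  refine eLpNorm_le_one_add (by omega) (by positivity) ?_
  refine (lintegral_mono fun ω => ?_).trans (hU.lintegral_dyadicVar_le hT hn a)
  rw [Real.enorm_of_nonneg (holderConst_nonneg U T n a ω), ← ENNReal.ofReal_pow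
    (holderConst_nonneg U T n a ω), holderConst, Real.rpow_inv_natCast_pow ENNReal.toReal_nonneg
    (by omega)]
  exact ENNReal.ofReal_toReal_le

/-- A common bound for the modes and their moduli of continuity on `[0, T]`. -/
def pathBound {N : ℕ} (U : ℝ → Mode N → Ω → ℂ) (T : ℝ) (n : ℕ) (ω : Ω) : ℝ :=
  ∑ a : Mode N, (‖U 0 a ω‖ + 5 * holderConst U T n a ω)

lemma pathBound_nonneg {N : ℕ} (U : ℝ → Mode N → Ω → ℂ) (T : ℝ) (n : ℕ) (ω : Ω) :
    0 ≤ pathBound U T n ω := Finset.sum_nonneg fun a _ => by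
  have := holderConst_nonneg U T n a ω; positivity

lemma IsRegularOU.measurable_pathBound {N : ℕ} {U : ℝ → Mode N → Ω → ℂ} (hU : IsRegularOU N U P)
    (T : ℝ) (n : ℕ) : Measurable (pathBound U T n) :=
  Finset.measurable_fun_sum _ fun a _ =>
    (hU.measurable 0 a).norm.add ((hU.measurable_holderConst T n a).const_mul 5)

/-- One random variable serves all modes, all times and all dyadic levels m, so the mesh can still
be chosen afterwards in terms of N. -/
lemma IsRegularOU.ae_pathBound {N : ℕ} {U : ℝ → Mode N → Ω → ℂ} (hU : IsRegularOU N U P)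
    {T : ℝ} (hT : 0 ≤ T) {n : ℕ} (hn : 3 ≤ n) : ∀ᵐ ω ∂P, ∀ a, ∀ τ ∈ Set.Icc (0 : ℝ) 1,
      ‖U (T * τ) a ω‖ ≤ pathBound U T n ω ∧ ∀ m,
        ‖U (T * τ) a ω - U (T * dyadicFloor m τ) a ω‖ ≤ pathBound U T n ω * (4 / 5) ^ m := by
  have h1 : ∀ᵐ ω ∂P, ∀ a, dyadicVar U T n a ω ≠ ∞ := ae_all_iff.2 fun a => by
    filter_upwards [ae_lt_top (hU.measurable_dyadicVar T n a)
      ((hU.lintegral_dyadicVar_le hT hn a).trans_lt ENNReal.ofReal_lt_top).ne] with ω hω using hω.ne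
  filter_upwards [h1] with ω hω a τ hτ
  have h0 := holderConst_nonneg U T n a ω
  have hc : Continuous fun τ => U (T * τ) a ω :=
    (hU.continuous_path a ω).comp (continuous_const.mul continuous_id)
  have hinc := fun j l (hl : l < 2 ^ j) =>
    increment_le_holderConst (U := U) (T := T) (by omega : n ≠ 0) (hω a) hl
  have hle : ‖U 0 a ω‖ + 5 * holderConst U T n a ω ≤ pathBound U T n ω :=
    Finset.single_le_sum (f := fun a => ‖U 0 a ω‖ + 5 * holderConst U T n a ω)
      (fun a _ => by have := holderConst_nonneg U T n a ω; positivity) (Finset.mem_univ a)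
  refine ⟨?_, fun m => ?_⟩
  · have := norm_le_of_dyadic hc h0 hinc hτ
    rw [mul_zero] at this
    exact this.trans hle
  · refine (norm_sub_dyadicFloor_le hc h0 hinc hτ m).trans ?_
    have : 4 * holderConst U T n a ω ≤ pathBound U T n ω := by
      linarith [norm_nonneg (U 0 a ω)]
    gcongr

lemma IsRegularOU.eLpNorm_pathBound_le {N : ℕ} (hN : 1 ≤ N) {U : ℝ → Mode N → Ω → ℂ}
    (hU : IsRegularOU N U P) {T : ℝ} (hT : 0 ≤ T) {n : ℕ} (hn : 3 ≤ n) :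
    eLpNorm (pathBound U T n) ((2 * n : ℕ) : ℝ≥0∞) P ≤
      ENNReal.ofReal (27 * (6 + momentConst n * (2 ^ n + 125 * T ^ n)) * N ^ 3) := by
  have hG := momentConst_nonneg n
  have h1n : (1 : ℝ≥0∞) ≤ ((2 * n : ℕ) : ℝ≥0∞) := by
    have : 1 ≤ 2 * n := by omega
    exact_mod_cast this
  have hmU : ∀ a, AEStronglyMeasurable (fun ω => ‖U 0 a ω‖) P := fun a =>
    (hU.measurable 0 a).norm.aestronglyMeasurable
  have hmH : ∀ a, AEStronglyMeasurable (fun ω => 5 * holderConst U T n a ω) P := fun a =>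
    ((hU.measurable_holderConst T n a).const_mul 5).aestronglyMeasurable
  have h0 : ∀ a, eLpNorm (fun ω => ‖U 0 a ω‖) ((2 * n : ℕ) : ℝ≥0∞) P ≤
      ENNReal.ofReal (1 + momentConst n * 2 ^ n) := by
    intro a
    rw [eLpNorm_norm]
    refine eLpNorm_le_one_add (by omega) (by positivity) ?_
    rw [lintegral_enorm_pow_eq (hU.isModeGaussian.allLp 0 a)]
    refine ENNReal.ofReal_le_ofReal ?_
    exact integral_norm_pow_le_of_gaussian
      (hU.isModeGaussian.gaussian.hasGaussianLaw_eval (0, a)) (hU.isModeGaussian.mean 0 a)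
      ((hU.variance 0 a).le.trans (modeVar_le_two a)) n
  have h2 : ∀ a, eLpNorm (fun ω => 5 * holderConst U T n a ω) ((2 * n : ℕ) : ℝ≥0∞) P ≤
      ENNReal.ofReal (5 * (1 + 25 * (momentConst n * T ^ n))) := by
    intro a
    refine (eLpNorm_const_smul_le (c := (5 : ℝ)) (f := holderConst U T n a)).trans ?_
    rw [Real.enorm_of_nonneg (by norm_num), ENNReal.ofReal_mul (by norm_num)]
    exact mul_le_mul_right (hU.eLpNorm_holderConst_le hT hn a) _
  have e : pathBound U T n = ∑ a : Mode N, fun ω => ‖U 0 a ω‖ + 5 * holderConst U T n a ω := by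
    funext ω; rw [pathBound, Finset.sum_apply]
  rw [e]
  refine (eLpNorm_sum_le (fun a _ => (hmU a).add (hmH a)) h1n).trans ?_
  have h3 : ∀ a ∈ (Finset.univ : Finset (Mode N)),
      eLpNorm (fun ω => ‖U 0 a ω‖ + 5 * holderConst U T n a ω) ((2 * n : ℕ) : ℝ≥0∞) P ≤
      ENNReal.ofReal (6 + momentConst n * (2 ^ n + 125 * T ^ n)) := fun a _ => by
    refine (eLpNorm_add_le (hmU a) (hmH a) h1n).trans ((add_le_add (h0 a) (h2 a)).trans ?_)
    rw [← ENNReal.ofReal_add (by positivity) (by positivity)]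
    exact ENNReal.ofReal_le_ofReal (by linarith)
  refine (Finset.sum_le_sum h3).trans ?_
  rw [Finset.sum_const, Finset.card_univ, nsmul_eq_mul, ← ENNReal.ofReal_natCast,
    ← ENNReal.ofReal_mul (by positivity)]
  refine ENNReal.ofReal_le_ofReal ?_
  calc _ ≤ 27 * (N : ℝ) ^ 3 * (6 + momentConst n * (2 ^ n + 125 * T ^ n)) := by
        have := card_mode_le hN
        gcongr
    _ = _ := by ring

end PathBound

/-! ### A grid on the torus -/

section SpaceGrid

lemma norm_char_sub_le (k : Freq) (x y : Fin 3 → ℝ) :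
    ‖char k x - char k y‖ ≤ Real.pi * ∑ j, |(k j : ℝ)| * |x j - y j| := by
  set a : ℝ := Real.pi * ∑ j, (k j : ℝ) * x j with ha
  set b : ℝ := Real.pi * ∑ j, (k j : ℝ) * y j with hb
  have e : char k x - char k y = char k y * (Complex.exp (Complex.I * ((a - b : ℝ) : ℂ)) - 1) := by
    rw [mul_sub, mul_one]
    congr 1
    rw [char, char, ← ha, ← hb, ← Complex.exp_add]
    congr 1
    push_cast; ring
  rw [e, norm_mul, norm_char, one_mul]
  refine (Real.norm_exp_I_mul_ofReal_sub_one_le).trans ?_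
  rw [ha, hb, ← mul_sub, ← Finset.sum_sub_distrib, norm_mul, Real.norm_of_nonneg Real.pi_pos.le]
  gcongr
  refine (norm_sum_le _ _).trans (Finset.sum_le_sum fun j _ => ?_)
  rw [← mul_sub, norm_mul, Real.norm_eq_abs, Real.norm_eq_abs]

lemma char_add_two_mul (k m : Freq) (x : Fin 3 → ℝ) :
    char k (fun j => x j + 2 * m j) = char k x := by
  have e : Complex.I * ((Real.pi * ∑ j, (k j : ℝ) * (x j + 2 * m j) : ℝ) : ℂ) =
      Complex.I * ((Real.pi * ∑ j, (k j : ℝ) * x j : ℝ) : ℂ) +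
        ((∑ j, k j * m j : ℤ) : ℂ) * (2 * Real.pi * Complex.I) := by
    push_cast
    simp only [mul_add, Finset.sum_add_distrib, Finset.mul_sum, Finset.sum_mul]
    congr 1
    exact Finset.sum_congr rfl fun j _ => by ring
  rw [char, e, Complex.exp_add, Complex.exp_int_mul_two_pi_mul_I, mul_one, char]

/-- The points of a dyadic grid of mesh `2⁻ᵐ` on the torus. -/
def gridPoint (m : ℕ) (l : Fin 3 → Fin (2 ^ (m + 1))) : Fin 3 → ℝ := fun j => (l j : ℝ) / 2 ^ m

/-- Round 2^m x down and reduce modulo 2^{m+1}, which is a translation by a period. The spatial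
error 2^{-m} is weakened to (4/5)^m to match the error in time; 12 bounds 3π. -/
lemma exists_gridPoint (m : ℕ) (x : Fin 3 → ℝ) : ∃ l, ∀ {K : ℕ} {k : Freq}, inBox K k →
    ‖char k x - char k (gridPoint m l)‖ ≤ 12 * K * (4 / 5) ^ m := by
  have hpos : (0 : ℤ) < 2 ^ (m + 1) := by positivity
  have h2 : (0 : ℝ) < 2 ^ m := by positivity
  set z : Fin 3 → ℤ := fun j => ⌊(2 : ℝ) ^ m * x j⌋ with hz
  have hlt : ∀ j, (z j % 2 ^ (m + 1)).toNat < 2 ^ (m + 1) := fun j => by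
    have h1 := Int.emod_nonneg (z j) hpos.ne'
    have h3 := Int.emod_lt_of_pos (z j) hpos
    zify
    rwa [Int.toNat_of_nonneg h1]
  set l : Fin 3 → Fin (2 ^ (m + 1)) := fun j => ⟨(z j % 2 ^ (m + 1)).toNat, hlt j⟩ with hl
  refine ⟨l, fun {K k} hk => ?_⟩
  have hz' : (fun j => gridPoint m l j + 2 * ((z j / 2 ^ (m + 1) : ℤ) : ℝ)) =
      fun j => (z j : ℝ) / 2 ^ m := by
    funext j
    have h1 : ((l j : ℕ) : ℝ) = ((z j % 2 ^ (m + 1) : ℤ) : ℝ) := by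
      have : ((l j : ℕ) : ℤ) = z j % 2 ^ (m + 1) := by
        simp only [hl]; exact Int.toNat_of_nonneg (Int.emod_nonneg (z j) hpos.ne')
      exact_mod_cast this
    have h3 : ((z j % 2 ^ (m + 1) : ℤ) : ℝ) + 2 ^ (m + 1) * ((z j / 2 ^ (m + 1) : ℤ) : ℝ) = z j := by
      exact_mod_cast Int.emod_add_mul_ediv (z j) (2 ^ (m + 1))
    have h4 : (2 : ℝ) ^ (m + 1) = 2 ^ m * 2 := pow_succ _ _
    rw [h4] at h3
    rw [gridPoint, h1, eq_div_iff h2.ne', add_mul, div_mul_cancel₀ _ h2.ne']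
    linarith
  rw [← char_add_two_mul k (fun j => z j / 2 ^ (m + 1)) (gridPoint m l), hz']
  refine (norm_char_sub_le k _ _).trans ?_
  have hd : ∀ j, |x j - (z j : ℝ) / 2 ^ m| ≤ (4 / 5) ^ m := fun j => by
    have h1 := Int.floor_le ((2 : ℝ) ^ m * x j)
    have h3 := Int.lt_floor_add_one ((2 : ℝ) ^ m * x j)
    have h4 : x j - (z j : ℝ) / 2 ^ m = (2 ^ m * x j - z j) * (1 / 2) ^ m := by
      rw [one_div, inv_pow]; field_simp
    have h5 : (1 / 2 : ℝ) ^ m ≤ (4 / 5) ^ m := pow_le_pow_left₀ (by norm_num) (by norm_num) m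
    rw [h4, abs_mul, abs_of_nonneg (by simp only [hz]; linarith), abs_of_nonneg (by positivity)]
    refine (mul_le_of_le_one_left (by positivity) ?_).trans h5
    simp only [hz]; linarith
  have hK : ∀ j, |(k j : ℝ)| ≤ K := fun j => by exact_mod_cast hk j
  calc Real.pi * ∑ j, |(k j : ℝ)| * |x j - (z j : ℝ) / 2 ^ m|
      ≤ Real.pi * ∑ _j : Fin 3, (K : ℝ) * (4 / 5) ^ m := by
        have := Real.pi_pos
        gcongr with j
        · exact hK j
        · exact hd j
    _ = Real.pi * (3 * (K * (4 / 5) ^ m)) := by simp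
    _ ≤ 4 * (3 * (K * (4 / 5) ^ m)) := by
        gcongr
        exact Real.pi_le_four
    _ = _ := by ring

end SpaceGrid

/-! ### Comparison of the square function with its values on the grid -/

section Transfer

variable {N J Γ A : ℕ} {B : Finset Freq} {c : ℕ → ℕ → Freq → Freq → Freq → ℂ}

/-- Translation of the kernel by `x`. -/
def twist (M : Freq → Freq → ℂ) (x : Fin 3 → ℝ) (k l : Freq) : ℂ := M k l * char (k + l) x

lemma char_zero_right (k : Freq) : char k 0 = 1 := by simp [char]

/-- The dependence on k₁ in the character is a phase, invisible to the square function, and the rest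
can be absorbed into the coefficients. Moving x is thereby a perturbation of the coefficients, just
as moving t. -/
lemma squareFun_twist (α : ℝ) (M : Freq → Freq → ℂ) (q : ℕ) (x : Fin 3 → ℝ) :
    squareFun A J α c B M q x = squareFun A J α c B (twist M x) q 0 := by
  have h : ∀ i k, ‖gker c B M q i x k‖ = ‖gker c B (twist M x) q i 0 k‖ := fun i k => by
    have e : gker c B M q i x k = char k x * gker c B (twist M x) q i 0 k := by
      rw [gker, gker, Finset.mul_sum]
      refine Finset.sum_congr rfl fun a _ => ?_
      rw [Finset.mul_sum]
      refine Finset.sum_congr rfl fun b _ => ?_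
      rw [twist, char_zero_right, add_assoc k a b, char_add k]; ring
    rw [e, norm_mul, norm_char, one_mul]
  simp only [squareFun, h]

lemma sqrt_sum_sq_add_le {ι : Type*} (s : Finset ι) (f g : ι → ℂ) :
    √(∑ k ∈ s, ‖f k + g k‖ ^ 2) ≤ √(∑ k ∈ s, ‖f k‖ ^ 2) + √(∑ k ∈ s, ‖g k‖ ^ 2) := by
  have h := norm_add_le (WithLp.toLp 2 fun k : s => f k : EuclideanSpace ℂ s)
    (WithLp.toLp 2 fun k : s => g k)
  rw [EuclideanSpace.norm_eq, EuclideanSpace.norm_eq, EuclideanSpace.norm_eq] at h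
  simp only [PiLp.add_apply] at h
  rwa [Finset.sum_coe_sort s (fun k => ‖f k + g k‖ ^ 2), Finset.sum_coe_sort s (fun k => ‖f k‖ ^ 2),
    Finset.sum_coe_sort s (fun k => ‖g k‖ ^ 2)] at h

lemma squareFun_le_add (α : ℝ) (M M' : Freq → Freq → ℂ) (q : ℕ) (x : Fin 3 → ℝ) :
    squareFun A J α c B M q x ≤ squareFun A J α c B M' q x +
      squareFun A J α c B (fun k l => M k l - M' k l) q x := by
  simp only [squareFun]
  rw [← Finset.sum_add_distrib]
  refine Finset.sum_le_sum fun i _ => ?_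
  rw [← mul_add]
  refine mul_le_mul_of_nonneg_left ?_ (by positivity)
  refine le_trans (le_of_eq ?_) (sqrt_sum_sq_add_le _ _ _)
  congr 1
  refine Finset.sum_congr rfl fun k _ => ?_
  congr 2
  simp only [gker]
  rw [← Finset.sum_add_distrib]
  refine Finset.sum_congr rfl fun a _ => ?_
  rw [← Finset.sum_add_distrib]
  exact Finset.sum_congr rfl fun b _ => by ring

lemma coefSum_le {R : ℝ} (hN : 1 ≤ N) {M : Freq → Freq → ℂ}
    (h : ∀ k ∈ boxF (5 * N), ∀ l ∈ boxF (5 * N), ‖M k l‖ ≤ R) (hR : 0 ≤ R) :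
    coefSum (boxF (5 * N)) M ≤ 2 * 10 ^ 6 * N ^ 6 * R := by
  have hcard : ((boxF (5 * N)).card : ℝ) ≤ 1331 * N ^ 3 := by
    rw [card_boxF]
    have : 2 * (5 * N) + 1 ≤ 11 * N := by omega
    calc (((2 * (5 * N) + 1) ^ 3 : ℕ) : ℝ) ≤ ((11 * N) ^ 3 : ℕ) := by
          exact_mod_cast Nat.pow_le_pow_left this 3
      _ = _ := by push_cast; ring
  calc coefSum (boxF (5 * N)) M ≤ ∑ _k ∈ boxF (5 * N), ∑ _l ∈ boxF (5 * N), R :=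
        Finset.sum_le_sum fun k hk => Finset.sum_le_sum fun l hl => h k hk l hl
    _ = (boxF (5 * N)).card * ((boxF (5 * N)).card * R) := by simp
    _ ≤ 1331 * N ^ 3 * (1331 * N ^ 3 * R) := by gcongr
    _ = 1771561 * (N ^ 6 * R) := by ring
    _ ≤ _ := by nlinarith [mul_nonneg (by positivity : (0 : ℝ) ≤ (N : ℝ) ^ 6) hR]

/-- Comparison of the square function with its values on a grid in time and space. -/
theorem GoodKernel.squareFun_le_grid (hN : 1 ≤ N) (hc : GoodKernel N J Γ A (boxF (5 * N)) c)
    (hΓ : 1 ≤ Γ) (hA : A ≤ Γ) (hJ : 2 ^ J ≤ Γ * N) {δ : ℝ} (hδ : 0 < δ) (hδ' : δ < 1 / 4)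
    {p : ℝ → Mode N → ℂ} (hpc : ∀ a, Continuous fun s => p s a) {S T : ℝ} (hS : 0 ≤ S)
    (hT : 0 ≤ T) {m : ℕ} (hp : ∀ a, ∀ τ ∈ Set.Icc (0 : ℝ) 1, ‖p (T * τ) a‖ ≤ S ∧
      ‖p (T * τ) a - p (T * dyadicFloor m τ) a‖ ≤ S * (4 / 5) ^ m)
    {t : ℝ} (ht : t ∈ Set.Icc 0 T) (x : Fin 3 → ℝ) : ∃ (i : Fin (2 ^ m + 1))
      (l : Fin 3 → Fin (2 ^ (m + 1))), ∀ q : ℕ, (2 : ℝ) ^ (((q : ℝ) - 1) * (-1 / 2 - 2 * δ)) *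
        squareFun A J (1 - δ) c (boxF (5 * N)) (mCoef N p t) q x ≤
      (2 : ℝ) ^ (((q : ℝ) - 1) * (-1 / 2 - 2 * δ)) *
        squareFun A J (1 - δ) c (boxF (5 * N)) (mCoef N p (T * (i / 2 ^ m))) q (gridPoint m l) +
      10 ^ 21 * Γ ^ 6 * (1 + T) ^ 2 * N ^ 23 * (1 + S) ^ 4 * (4 / 5) ^ m := by
  obtain ⟨τ, hτ, rfl⟩ : ∃ τ ∈ Set.Icc (0 : ℝ) 1, T * τ = t := by
    rcases hT.eq_or_lt with rfl | hT'
    · exact ⟨0, by simp, by rw [mul_zero]; exact le_antisymm ht.1 ht.2⟩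
    · exact ⟨t / T, ⟨div_nonneg ht.1 hT, (div_le_one hT').2 ht.2⟩, mul_div_cancel₀ _ hT'.ne'⟩
  set h : ℝ := (4 / 5) ^ m with hh
  have hh0 : 0 ≤ h := by positivity
  obtain ⟨l, hl⟩ := exists_gridPoint m x
  have hi : ⌊(2 : ℝ) ^ m * τ⌋₊ < 2 ^ m + 1 := by
    rw [Nat.lt_succ_iff]
    refine Nat.floor_le_of_le ?_
    push_cast
    exact mul_le_of_le_one_right (by positivity) hτ.2
  refine ⟨⟨⌊(2 : ℝ) ^ m * τ⌋₊, hi⟩, l, fun q => ?_⟩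
  change _ ≤ _ * squareFun A J (1 - δ) c (boxF (5 * N)) (mCoef N p (T * dyadicFloor m τ)) q
    (gridPoint m l) + _
  set t := T * τ with ht_def
  set t' := T * dyadicFloor m τ with ht'_def
  have hτ' : dyadicFloor m τ ≤ τ := dyadicFloor_le m hτ.1
  have ht' : t' ∈ Set.Icc 0 T := ⟨mul_nonneg hT (dyadicFloor_nonneg _ _),
    mul_le_of_le_one_right hT (hτ'.trans hτ.2)⟩
  have htt : t' ≤ t := mul_le_mul_of_nonneg_left hτ' hT
  have hth : t - t' ≤ T * h := by
    rw [ht_def, ht'_def, ← mul_sub]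
    refine mul_le_mul_of_nonneg_left ((sub_dyadicFloor_le m τ).trans ?_) hT
    rw [← inv_pow]
    exact pow_le_pow_left₀ (by norm_num) (by norm_num) m
  have hpS : ∀ s ∈ Set.Icc 0 T, ∀ a, ‖p s a‖ ≤ S := by
    intro s hs a
    rcases hT.eq_or_lt with h0 | hT'
    · have := (hp a 0 (by simp)).1
      rw [← h0] at hs
      rw [mul_zero] at this
      rwa [le_antisymm hs.2 hs.1]
    · have := (hp a (s / T) ⟨div_nonneg hs.1 hT, (div_le_one hT').2 hs.2⟩).1
      rwa [mul_div_cancel₀ _ hT'.ne'] at this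
  have hX := xBound_nonneg N S
  have hN' : (1 : ℝ) ≤ N := by exact_mod_cast hN
  -- The constant adds 27 from the change of time and 120 from the change of the character at
  -- frequencies up to 10N.
  have hdiff : ∀ k ∈ boxF (5 * N), ∀ l' ∈ boxF (5 * N),
      ‖twist (mCoef N p t) x k l' - twist (mCoef N p t') (gridPoint m l) k l'‖ ≤
      147 * (1 + T) ^ 2 * N ^ 2 * xBound N S ^ 2 * h := by
    intro k hk l' hl'
    have hkl : inBox (10 * N) (k + l') := fun j => by
      have h1 := mem_boxF.1 hk j
      have h2 := mem_boxF.1 hl' j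
      have := abs_add_le (k j) (l' j)
      rw [Pi.add_apply]
      push_cast at h1 h2 ⊢
      omega
    have h1 := norm_mCoef_sub_le hN hpc hS hh0 hpS ht ht' htt hth
      (fun a => (hp a τ hτ).2) k l'
    have h2 := hl hkl
    have h3 := norm_mCoef_le hN hS hpS ht' k l'
    have e : twist (mCoef N p t) x k l' - twist (mCoef N p t') (gridPoint m l) k l' =
        (mCoef N p t k l' - mCoef N p t' k l') * char (k + l') x +
        mCoef N p t' k l' * (char (k + l') x - char (k + l') (gridPoint m l)) := by
      rw [twist, twist]; ring
    rw [e]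
    refine (norm_add_le _ _).trans ?_
    rw [norm_mul, norm_char, mul_one, norm_mul]
    refine (add_le_add h1 (mul_le_mul h3 h2 (norm_nonneg _) (by positivity))).trans ?_
    have h4 : T * (12 * ((10 * N : ℕ) : ℝ)) ≤ 120 * (1 + T) ^ 2 * N ^ 2 := by
      push_cast
      have h5 : T ≤ (1 + T) ^ 2 := by nlinarith
      have h6 : (N : ℝ) ≤ N ^ 2 := by nlinarith
      have := mul_le_mul h5 h6 (by positivity) (by positivity)
      nlinarith
    calc _ = (27 * (1 + T) ^ 2 * N ^ 2 + T * (12 * ((10 * N : ℕ) : ℝ))) *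
          (xBound N S ^ 2 * h) := by ring
      _ ≤ (27 * (1 + T) ^ 2 * N ^ 2 + 120 * (1 + T) ^ 2 * N ^ 2) * (xBound N S ^ 2 * h) := by
          gcongr
      _ = _ := by ring
  rw [squareFun_twist, squareFun_twist _ _ _ (gridPoint m l)]
  refine (mul_le_mul_of_nonneg_left (squareFun_le_add _ _ (twist (mCoef N p t') (gridPoint m l))
    q 0) (by positivity)).trans ?_
  rw [mul_add]
  refine add_le_add le_rfl ((hc.weighted_squareFun_le hΓ hA hJ hδ hδ' _ q 0).trans ?_)
  have hV := coefSum_le hN hdiff (by positivity)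
  -- The power of N is 3 + 6 + 2 + 12, the last from the square of `xBound`, which also gives the
  -- fourth power of 1 + S.
  calc _ ≤ 36 * Γ ^ 6 * N ^ 3 * (2 * 10 ^ 6 * N ^ 6 *
        (147 * (1 + T) ^ 2 * N ^ 2 * xBound N S ^ 2 * h)) := by gcongr
    _ = 36 * 2 * 10 ^ 6 * 147 * 40000 ^ 2 *
        (Γ ^ 6 * (1 + T) ^ 2 * N ^ 23 * (1 + S) ^ 4 * h) := by rw [xBound]; ring
    _ ≤ 10 ^ 21 * (Γ ^ 6 * (1 + T) ^ 2 * N ^ 23 * (1 + S) ^ 4 * h) := by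
        gcongr
        norm_num
    _ = _ := by ring

end Transfer

/-! ### Moments of the operator norm via the grid -/

section Moments

variable {Ω : Type*} [MeasurableSpace Ω] {P : Measure Ω} [IsProbabilityMeasure P]

lemma lintegral_rpow_le_of_exponent_le {X : Ω → ℝ≥0∞} (hX : AEMeasurable X P) {r s : ℝ}
    (hr : 0 < r) (hrs : r ≤ s) :
    (∫⁻ ω, X ω ^ r ∂P) ^ (1 / r) ≤ (∫⁻ ω, X ω ^ s ∂P) ^ (1 / s) := by
  have := eLpNorm'_le_eLpNorm'_of_exponent_le hr hrs P hX.aestronglyMeasurable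
  simpa [eLpNorm'] using this

/-- The indices of the grid: times, points, and Littlewood–Paley blocks. -/
abbrev GridIndex (m Q : ℕ) : Type :=
  Fin (2 ^ m + 1) × (Fin 3 → Fin (2 ^ (m + 1))) × Fin Q

variable {D : DyadicPartition} {N J Γ A : ℕ} {c : ℕ → ℕ → Freq → Freq → Freq → ℂ}

/-- The weighted square function at a point of the grid. -/
def gridFun (N A J m : ℕ) (c : ℕ → ℕ → Freq → Freq → Freq → ℂ) (δ T : ℝ) {Q : ℕ}
    (p : ℝ → Mode N → ℂ) (g : GridIndex m Q) : ℝ :=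
  (2 : ℝ) ^ ((((g.2.2 : ℕ) : ℝ) - 1) * (-1 / 2 - 2 * δ)) *
    squareFun A J (1 - δ) c (boxF (5 * N)) (mCoef N p (T * ((g.1 : ℕ) / 2 ^ m))) g.2.2
      (gridPoint m g.2.1)

lemma gridFun_nonneg {m Q : ℕ} {δ T : ℝ} (p : ℝ → Mode N → ℂ) (g : GridIndex m Q) :
    0 ≤ gridFun N A J m c δ T p g :=
  mul_nonneg (by positivity) (Finset.sum_nonneg fun _ _ => by positivity)

/-- The operator norm along a path is controlled by the values on the grid. -/
lemma GoodKernel.pathOpNorm_le_grid (hN : 1 ≤ N) (hD : D.Bound A)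
    (hc : GoodKernel N J Γ A (boxF (5 * N)) c) (hΓ : 1 ≤ Γ) (hA : A ≤ Γ) (hJ : 2 ^ J ≤ Γ * N)
    {δ : ℝ} (hδ : 0 < δ) (hδ' : δ < 1 / 4) {p : ℝ → Mode N → ℂ}
    (hpc : ∀ a, Continuous fun s => p s a) {S T : ℝ} (hS : 0 ≤ S) (hT : 0 ≤ T) {m : ℕ}
    (hp : ∀ a, ∀ τ ∈ Set.Icc (0 : ℝ) 1, ‖p (T * τ) a‖ ≤ S ∧
      ‖p (T * τ) a - p (T * dyadicFloor m τ) a‖ ≤ S * (4 / 5) ^ m)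
    {L : ℝ → Coeff → Coeff} (hL : ∀ t, HasKernel D A J c (boxF (5 * N)) (mCoef N p t) (L t))
    {s : ℝ} (hs : 0 < s) :
    pathOpNorm D (1 - δ) (-1 / 2 - 2 * δ) T L ≤
      (∑ g : GridIndex m (Γ * N + 1), ‖gridFun N A J m c δ T p g‖ₑ ^ s) ^ (1 / s) +
      ENNReal.ofReal (10 ^ 21 * Γ ^ 6 * (1 + T) ^ 2 * N ^ 23 * (1 + S) ^ 4 * (4 / 5) ^ m) := by
  refine iSup₂_le fun t ht => ((hL t).opNorm_le hD _ _).trans (iSup₂_le fun q x => ?_)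
  by_cases hq : Γ * N < 2 ^ q
  · rw [hc.squareFun_eq_zero hq]; simp
  -- The crude count q < 2^q suffices here, since the number of grid indices only has to be
  -- polynomial in N.
  have hq' : q < Γ * N + 1 := by
    have := Nat.lt_two_pow_self (n := q); omega
  obtain ⟨i, l, h⟩ := hc.squareFun_le_grid hN hΓ hA hJ hδ hδ' hpc hS hT hp ht x
  refine (ENNReal.ofReal_le_ofReal (h q)).trans (ENNReal.ofReal_add_le.trans ?_)
  gcongr
  set g : GridIndex m (Γ * N + 1) := (i, l, ⟨q, hq'⟩)
  change ENNReal.ofReal (gridFun N A J m c δ T p g) ≤ _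
  rw [← Real.enorm_of_nonneg (gridFun_nonneg p g)]
  calc ‖gridFun N A J m c δ T p g‖ₑ = (‖gridFun N A J m c δ T p g‖ₑ ^ s) ^ (1 / s) := by
        rw [one_div, ENNReal.rpow_rpow_inv hs.ne']
    _ ≤ _ := by
        refine ENNReal.rpow_le_rpow ?_ (by positivity)
        exact Finset.single_le_sum (f := fun g => ‖gridFun N A J m c δ T p g‖ₑ ^ s)
          (fun _ _ => bot_le) (Finset.mem_univ g)

lemma IsRegularOU.eLpNorm_one_add_pathBound_le (hN : 1 ≤ N) {U : ℝ → Mode N → Ω → ℂ}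
    (hU : IsRegularOU N U P) {T : ℝ} (hT : 0 ≤ T) {n : ℕ} (hn : 3 ≤ n) :
    eLpNorm (fun ω => 1 + pathBound U T n ω) ((2 * n : ℕ) : ℝ≥0∞) P ≤
      ENNReal.ofReal ((1 + 27 * (6 + momentConst n * (2 ^ n + 125 * T ^ n))) * N ^ 3) := by
  have hG := momentConst_nonneg n
  have hN' : (1 : ℝ) ≤ N ^ 3 := one_le_pow₀ (by exact_mod_cast hN)
  have h1n : (1 : ℝ≥0∞) ≤ ((2 * n : ℕ) : ℝ≥0∞) := by
    have : 1 ≤ 2 * n := by omega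
    exact_mod_cast this
  refine (eLpNorm_add_le aestronglyMeasurable_const
    (hU.measurable_pathBound T n).aestronglyMeasurable h1n).trans ?_
  have h1 : eLpNorm (fun _ : Ω => (1 : ℝ)) ((2 * n : ℕ) : ℝ≥0∞) P ≤ ENNReal.ofReal 1 := by
    rw [eLpNorm_const _ (by exact_mod_cast (by omega : 2 * n ≠ 0)) (IsProbabilityMeasure.ne_zero P)]
    simp
  refine (add_le_add h1 (hU.eLpNorm_pathBound_le hN hT hn)).trans ?_
  rw [← ENNReal.ofReal_add (by norm_num) (by positivity)]
  exact ENNReal.ofReal_le_ofReal (by linarith)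

/-- Moments of the operator norm along a path, in terms of the mesh of the grid. -/
theorem IsRegularOU.moment_pathOpNorm_le (hN : 1 ≤ N) (hD : D.Bound A)
    {U : ℝ → Mode N → Ω → ℂ} (hU : IsRegularOU N U P)
    (hc : GoodKernel N J Γ A (boxF (5 * N)) c) (hΓ : 1 ≤ Γ) (hA : A ≤ Γ) (hJ : 2 ^ J ≤ Γ * N)
    {δ : ℝ} (hδ : 0 < δ) (hδ' : δ < 1 / 4) {T : ℝ} (hT : 0 ≤ T) {n : ℕ} (hn : n ≠ 0) (m : ℕ)
    {L : Ω → ℝ → Coeff → Coeff}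
    (hL : ∀ᵐ ω ∂P, ∀ t, HasKernel D A J c (boxF (5 * N)) (mCoef N (fun s a => U s a ω) t) (L ω t)) :
    (∫⁻ ω, pathOpNorm D (1 - δ) (-1 / 2 - 2 * δ) T (L ω) ^ ((2 * n : ℕ) : ℝ) ∂P) ^
        (1 / ((2 * n : ℕ) : ℝ)) ≤
      (Fintype.card (GridIndex m (Γ * N + 1)) : ℝ≥0∞) ^ (1 / ((2 * n : ℕ) : ℝ)) *
        ENNReal.ofReal (10 ^ 14 * Γ ^ 7 * wickConst n * (J * logSum N ^ 3) * (N : ℝ) ^ (-δ)) +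
      ENNReal.ofReal (10 ^ 21 * Γ ^ 6 * (1 + T) ^ 2 * N ^ 23 * (4 / 5) ^ m *
        ((1 + 27 * (6 + momentConst (4 * n) * (2 ^ (4 * n) + 125 * T ^ (4 * n)))) * N ^ 3) ^ 4) := by
  have hG := momentConst_nonneg (4 * n)
  have h2n : 2 * n ≠ 0 := by omega
  set s : ℝ := ((2 * n : ℕ) : ℝ) with hs
  -- The error term contains the fourth power of 1 + S, so its 2n-th moment needs the 8n-th moment
  -- of S. This is why the path bound is taken with parameter 4n.
  have hs0 : 0 < s := by rw [hs]; exact_mod_cast Nat.pos_of_ne_zero h2n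
  have hs1 : 1 ≤ s := by
    have : 1 ≤ 2 * n := by omega
    rw [hs]; exact_mod_cast this
  set S := pathBound U T (4 * n) with hS
  set E : ℝ := (1 + 27 * (6 + momentConst (4 * n) * (2 ^ (4 * n) + 125 * T ^ (4 * n)))) * N ^ 3
    with hE
  set κ : ℝ := 10 ^ 21 * Γ ^ 6 * (1 + T) ^ 2 * N ^ 23 * (4 / 5) ^ m with hκ
  have hκ0 : 0 ≤ κ := by positivity
  have hE0 : 0 ≤ E := by positivity
  set Φ : GridIndex m (Γ * N + 1) → Ω → ℝ := fun g ω =>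
    gridFun N A J m c δ T (fun s a => U s a ω) g with hΦ
  have hΦm : ∀ g, Measurable (Φ g) := fun g => (measurable_squareFun
    (measurable_mCoef hU.measurable hU.continuous_path _) _ _).const_mul _
  set F : Ω → ℝ≥0∞ := fun ω => (∑ g, ‖Φ g ω‖ₑ ^ s) ^ (1 / s) with hF
  set R : Ω → ℝ≥0∞ := fun ω => ENNReal.ofReal (κ * (1 + S ω) ^ 4) with hR
  have hSm : Measurable S := hU.measurable_pathBound T (4 * n)
  have hFm : Measurable F :=
    (Finset.measurable_fun_sum _ fun g _ => (hΦm g).enorm.pow_const s).pow_const _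
  have hRm : Measurable R := (((hSm.const_add 1).pow_const 4).const_mul κ).ennreal_ofReal
  have hle : ∀ᵐ ω ∂P, pathOpNorm D (1 - δ) (-1 / 2 - 2 * δ) T (L ω) ≤ (F + R) ω := by
    filter_upwards [hL, hU.ae_pathBound hT (by omega : 3 ≤ 4 * n)] with ω h1 h2
    refine (hc.pathOpNorm_le_grid hN hD hΓ hA hJ hδ hδ' (fun a => hU.continuous_path a ω)
      (pathBound_nonneg U T (4 * n) ω) hT (m := m)
      (fun a τ hτ => ⟨(h2 a τ hτ).1, (h2 a τ hτ).2 m⟩) h1 hs0).trans ?_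
    refine add_le_add le_rfl (ENNReal.ofReal_le_ofReal (le_of_eq ?_))
    rw [hκ, hS]; ring
  have h1 : (∫⁻ ω, pathOpNorm D (1 - δ) (-1 / 2 - 2 * δ) T (L ω) ^ s ∂P) ^ (1 / s) ≤
      (∫⁻ ω, (F + R) ω ^ s ∂P) ^ (1 / s) := by
    refine ENNReal.rpow_le_rpow (lintegral_mono_ae (hle.mono fun ω h => ?_)) (by positivity)
    exact ENNReal.rpow_le_rpow h hs0.le
  refine h1.trans ((ENNReal.lintegral_Lp_add_le hFm.aemeasurable hRm.aemeasurable hs1).trans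
    (add_le_add ?_ ?_))
  · have e : ∀ ω, F ω ^ s = ∑ g, ‖Φ g ω‖ₑ ^ s := fun ω => by
      rw [hF, one_div, ENNReal.rpow_inv_rpow hs0.ne']
    simp only [e]
    rw [lintegral_finsetSum _ fun g _ => (hΦm g).enorm.pow_const s]
    set b := ENNReal.ofReal (10 ^ 14 * Γ ^ 7 * wickConst n * (J * logSum N ^ 3) * (N : ℝ) ^ (-δ))
    have hg : ∀ g ∈ (Finset.univ : Finset (GridIndex m (Γ * N + 1))),
        -- The maximum over the grid is bounded by the ℓ^s norm, so only moments at fixed time,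
        -- point and block enter, and the grid costs its cardinality to the power 1/s.
        ∫⁻ ω, ‖Φ g ω‖ₑ ^ s ∂P ≤ b ^ s := fun g _ => by
      have := hU.eLpNorm_squareFun_le hN hc hΓ hA hJ hn
        (t := T * ((g.1 : ℕ) / 2 ^ m)) (by positivity) hδ hδ' g.2.2 (gridPoint m g.2.1)
      rw [eLpNorm_nat_le_iff h2n] at this
      simp only [hs, ENNReal.rpow_natCast]
      exact this
    calc (∑ g, ∫⁻ ω, ‖Φ g ω‖ₑ ^ s ∂P) ^ (1 / s)
        ≤ (∑ _g : GridIndex m (Γ * N + 1), b ^ s) ^ (1 / s) :=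
          ENNReal.rpow_le_rpow (Finset.sum_le_sum hg) (by positivity)
      _ = _ := by
          rw [Finset.sum_const, Finset.card_univ, nsmul_eq_mul,
            ENNReal.mul_rpow_of_nonneg _ _ (by positivity), one_div, ENNReal.rpow_rpow_inv hs0.ne']
  · rw [one_div, ENNReal.rpow_inv_le_iff hs0]
    have h2 := hU.eLpNorm_one_add_pathBound_le hN hT (by omega : 3 ≤ 4 * n)
    rw [eLpNorm_nat_le_iff (by omega)] at h2
    have e : ∀ ω, R ω ^ s = ENNReal.ofReal κ ^ (2 * n) * ‖1 + S ω‖ₑ ^ (2 * (4 * n)) := fun ω => by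
      have h0 : 0 ≤ S ω := pathBound_nonneg U T (4 * n) ω
      simp only [hR]
      rw [hs, ENNReal.rpow_natCast, ENNReal.ofReal_mul hκ0, mul_pow,
        Real.enorm_of_nonneg (by linarith), ENNReal.ofReal_pow (by linarith), ← pow_mul]
      congr 2; ring
    simp only [e]
    rw [lintegral_const_mul _ ((hSm.const_add 1).enorm.pow_const _), hs, ENNReal.rpow_natCast,
      ENNReal.ofReal_mul hκ0, mul_pow, ENNReal.ofReal_pow hE0, ← pow_mul]
    refine mul_le_mul_right (h2.trans (le_of_eq ?_)) _
    congr 1; ring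

end Moments

/-! ### Choice of the mesh and of the moment -/

section GridChoice

/-- The error carries N^{23} from the comparison and (N³)⁴ from the path bound, in total N^{35}; one
further power makes it at most N⁻¹. Since 2 ≤ (5/4)⁴, the number of points per direction is then of
order at most N^{144}. -/
lemma exists_mesh {N : ℕ} (hN : 1 ≤ N) : ∃ m : ℕ, (4 / 5 : ℝ) ^ m * N ^ 36 ≤ 1 ∧
    (2 : ℝ) ^ m ≤ 3 * N ^ 144 := by
  have hN' : (1 : ℝ) ≤ N := by exact_mod_cast hN
  obtain ⟨k, h1, h2⟩ := exists_nat_pow_near (x := (N : ℝ) ^ 36) (y := 5 / 4) (one_le_pow₀ hN')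
    (by norm_num)
  refine ⟨k + 1, ?_, ?_⟩
  · calc (4 / 5 : ℝ) ^ (k + 1) * N ^ 36 ≤ (4 / 5 : ℝ) ^ (k + 1) * (5 / 4) ^ (k + 1) := by gcongr
      _ = 1 := by rw [← mul_pow]; norm_num
  · calc (2 : ℝ) ^ (k + 1) ≤ ((5 / 4) ^ 4) ^ (k + 1) :=
          pow_le_pow_left₀ (by norm_num) (by norm_num) _
      _ = (5 / 4) ^ 4 * ((5 / 4) ^ k) ^ 4 := by rw [← pow_mul, ← pow_mul]; ring
      _ ≤ (5 / 4) ^ 4 * ((N : ℝ) ^ 36) ^ 4 := by gcongr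
      _ = (5 / 4) ^ 4 * (N : ℝ) ^ 144 := by rw [← pow_mul]
      _ ≤ 3 * N ^ 144 := by gcongr; norm_num

/-- One time and three space directions give N^{4·144}, and the blocks one more power: 577. -/
lemma card_gridIndex_le {N Γ m : ℕ} (hN : 1 ≤ N) (hΓ : 1 ≤ Γ) (hm : (2 : ℝ) ^ m ≤ 3 * N ^ 144) :
    (Fintype.card (GridIndex m (Γ * N + 1)) : ℝ) ≤ 2592 * Γ * N ^ 577 := by
  have hN' : (1 : ℝ) ≤ N := by exact_mod_cast hN
  have hΓ' : (1 : ℝ) ≤ Γ := by exact_mod_cast hΓ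
  have h2 : (1 : ℝ) ≤ 2 ^ m := one_le_pow₀ (by norm_num)
  have e : (Fintype.card (GridIndex m (Γ * N + 1)) : ℝ) =
      (2 ^ m + 1) * ((2 ^ m * 2) ^ 3 * (Γ * N + 1)) := by
    simp only [Fintype.card_prod, Fintype.card_fin, Fintype.card_pi, Finset.prod_const,
      Finset.card_univ, pow_succ 2 m]
    push_cast; ring
  rw [e]
  calc _ ≤ ((2 : ℝ) ^ m + 2 ^ m) * ((2 ^ m * 2) ^ 3 * (Γ * N + Γ * N)) := by
        gcongr
        nlinarith
    _ = 32 * Γ * N * ((2 : ℝ) ^ m) ^ 4 := by ring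
    _ ≤ 32 * Γ * N * (3 * N ^ 144) ^ 4 := by gcongr
    _ = _ := by ring

variable {Ω : Type*} [MeasurableSpace Ω]

/-- Moments of the operator norm along a path, uniformly in the lattice. -/
theorem exists_moment_pathOpNorm_le (P : Measure Ω) [IsProbabilityMeasure P]
    {D : DyadicPartition} {A Γ : ℕ} (hD : D.Bound A) (hΓA : 20 * A ≤ Γ) {δ : ℝ} (hδ : 0 < δ)
    (hδ' : δ < 1 / 4) {T : ℝ} (hT : 0 ≤ T) {η r : ℝ} (hη : 0 < η) (hr : 1 ≤ r) :
    ∃ C : ℝ, 0 ≤ C ∧ ∀ (N : ℕ) (U : ℝ → Mode N → Ω → ℂ) (c : ℕ → ℕ → Freq → Freq → Freq → ℂ)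
      (L : Ω → ℝ → Coeff → Coeff), 1 ≤ N → IsRegularOU N U P →
      GoodKernel N (levels A N) Γ A (boxF (5 * N)) c →
      (∀ᵐ ω ∂P, ∀ t, HasKernel D A (levels A N) c (boxF (5 * N))
        (mCoef N (fun s a => U s a ω) t) (L ω t)) →
      (∫⁻ ω, pathOpNorm D (1 - δ) (-1 / 2 - 2 * δ) T (L ω) ^ r ∂P) ^ (1 / r) ≤
        ENNReal.ofReal (C * (N : ℝ) ^ (-δ + η)) := by
  have hA1 : 1 ≤ A := hD.one_le
  have hΓ : 1 ≤ Γ := by omega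
  have hΓ' : (1 : ℝ) ≤ Γ := by exact_mod_cast hΓ
  obtain ⟨n, hn⟩ := exists_nat_ge (max r (577 / η))
  have hnr : r ≤ n := (le_max_left _ _).trans hn
  have hn0 : n ≠ 0 := by
    rintro rfl
    simp only [Nat.cast_zero] at hnr; linarith
  have hnp : (0 : ℝ) < n := by exact_mod_cast Nat.pos_of_ne_zero hn0
  have hnη : 577 / ((2 * n : ℕ) : ℝ) ≤ η / 2 := by
    have h1 : 577 / η ≤ n := (le_max_right _ _).trans hn
    rw [div_le_iff₀ hη] at h1
    push_cast
    rw [div_le_iff₀ (by positivity)]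
    linarith
  obtain ⟨C₁, hC₁, hlog⟩ := exists_levels_mul_logSum_le hA1 (by positivity : 0 < η / 2)
  have hw := wickConst_nonneg n
  have hG := momentConst_nonneg (4 * n)
  set E : ℝ := 1 + 27 * (6 + momentConst (4 * n) * (2 ^ (4 * n) + 125 * T ^ (4 * n))) with hE
  have hE0 : 0 ≤ E := by positivity
  set a₁ : ℝ := 2592 * Γ * (10 ^ 14 * Γ ^ 7 * wickConst n * C₁) with ha₁
  set a₂ : ℝ := 10 ^ 21 * Γ ^ 6 * (1 + T) ^ 2 * E ^ 4 with ha₂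
  refine ⟨a₁ + a₂, by positivity, fun N U c L hN hU hc hL => ?_⟩
  have hN' : (1 : ℝ) ≤ N := by exact_mod_cast hN
  have hN0 : (0 : ℝ) < N := by linarith
  have hJ : 2 ^ levels A N ≤ Γ * N :=
    (two_pow_levels_le hA1 hN).trans (Nat.mul_le_mul_right N hΓA)
  obtain ⟨m, hm1, hm2⟩ := exists_mesh hN
  have hX := aemeasurable_pathOpNorm (D := D) hU hL hT (1 - δ) (-1 / 2 - 2 * δ)
  have hrs : r ≤ ((2 * n : ℕ) : ℝ) := by push_cast; linarith
  refine (lintegral_rpow_le_of_exponent_le hX (by linarith) hrs).trans ?_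
  refine (hU.moment_pathOpNorm_le hN hD hc hΓ (by omega) hJ hδ hδ' hT hn0 m hL).trans ?_
  have hcard : (Fintype.card (GridIndex m (Γ * N + 1)) : ℝ≥0∞) ^ (1 / ((2 * n : ℕ) : ℝ)) ≤
      ENNReal.ofReal (2592 * Γ * (N : ℝ) ^ (η / 2)) := by
    rw [← ENNReal.ofReal_natCast, ENNReal.ofReal_rpow_of_nonneg (by positivity) (by positivity)]
    refine ENNReal.ofReal_le_ofReal ?_
    have h1 : 1 / ((2 * n : ℕ) : ℝ) ≤ 1 := by
      rw [div_le_one (by push_cast; positivity)]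
      exact hr.trans hrs
    calc _ ≤ (2592 * Γ * (N : ℝ) ^ 577) ^ (1 / ((2 * n : ℕ) : ℝ)) :=
          Real.rpow_le_rpow (by positivity) (card_gridIndex_le hN hΓ hm2) (by positivity)
      _ = (2592 * Γ : ℝ) ^ (1 / ((2 * n : ℕ) : ℝ)) * ((N : ℝ) ^ 577) ^ (1 / ((2 * n : ℕ) : ℝ)) :=
          Real.mul_rpow (by positivity) (by positivity)
      _ ≤ (2592 * Γ) * (N : ℝ) ^ (η / 2) := by
          gcongr
          · exact (Real.rpow_le_rpow_of_exponent_le (by linarith) h1).trans (Real.rpow_one _).le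
          · rw [← Real.rpow_natCast, ← Real.rpow_mul hN0.le]
            refine Real.rpow_le_rpow_of_exponent_le hN' (le_trans (le_of_eq ?_) hnη)
            push_cast; ring
  have hpow : (N : ℝ) ^ (η / 2) * ((N : ℝ) ^ (η / 2) * (N : ℝ) ^ (-δ)) = (N : ℝ) ^ (-δ + η) := by
    rw [← Real.rpow_add hN0, ← Real.rpow_add hN0]; congr 1; ring
  have hL0 : 0 ≤ logSum N := logSum_nonneg N
  have t1 : ENNReal.ofReal (2592 * Γ * (N : ℝ) ^ (η / 2)) * ENNReal.ofReal (10 ^ 14 * Γ ^ 7 *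
      wickConst n * (levels A N * logSum N ^ 3) * (N : ℝ) ^ (-δ)) ≤
      ENNReal.ofReal (a₁ * (N : ℝ) ^ (-δ + η)) := by
    rw [← ENNReal.ofReal_mul (by positivity)]
    refine ENNReal.ofReal_le_ofReal ?_
    have h := hlog N hN
    set y := (levels A N : ℝ) * logSum N ^ 3
    calc _ ≤ 2592 * Γ * (N : ℝ) ^ (η / 2) * (10 ^ 14 * Γ ^ 7 * wickConst n *
          (C₁ * (N : ℝ) ^ (η / 2)) * (N : ℝ) ^ (-δ)) := by
          gcongr
      _ = a₁ * ((N : ℝ) ^ (η / 2) * ((N : ℝ) ^ (η / 2) * (N : ℝ) ^ (-δ))) := by rw [ha₁]; ring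
      _ = _ := by rw [hpow]
  have t2 : 10 ^ 21 * Γ ^ 6 * (1 + T) ^ 2 * N ^ 23 * (4 / 5) ^ m * (E * N ^ 3) ^ 4 ≤
      a₂ * (N : ℝ) ^ (-δ + η) := by
    have h1 : (4 / 5 : ℝ) ^ m * N ^ 35 ≤ (N : ℝ) ^ (-1 : ℝ) := by
      rw [Real.rpow_neg_one]
      rw [← one_div, le_div_iff₀ hN0]
      calc _ = (4 / 5 : ℝ) ^ m * N ^ 36 := by ring
        _ ≤ 1 := hm1
    -- The discretisation error N⁻¹ is negligible because δ < 1.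
    have h2 : (N : ℝ) ^ (-1 : ℝ) ≤ (N : ℝ) ^ (-δ + η) :=
      Real.rpow_le_rpow_of_exponent_le hN' (by linarith)
    calc _ = a₂ * ((4 / 5 : ℝ) ^ m * N ^ 35) := by rw [ha₂]; ring
      _ ≤ _ := by gcongr; exact h1.trans h2
  rw [add_mul a₁ a₂, ENNReal.ofReal_add (by positivity) (by positivity)]
  exact add_le_add ((mul_le_mul_left hcard _).trans t1) (ENNReal.ofReal_le_ofReal t2)

end GridChoice

end LatticePhi
end

/-! ### Assembly: paths, measurability, moments and convergence in probability -/

theorem theorem6p7 {Ω : Type*} [MeasurableSpace Ω] (P : Measure Ω) [IsProbabilityMeasure P]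
    (W : ℝ → LatticePhi.Freq → Ω → ℂ) (hW : LatticePhi.IsWienerModes P W)
    (D : LatticePhi.DyadicPartition)
    (φ : EuclideanSpace ℝ (Fin 3) → ℝ) (hφ : LatticePhi.IsCutoff φ)
    (T : ℝ) (hT : 0 ≤ T) (δ : ℝ) (hδ : 0 < δ) (hδ' : δ < 1 / 4) :
    (∀ N : ℕ, 1 ≤ N → ∀ᵐ ω ∂P,
      LatticePhi.ContinuousInOpNorm D (1 - δ) (-1 / 2 - 2 * δ) T
        (LatticePhi.op1 D N fun t k => W t k ω) ∧
      LatticePhi.ContinuousInOpNorm D (1 - δ) (-1 / 2 - 2 * δ) T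
        (LatticePhi.op2 D φ N fun t k => W t k ω)) ∧
    (∀ N : ℕ, 1 ≤ N → AEMeasurable (fun ω => LatticePhi.AN D φ δ T N fun t k => W t k ω) P) ∧
    (∀ η r : ℝ, 0 < η → η < δ → 1 ≤ r → ∃ C : ℝ, ∀ N : ℕ, 1 ≤ N →
      (∫⁻ ω, (LatticePhi.AN D φ δ T N fun t k => W t k ω) ^ r ∂P) ^ (1 / r) ≤
        ENNReal.ofReal (C * (N : ℝ) ^ (-δ + η))) ∧
    (∀ a : ℝ≥0∞, 0 < a → Tendsto
      (fun N : ℕ => P {ω | a ≤ LatticePhi.AN D φ δ T N fun t k => W t k ω}) atTop (𝓝 0)) := by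
  obtain ⟨A, hA⟩ := D.exists_bound
  obtain ⟨Γ, hΓA, hgood⟩ := LatticePhi.exists_goodKernel D hφ hA
  have hA1 : 1 ≤ A := hA.one_le
  have hΓ : 1 ≤ Γ := by omega
  have hJ : ∀ N : ℕ, 1 ≤ N → 2 ^ LatticePhi.levels A N ≤ Γ * N := fun N hN =>
    (LatticePhi.two_pow_levels_le hA1 hN).trans (Nat.mul_le_mul_right N hΓA)
  have hmeas : ∀ N : ℕ, 1 ≤ N →
      AEMeasurable (fun ω => LatticePhi.pathOpNorm D (1 - δ) (-1 / 2 - 2 * δ) T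
        (LatticePhi.op1 D N fun t k => W t k ω)) P ∧
      AEMeasurable (fun ω => LatticePhi.pathOpNorm D (1 - δ) (-1 / 2 - 2 * δ) T
        (LatticePhi.op2 D φ N fun t k => W t k ω)) P := by
    intro N hN
    obtain ⟨U, hU, h1, h2⟩ := hW.ae_hasKernel hA φ hN
    exact ⟨LatticePhi.aemeasurable_pathOpNorm hU h1 hT _ _,
      LatticePhi.aemeasurable_pathOpNorm hU h2 hT _ _⟩
  have hAN : ∀ N : ℕ, 1 ≤ N →
      AEMeasurable (fun ω => LatticePhi.AN D φ δ T N fun t k => W t k ω) P :=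
    fun N hN => (hmeas N hN).1.add (hmeas N hN).2
  have hmom : ∀ η r : ℝ, 0 < η → η < δ → 1 ≤ r → ∃ C : ℝ, ∀ N : ℕ, 1 ≤ N →
      (∫⁻ ω, (LatticePhi.AN D φ δ T N fun t k => W t k ω) ^ r ∂P) ^ (1 / r) ≤
        ENNReal.ofReal (C * (N : ℝ) ^ (-δ + η)) := by
    intro η r hη _ hr
    obtain ⟨C, hC, h⟩ := LatticePhi.exists_moment_pathOpNorm_le P hA hΓA hδ hδ' hT hη hr
    refine ⟨C + C, fun N hN => ?_⟩
    obtain ⟨U, hU, h1, h2⟩ := hW.ae_hasKernel hA φ hN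
    refine (ENNReal.lintegral_Lp_add_le (hmeas N hN).1 (hmeas N hN).2 hr).trans ?_
    rw [add_mul, ENNReal.ofReal_add (by positivity) (by positivity)]
    exact add_le_add (h N U _ _ hN hU (hgood N hN).1 h1) (h N U _ _ hN hU (hgood N hN).2 h2)
  refine ⟨fun N hN => ?_, hAN, hmom, fun a ha => ?_⟩
  · obtain ⟨U, hU, h1, h2⟩ := hW.ae_hasKernel hA φ hN
    filter_upwards [h1, h2] with ω h1 h2
    exact ⟨LatticePhi.continuousInOpNorm_of_hasKernel hA (hgood N hN).1 hΓ (by omega) (hJ N hN)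
        hδ hδ' (fun a => hU.continuous_path a ω) h1 T,
      LatticePhi.continuousInOpNorm_of_hasKernel hA (hgood N hN).2 hΓ (by omega) (hJ N hN)
        hδ hδ' (fun a => hU.continuous_path a ω) h2 T⟩
  · obtain ⟨C, h⟩ := hmom (δ / 2) 1 (by positivity) (by linarith) le_rfl
    -- Markov's inequality requires a finite level, while `a` may be infinite.
    set b : ℝ≥0∞ := min a 1 with hb
    have hb0 : b ≠ 0 := (lt_min ha one_pos).ne'
    have hbt : b ≠ ∞ := ne_top_of_le_ne_top ENNReal.one_ne_top (min_le_right _ _)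
    have hpow : Tendsto (fun N : ℕ => (N : ℝ) ^ (-(δ / 2))) atTop (𝓝 0) :=
      (tendsto_rpow_neg_atTop (by positivity : 0 < δ / 2)).comp tendsto_natCast_atTop_atTop
    have hlim : Tendsto (fun N : ℕ => ENNReal.ofReal (C * (N : ℝ) ^ (-(δ / 2))) / b) atTop
        (𝓝 0) := by
      have h1 := ENNReal.tendsto_ofReal (hpow.const_mul C)
      rw [mul_zero, ENNReal.ofReal_zero] at h1
      have h2 := ENNReal.Tendsto.div_const (b := b) h1 (Or.inr hb0)
      rwa [ENNReal.zero_div] at h2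
    refine tendsto_of_tendsto_of_tendsto_of_le_of_le' tendsto_const_nhds hlim
      (Eventually.of_forall fun _ => bot_le) ?_
    filter_upwards [eventually_ge_atTop 1] with N hN
    have hN' := h N hN
    simp only [ENNReal.rpow_one, div_one] at hN'
    rw [show -δ + δ / 2 = -(δ / 2) by ring] at hN'
    calc P {ω | a ≤ LatticePhi.AN D φ δ T N fun t k => W t k ω}
        ≤ P {ω | b ≤ LatticePhi.AN D φ δ T N fun t k => W t k ω} :=
          measure_mono fun ω hω => (min_le_left a 1).trans hω
      _ ≤ (∫⁻ ω, LatticePhi.AN D φ δ T N (fun t k => W t k ω) ∂P) / b :=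
          meas_ge_le_lintegral_div (hAN N hN) hb0 hbt
      _ ≤ _ := ENNReal.div_le_div_right hN' b
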